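/- **Setting.** Let $n\ge 1$, $G={\rm U}(n+1,\mathbb H)=\{g: \bar g^{\rm t}g=I\}$, $H={\rm U}(1,\mathbb H)\times{\rm U}(n,\mathbb H)$ (block-diagonal), $M=\mathbb{HP}^n=G/H$, $\mathfrak g=\mathfrak h\oplus\mathfrak m$ the symmetric decomposition of $\mathfrak g=\mathfrak u(n+1,\mathbb H)$, $\langle X,Y\rangle=4(n+2)\,{\rm Re}\,{\rm tr}(XY)$ its Killing form and $\chi=8(n+2)$. For a smooth lift (frame) $\psi$ of a curve or flow to $G$ put $e+\omega=\psi^{-1}d\psi$ with $e\in\mathfrak m$, $\omega\in\mathfrak h$; tangent vectors $X$ along it have components $e_X\in\mathfrak m$, and the Riemannian metric, the Riemannian connection and the tensor ${\rm ad}^2$ of $M$ are given by $g(X,Y)=-\langle e_X,e_Y\rangle$, $e_{\nabla_s Y}=D_s e_Y+[\omega_s,e_Y]$, $e_{{\rm ad}^2(X)Z}=[e_X,[e_X,e_Z]]$. For $a\in\mathbb H$, $\mathbf b\in\mathbb H^{n-1}$ (row vector) write $(a,\mathbf b)_{\mathfrak m}$ for the element of $\mathfrak m$ with first row $(0,a,\mathbf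 b)$ and, for imaginary $a$, $(a,\mathbf b)_{\mathfrak h}\in\mathfrak h$ for the skew-Hermitian matrix with diagonal $(a,-a,0,\dots,0)$ whose only other non-zero entries are $\mathbf b$ in the second row and $-\bar{\mathbf b}^{\rm t}$ in the second column. A frame along a unit-speed curve is *parallel with covariants $({\rm u},\mathbf u)$*, ${\rm u}\in{\rm Im}\,\mathbb H$, $\mathbf u\in\mathbb H^{n-1}$, if $e_x=\chi^{-1/2}(1,\mathbf 0)_{\mathfrak m}$ and $\omega_x=({\rm u},\mathbf u)_{\mathfrak h}$. With $C(a,b)=ab-ba$, $A(a,b)=ab+ba$, $\langle\mathbf a,\mathbf b\rangle=\mathbf a\bar{\mathbf b}^{\rm t}$, $C(\mathbf a,\mathbf b)=\langle\mathbf a,\mathbf b\rangle-\langle\mathbf b,\mathbf a\rangle$, $A(\mathbf a,\mathbf b)=\langle\mathbf a,\mathbf b\rangle+\langle\mathbf b,\mathbf a\rangle$, $\mathbf C(\mathbf a,\mathbf b)=\bar{\mathbf a}^{\rm t}\mathbf b-\bar{\mathbf b}^{\rm t}\mathbf a$, the operators $\mathcal J,\mathcal H$ are $$\mathcal J\binom{\rm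 h}{\mathbf h}=\binom{\frac14D_x{\rm h}+\frac14C(\mathbf u,\mathbf h)+{\rm h}_\parallel{\rm u}}{D_x\mathbf h+\frac12{\rm h}\mathbf u+{\rm u}\mathbf h+{\rm h}_\parallel\mathbf u},\qquad {\rm h}_\parallel=-D_x^{-1}\big(\tfrac12A({\rm u},{\rm h})-\tfrac12A(\mathbf u,\mathbf h)\big),$$ $$\mathcal H\binom{\rm w}{\mathbf w}=\binom{D_x{\rm w}+C({\rm u},{\rm w}^\parallel)+\frac12C(\mathbf u,\mathbf w)}{D_x\mathbf w-{\rm w}^\parallel\mathbf u+\mathbf u\mathbf W^\parallel+{\rm w}\mathbf u-{\rm u}\mathbf w},\quad {\rm w}^\parallel=-D_x^{-1}\big(C({\rm u},{\rm w})-\tfrac12C(\mathbf u,\mathbf w)\big),\ \mathbf W^\parallel=D_x^{-1}\mathbf C(\mathbf u,\mathbf w),$$ and $({\rm h}_{(l)},\mathbf h_{(l)})=(\mathcal H\mathcal J)^l({\rm u}_x,\mathbf u_x)$, $l\ge0$, where $D_x^{-1}$ gives the antiderivative without constant term among differential polynomials. The $(+l)$-flow, $l\ge1$, of the bi-Hamiltonian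 hierarchy is $({\rm u},\mathbf u)_t=({\rm h}_{(l)},\mathbf h_{(l)})+\chi^{-1}({\rm h}_{(l-1)},\mathbf h_{(l-1)})$. The $-1$ (SG) flow is $({\rm u},\mathbf u)_t=\chi^{-1}({\rm h},\mathbf h)$ with $\mathcal J({\rm h},\mathbf h)=0$, where ${\rm h}_\parallel$ is any smooth real function with $D_x{\rm h}_\parallel=-\frac12A({\rm u},{\rm h})+\frac12A(\mathbf u,\mathbf h)$. All functions and flows are smooth, with $t$ and $x$ ranging over arbitrary open intervals. **Theorem.** All $({\rm h}_{(l)},\mathbf h_{(l)})$ are differential polynomials in $({\rm u},\mathbf u)$, each $D_x^{-1}$ being applied to a total derivative. For every $l\ge 1$ there is a smooth function $Y_{(l)}$ of finitely many of the vectors $\gamma_x,\nabla_x\gamma_x,\nabla_x^2\gamma_x,\dots$ such that: 1. $Y_{(l)}$, and hence the equation $\gamma_t=Y_{(l)}(\gamma_x,\nabla_x\gamma_x,\dots)$, $|\gamma_x|=1$, is invariant under the isometry group ${\rm U}(n+1,\mathbb H)$. 2. The flow is non-stretching (preserves arclength): $g(\nabla_xY_{(l)},\gamma_x)=0$ along every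 unit-speed curve. 3. In any parallel frame with covariants $({\rm u},\mathbf u)$, $Y_{(l)}$ has components $\chi^{-1/2}\big({\rm h}_\parallel+\frac12{\rm h}_{(l-1)},-\mathbf h_{(l-1)}\big)_{\mathfrak m}$, with ${\rm h}_\parallel$ formed from $({\rm h}_{(l-1)},\mathbf h_{(l-1)})$. 4. Every flow $\gamma(t,x)$ with $\gamma_t=Y_{(l)}$, $|\gamma_x|=1$ has a smooth parallel frame whose covariants satisfy the $(+l)$-flow; conversely every solution $({\rm u},\mathbf u)$ of the $(+l)$-flow is the pair of covariants of a parallel frame of such a flow $\gamma$. For $l=1$ (the mKdV flow), the curve flow is the non-stretching mKdV map $$\gamma_t=\mathcal X_\gamma^{-1}\big(\chi^{-1}\nabla_x^2\gamma_x-\tfrac12{\rm ad}^2(\nabla_x\gamma_x)\gamma_x\big)_\perp+\tfrac12\chi^{-1}g(\mathcal X_\gamma^{-1}\nabla_x\gamma_x,\nabla_x\gamma_x)\gamma_x,\qquad|\gamma_x|=1,$$ where $\mathcal X_\gamma=-{\rm ad}^2(\gamma_x)$, inverted on the normal space of the curve, and $\perp$ denotes the normal component. The $-1$ (SG) flow corresponds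 to the non-stretching wave map $\nabla_x\gamma_t=0$, $|\gamma_x|=1$: every such $\gamma$ has a smooth parallel frame whose covariants satisfy the $-1$ flow, with $\gamma_t$ having components $\chi^{-1/2}({\rm h}_\parallel+\frac12{\rm h},-\mathbf h)_{\mathfrak m}$, and every solution of the $-1$ flow arises in this way. The wave map equation is invariant under ${\rm U}(n+1,\mathbb H)$ and conserves $|\gamma_t|$, i.e. $\nabla_x|\gamma_t|=0$. -/

import Mathlib

open scoped Quaternion ContDiff

attribute [local instance] Matrix.normedAddCommGroup Matrix.normedSpace

noncomputable section

namespace QuatFlow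

/-! ### The symmetric space `HP^n = U(n+1,ℍ) / (U(1,ℍ) × U(n,ℍ))`, with `n = m + 1 ≥ 1` -/

/-- Quaternionic matrices of size `n + 1 = m + 2`. -/
abbrev Mat (m : ℕ) : Type := Matrix (Fin (m + 2)) (Fin (m + 2)) ℍ

/-- The quaternionic unitary group `U(n+1,ℍ)`, i.e. `star g * g = 1 = g * star g`. -/
abbrev UGroup (m : ℕ) : Type := unitary (Mat m)

/-- The isotropy subgroup `U(1,ℍ) × U(n,ℍ)`: block-diagonal unitary matrices. -/
def isotropy (m : ℕ) : Subgroup (UGroup m) where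
  carrier := {g | ∀ j : Fin (m + 2), j ≠ 0 → (g : Mat m) 0 j = 0 ∧ (g : Mat m) j 0 = 0}
  one_mem' := by
    intro j hj
    simp [hj, hj.symm]
  mul_mem' := by
    intro a b ha hb j hj
    constructor
    · simp only [Submonoid.coe_mul, Matrix.mul_apply]
      refine Finset.sum_eq_zero fun k _ => ?_
      by_cases hk : k = 0
      · rw [hk, (hb j hj).1, mul_zero]
      · rw [(ha k hk).1, zero_mul]
    · simp only [Submonoid.coe_mul, Matrix.mul_apply]
      refine Finset.sum_eq_zero fun k _ => ?_
      by_cases hk : k = 0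
      · rw [hk, (ha j hj).2, zero_mul]
      · rw [(hb k hk).2, mul_zero]
  inv_mem' := by
    intro a ha j hj
    have h : ((a⁻¹ : UGroup m) : Mat m) = star (a : Mat m) := rfl
    simp [h, Matrix.star_apply, (ha j hj).1, (ha j hj).2]

/-- Quaternionic projective space `HP^n`, `n = m + 1`, as a space of left cosets.
`U(n+1,ℍ)` acts on it by left translation `g • p`. -/
abbrev HP (m : ℕ) : Type := UGroup m ⧸ isotropy m

/-- The matrix `S = diag(-1, 1, …, 1)` of the symmetry at the origin. -/
def symmS (m : ℕ) : Mat m := Matrix.diagonal fun i => if i = 0 then -1 else 1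

theorem isotropy_comm {m : ℕ} {g : UGroup m} (hg : g ∈ isotropy m) :
    (g : Mat m) * symmS m = symmS m * (g : Mat m) := by
  ext1 i j
  rw [symmS, Matrix.mul_diagonal, Matrix.diagonal_mul]
  by_cases hi : i = 0 <;> by_cases hj : j = 0
  · simp [hi, hj]
  · simp [hi, (hg j hj).1]
  · simp [hj, (hg i hi).2]
  · simp [hi, hj]

/-- The Cartan embedding `gH ↦ g S g⁻¹` of `HP^n` into matrices: the geodesic symmetry at `gH`.
It is an equivariant closed embedding, so a map into `HP^n` is smooth if and only if its composite
with `reflection` is. -/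
def reflection {m : ℕ} (p : HP m) : Mat m :=
  Quotient.liftOn' p (fun g : UGroup m => (g : Mat m) * symmS m * star (g : Mat m)) (by
    intro a b hab
    have h : a⁻¹ * b ∈ isotropy m := QuotientGroup.leftRel_apply.mp hab
    have hb : b = a * (a⁻¹ * b) := by group
    have hu : ((a⁻¹ * b : UGroup m) : Mat m) * star ((a⁻¹ * b : UGroup m) : Mat m) = 1 :=
      Unitary.mul_star_self_of_mem (a⁻¹ * b).2
    have hc := isotropy_comm h
    generalize a⁻¹ * b = k at *
    subst hb
    simp only [Submonoid.coe_mul, star_mul]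
    calc (a : Mat m) * symmS m * star (a : Mat m)
        = (a : Mat m) * (symmS m * ((k : Mat m) * star (k : Mat m))) * star (a : Mat m) := by
          rw [hu, mul_one]
      _ = (a : Mat m) * (symmS m * (k : Mat m)) * star (k : Mat m) * star (a : Mat m) := by
          simp only [mul_assoc]
      _ = _ := by rw [← hc]; simp only [mul_assoc])

/-- The constant `χ = 8(n+2)`. -/
def chi (m : ℕ) : ℝ := 8 * ((m : ℝ) + 3)

/-- The Cartan-Killing form `4(n+2) Re tr(XY)` of `𝔤 = u(n+1,ℍ)`. -/
def killing {m : ℕ} (X Y : Mat m) : ℝ := 4 * ((m : ℝ) + 3) * (X * Y).trace.re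

/-- Components in `𝔪` (anti-commuting with `S`). -/
def mPart {m : ℕ} (X : Mat m) : Mat m := (1 / 2 : ℝ) • (X - symmS m * X * symmS m)

/-- Components in `𝔥` (commuting with `S`). -/
def hPart {m : ℕ} (X : Mat m) : Mat m := (1 / 2 : ℝ) • (X + symmS m * X * symmS m)

/-! ### Tangent vectors, metric and connection

The tangent bundle `G ×_H 𝔪` of `G/H` is realised inside `HP^n × 𝔤` by `[g, z] ↦ (gH, g z g⁻¹)`.
In a frame (a lift `ψ` of a curve to `G`) the coframe components of a tangent vector `Z` are
`e ⌋ Z = ψ⁻¹ Z ψ ∈ 𝔪`, and isometries act on tangent vectors by `Z ↦ g Z g⁻¹`. -/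

/-- `T_p HP^n = g 𝔪 g⁻¹` for `p = gH`: the elements of `u(n+1,ℍ)` that are odd under the geodesic
symmetry at `p`. -/
def IsTangent {m : ℕ} (p : HP m) (Z : Mat m) : Prop :=
  star Z = -Z ∧ reflection p * Z * reflection p = -Z

/-- Projection of `𝔤` onto the tangent space at `p`. -/
def tangentPart {m : ℕ} (p : HP m) (Z : Mat m) : Mat m :=
  (1 / 2 : ℝ) • (Z - reflection p * Z * reflection p)

/-- The Riemannian metric `g(X,Y) = -⟨e_X, e_Y⟩` (the Killing form is `Ad`-invariant). -/
def metric {m : ℕ} (X Y : Mat m) : ℝ := -killing X Y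

/-- The tensor `ad_x²(X)Z`, with `e ⌋ ad_x²(X)Z = ad(e_X)² e_Z`. -/
def adSq {m : ℕ} (X Z : Mat m) : Mat m := ⁅X, ⁅X, Z⁆⁆

/-- The velocity of a curve; see `velocity_of_lift`. -/
def velocity {m : ℕ} (c : ℝ → HP m) (s : ℝ) : Mat m :=
  (1 / 2 : ℝ) • (deriv (fun r => reflection (c r)) s * reflection (c s))

/-- The Riemannian covariant derivative of a vector field `V` along a curve;
see `covDeriv_of_lift`. -/
def covDeriv {m : ℕ} (c : ℝ → HP m) (V : ℝ → Mat m) (s : ℝ) : Mat m :=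
  tangentPart (c s) (deriv V s)

/-- `covJet c k = ∇_x^k γ_x`. -/
def covJet {m : ℕ} (c : ℝ → HP m) : ℕ → ℝ → Mat m
  | 0 => velocity c
  | k + 1 => covDeriv c (covJet c k)

/-- The pull-back `e + ω = ψ⁻¹ dψ` of the Maurer-Cartan form by a lift `ψ`. Its `𝔪`-part is the
coframe `e` and its `𝔥`-part the connection `ω`, evaluated on the velocity of the curve. -/
def mcForm {m : ℕ} (ψ : ℝ → UGroup m) (s : ℝ) : Mat m :=
  star (ψ s : Mat m) * deriv (fun r => (ψ r : Mat m)) s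

theorem symmS_sq (m : ℕ) : symmS m * symmS m = 1 := by
  rw [symmS, Matrix.diagonal_mul_diagonal, ← Matrix.diagonal_one]
  congr 1
  ext1 i
  by_cases h : i = 0 <;> simp [h]

theorem hasDerivAt_mul {m : ℕ} {A B : ℝ → Mat m} {A' B' : Mat m} {s : ℝ}
    (hA : HasDerivAt A A' s) (hB : HasDerivAt B B' s) :
    HasDerivAt (fun r => A r * B r) (A' * B s + A s * B') s := by
  refine hasDerivAt_pi.2 fun i => hasDerivAt_pi.2 fun j => ?_
  have hA' := fun k => hasDerivAt_pi.1 (hasDerivAt_pi.1 hA i) k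
  have hB' := fun k => hasDerivAt_pi.1 (hasDerivAt_pi.1 hB k) j
  have h := HasDerivAt.fun_sum (u := Finset.univ) fun k _ => (hA' k).mul (hB' k)
  simpa only [Matrix.add_apply, Matrix.mul_apply, ← Finset.sum_add_distrib, Pi.mul_apply] using h

theorem hasDerivAt_star {m : ℕ} {A : ℝ → Mat m} {A' : Mat m} {s : ℝ} (hA : HasDerivAt A A' s) :
    HasDerivAt (fun r => star (A r)) (star A') s := by
  let L : ℍ →ₗ[ℝ] ℍ :=
    { toFun := star, map_add' := star_add, map_smul' := fun a q => Quaternion.star_smul a q }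
  exact hasDerivAt_pi.2 fun i => hasDerivAt_pi.2 fun j =>
    L.toContinuousLinearMap.hasFDerivAt.comp_hasDerivAt s
      (hasDerivAt_pi.1 (hasDerivAt_pi.1 hA j) i)

theorem skew_of_lift {m : ℕ} {ψ : ℝ → UGroup m} {D : Mat m} {s : ℝ}
    (hψ : HasDerivAt (fun r => (ψ r : Mat m)) D s) :
    star D * (ψ s : Mat m) = -(star (ψ s : Mat m) * D) := by
  have h := hasDerivAt_mul (hasDerivAt_star hψ) hψ
  have h1 : (fun r => star (ψ r : Mat m) * (ψ r : Mat m)) = fun _ => 1 :=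
    funext fun r => Unitary.star_mul_self_of_mem (ψ r).2
  rw [h1] at h
  exact eq_neg_of_add_eq_zero_left (h.unique (hasDerivAt_const s 1))

/-- The velocity has coframe components `e = (ψ⁻¹ dψ)_𝔪` in every frame `ψ`. -/
theorem velocity_of_lift {m : ℕ} {c : ℝ → HP m} {ψ : ℝ → UGroup m} {D : Mat m} {s : ℝ}
    (hψ : HasDerivAt (fun r => (ψ r : Mat m)) D s)
    (hc : ∀ᶠ r in nhds s, c r = (ψ r : HP m)) :
    velocity c s = (ψ s : Mat m) * mPart (star (ψ s : Mat m) * D) * star (ψ s : Mat m) := by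
  have hr : (fun r => reflection (c r)) =ᶠ[nhds s]
      fun r => (ψ r : Mat m) * symmS m * star (ψ r : Mat m) := by
    filter_upwards [hc] with r hr
    rw [hr]
    rfl
  have hd := (hasDerivAt_mul (hasDerivAt_mul hψ (hasDerivAt_const s (symmS m)))
    (hasDerivAt_star hψ)).congr_of_eventuallyEq hr
  have h1 : (ψ s : Mat m) * star (ψ s : Mat m) = 1 := Unitary.mul_star_self_of_mem (ψ s).2
  have h2 : star (ψ s : Mat m) * (ψ s : Mat m) = 1 := Unitary.star_mul_self_of_mem (ψ s).2
  have hdd : deriv (fun r => reflection (c r)) s = _ := hd.deriv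
  rw [velocity, hdd, hr.eq_of_nhds, mPart, mul_smul_comm, smul_mul_assoc]
  congr 1
  have e1 : (D * symmS m * star (ψ s : Mat m)) * ((ψ s : Mat m) * symmS m * star (ψ s : Mat m))
      = D * star (ψ s : Mat m) := by
    calc _ = D * symmS m * (star (ψ s : Mat m) * (ψ s : Mat m)) * symmS m * star (ψ s : Mat m) := by
          simp only [mul_assoc]
      _ = D * (symmS m * symmS m) * star (ψ s : Mat m) := by rw [h2]; simp only [mul_assoc, one_mul]
      _ = _ := by rw [symmS_sq, mul_one]
  have e2 : ((ψ s : Mat m) * symmS m * star D) * ((ψ s : Mat m) * symmS m * star (ψ s : Mat m))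
      = -((ψ s : Mat m) * (symmS m * (star (ψ s : Mat m) * D) * symmS m) * star (ψ s : Mat m)) := by
    calc _ = (ψ s : Mat m) * symmS m * (star D * (ψ s : Mat m)) * symmS m
            * star (ψ s : Mat m) := by simp only [mul_assoc]
      _ = _ := by rw [skew_of_lift hψ]; simp only [mul_assoc, mul_neg, neg_mul]
  have e3 : (ψ s : Mat m) * (star (ψ s : Mat m) * D) = D := by rw [← mul_assoc, h1, one_mul]
  rw [mul_sub, sub_mul, e3, mul_zero, add_zero, add_mul, e1, e2, ← sub_eq_add_neg]

/-- In every frame `ψ`, a field `V` with coframe components `y = e ⌋ V` satisfies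
`e ⌋ ∇V = y' + [ω, y]`, where `ω = (ψ⁻¹ dψ)_𝔥`. -/
theorem covDeriv_of_lift {m : ℕ} {c : ℝ → HP m} {ψ : ℝ → UGroup m} {D : Mat m} {s : ℝ}
    (hψ : HasDerivAt (fun r => (ψ r : Mat m)) D s) (hc : c s = (ψ s : HP m))
    {y : ℝ → Mat m} {y' : Mat m} (hy : HasDerivAt y y' s)
    (hm : ∀ r, symmS m * y r * symmS m = -y r) {V : ℝ → Mat m}
    (hV : ∀ᶠ r in nhds s, V r = (ψ r : Mat m) * y r * star (ψ r : Mat m)) :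
    covDeriv c V s =
      (ψ s : Mat m) * (y' + ⁅hPart (star (ψ s : Mat m) * D), y s⁆) * star (ψ s : Mat m) := by
  have hV' : V =ᶠ[nhds s] fun r => (ψ r : Mat m) * y r * star (ψ r : Mat m) := hV
  have hd := (hasDerivAt_mul (hasDerivAt_mul hψ hy)
    (hasDerivAt_star hψ)).congr_of_eventuallyEq hV'
  have h1 : (ψ s : Mat m) * star (ψ s : Mat m) = 1 := Unitary.mul_star_self_of_mem (ψ s).2
  have h2 : star (ψ s : Mat m) * (ψ s : Mat m) = 1 := Unitary.star_mul_self_of_mem (ψ s).2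
  have hS := symmS_sq m
  have hym : symmS m * y s = -(y s * symmS m) := by
    calc _ = (symmS m * y s * symmS m) * symmS m := by rw [mul_assoc _ (symmS m), hS, mul_one]
      _ = _ := by rw [hm s, neg_mul]
  have hy'm : symmS m * y' * symmS m = -y' := by
    have h := hasDerivAt_mul (hasDerivAt_mul (hasDerivAt_const s (symmS m)) hy)
      (hasDerivAt_const s (symmS m))
    rw [funext hm] at h
    simpa using h.unique hy.neg
  have hsk := skew_of_lift hψ
  generalize hX : star (ψ s : Mat m) * D = X at *
  have hD : D = (ψ s : Mat m) * X := by rw [← hX, ← mul_assoc, h1, one_mul]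
  have hDs : star D = -(X * star (ψ s : Mat m)) := by
    rw [← neg_mul, ← hsk, mul_assoc, h1, mul_one]
  have hdv : deriv V s = (ψ s : Mat m) * (y' + (X * y s - y s * X)) * star (ψ s : Mat m) := by
    have hdd : deriv V s = _ := hd.deriv
    rw [hdd, hDs]
    nth_rewrite 1 [hD]
    noncomm_ring
  have hrefl : reflection (c s) = (ψ s : Mat m) * symmS m * star (ψ s : Mat m) := by
    rw [hc]
    rfl
  have hconj : ∀ Z : Mat m, tangentPart (c s) ((ψ s : Mat m) * Z * star (ψ s : Mat m)) =
      (ψ s : Mat m) * mPart Z * star (ψ s : Mat m) := by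
    intro Z
    have : ((ψ s : Mat m) * symmS m * star (ψ s : Mat m)) *
        ((ψ s : Mat m) * Z * star (ψ s : Mat m)) *
        ((ψ s : Mat m) * symmS m * star (ψ s : Mat m)) =
        (ψ s : Mat m) * (symmS m * Z * symmS m) * star (ψ s : Mat m) := by
      calc _ = (ψ s : Mat m) * symmS m * (star (ψ s : Mat m) * (ψ s : Mat m)) * Z *
            (star (ψ s : Mat m) * (ψ s : Mat m)) * symmS m * star (ψ s : Mat m) := by
            simp only [mul_assoc]
        _ = _ := by rw [h2]; simp only [mul_assoc, one_mul]
    rw [tangentPart, mPart, hrefl, this, mul_smul_comm, smul_mul_assoc, mul_sub, sub_mul]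
  rw [covDeriv, hdv, hconj]
  congr 2
  have hym' : y s * symmS m = -(symmS m * y s) := by rw [hym, neg_neg]
  have e1 : symmS m * (X * y s) * symmS m = -(symmS m * X * symmS m * y s) := by
    rw [mul_assoc, mul_assoc X, hym']
    simp only [mul_assoc, mul_neg]
  have e2 : symmS m * (y s * X) * symmS m = -(y s * (symmS m * X * symmS m)) := by
    rw [← mul_assoc (symmS m), hym]
    simp only [mul_assoc, neg_mul]
  have e3 : symmS m * (y' + (X * y s - y s * X)) * symmS m =
      -y' - symmS m * X * symmS m * y s + y s * (symmS m * X * symmS m) := by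
    rw [mul_add, add_mul, mul_sub, sub_mul, hy'm, e1, e2]
    abel
  rw [mPart, e3, hPart, Ring.lie_def, smul_mul_assoc, mul_smul_comm, ← smul_sub]
  have e4 : y' = (1 / 2 : ℝ) • (y' + y') := by rw [← two_smul ℝ y', smul_smul]; norm_num
  nth_rewrite 3 [e4]
  rw [← smul_add]
  congr 1
  noncomm_ring

/-! ### Parallel frames -/

/-- The matrix `(a, b) ∈ 𝔪`, `a ∈ ℍ`, `b ∈ ℍ^{n-1}`. It lies in `𝔪_⊥` when `a` is imaginary and
`b` arbitrary, and in `𝔪_∥` when `a` is real and `b = 0`. -/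
def mMat {m : ℕ} (a : ℍ) (b : Fin m → ℍ) : Mat m :=
  Matrix.single 0 1 a - Matrix.single 1 0 (star a) +
    ∑ j : Fin m, (Matrix.single 0 j.succ.succ (b j) - Matrix.single j.succ.succ 0 (star (b j)))

/-- The matrix `(a, b) ∈ 𝔥_⊥`, with `a` an imaginary quaternion and `b ∈ ℍ^{n-1}`. -/
def hMat {m : ℕ} (a : ℍ) (b : Fin m → ℍ) : Mat m :=
  Matrix.single 0 0 a - Matrix.single 1 1 a +
    ∑ j : Fin m, (Matrix.single 1 j.succ.succ (b j) - Matrix.single j.succ.succ 1 (star (b j)))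

/-- `ψ` is a parallel frame along the curve `c` over `J`, with covariants `(u, v)`: a smooth lift
with constant unit `e_x = χ^{-1/2} (1, 0)` and with `ω_x = (u, v) ∈ 𝔥_⊥`. -/
def IsParallelFrame {m : ℕ} (c : ℝ → HP m) (J : Set ℝ) (ψ : ℝ → UGroup m)
    (u : ℝ → ℍ) (v : ℝ → Fin m → ℍ) : Prop :=
  ContDiffOn ℝ ∞ (fun x => (ψ x : Mat m)) J ∧
  ∀ x ∈ J, c x = (ψ x : HP m) ∧ (u x).re = 0 ∧
    mPart (mcForm ψ x) = (1 / √(chi m)) • mMat 1 0 ∧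
    hPart (mcForm ψ x) = hMat (u x) (v x)

/-- A smooth family of parallel frames along the curves `γ t`, `t ∈ I`. -/
def IsParallelFlowFrame {m : ℕ} (γ : ℝ → ℝ → HP m) (I J : Set ℝ) (ψ : ℝ → ℝ → UGroup m)
    (u : ℝ → ℝ → ℍ) (v : ℝ → ℝ → Fin m → ℍ) : Prop :=
  ContDiffOn ℝ ∞ (fun q : ℝ × ℝ => (ψ q.1 q.2 : Mat m)) (I ×ˢ J) ∧
  ∀ t ∈ I, IsParallelFrame (γ t) J (ψ t) (u t) (v t)

/-- The coframe components `e ⌋ Z = g⁻¹ Z g` of a tangent vector at `gH` in the frame `g`. -/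
def coframe {m : ℕ} (g : UGroup m) (Z : Mat m) : Mat m := star (g : Mat m) * Z * (g : Mat m)

/-! ### Quaternionic brackets and the pieces of the Hamiltonian operators

These are over `ℍ[R]`, to be used both for differential polynomials and for actual functions. -/

section Algebra

variable {R : Type} [CommRing R] [Algebra ℝ R] {m : ℕ}

/-- `C(a,b) = ab - ba`. -/
def comm (a b : ℍ[R]) : ℍ[R] := a * b - b * a

/-- `A(a,b) = ab + ba`. -/
def acomm (a b : ℍ[R]) : ℍ[R] := a * b + b * a

/-- The Hermitian product `⟨a,b⟩ = ∑ a_j b̄_j`. -/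
def herm (a b : Fin m → ℍ[R]) : ℍ[R] := ∑ j, a j * star (b j)

/-- `C(a,b) = ⟨a,b⟩ - ⟨b,a⟩`. -/
def commV (a b : Fin m → ℍ[R]) : ℍ[R] := herm a b - herm b a

/-- `A(a,b) = ⟨a,b⟩ + ⟨b,a⟩`. -/
def acommV (a b : Fin m → ℍ[R]) : ℍ[R] := herm a b + herm b a

/-- The matrix commutator `āᵗ b - b̄ᵗ a ∈ u(n-1,ℍ)`. -/
def commM (a b : Fin m → ℍ[R]) : Matrix (Fin m) (Fin m) ℍ[R] :=
  Matrix.of fun i j => star (a i) * b j - star (b i) * a j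

/-- `D_x h_∥ = -(½ A(u,h) - ½ A(v,k))`. -/
def hParDeriv (u : ℍ[R]) (v : Fin m → ℍ[R]) (h : ℍ[R]) (k : Fin m → ℍ[R]) : ℍ[R] :=
  -((1 / 2 : ℝ) • acomm u h - (1 / 2 : ℝ) • acommV v k)

/-- Scalar part of `𝒥(h,k)`: `¼ D_x h + ¼ C(v,k) + h_∥ u`, with `dh = D_x h`, `p = h_∥`. -/
def symplS (u : ℍ[R]) (v k : Fin m → ℍ[R]) (dh p : ℍ[R]) : ℍ[R] :=
  (1 / 4 : ℝ) • dh + (1 / 4 : ℝ) • commV v k + p * u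

/-- Vector part of `𝒥(h,k)`: `D_x k + ½ h v + u k + h_∥ v`, with `dk = D_x k`, `p = h_∥`. -/
def symplV (u : ℍ[R]) (v : Fin m → ℍ[R]) (h : ℍ[R]) (k dk : Fin m → ℍ[R]) (p : ℍ[R]) :
    Fin m → ℍ[R] :=
  fun j => dk j + (1 / 2 : ℝ) • (h * v j) + u * k j + p * v j

end Algebra

/-! ### Differential polynomials and the hierarchy -/

/-- The real coordinates of `(u, v) ∈ Im ℍ × ℍ^{n-1}`. -/
abbrev Coord (m : ℕ) : Type := Fin 3 ⊕ Fin m × Fin 4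

/-- Real differential polynomials in `(u, v)`: the variable `(c, k)` is the `k`-th `x`-derivative of
the coordinate `c`. -/
abbrev DPoly (m : ℕ) : Type := MvPolynomial (Coord m × ℕ) ℝ

/-- The total derivative `D_x`. -/
def totalD (m : ℕ) : Derivation ℝ (DPoly m) (DPoly m) :=
  MvPolynomial.mkDerivation ℝ fun i => MvPolynomial.X (i.1, i.2 + 1)

open Classical in
/-- The formal inverse `D_x⁻¹`: on a total derivative `f`, the unique differential polynomial without
constant term whose total derivative is `f` (and `0` if `f` is not a total derivative). -/
def totalDInv {m : ℕ} (f : DPoly m) : DPoly m :=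
  if h : ∃ g : DPoly m, MvPolynomial.constantCoeff g = 0 ∧ totalD m g = f then h.choose else 0

/-- Apply a map to the four real components of a quaternion. -/
def qmap {R S : Type} [CommRing R] [CommRing S] (f : R → S) (q : ℍ[R]) : ℍ[S] := ⟨f q.re, f q.imI, f q.imJ, f q.imK⟩

/-- `D_x` on quaternionic differential polynomials. -/
def qD {m : ℕ} (q : ℍ[DPoly m]) : ℍ[DPoly m] := qmap (totalD m) q

/-- `D_x⁻¹` on quaternionic differential polynomials. -/
def qDInv {m : ℕ} (q : ℍ[DPoly m]) : ℍ[DPoly m] := qmap totalDInv q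

/-- `q` is a total `x`-derivative. -/
def IsTotalDerivative {m : ℕ} (q : ℍ[DPoly m]) : Prop := ∃ r : ℍ[DPoly m], qD r = q

/-- Scalar-vector pairs of quaternionic differential polynomials. -/
abbrev DPair (m : ℕ) : Type := ℍ[DPoly m] × (Fin m → ℍ[DPoly m])

/-- The `k`-th `x`-derivative `(u_{kx}, v_{kx})` of the flow variables. -/
def jetVar (m : ℕ) (k : ℕ) : DPair m :=
  (⟨0, .X (.inl 0, k), .X (.inl 1, k), .X (.inl 2, k)⟩,
    fun j => ⟨.X (.inr (j, 0), k), .X (.inr (j, 1), k), .X (.inr (j, 2), k),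
      .X (.inr (j, 3), k)⟩)

/-- `D_x w^∥ = -(C(u,w) - ½ C(v,z))` for `(w, z) ∈ 𝔥_⊥`. -/
def wParDeriv {m : ℕ} (w : DPair m) : ℍ[DPoly m] :=
  -(comm (jetVar m 0).1 w.1 - (1 / 2 : ℝ) • commV (jetVar m 0).2 w.2)

/-- `h_∥` for `(h, k) ∈ 𝔥_⊥`. -/
def hPar {m : ℕ} (h : DPair m) : ℍ[DPoly m] :=
  qDInv (hParDeriv (jetVar m 0).1 (jetVar m 0).2 h.1 h.2)

/-- The cosymplectic Hamiltonian operator `ℋ`. -/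
def hamOp {m : ℕ} (w : DPair m) : DPair m :=
  let u := (jetVar m 0).1
  let v := (jetVar m 0).2
  let wp := qDInv (wParDeriv w)
  let Wp := (commM v w.2).map qDInv
  (qD w.1 + comm u wp + (1 / 2 : ℝ) • commV v w.2,
    fun j => qD (w.2 j) - wp * v j + Matrix.vecMul v Wp j + w.1 * v j - u * w.2 j)

/-- The symplectic operator `𝒥`. -/
def symplOp {m : ℕ} (h : DPair m) : DPair m :=
  (symplS (jetVar m 0).1 (jetVar m 0).2 h.2 (qD h.1) (hPar h),
    symplV (jetVar m 0).1 (jetVar m 0).2 h.1 h.2 (fun j => qD (h.2 j)) (hPar h))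

/-- The recursion operator `ℛ = ℋ𝒥`. -/
def recOp {m : ℕ} (h : DPair m) : DPair m := hamOp (symplOp h)

/-- The hierarchy `h_(l) = ℛ^l (u_x, v_x)`. -/
def hier (m l : ℕ) : DPair m := recOp^[l] (jetVar m 1)

/-- The formal inverses `D_x⁻¹` in `ℛ h = ℋ𝒥 h` are all applied to total derivatives. -/
def IsLocalAt {m : ℕ} (h : DPair m) : Prop :=
  IsTotalDerivative (hParDeriv (jetVar m 0).1 (jetVar m 0).2 h.1 h.2) ∧
  IsTotalDerivative (wParDeriv (symplOp h)) ∧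
  ∀ i j, IsTotalDerivative (commM (jetVar m 0).2 (symplOp h).2 i j)

/-- The real coordinates of a pair of functions. -/
def coordFun {m : ℕ} (u : ℝ → ℍ) (v : ℝ → Fin m → ℍ) : Coord m → ℝ → ℝ
  | .inl i => fun x => ![(u x).imI, (u x).imJ, (u x).imK] i
  | .inr (j, i) => fun x => ![(v x j).re, (v x j).imI, (v x j).imJ, (v x j).imK] i

/-- Evaluation of a quaternionic differential polynomial on functions `(u, v)` at `x`. -/
def evalJet {m : ℕ} (u : ℝ → ℍ) (v : ℝ → Fin m → ℍ) (x : ℝ) (q : ℍ[DPoly m]) : ℍ :=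
  qmap (fun f : DPoly m => MvPolynomial.aeval (R := ℝ)
    (fun i : Coord m × ℕ => iteratedDeriv i.2 (coordFun u v i.1) x) f) q

/-- The `(+l)`-flow `u_t = h_(l) + χ⁻¹ h_(l-1)` (for `l ≥ 1`) of the hierarchy, on `I × J`. -/
def IsHierarchyFlow {m : ℕ} (l : ℕ) (I J : Set ℝ)
    (u : ℝ → ℝ → ℍ) (v : ℝ → ℝ → Fin m → ℍ) : Prop :=
  ContDiffOn ℝ ∞ (fun q : ℝ × ℝ => u q.1 q.2) (I ×ˢ J) ∧
  ContDiffOn ℝ ∞ (fun q : ℝ × ℝ => v q.1 q.2) (I ×ˢ J) ∧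
  ∀ t ∈ I, ∀ x ∈ J, (u t x).re = 0 ∧
    deriv (fun s => u s x) t =
      evalJet (u t) (v t) x (hier m l).1 +
        (chi m)⁻¹ • evalJet (u t) (v t) x (hier m (l - 1)).1 ∧
    ∀ j, deriv (fun s => v s x j) t =
      evalJet (u t) (v t) x ((hier m l).2 j) +
        (chi m)⁻¹ • evalJet (u t) (v t) x ((hier m (l - 1)).2 j)

/-- The `-1` (SG) flow on `I × J`: `𝒥(h,k) = 0` (with `p = h_∥` a potential for the inverse `D_x⁻¹`
that occurs in `𝒥`) and `(u,v)_t = χ⁻¹ (h,k)`. -/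
def IsMinusOneFlow {m : ℕ} (I J : Set ℝ) (u : ℝ → ℝ → ℍ) (v : ℝ → ℝ → Fin m → ℍ)
    (h : ℝ → ℝ → ℍ) (k : ℝ → ℝ → Fin m → ℍ) (p : ℝ → ℝ → ℝ) : Prop :=
  ContDiffOn ℝ ∞ (fun q : ℝ × ℝ => u q.1 q.2) (I ×ˢ J) ∧
  ContDiffOn ℝ ∞ (fun q : ℝ × ℝ => v q.1 q.2) (I ×ˢ J) ∧
  ContDiffOn ℝ ∞ (fun q : ℝ × ℝ => h q.1 q.2) (I ×ˢ J) ∧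
  ContDiffOn ℝ ∞ (fun q : ℝ × ℝ => k q.1 q.2) (I ×ˢ J) ∧
  ContDiffOn ℝ ∞ (fun q : ℝ × ℝ => p q.1 q.2) (I ×ˢ J) ∧
  ∀ t ∈ I, ∀ x ∈ J, (u t x).re = 0 ∧ (h t x).re = 0 ∧
    ((deriv (fun y => p t y) x : ℝ) : ℍ) = hParDeriv (u t x) (v t x) (h t x) (k t x) ∧
    symplS (u t x) (v t x) (k t x) (deriv (fun y => h t y) x) ((p t x : ℝ) : ℍ) = 0 ∧
    symplV (u t x) (v t x) (h t x) (k t x) (fun j => deriv (fun y => k t y j) x)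
      ((p t x : ℝ) : ℍ) = 0 ∧
    deriv (fun s => u s x) t = (chi m)⁻¹ • h t x ∧
    ∀ j, deriv (fun s => v s x j) t = (chi m)⁻¹ • k t x j

/-! ### Curve flows -/

/-- A smooth arclength-parametrised curve `c : J → HP^n`. -/
def IsUnitSpeed {m : ℕ} (c : ℝ → HP m) (J : Set ℝ) : Prop :=
  ContDiffOn ℝ ∞ (fun x => reflection (c x)) J ∧
  ∀ x ∈ J, metric (velocity c x) (velocity c x) = 1

/-- A smooth flow `γ : I × J → HP^n` with `|γ_x| = 1`. -/
def IsNonStretching {m : ℕ} (γ : ℝ → ℝ → HP m) (I J : Set ℝ) : Prop :=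
  ContDiffOn ℝ ∞ (fun q : ℝ × ℝ => reflection (γ q.1 q.2)) (I ×ˢ J) ∧
  ∀ t ∈ I, ∀ x ∈ J, metric (velocity (γ t) x) (velocity (γ t) x) = 1

/-- A smooth function `Y` that sends finitely many tangent vectors at a point to a tangent vector at
the same point. -/
structure CurveOperator (m : ℕ) where
  order : ℕ
  toFun : HP m → (Fin (order + 1) → Mat m) → Mat m
  smooth : ∀ p, ContDiff ℝ ∞ (toFun p)
  tangent : ∀ p Z, (∀ i, IsTangent p (Z i)) → IsTangent p (toFun p Z)

/-- `Y(γ_x, ∇_xγ_x, …, ∇_x^N γ_x)` along a curve. -/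
def CurveOperator.along {m : ℕ} (Y : CurveOperator m) (c : ℝ → HP m) (x : ℝ) : Mat m :=
  Y.toFun (c x) fun i => covJet c i x

/-- Equivariance of `Y` under the isometry group `U(n+1,ℍ)`. -/
def CurveOperator.IsInvariant {m : ℕ} (Y : CurveOperator m) : Prop :=
  ∀ (g : UGroup m) (p : HP m) (Z : Fin (Y.order + 1) → Mat m), (∀ i, IsTangent p (Z i)) →
    Y.toFun (g • p) (fun i => (g : Mat m) * Z i * star (g : Mat m)) =
      (g : Mat m) * Y.toFun p Z * star (g : Mat m)

/-- `γ` solves `γ_t = Y(γ_x, ∇_xγ_x, …)`, `|γ_x| = 1`, on `I × J`. -/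
def IsCurveFlow {m : ℕ} (Y : CurveOperator m) (γ : ℝ → ℝ → HP m) (I J : Set ℝ) : Prop :=
  IsNonStretching γ I J ∧
  ∀ t ∈ I, ∀ x ∈ J, velocity (fun s => γ s x) t = Y.along (γ t) x

/-- `γ` is a non-stretching wave map: `∇_x γ_t = 0`, `|γ_x| = 1`, on `I × J`. -/
def IsWaveMap {m : ℕ} (γ : ℝ → ℝ → HP m) (I J : Set ℝ) : Prop :=
  IsNonStretching γ I J ∧
  ∀ t ∈ I, ∀ x ∈ J, covDeriv (γ t) (fun y => velocity (fun s => γ s y) t) x = 0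

/-- The normal component relative to a unit vector `T`. -/
def normalPart {m : ℕ} (T Z : Mat m) : Mat m := Z - metric Z T • T

/-- `B = 𝒳_γ⁻¹ Z` at a point `p` of a curve with unit tangent vector `T`, where
`𝒳_γ = -ad_x²(T)`, which is invertible on the normal space of the curve. -/
def IsXInv {m : ℕ} (p : HP m) (T Z B : Mat m) : Prop :=
  IsTangent p B ∧ metric B T = 0 ∧ -adSq T B = Z

/-- `V` is the right-hand side of the non-stretching mKdV map for the curve `c` at `x`:
`𝒳⁻¹(χ⁻¹ ∇_x²γ_x - ½ ad_x²(∇_xγ_x)γ_x)_⊥ + ½ χ⁻¹ g(𝒳⁻¹∇_xγ_x, ∇_xγ_x) γ_x`. -/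
def IsMKdVVector {m : ℕ} (c : ℝ → HP m) (x : ℝ) (V : Mat m) : Prop :=
  let T := covJet c 0 x
  let N := covJet c 1 x
  let N' := covJet c 2 x
  ∃ A B : Mat m,
    IsXInv (c x) T (normalPart T ((chi m)⁻¹ • N' - (1 / 2 : ℝ) • adSq N T)) A ∧
    IsXInv (c x) T N B ∧
    V = A + ((1 / 2 : ℝ) * (chi m)⁻¹ * metric B N) • T

/-- A non-empty open interval. -/
def IsOpenInterval (J : Set ℝ) : Prop := IsOpen J ∧ J.OrdConnected ∧ J.Nonempty

end QuatFlow

end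

set_option linter.unusedSimpArgs false
set_option linter.unusedSectionVars false

noncomputable section

namespace QuatFlow

/-! ### Formal solutions of the Lax equation -/

section Lax

variable {A : Type*} [Ring A] [Algebra ℝ A]

/-! All flows come from one formal object. Let E = (1, 0) ∈ 𝔪, so that E³ = −E, and let ∇ = D_x +
ad(u, v). The equation X∇Q + [E, Q] = 0 together with Q³ = −Q has exactly one formal solution Q = E
+ q₁X + q₂X² + ⋯ (`laxPartial_spec`, `lax_unique`). Indeed E³ = −E makes ad E semisimple, with an
explicit polynomial inverse on its image; the linear equation determines q_{k+1} up to the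
centraliser of E, and the cubic equation fixes the remaining part algebraically. No integration
occurs, so every q_k is a differential polynomial.

Uniqueness transfers symmetries to Q: it is skew-Hermitian, with even coefficients in 𝔪 and odd ones
in 𝔥. Splitting the linear equation along the kernel and the image of ad E then reproduces the
Hamiltonian operators: the 𝔥_⊥ part of q_{2l+1} is (−1)^l w_(l) with w_(0) = (u, v), and q_{2l+2} =
(−1)^{l+1}(h_∥ + ½h_(l), −𝐡_(l)), where h_(l) = ℋw_(l) and w_(l+1) = 𝒥h_(l). The components in the
kernel of ad E are the nonlocal terms of ℋ and 𝒥. They are differential polynomials without constant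
term, so each D_x⁻¹ meets a total derivative and takes the expected value (`OddForm.step`).

The same recursion makes sense for noncommutative polynomials in the jets ∇_x^k γ_x, with leading
term √χ γ_x. Naturality (`map_lax`) identifies the result along a curve with Q in any parallel frame
(`curveLax_frame`). Hence Y_(l) = (−1)^l χ^{-1/2} q_{2l}, evaluated on jets, is equivariant; and ∇_x
Y_(l) is a bracket with γ_x, therefore orthogonal to it.

For the evolution, put M = χ^{-1/2}E + (u, v) and V = (−1)^l(χ^{-1/2}q_{2l} + q_{2l+1}). In V_x +
[M, V] everything cancels except (−1)^l(χ⁻¹[E, q_{2l}] − [E, q_{2l+2}]) = h_(l) + χ⁻¹h_(l−1)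
(`hasDerivAt_flowMat`), so the zero curvature equation of ψ_x = ψM, ψ_t = ψV is the (+l)-flow. A
solution of the flow is integrated to a frame, hence to a curve flow, by
`exists_flow_of_covariants`. Conversely `exists_flow_frame` puts a parallel frame with prescribed
time evolution on a given curve flow; its integrability again rests on semisimplicity of ad E. The
wave map is treated in the same way with γ_t itself as generator: ∇_xγ_t = 0 reads 𝒥(h, 𝐡) = 0 in a
frame (`qh_comm_waveMat_eq_zero`). The mKdV form of Y_(1) is an explicit computation with the first
three jets (`mKdV_iff`). -/

/-- The operator that inverts `ad z` on its image when `z³ = -z`. -/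
def adInv (z x : A) : A :=
  (-(1 / 4) : ℝ) • (z * (z * (z * x - x * z) - (z * x - x * z) * z) -
    (z * (z * x - x * z) - (z * x - x * z) * z) * z) - (5 / 4 : ℝ) • (z * x - x * z)

/-- The primitive of `adInv z` with respect to `ad z`. -/
def adInvPot (z x : A) : A :=
  (-(1 / 4) : ℝ) • (z * (z * x - x * z) - (z * x - x * z) * z) - (5 / 4 : ℝ) • x

/-- Writing the inverse as a bracket [z, P] keeps track of parity: for odd z and x the potential P
is odd too, so the bracket is even. This form is used to build the connection in
`exists_flow_frame`. -/
theorem adInv_eq_comm (z x : A) : adInv z x = z * adInvPot z x - adInvPot z x * z := by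
  simp only [adInv, adInvPot, mul_sub, sub_mul, mul_smul_comm, smul_mul_assoc, smul_sub]
  abel

theorem adInv_zero (z : A) : adInv z 0 = 0 := by simp [adInv]

theorem map_adInv {B : Type*} [Ring B] [Algebra ℝ B] (f : A →ₐ[ℝ] B) (z x : A) :
    f (adInv z x) = adInv (f z) (f x) := by
  simp [adInv]

/-- The two shapes in which z³ appears once products are associated to the right; with them any
polynomial identity in left and right multiplication by z can be checked by `simp` and `module`. -/
theorem cube_rules {z : A} (hz : z * z * z = -z) :
    z * (z * z) = -z ∧ ∀ y, z * (z * (z * y)) = -(z * y) := by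
  refine ⟨by rw [← mul_assoc, hz], fun y => ?_⟩
  rw [← mul_assoc, ← mul_assoc, hz, neg_mul]

/-- The eigenvalues of a = ad z are differences of the eigenvalues 0, ±i of z, so a(a² + 1)(a² + 4)
= 0. Hence −(a³ + 5a)/4 inverts a on its image, which explains the constants 1/4 and 5/4. -/
theorem adInv_ad_ad {z : A} (hz : z * z * z = -z) (x : A) :
    adInv z (z * (z * x - x * z) - (z * x - x * z) * z) = z * x - x * z := by
  obtain ⟨h1, h2⟩ := cube_rules hz
  simp only [adInv, mul_add, add_mul, mul_sub, sub_mul, mul_smul_comm, smul_mul_assoc, smul_add,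
    smul_sub, mul_assoc, h1, h2, mul_neg, neg_mul, neg_neg, smul_neg]
  module

/-- `ad z` is semisimple. -/
theorem ad_eq_zero_of_ad_ad {z : A} (hz : z * z * z = -z) {x : A}
    (h : z * (z * x - x * z) - (z * x - x * z) * z = 0) : z * x - x * z = 0 := by
  rw [← adInv_ad_ad hz x, h, adInv_zero]

/-- Solutions of the linearised equation `z³ = -z` lie in the image of `ad z`. -/
theorem ad_adInv_of_cubic {z : A} (hz : z * z * z = -z) {y : A}
    (hy : y * z * z + z * y * z + z * z * y + y = 0) :
    z * adInv z y - adInv z y * z = y := by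
  obtain ⟨h1, h2⟩ := cube_rules hz
  -- Between the eigenvalues λ and μ of left and right multiplication by z, the linearised cubic
  -- acts as λ² + λμ + μ² + 1. This is 0 for λ ≠ μ, and on the diagonal 1 (λ = 0) or −2 (λ = ±i);
  -- the factor 1 + (3/2)λμ inverts it there, so the right side is the projection to the centraliser
  -- of z.
  have e : y - (z * adInv z y - adInv z y * z) =
      (y * z * z + z * y * z + z * z * y + y) +
        (3 / 2 : ℝ) • (z * (y * z * z + z * y * z + z * z * y + y) * z) := by
    simp only [adInv, mul_add, add_mul, mul_sub, sub_mul, mul_smul_comm, smul_mul_assoc, smul_add,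
      smul_sub, mul_assoc, h1, h2, mul_neg, neg_mul, neg_neg, smul_neg]
    module
  rw [hy, mul_zero, zero_mul, smul_zero, add_zero, sub_eq_zero] at e
  exact e.symm

/-- The Lax equation and the cubic normalisation determine an element commuting with `z`. -/
theorem eq_zero_of_ad_of_cubic {z : A} (hz : z * z * z = -z) {y : A}
    (hy : y * z * z + z * y * z + z * z * y + y = 0) (h : z * y - y * z = 0) : y = 0 := by
  rw [← ad_adInv_of_cubic hz hy, adInv, h]
  simp

open PowerSeries in
/-- The partial sums of the formal solution `Q = z + q₁ X + q₂ X² + ⋯` of `X ∇Q + [z, Q] = 0`,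
`Q³ = -Q`. -/
def laxPartial (D : A → A) (z : A) : ℕ → A⟦X⟧
  | 0 => C z
  | k + 1 =>
    -- Inverting ad z on D q_k provides the part of the next coefficient that lies in the image of
    -- ad z.
    let S := laxPartial D z k - monomial (k + 1) (adInv z (D (coeff k (laxPartial D z k))))
    let p := coeff (k + 1) (S * S * S + S)
    -- On elements commuting with z the linearised cubic is 1 + 3z², whose inverse is 1 + (3/2)z²
    -- because z⁴ = −z².
    S - monomial (k + 1) (p + (3 / 2 : ℝ) • (z * (z * p)))

/-- The coefficients of the formal solution of the Lax equation. -/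
def lax (D : A → A) (z : A) (k : ℕ) : A := PowerSeries.coeff k (laxPartial D z k)

-- The recursion uses only ring operations, real scalars and the derivation, so a homomorphism that
-- intertwines two derivations carries one formal solution to the other. This links jets,
-- differential polynomials and functions.
open PowerSeries in
theorem map_laxPartial {B : Type*} [Ring B] [Algebra ℝ B] (f : A →ₐ[ℝ] B) {D : A → A} {D' : B → B}
    (hf : ∀ a, f (D a) = D' (f a)) (z : A) (k : ℕ) :
    PowerSeries.map (f : A →+* B) (laxPartial D z k) = laxPartial D' (f z) k := by
  induction k with
  | zero => simp [laxPartial]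
  | succ k ih =>
    have h : ∀ (n : ℕ) (P : A⟦X⟧), f (coeff n P) = coeff n (PowerSeries.map (f : A →+* B) P) :=
      fun n P => by simp
    have hmono : ∀ (n : ℕ) (a : A),
        PowerSeries.map (f : A →+* B) (monomial n a) = monomial n (f a) := fun n a => by
      ext j
      rw [coeff_map, coeff_monomial, coeff_monomial]
      split <;> simp
    simp only [laxPartial, map_sub, hmono, RingHom.coe_coe, map_add, map_smul, map_mul, h,
      map_adInv, hf, ih]

theorem map_lax {B : Type*} [Ring B] [Algebra ℝ B] (f : A →ₐ[ℝ] B) {D : A → A} {D' : B → B}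
    (hf : ∀ a, f (D a) = D' (f a)) (z : A) (k : ℕ) : f (lax D z k) = lax D' (f z) k := by
  rw [lax, lax, ← map_laxPartial f hf]
  simp

open PowerSeries in
/-- The operator `X ∇ + ad z` on power series. -/
def laxOp (D : A → A) (z : A) (Q : A⟦X⟧) : A⟦X⟧ :=
  X * PowerSeries.mk (fun n => D (coeff n Q)) + (C z * Q - Q * C z)

open PowerSeries in
theorem coeff_zero_laxOp (D : A → A) (z : A) (Q : A⟦X⟧) :
    coeff 0 (laxOp D z Q) = z * coeff 0 Q - coeff 0 Q * z := by
  simp [laxOp]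

open PowerSeries in
theorem coeff_succ_laxOp (D : A → A) (z : A) (Q : A⟦X⟧) (n : ℕ) :
    coeff (n + 1) (laxOp D z Q) =
      D (coeff n Q) + (z * coeff (n + 1) Q - coeff (n + 1) Q * z) := by
  simp [laxOp, coeff_succ_X_mul]

-- X is central, so X∇ is a derivation like ad z. Applied to Q³ + Q this makes the linear and the
-- cubic equation interact.
open PowerSeries in
theorem laxOp_mul (D : A →+ A) (hD : ∀ x y, D (x * y) = D x * y + x * D y) (z : A) (P Q : A⟦X⟧) :
    laxOp D z (P * Q) = laxOp D z P * Q + P * laxOp D z Q := by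
  have h : PowerSeries.mk (fun n => D (coeff n (P * Q))) =
      PowerSeries.mk (fun n => D (coeff n P)) * Q + P * PowerSeries.mk (fun n => D (coeff n Q)) := by
    ext n
    simp only [coeff_mk, coeff_mul, map_sum, hD, map_add, Finset.sum_add_distrib]
  have hX : X * P = P * X := X_mul
  have h2 : X * (P * PowerSeries.mk (fun n => D (coeff n Q))) =
      P * (X * PowerSeries.mk (fun n => D (coeff n Q))) := by
    rw [← mul_assoc, hX, mul_assoc]
  simp only [laxOp, h, mul_add, add_mul, h2, mul_sub, sub_mul, mul_assoc]
  abel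

open PowerSeries in
theorem laxOp_add (D : A →+ A) (z : A) (P Q : A⟦X⟧) :
    laxOp D z (P + Q) = laxOp D z P + laxOp D z Q := by
  have h : PowerSeries.mk (fun n => D (coeff n (P + Q))) =
      PowerSeries.mk (fun n => D (coeff n P)) + PowerSeries.mk (fun n => D (coeff n Q)) := by
    ext n
    simp
  simp only [laxOp, h, mul_add, add_mul]
  abel

open PowerSeries in
/-- The coefficients of a product, to first order in leading terms. -/
theorem coeff_mul_of_vanish {P Q : A⟦X⟧} {k : ℕ} (hP : ∀ j < k, coeff j P = 0) :
    coeff k (P * Q) = coeff k P * coeff 0 Q := by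
  rw [coeff_mul, Finset.sum_eq_single (k, 0)]
  · rintro ⟨a, b⟩ hab hne
    rw [Finset.HasAntidiagonal.mem_antidiagonal] at hab
    have : a < k := by
      rcases Nat.eq_zero_or_pos b with hb | hb
      · exact absurd (by simp_all) hne
      · simp only at hab; omega
    rw [hP a this, zero_mul]
  · intro h; simp at h

open PowerSeries in
theorem coeff_mul_of_vanish' {P Q : A⟦X⟧} {k : ℕ} (hP : ∀ j < k, coeff j P = 0) :
    coeff k (Q * P) = coeff 0 Q * coeff k P := by
  rw [coeff_mul, Finset.sum_eq_single (0, k)]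
  · rintro ⟨a, b⟩ hab hne
    rw [Finset.HasAntidiagonal.mem_antidiagonal] at hab
    have : b < k := by
      rcases Nat.eq_zero_or_pos a with hb | hb
      · exact absurd (by simp_all) hne
      · simp only at hab; omega
    rw [hP b this, mul_zero]
  · intro h; simp at h

open PowerSeries in
theorem coeff_mul_vanish {P Q : A⟦X⟧} {k : ℕ} (hP : ∀ j < k, coeff j P = 0) :
    (∀ j < k, coeff j (P * Q) = 0) ∧ ∀ j < k, coeff j (Q * P) = 0 := by
  constructor <;> intro j hj
  · rw [coeff_mul_of_vanish fun i hi => hP i (hi.trans hj), hP j hj, zero_mul]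
  · rw [coeff_mul_of_vanish' fun i hi => hP i (hi.trans hj), hP j hj, mul_zero]

open PowerSeries in
/-- First variation of `S ↦ S³ + S` at the leading order. -/
theorem coeff_cubic_add {S T : A⟦X⟧} {k : ℕ} (hk : 0 < k) (hT : ∀ j < k, coeff j T = 0) {z : A}
    (hz : coeff 0 S = z) :
    (∀ j < k, coeff j ((S + T) * (S + T) * (S + T) + (S + T)) = coeff j (S * S * S + S)) ∧
    coeff k ((S + T) * (S + T) * (S + T) + (S + T)) = coeff k (S * S * S + S) +
      (coeff k T * z * z + z * coeff k T * z + z * z * coeff k T + coeff k T) := by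
  have e : (S + T) * (S + T) * (S + T) + (S + T) = (S * S * S + S) +
      (T * ((S + T) * (S + T)) + S * (T * (S + T)) + S * S * T + T) := by noncomm_ring
  have h0 : coeff 0 (S + T) = z := by rw [map_add, hz, hT 0 hk, add_zero]
  have h1 := coeff_mul_vanish (Q := (S + T) * (S + T)) hT
  have h2 := coeff_mul_vanish (Q := S + T) hT
  have h3 := coeff_mul_vanish (Q := S) h2.1
  have h4 := coeff_mul_vanish (Q := S * S) hT
  have hm : ∀ P Q : A⟦X⟧, coeff 0 (P * Q) = coeff 0 P * coeff 0 Q := fun P Q => by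
    simp [coeff_mul]
  rw [e]
  constructor
  · intro j hj
    rw [map_add _ (S * S * S + S)]
    simp only [map_add, h1.1 j hj, h3.2 j hj, h4.2 j hj, hT j hj, add_zero]
  · rw [map_add _ (S * S * S + S)]
    congr 1
    rw [map_add, map_add, map_add, coeff_mul_of_vanish hT, coeff_mul_of_vanish' h2.1,
      coeff_mul_of_vanish hT, coeff_mul_of_vanish' hT, hm, hm, h0, hz]
    simp only [mul_assoc]

open PowerSeries in
/-- The formal solution is unique. -/
theorem lax_unique (D : A →+ A) {z : A} (hz : z * z * z = -z) {P Q : A⟦X⟧}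
    (hP0 : coeff 0 P = z) (hQ0 : coeff 0 Q = z) (hP : laxOp D z P = 0) (hQ : laxOp D z Q = 0)
    (hP3 : P * P * P + P = 0) (hQ3 : Q * Q * Q + Q = 0) : P = Q := by
  ext k
  induction k using Nat.strong_induction_on with
  | _ k ih =>
    rcases k with _ | k
    · rw [hP0, hQ0]
    -- The first coefficient of Q − P that could be nonzero solves the linearised cubic and commutes
    -- with z, hence vanishes.
    · have hT : ∀ j < k + 1, coeff j (Q - P) = 0 := fun j hj => by
        rw [map_sub, ih j hj, sub_self]
      have h := (coeff_cubic_add (S := P) (Nat.succ_pos k) hT hP0).2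
      rw [add_sub_cancel, hP3, hQ3, map_zero, zero_add] at h
      have h1 := congrArg (coeff (k + 1)) hP
      have h2 := congrArg (coeff (k + 1)) hQ
      rw [coeff_succ_laxOp, map_zero] at h1 h2
      have h3 : z * coeff (k + 1) (Q - P) - coeff (k + 1) (Q - P) * z = 0 := by
        have := h2.trans h1.symm
        rw [ih k (Nat.lt_succ_self k)] at this
        rw [map_sub, mul_sub, sub_mul]
        rw [← sub_eq_zero.2 (add_left_cancel this)]
        abel
      have h4 := eq_zero_of_ad_of_cubic hz h.symm h3
      rw [map_sub, sub_eq_zero] at h4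
      exact h4.symm

-- Solvability at order k + 1 needs D q_k to lie in the image of ad z, which the linear equation
-- alone does not give. The defect ℓ of the linear equation commutes with z by the choice of d.
-- Applying the derivation `laxOp` to S³ + S shows that [z, p] is the linearised cubic of ℓ, where p
-- is the cubic defect. Semisimplicity forces both sides to vanish; so ℓ = 0, and p commutes with z
-- and can be removed without disturbing the linear equation.
open PowerSeries in
theorem laxPartial_spec (D : A →+ A) (hD : ∀ x y, D (x * y) = D x * y + x * D y) {z : A}
    (hz : z * z * z = -z) (k : ℕ) :
    coeff 0 (laxPartial D z k) = z ∧ (∀ j, k < j → coeff j (laxPartial D z k) = 0) ∧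
    (∀ j ≤ k, coeff j (laxOp D z (laxPartial D z k)) = 0) ∧
    (∀ j ≤ k, coeff j (laxPartial D z k * laxPartial D z k * laxPartial D z k
      + laxPartial D z k) = 0) := by
  induction k with
  | zero =>
    refine ⟨by simp [laxPartial], fun j hj => ?_, fun j hj => ?_, fun j hj => ?_⟩
    · simp [laxPartial, coeff_C, hj.ne']
    · obtain rfl : j = 0 := by omega
      simp [coeff_zero_laxOp, laxPartial]
    · obtain rfl : j = 0 := by omega
      simp [laxPartial, hz]
  | succ k ih =>
    obtain ⟨h0, hv, hl, hc⟩ := ih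
    set Q := laxPartial D z k with hQ
    set d := adInv z (D (coeff k Q)) with hd
    set S := Q + -monomial (k + 1) d with hS
    set p := coeff (k + 1) (S * S * S + S) with hp
    set c := p + (3 / 2 : ℝ) • (z * (z * p)) with hcdef
    have hstep : laxPartial D z (k + 1) = S + -monomial (k + 1) c := by
      simp only [laxPartial, ← hQ, hS, sub_eq_add_neg, hcdef, hp, hd]
    clear_value c p S d
    have hm : ∀ e : A, ∀ j < k + 1, coeff j (-monomial (k + 1) e : A⟦X⟧) = 0 := fun e j hj => by
      rw [map_neg, coeff_monomial, if_neg hj.ne, neg_zero]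
    have hm' : ∀ e : A, coeff (k + 1) (-monomial (k + 1) e : A⟦X⟧) = -e := fun e => by
      rw [map_neg, coeff_monomial, if_pos rfl]
    have hSj : ∀ j < k + 1, coeff j S = coeff j Q := fun j hj => by
      rw [hS, map_add, hm d j hj, add_zero]
    have hSk : coeff (k + 1) S = -d := by
      rw [hS, map_add, hm', hv _ (Nat.lt_succ_self k), zero_add]
    have hS0 : coeff 0 S = z := by rw [hSj 0 (Nat.succ_pos k), h0]
    have hScub : ∀ j < k + 1, coeff j (S * S * S + S) = 0 := fun j hj => by
      rw [hS, (coeff_cubic_add (Nat.succ_pos k) (hm d) h0).1 j hj, hc j (by omega)]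
    have hSlax : ∀ j < k + 1, coeff j (laxOp D z S) = 0 := fun j hj => by
      rw [← hl j (by omega)]
      rcases j with _ | j
      · simp only [coeff_zero_laxOp, hSj 0 hj]
      · simp only [coeff_succ_laxOp, hSj _ hj, hSj j (by omega)]
    set ℓ := coeff (k + 1) (laxOp D z S) with hℓ
    have hℓe : ℓ = D (coeff k Q) - (z * d - d * z) := by
      rw [hℓ, coeff_succ_laxOp, hSk, hSj k (Nat.lt_succ_self k)]
      noncomm_ring
    -- The identity a⁵ + 5a³ + 4a = 0 for a = ad z gives a(1 − a ∘ adInv) = 0 on every element.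
    have hadℓ : z * ℓ - ℓ * z = 0 := by
      obtain ⟨h1, h2⟩ := cube_rules hz
      rw [hℓe, hd]
      simp only [adInv, mul_add, add_mul, mul_sub, sub_mul, mul_smul_comm, smul_mul_assoc, smul_add,
        smul_sub, mul_assoc, h1, h2, mul_neg, neg_mul, neg_neg, smul_neg]
      module
    -- Both `laxOp D z S` and S³ + S vanish below order k + 1, so only products with constant terms
    -- contribute to this coefficient.
    have hprod : z * p - p * z = ℓ * z * z + z * ℓ * z + z * z * ℓ + ℓ := by
      have e : laxOp D z (S * S * S + S) = laxOp D z S * (S * S) + S * (laxOp D z S * S)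
          + S * S * laxOp D z S + laxOp D z S := by
        rw [laxOp_add, laxOp_mul D hD, laxOp_mul D hD]
        noncomm_ring
      have e' := congrArg (coeff (k + 1)) e
      have hm0 : coeff 0 (S * S) = z * z := by simp only [coeff_mul]; simp [← hS0]
      rw [coeff_succ_laxOp, hScub k (Nat.lt_succ_self k), map_zero, zero_add, ← hp, map_add, map_add,
        map_add, coeff_mul_of_vanish hSlax, coeff_mul_of_vanish' (coeff_mul_vanish hSlax).1,
        coeff_mul_of_vanish hSlax, coeff_mul_of_vanish' hSlax, hm0, hS0] at e'
      rw [← hℓ] at e'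
      rw [e']
      simp only [mul_assoc]
    have hzℓ : z * ℓ = ℓ * z := sub_eq_zero.1 hadℓ
    -- The linearised cubic of ℓ commutes with z because ℓ does; thus (ad z)²p = 0 and
    -- `ad_eq_zero_of_ad_ad` applies.
    have hadp : z * p - p * z = 0 := by
      apply ad_eq_zero_of_ad_ad hz
      rw [hprod]
      have a1 : z * (ℓ * z * z + z * ℓ * z + z * z * ℓ + ℓ) =
        (ℓ * z * z + z * ℓ * z + z * z * ℓ + ℓ) * z := by
        have : ∀ y, z * (ℓ * y) = ℓ * (z * y) := fun y => by rw [← mul_assoc, hzℓ, mul_assoc]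
        simp only [mul_add, add_mul, mul_assoc, hzℓ, this]
      rw [a1, sub_self]
    have hℓ0 : ℓ = 0 := eq_zero_of_ad_of_cubic hz (by rw [← hprod, hadp]) hadℓ
    have hzp : z * p = p * z := sub_eq_zero.1 hadp
    have hzp' : ∀ y, z * (p * y) = p * (z * y) := fun y => by rw [← mul_assoc, hzp, mul_assoc]
    have hTj : ∀ j < k + 1, coeff j (laxPartial D z (k + 1)) = coeff j S := fun j hj => by
      rw [hstep, map_add, hm c j hj, add_zero]
    refine ⟨by rw [hTj 0 (Nat.succ_pos k), hS0], fun j hj => ?_, fun j hj => ?_, fun j hj => ?_⟩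
    · rw [hstep, hS, map_add, map_add, hv j (by omega), map_neg, map_neg, coeff_monomial,
        coeff_monomial, if_neg hj.ne', if_neg hj.ne']
      simp
    · rcases hj.lt_or_eq with hj | rfl
      · rw [← hSlax j hj]
        rcases j with _ | j
        · simp only [coeff_zero_laxOp, hTj 0 hj]
        · simp only [coeff_succ_laxOp, hTj _ hj, hTj j (by omega)]
      · rw [coeff_succ_laxOp, hTj k (Nat.lt_succ_self k), hstep, map_add, hm', ← hℓ0, hℓ,
          coeff_succ_laxOp]
        have : z * c - c * z = 0 := by
          rw [hcdef]
          simp only [mul_add, add_mul, mul_smul_comm, smul_mul_assoc, mul_assoc, hzp, hzp', sub_self]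
        rw [mul_add, add_mul, mul_neg, neg_mul]
        rw [sub_eq_zero] at this
        rw [this]
        abel
    · rcases hj.lt_or_eq with hj | rfl
      · rw [hstep, (coeff_cubic_add (Nat.succ_pos k) (hm c) hS0).1 j hj, hScub j hj]
      · rw [hstep, (coeff_cubic_add (Nat.succ_pos k) (hm c) hS0).2, ← hp, hm', hcdef]
        obtain ⟨h1, h2⟩ := cube_rules hz
        simp only [mul_add, add_mul, mul_smul_comm, smul_mul_assoc, mul_assoc, hzp, hzp', h1, h2,
          mul_neg, neg_mul, smul_add, neg_add, neg_neg, smul_neg]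
        module

-- Each stage changes a single new coefficient, so the partial sums stabilise coefficientwise.
open PowerSeries in
theorem coeff_laxPartial (D : A →+ A) (z : A) {j k : ℕ} (h : j ≤ k) :
    coeff j (laxPartial D z k) = lax D z j := by
  induction k, h using Nat.le_induction with
  | base => rfl
  | succ k hk ih =>
    rw [← ih, laxPartial, map_sub, map_sub, coeff_monomial, coeff_monomial, if_neg (by omega),
      if_neg (by omega), sub_zero, sub_zero]

open PowerSeries in
/-- The formal solution exists. -/
theorem mk_lax_spec (D : A →+ A) (hD : ∀ x y, D (x * y) = D x * y + x * D y) {z : A}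
    (hz : z * z * z = -z) :
    laxOp D z (PowerSeries.mk (lax D z)) = 0 ∧
    PowerSeries.mk (lax D z) * PowerSeries.mk (lax D z) * PowerSeries.mk (lax D z) +
      PowerSeries.mk (lax D z) = 0 := by
  constructor
  · ext n
    rw [map_zero, ← (laxPartial_spec D hD hz n).2.2.1 n le_rfl]
    rcases n with _ | n
    · simp only [coeff_zero_laxOp, coeff_mk, coeff_laxPartial D z le_rfl]
    · simp only [coeff_succ_laxOp, coeff_mk, coeff_laxPartial D z le_rfl,
        coeff_laxPartial D z (Nat.le_succ n)]
  · ext n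
    rw [map_zero, ← (laxPartial_spec D hD hz n).2.2.2 n le_rfl]
    simp only [map_add, coeff_mul, coeff_mk, coeff_laxPartial D z le_rfl]
    congr 1
    refine Finset.sum_congr rfl fun x hx => ?_
    rw [Finset.HasAntidiagonal.mem_antidiagonal] at hx
    rw [coeff_laxPartial D z (by omega)]
    congr 1
    refine Finset.sum_congr rfl fun y hy => ?_
    rw [Finset.HasAntidiagonal.mem_antidiagonal] at hy
    rw [coeff_laxPartial D z (by omega), coeff_laxPartial D z (by omega)]

theorem lax_zero (D : A → A) (z : A) : lax D z 0 = z := by simp [lax, laxPartial]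

theorem lax_rec (D : A →+ A) (hD : ∀ x y, D (x * y) = D x * y + x * D y) {z : A}
    (hz : z * z * z = -z) (k : ℕ) :
    D (lax D z k) + (z * lax D z (k + 1) - lax D z (k + 1) * z) = 0 := by
  have h := congrArg (PowerSeries.coeff (k + 1)) (mk_lax_spec D hD hz).1
  rw [coeff_succ_laxOp] at h
  simpa only [PowerSeries.coeff_mk, map_zero] using h

open PowerSeries in
/-- A sequence with `q₀ = z` solving the Lax equation and the cubic equation is `lax`. -/
theorem eq_lax (D : A →+ A) (hD : ∀ x y, D (x * y) = D x * y + x * D y) {z : A}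
    (hz : z * z * z = -z) {q : ℕ → A} (h0 : q 0 = z)
    (hq : ∀ k, D (q k) + (z * q (k + 1) - q (k + 1) * z) = 0)
    (h3 : ∀ n, (∑ x ∈ Finset.HasAntidiagonal.antidiagonal n, (∑ y ∈ Finset.HasAntidiagonal.antidiagonal x.1, q y.1 * q y.2) * q x.2)
      + q n = 0) (k : ℕ) : q k = lax D z k := by
  have h := mk_lax_spec D hD hz
  have := lax_unique D hz (P := PowerSeries.mk q) (Q := PowerSeries.mk (lax D z))
    (by rw [coeff_mk, h0]) (by rw [coeff_mk, lax_zero]) ?_ h.1 ?_ h.2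
  · simpa using congrArg (coeff k) this
  · ext n
    rcases n with _ | n
    · simp [coeff_zero_laxOp, h0]
    · rw [coeff_succ_laxOp]; simpa using hq n
  · ext n
    simpa [coeff_mul] using h3 n

theorem lax_cubic (D : A →+ A) (hD : ∀ x y, D (x * y) = D x * y + x * D y) {z : A}
    (hz : z * z * z = -z) (n : ℕ) :
    (∑ x ∈ Finset.HasAntidiagonal.antidiagonal n,
      (∑ y ∈ Finset.HasAntidiagonal.antidiagonal x.1, lax D z y.1 * lax D z y.2) * lax D z x.2) + lax D z n = 0 := by
  simpa [PowerSeries.coeff_mul] using congrArg (PowerSeries.coeff n) (mk_lax_spec D hD hz).2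

/-- Without derivative terms the formal solution is constant. -/
theorem lax_trivial {z : A} (hz : z * z * z = -z) (k : ℕ) :
    lax (fun _ => (0 : A)) z (k + 1) = 0 := by
  have hq0 : ∀ j : ℕ, (if j = 0 then z else 0 : A) = lax (0 : A →+ A) z j :=
    eq_lax (0 : A →+ A) (by simp) hz (by simp) (by simp) (by
      intro n
      rcases n with _ | n
      · simp [hz]
      · rw [if_neg (by omega), add_zero]
        refine Finset.sum_eq_zero fun x hx => ?_
        rw [Finset.HasAntidiagonal.mem_antidiagonal] at hx
        by_cases h2 : x.2 = 0
        · rw [Finset.sum_eq_zero, zero_mul]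
          intro y hy
          rw [Finset.HasAntidiagonal.mem_antidiagonal] at hy
          by_cases h1 : y.1 = 0
          · rw [if_neg (show ¬ y.2 = 0 by omega), mul_zero]
          · rw [if_neg h1, zero_mul]
        · rw [if_neg h2, mul_zero])
  have := hq0 (k + 1)
  rw [if_neg (by omega)] at this
  exact this.symm

/-- The formal solution is skew when `z` is. -/
theorem star_lax [StarRing A] (D : A →+ A) (hD : ∀ x y, D (x * y) = D x * y + x * D y)
    (hs : ∀ x, star (D x) = D (star x)) {z : A} (hz : z * z * z = -z) (hsz : star z = -z) (k : ℕ) :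
    star (lax D z k) = -lax D z k := by
  have h := eq_lax D hD hz (q := fun k => -star (lax D z k)) (by simp [lax_zero, hsz]) ?_ ?_ k
  · exact neg_eq_iff_eq_neg.1 h
  · intro k
    have := congrArg star (lax_rec D hD hz k)
    simp only [star_add, star_sub, star_mul, hsz, hs, star_zero] at this
    rw [map_neg, ← neg_eq_zero, ← this]
    noncomm_ring
  · intro n
    have := congrArg star (lax_cubic D hD hz n)
    rw [← neg_eq_zero, ← star_zero, ← this]
    simp only [star_add, star_sum, star_mul, neg_add, neg_neg, Finset.mul_sum, Finset.sum_mul,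
      neg_mul, mul_neg, Finset.sum_neg_distrib]
    congr 1
    rw [Finset.sum_sigma', Finset.sum_sigma']
    -- Conjugation reverses triple products; this involution of nested antidiagonals reverses the
    -- index triple (c, d, b).
    refine Finset.sum_nbij' (fun x => ⟨(x.2.2 + x.1.2, x.2.1), (x.1.2, x.2.2)⟩)
      (fun x => ⟨(x.2.2 + x.1.2, x.2.1), (x.1.2, x.2.2)⟩) ?_ ?_ ?_ ?_ ?_
    · rintro ⟨⟨a, b⟩, ⟨c, d⟩⟩ h; simp at h ⊢; omega
    · rintro ⟨⟨a, b⟩, ⟨c, d⟩⟩ h; simp at h ⊢; omega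
    · rintro ⟨⟨a, b⟩, ⟨c, d⟩⟩ h
      simp at h ⊢
      omega
    · rintro ⟨⟨a, b⟩, ⟨c, d⟩⟩ h
      simp at h ⊢
      omega
    · rintro ⟨⟨a, b⟩, ⟨c, d⟩⟩ h
      simp only [mul_assoc]

/-- The formal solution alternates in parity when `z` is odd under an involution `s`. -/
theorem parity_lax (D : A →+ A) (hD : ∀ x y, D (x * y) = D x * y + x * D y) {s : A}
    (hs : s * s = 1) (hDs : ∀ x, D (s * x * s) = s * D x * s) {z : A} (hz : z * z * z = -z)
    (hsz : s * z * s = -z) (k : ℕ) :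
    s * lax D z k * s = (-1 : ℝ) ^ (k + 1) • lax D z k := by
  have hs' : ∀ y, s * (s * y) = y := fun y => by rw [← mul_assoc, hs, one_mul]
  have hzs : z = -(s * z * s) := by rw [hsz, neg_neg]
  have hcm : ∀ x, z * (s * x * s) - (s * x * s) * z = -(s * (z * x - x * z) * s) := fun x => by
    nth_rewrite 1 2 [hzs]
    simp only [mul_assoc, hs', neg_mul, mul_neg, mul_sub, sub_mul]
    abel
  have hDr : ∀ (n : ℕ) x, D ((-1 : ℝ) ^ n • x) = (-1 : ℝ) ^ n • D x := fun n x => by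
    rcases neg_one_pow_eq_or ℝ n with h | h <;> rw [h] <;> simp
  -- These are the coefficients of −s Q(−X) s: conjugation by s sends z to −z, the substitution X ↦
  -- −X compensates in the linear equation, and the overall sign restores the leading term.
  have h := eq_lax D hD hz (q := fun k => (-1 : ℝ) ^ (k + 1) • (s * lax D z k * s))
    (by simp [lax_zero, hsz]) ?_ ?_ k
  · conv_rhs => rw [← h, smul_smul, ← mul_pow]
    simp
  · intro k
    have := lax_rec D hD hz k
    rw [hDr, hDs, mul_smul_comm, smul_mul_assoc, ← smul_sub, hcm, pow_succ (-1 : ℝ) (k + 1),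
      mul_neg_one, neg_smul, smul_neg, neg_neg, ← smul_add, ← add_mul, ← mul_add, this]
    simp
  · intro n
    have := lax_cubic D hD hz n
    have h1 : ∀ x ∈ Finset.HasAntidiagonal.antidiagonal n, ∀ y ∈ Finset.HasAntidiagonal.antidiagonal x.1,
        ((-1 : ℝ) ^ (y.1 + 1) • (s * lax D z y.1 * s)) * ((-1 : ℝ) ^ (y.2 + 1) • (s * lax D z y.2 * s))
          * ((-1 : ℝ) ^ (x.2 + 1) • (s * lax D z x.2 * s)) =
        (-1 : ℝ) ^ (n + 1) • (s * (lax D z y.1 * lax D z y.2 * lax D z x.2) * s) := by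
      intro x hx y hy
      rw [Finset.HasAntidiagonal.mem_antidiagonal] at hx hy
      simp only [mul_smul_comm, smul_mul_assoc, smul_smul, ← pow_add]
      rw [show x.2 + 1 + (y.2 + 1 + (y.1 + 1)) = (n + 1) + 2 by omega, pow_add]
      simp only [mul_assoc, hs']
      norm_num
    calc _ = (∑ x ∈ Finset.HasAntidiagonal.antidiagonal n, ∑ y ∈ Finset.HasAntidiagonal.antidiagonal x.1,
          (-1 : ℝ) ^ (n + 1) • (s * (lax D z y.1 * lax D z y.2 * lax D z x.2) * s)) +
          (-1 : ℝ) ^ (n + 1) • (s * lax D z n * s) := by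
          congr 1
          refine Finset.sum_congr rfl fun x hx => ?_
          rw [Finset.sum_mul]
          exact Finset.sum_congr rfl fun y hy => h1 x hx y hy
      _ = (-1 : ℝ) ^ (n + 1) • (s * ((∑ x ∈ Finset.HasAntidiagonal.antidiagonal n,
          (∑ y ∈ Finset.HasAntidiagonal.antidiagonal x.1, lax D z y.1 * lax D z y.2) * lax D z x.2)
            + lax D z n) * s) := by
          simp only [mul_add, add_mul, smul_add, Finset.mul_sum, Finset.sum_mul, Finset.smul_sum]
      _ = 0 := by rw [this]; simp

end Lax

/-! ### Total derivatives of differential polynomials -/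

section TotalDerivative

variable {m : ℕ}

theorem totalD_X (i : Coord m × ℕ) :
    totalD m (MvPolynomial.X i : DPoly m) = (MvPolynomial.X (i.1, i.2 + 1) : DPoly m) := by
  rw [totalD, MvPolynomial.mkDerivation_X]

/-- Both sides come from derivations, so the commutator relation [∂_{c,k+1}, D_x] = ∂_{c,k} has to
be checked on variables only. -/
theorem pderiv_succ_totalD (c : Coord m) (k : ℕ) (f : DPoly m) :
    MvPolynomial.pderiv (c, k + 1) (totalD m f) =
      totalD m (MvPolynomial.pderiv (c, k + 1) f) + MvPolynomial.pderiv (c, k) f := by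
  classical
  have h : ⁅(MvPolynomial.pderiv (c, k + 1) : Derivation ℝ (DPoly m) (DPoly m)), totalD m⁆ =
      (MvPolynomial.pderiv (c, k) : Derivation ℝ (DPoly m) (DPoly m)) := by
    refine MvPolynomial.derivation_ext fun i => ?_
    obtain ⟨d, j⟩ := i
    rw [Derivation.commutator_apply, totalD_X, MvPolynomial.pderiv_X, MvPolynomial.pderiv_X,
      MvPolynomial.pderiv_X]
    by_cases h : d = c ∧ j = k
    · obtain ⟨rfl, rfl⟩ := h
      have : ((d, j + 1) : Coord m × ℕ) ≠ (d, j) := by simp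
      simp [Pi.single_apply]
    · have h2 : ¬ (((d, j) : Coord m × ℕ) = (c, k)) := by simpa using h
      have h1 : ¬ (((d, j + 1) : Coord m × ℕ) = (c, k + 1)) := by simpa using h
      simp only [Pi.single_apply, h2, h1, if_false]
      split <;> simp
  have h' := congrArg (fun D : Derivation ℝ (DPoly m) (DPoly m) => D f) h
  simp only [Derivation.commutator_apply] at h'
  rw [← h']
  abel

theorem eq_C_of_pderiv {σ : Type*} {f : MvPolynomial σ ℝ}
    (h : ∀ i, MvPolynomial.pderiv i f = 0) : f = MvPolynomial.C (MvPolynomial.constantCoeff f) := by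
  classical
  ext d
  rw [MvPolynomial.coeff_C]
  by_cases hd : 0 = d
  · rw [if_pos hd, ← hd]; rfl
  · rw [if_neg hd]
    obtain ⟨i, hi⟩ : ∃ i, d i ≠ 0 := by
      by_contra! hc
      exact hd (Finsupp.ext fun i => (hc i).symm)
    have h1 := congrArg (MvPolynomial.coeff (d - Finsupp.single i 1)) (h i)
    rw [MvPolynomial.coeff_pderiv, MvPolynomial.coeff_zero] at h1
    have h2 : d - Finsupp.single i 1 + Finsupp.single i 1 = d :=
      tsub_add_cancel_of_le (Finsupp.single_le_iff.2 (Nat.one_le_iff_ne_zero.2 hi))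
    rw [h2] at h1
    rcases mul_eq_zero.1 h1 with h3 | h3
    · exact h3
    · exact absurd h3 (by positivity)

/-- The kernel of the total derivative consists of the constants. -/
theorem eq_C_of_totalD {f : DPoly m} (h : totalD m f = 0) :
    f = MvPolynomial.C (MvPolynomial.constantCoeff f) := by
  obtain ⟨N, hN⟩ : ∃ N : ℕ, ∀ i ∈ f.vars, i.2 < N :=
    ⟨f.vars.sup (fun i => i.2) + 1, fun i hi => Nat.lt_succ_of_le (Finset.le_sup (f := fun i => i.2) hi)⟩
  have h0 : ∀ (c : Coord m) (k : ℕ), N ≤ k → MvPolynomial.pderiv (c, k) f = 0 := fun c k hk =>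
    MvPolynomial.pderiv_eq_zero_of_notMem_vars fun hc => absurd (hN _ hc) (by simpa using hk)
  -- Descending induction on the jet order: if D_x f = 0 and ∂_{c,k+1} f = 0, the commutator
  -- relation yields ∂_{c,k} f = 0. The start N exceeds the order of f, and j bounds the distance
  -- down from N.
  have h1 : ∀ (c : Coord m) (j k : ℕ), N ≤ k + j → MvPolynomial.pderiv (c, k) f = 0 := by
    intro c j
    induction j with
    | zero => exact fun k hk => h0 c k hk
    | succ j ih =>
      intro k hk
      have := pderiv_succ_totalD c k f
      rw [h, ih (k + 1) (by omega), map_zero, map_zero, zero_add] at this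
      exact this.symm
  exact eq_C_of_pderiv fun i => h1 i.1 N i.2 (by omega)

/-- Only constants are killed by D_x, so the normalisation of the constant term makes the chosen
primitive the given one. -/
theorem totalDInv_eq {f g : DPoly m} (hg : MvPolynomial.constantCoeff g = 0)
    (h : totalD m g = f) : totalDInv f = g := by
  have hex : ∃ g : DPoly m, MvPolynomial.constantCoeff g = 0 ∧ totalD m g = f := ⟨g, hg, h⟩
  rw [totalDInv, dif_pos hex]
  have hs := hex.choose_spec
  have h1 : totalD m (hex.choose - g) = 0 := by rw [map_sub, hs.2, h, sub_self]
  have h2 := eq_C_of_totalD h1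
  rw [map_sub, hs.1, hg, sub_self, map_zero] at h2
  exact sub_eq_zero.1 h2

end TotalDerivative

/-! ### Quaternions over commutative algebras -/

section QuaternionMap

variable {R S : Type} [CommRing R] [Algebra ℝ R] [CommRing S] [Algebra ℝ S]

@[simp] theorem qmap_re (f : R → S) (q : ℍ[R]) : (qmap f q).re = f q.re := rfl

@[simp] theorem qmap_imI (f : R → S) (q : ℍ[R]) : (qmap f q).imI = f q.imI := rfl

@[simp] theorem qmap_imJ (f : R → S) (q : ℍ[R]) : (qmap f q).imJ = f q.imJ := rfl

@[simp] theorem qmap_imK (f : R → S) (q : ℍ[R]) : (qmap f q).imK = f q.imK := rfl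

/-- `qmap` of an algebra homomorphism. -/
def qmapHom (f : R →ₐ[ℝ] S) : ℍ[R] →ₐ[ℝ] ℍ[S] where
  toFun := qmap f
  map_one' := by apply Quaternion.ext <;> simp
  map_mul' x y := by apply Quaternion.ext <;> simp
  map_zero' := by apply Quaternion.ext <;> simp
  map_add' x y := by apply Quaternion.ext <;> simp
  commutes' r := by
    rw [IsScalarTower.algebraMap_apply ℝ R ℍ[R], IsScalarTower.algebraMap_apply ℝ S ℍ[S]]
    apply Quaternion.ext <;> simp

theorem qmapHom_apply (f : R →ₐ[ℝ] S) (q : ℍ[R]) : qmapHom f q = qmap f q := rfl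

theorem qmapHom_star (f : R →ₐ[ℝ] S) (q : ℍ[R]) : qmapHom f (star q) = star (qmapHom f q) := by
  apply Quaternion.ext <;> simp [qmapHom_apply]

end QuaternionMap

/-! ### The total derivative and its inverse on quaternionic differential polynomials -/

section QuaternionDerivative

variable {m : ℕ}

theorem qD_add (x y : ℍ[DPoly m]) : qD (x + y) = qD x + qD y := by
  apply Quaternion.ext <;> simp [qD]

theorem qD_mul (x y : ℍ[DPoly m]) : qD (x * y) = qD x * y + x * qD y := by
  apply Quaternion.ext <;> simp only [qD, qmap_re, qmap_imI, qmap_imJ, qmap_imK, Quaternion.re_mul, Quaternion.imI_mul, Quaternion.imJ_mul,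
    Quaternion.imK_mul, Quaternion.re_add, Quaternion.imI_add, Quaternion.imJ_add,
    Quaternion.imK_add, map_add, map_sub, Derivation.leibniz, smul_eq_mul] <;> ring

/-- `D_x` as an additive homomorphism. -/
def qDHom : ℍ[DPoly m] →+ ℍ[DPoly m] where
  toFun := qD
  map_zero' := by apply Quaternion.ext <;> simp [qD]
  map_add' := qD_add

theorem qDHom_apply (x : ℍ[DPoly m]) : qDHom x = qD x := rfl

theorem qD_zero : qD (0 : ℍ[DPoly m]) = 0 := qDHom.map_zero

theorem qD_one : qD (1 : ℍ[DPoly m]) = 0 := by apply Quaternion.ext <;> simp [qD]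

theorem qD_neg (x : ℍ[DPoly m]) : qD (-x) = -qD x := qDHom.map_neg x

theorem qD_sub (x y : ℍ[DPoly m]) : qD (x - y) = qD x - qD y := qDHom.map_sub x y

theorem qD_star (x : ℍ[DPoly m]) : qD (star x) = star (qD x) := by
  apply Quaternion.ext <;> simp [qD]

theorem qD_smul (r : ℝ) (x : ℍ[DPoly m]) : qD (r • x) = r • qD x := by
  apply Quaternion.ext <;> simp [qD]

/-- The constant terms of a quaternionic differential polynomial. -/
def qcc : ℍ[DPoly m] →ₐ[ℝ] ℍ[ℝ] := qmapHom (MvPolynomial.aeval fun _ => (0 : ℝ))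

/-- Every monomial of a total derivative contains a jet variable of positive order. -/
theorem qcc_qD (x : ℍ[DPoly m]) : qcc (qD x) = 0 := by
  have h : ∀ f : DPoly m, MvPolynomial.constantCoeff (totalD m f) = 0 := fun f => by
    induction f using MvPolynomial.induction_on with
    | C a => simp [totalD]
    | add p q hp hq => rw [map_add, map_add, hp, hq, add_zero]
    | mul_X p i hp => rw [Derivation.leibniz, totalD_X]; simp [hp]
  apply Quaternion.ext <;> simp [qcc, qmapHom_apply, qD, h]

/-- This is how each D_x⁻¹ is evaluated in the hierarchy: a primitive without constant term is
exhibited. -/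
theorem qDInv_eq {x y : ℍ[DPoly m]} (hy : qcc y = 0) (h : qD y = x) : qDInv x = y := by
  subst h
  have hc : ∀ f : DPoly m, MvPolynomial.aeval (fun _ => (0 : ℝ)) f = MvPolynomial.constantCoeff f :=
    fun f => by simp [MvPolynomial.aeval_zero']
  have h1 := congrArg (fun q : ℍ => q.re) hy
  have h2 := congrArg (fun q : ℍ => q.imI) hy
  have h3 := congrArg (fun q : ℍ => q.imJ) hy
  have h4 := congrArg (fun q : ℍ => q.imK) hy
  simp only [qcc, qmapHom_apply, qmap_re, qmap_imI, qmap_imJ, qmap_imK, hc] at h1 h2 h3 h4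
  apply Quaternion.ext
  · exact totalDInv_eq h1 rfl
  · exact totalDInv_eq h2 rfl
  · exact totalDInv_eq h3 rfl
  · exact totalDInv_eq h4 rfl

end QuaternionDerivative

/-! ### Block matrices -/

section Block

variable {S : Type*} {m : ℕ}

/-- A matrix of size `m + 2` in blocks of size `1`, `1`, `m`. -/
def blk (a b c d : S) (r s p q : Fin m → S) (W : Matrix (Fin m) (Fin m) S) :
    Matrix (Fin (m + 2)) (Fin (m + 2)) S :=
  Matrix.of (Fin.cons (Fin.cons a (Fin.cons b r)) (Fin.cons (Fin.cons c (Fin.cons d s))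
    fun i => Fin.cons (p i) (Fin.cons (q i) (W i))))

theorem blk_apply (a b c d : S) (r s p q : Fin m → S) (W : Matrix (Fin m) (Fin m) S) :
    blk a b c d r s p q W 0 0 = a ∧ blk a b c d r s p q W 0 1 = b ∧ blk a b c d r s p q W 1 0 = c ∧
    blk a b c d r s p q W 1 1 = d ∧ (∀ j, blk a b c d r s p q W 0 j.succ.succ = r j) ∧
    (∀ j, blk a b c d r s p q W 1 j.succ.succ = s j) ∧
    (∀ i, blk a b c d r s p q W i.succ.succ 0 = p i) ∧
    (∀ i, blk a b c d r s p q W i.succ.succ 1 = q i) ∧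
    ∀ i j, blk a b c d r s p q W i.succ.succ j.succ.succ = W i j :=
  ⟨rfl, rfl, rfl, rfl, fun _ => rfl, fun _ => rfl, fun _ => rfl, fun _ => rfl, fun _ _ => rfl⟩

theorem ext_blk {X Y : Matrix (Fin (m + 2)) (Fin (m + 2)) S} (h00 : X 0 0 = Y 0 0)
    (h01 : X 0 1 = Y 0 1) (h10 : X 1 0 = Y 1 0) (h11 : X 1 1 = Y 1 1)
    (h0 : ∀ j : Fin m, X 0 j.succ.succ = Y 0 j.succ.succ)
    (h1 : ∀ j : Fin m, X 1 j.succ.succ = Y 1 j.succ.succ)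
    (h2 : ∀ i : Fin m, X i.succ.succ 0 = Y i.succ.succ 0)
    (h3 : ∀ i : Fin m, X i.succ.succ 1 = Y i.succ.succ 1)
    (h4 : ∀ i j : Fin m, X i.succ.succ j.succ.succ = Y i.succ.succ j.succ.succ) : X = Y := by
  ext1 i j
  refine Fin.cases ?_ (fun i => Fin.cases ?_ (fun i => ?_) i) i <;>
  refine Fin.cases ?_ (fun j => Fin.cases ?_ (fun j => ?_) j) j
  exacts [h00, h01, h0 j, h10, h11, h1 j, h2 i, h3 i, h4 i j]

theorem eq_blk (X : Matrix (Fin (m + 2)) (Fin (m + 2)) S) :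
    X = blk (X 0 0) (X 0 1) (X 1 0) (X 1 1) (fun j => X 0 j.succ.succ) (fun j => X 1 j.succ.succ)
      (fun i => X i.succ.succ 0) (fun i => X i.succ.succ 1)
      (Matrix.of fun i j => X i.succ.succ j.succ.succ) := by
  apply ext_blk <;> intros <;> rfl

theorem blk_mul [NonUnitalSemiring S] (a b c d a' b' c' d' : S) (r s p q r' s' p' q' : Fin m → S)
    (W W' : Matrix (Fin m) (Fin m) S) :
    blk a b c d r s p q W * blk a' b' c' d' r' s' p' q' W' =
      blk (a * a' + b * c' + ∑ k, r k * p' k) (a * b' + b * d' + ∑ k, r k * q' k)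
        (c * a' + d * c' + ∑ k, s k * p' k) (c * b' + d * d' + ∑ k, s k * q' k)
        (fun j => a * r' j + b * s' j + ∑ k, r k * W' k j)
        (fun j => c * r' j + d * s' j + ∑ k, s k * W' k j)
        (fun i => p i * a' + q i * c' + ∑ k, W i k * p' k)
        (fun i => p i * b' + q i * d' + ∑ k, W i k * q' k)
        (Matrix.of fun i j => p i * r' j + q i * s' j + ∑ k, W i k * W' k j) := by
  apply ext_blk <;> intros <;> rw [Matrix.mul_apply, Fin.sum_univ_succ, Fin.sum_univ_succ,
    ← add_assoc] <;> rfl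

theorem blk_add [Add S] (a b c d a' b' c' d' : S) (r s p q r' s' p' q' : Fin m → S)
    (W W' : Matrix (Fin m) (Fin m) S) :
    blk a b c d r s p q W + blk a' b' c' d' r' s' p' q' W' =
      blk (a + a') (b + b') (c + c') (d + d') (fun j => r j + r' j) (fun j => s j + s' j)
        (fun j => p j + p' j) (fun j => q j + q' j) (Matrix.of fun i j => W i j + W' i j) := by
  apply ext_blk <;> intros <;> rfl

theorem blk_sub [Sub S] (a b c d a' b' c' d' : S) (r s p q r' s' p' q' : Fin m → S)
    (W W' : Matrix (Fin m) (Fin m) S) :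
    blk a b c d r s p q W - blk a' b' c' d' r' s' p' q' W' =
      blk (a - a') (b - b') (c - c') (d - d') (fun j => r j - r' j) (fun j => s j - s' j)
        (fun j => p j - p' j) (fun j => q j - q' j) (Matrix.of fun i j => W i j - W' i j) := by
  apply ext_blk <;> intros <;> rfl

theorem blk_neg [Neg S] (a b c d : S) (r s p q : Fin m → S) (W : Matrix (Fin m) (Fin m) S) :
    -blk a b c d r s p q W = blk (-a) (-b) (-c) (-d) (fun j => -r j) (fun j => -s j)
        (fun j => -p j) (fun j => -q j) (Matrix.of fun i j => -W i j) := by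
  apply ext_blk <;> intros <;> rfl

theorem blk_smul {T : Type*} [SMul T S] (t : T) (a b c d : S) (r s p q : Fin m → S)
    (W : Matrix (Fin m) (Fin m) S) :
    t • blk a b c d r s p q W = blk (t • a) (t • b) (t • c) (t • d) (fun j => t • r j)
      (fun j => t • s j) (fun j => t • p j) (fun j => t • q j) (Matrix.of fun i j => t • W i j) := by
  apply ext_blk <;> intros <;> rfl

theorem blk_map {T : Type*} (f : S → T) (a b c d : S) (r s p q : Fin m → S)
    (W : Matrix (Fin m) (Fin m) S) :
    (blk a b c d r s p q W).map f = blk (f a) (f b) (f c) (f d) (fun j => f (r j))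
      (fun j => f (s j)) (fun j => f (p j)) (fun j => f (q j)) (W.map f) := by
  apply ext_blk <;> intros <;> rfl

theorem blk_star [Star S] (a b c d : S) (r s p q : Fin m → S) (W : Matrix (Fin m) (Fin m) S) :
    star (blk a b c d r s p q W) = blk (star a) (star c) (star b) (star d) (fun j => star (p j))
      (fun j => star (q j)) (fun j => star (r j)) (fun j => star (s j)) (star W) := by
  apply ext_blk <;> intros <;> rfl

theorem blk_inj {a b c d a' b' c' d' : S} {r s p q r' s' p' q' : Fin m → S}
    {W W' : Matrix (Fin m) (Fin m) S}
    (h : blk a b c d r s p q W = blk a' b' c' d' r' s' p' q' W') :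
    a = a' ∧ b = b' ∧ c = c' ∧ d = d' ∧ r = r' ∧ s = s' ∧ p = p' ∧ q = q' ∧ W = W' := by
  have h' := fun i j => congrFun (congrFun h i) j
  exact ⟨h' 0 0, h' 0 1, h' 1 0, h' 1 1, funext fun j => h' 0 j.succ.succ,
    funext fun j => h' 1 j.succ.succ, funext fun j => h' j.succ.succ 0,
    funext fun j => h' j.succ.succ 1, Matrix.ext fun i j => h' i.succ.succ j.succ.succ⟩

end Block

/-! ### The pieces 𝔪, 𝔥_⊥ and 𝔥_∥ as block matrices -/

section Brackets

variable {R : Type} [CommRing R] [Algebra ℝ R] {m : ℕ}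

/-- The element `(a, b)` of `𝔪`, over a general algebra. -/
def qm (a : ℍ[R]) (b : Fin m → ℍ[R]) : Matrix (Fin (m + 2)) (Fin (m + 2)) ℍ[R] :=
  blk 0 a (-star a) 0 b 0 (fun j => -star (b j)) 0 0

/-- The element `(w, z)` of `𝔥_⊥`, over a general algebra. -/
def qh (w : ℍ[R]) (z : Fin m → ℍ[R]) : Matrix (Fin (m + 2)) (Fin (m + 2)) ℍ[R] :=
  blk w 0 0 (-w) 0 z 0 (fun j => -star (z j)) 0

/-- The element `(q, W)` of `𝔥_∥`. -/
def qd (q : ℍ[R]) (W : Matrix (Fin m) (Fin m) ℍ[R]) : Matrix (Fin (m + 2)) (Fin (m + 2)) ℍ[R] :=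
  blk q 0 0 q 0 0 0 0 W

/-- The matrix `diag(-1, 1, …, 1)`. -/
def qS (R : Type) [CommRing R] (m : ℕ) : Matrix (Fin (m + 2)) (Fin (m + 2)) ℍ[R] :=
  blk (-1) 0 0 1 0 0 0 0 1

theorem mMat_eq (a : ℍ) (b : Fin m → ℍ) : mMat a b = qm a b := by
  apply ext_blk <;> intros <;> simp [mMat, qm, blk_apply, Matrix.sum_apply, Matrix.single_apply,
    Fin.succ_ne_zero, Fin.succ_succ_ne_one, (Fin.succ_ne_zero _).symm,
    (Fin.succ_succ_ne_one _).symm]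

theorem hMat_eq (a : ℍ) (b : Fin m → ℍ) : hMat a b = qh a b := by
  apply ext_blk <;> intros <;> simp [hMat, qh, blk_apply, Matrix.sum_apply, Matrix.single_apply,
    Fin.succ_ne_zero, Fin.succ_succ_ne_one, (Fin.succ_ne_zero _).symm,
    (Fin.succ_succ_ne_one _).symm]

theorem symmS_eq : symmS m = qS ℝ m := by
  apply ext_blk <;> intros <;> simp [symmS, qS, blk_apply, Matrix.diagonal_apply, Matrix.one_apply,
    Fin.succ_ne_zero, Fin.succ_succ_ne_one, (Fin.succ_ne_zero _).symm,
    (Fin.succ_succ_ne_one _).symm]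

end Brackets

/-! ### Bracket relations and normal forms by parity -/

section Brackets

variable {R : Type} [CommRing R] [Algebra ℝ R] {m : ℕ}

theorem qm_inj {a a' : ℍ[R]} {b b' : Fin m → ℍ[R]} (h : qm a b = qm a' b') : a = a' ∧ b = b' := by
  obtain ⟨-, h1, -, -, h2, -⟩ := blk_inj h
  exact ⟨h1, h2⟩

theorem star_mul_sum (v : Fin m → ℍ[R]) (b : Fin m → ℍ[R]) :
    star (∑ k, v k * star (b k)) = ∑ k, b k * star (v k) := by
  simp [star_sum]

theorem qh_qm {u : ℍ[R]} (hu : star u = -u) (v : Fin m → ℍ[R]) (a : ℍ[R]) (b : Fin m → ℍ[R]) :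
    qh u v * qm a b - qm a b * qh u v = qm (u * a + a * u + herm b v) fun j => u * b j - a * v j := by
  simp only [qh, qm, blk_mul, blk_sub, herm, star_add, star_sub, star_mul, hu, star_mul_sum]
  apply ext_blk <;> intros <;> simp [blk_apply, add_assoc, sub_eq_add_neg] <;> abel

/-- On 𝔪 the kernel of ad E is the real line a = ā, b = 0; this is where h_∥ lives. An imaginary a
is doubled, which is the origin of the ½ in front of h in the components of the flow vector. -/
theorem E_qm (a : ℍ[R]) (b : Fin m → ℍ[R]) :
    qm 1 0 * qm a b - qm a b * qm 1 0 = qh (a - star a) fun j => -b j := by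
  simp only [qh, qm, blk_mul, blk_sub]
  apply ext_blk <;> intros <;> simp [blk_apply, add_assoc, sub_eq_add_neg]
  · rw [add_comm]
  · rw [add_comm]

/-- The 𝔥_∥ block commutes with E, so ad E sees the 𝔥_⊥ part alone. Combined with `E_qm`, (ad E)² is
−4 on imaginary a and −1 on b. -/
theorem E_qh {w : ℍ[R]} (hw : star w = -w) (z : Fin m → ℍ[R]) (q : ℍ[R])
    (W : Matrix (Fin m) (Fin m) ℍ[R]) :
    qm 1 0 * (qh w z + qd q W) - (qh w z + qd q W) * qm 1 0 = qm (-(2 : ℝ) • w) z := by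
  simp only [qh, qm, qd, blk_add, blk_mul, blk_sub]
  apply ext_blk <;> intros <;> simp [blk_apply, add_assoc, sub_eq_add_neg, two_smul, hw]
  abel

/-- The 𝔥_⊥ part of this bracket yields the terms of ℋ without derivative, and its 𝔥_∥ part yields
the expressions to which ℋ applies D_x⁻¹. -/
theorem qh_qh {u : ℍ[R]} (hu : star u = -u) (v : Fin m → ℍ[R]) {w : ℍ[R]} (hw : star w = -w)
    (z : Fin m → ℍ[R]) {q : ℍ[R]} (hq : star q = -q) {W : Matrix (Fin m) (Fin m) ℍ[R]}
    (hW : star W = -W) :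
    qh u v * (qh w z + qd q W) - (qh w z + qd q W) * qh u v =
      qh (comm u q + (1 / 2 : ℝ) • commV v z)
        (fun j => -u * z j + Matrix.vecMul v W j + w * v j - q * v j) +
      qd (comm u w - (1 / 2 : ℝ) • commV v z) (-commM v z) := by
  have hW' : ∀ i j, W i j = -star (W j i) := fun i j => by
    have := congrFun (congrFun hW i) j
    rw [Matrix.star_apply, Matrix.neg_apply] at this
    rw [this, neg_neg]
  simp only [qh, qm, qd, blk_add, blk_mul, blk_sub]
  apply ext_blk
  · simp [blk_apply, comm, commV]; noncomm_ring
  · simp [blk_apply]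
  · simp [blk_apply]
  · simp [blk_apply, comm, commV, herm]
    simp only [mul_add, add_mul, mul_neg, neg_mul]
    module
  · intro j; simp [blk_apply]
  · intro j; simp [blk_apply, Matrix.vecMul, dotProduct]; noncomm_ring
  · intro j; simp [blk_apply]
  · intro j
    simp [blk_apply, Matrix.vecMul, dotProduct, hu, hw, hq, star_sum]
    have e : ∑ x, W j x * star (v x) = -∑ x, star (W x j) * star (v x) := by
      rw [← Finset.sum_neg_distrib]
      exact Finset.sum_congr rfl fun x _ => by rw [hW' j x, neg_mul]
    rw [e]
    noncomm_ring
  · intro i j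
    simp [blk_apply, commM]
    noncomm_ring

/-- E is a rotation by a right angle in the first two coordinates and zero in the others. -/
theorem E_cube : (qm 1 0 : Matrix (Fin (m + 2)) (Fin (m + 2)) ℍ[R]) * qm 1 0 * qm 1 0 = -qm 1 0 := by
  simp only [qm, blk_mul, blk_neg]
  apply ext_blk <;> intros <;> simp [blk_apply]

theorem qS_sq : qS R m * qS R m = 1 := by
  simp only [qS, blk_mul]
  apply ext_blk <;> intros <;> simp [blk_apply, Matrix.one_apply, Fin.succ_ne_zero,
    Fin.succ_succ_ne_one, (Fin.succ_ne_zero _).symm, (Fin.succ_succ_ne_one _).symm]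

theorem qS_conj (X : Matrix (Fin (m + 2)) (Fin (m + 2)) ℍ[R]) :
    qS R m * X * qS R m = blk (X 0 0) (-X 0 1) (-X 1 0) (X 1 1) (fun j => -X 0 j.succ.succ)
      (fun j => X 1 j.succ.succ) (fun i => -X i.succ.succ 0) (fun i => X i.succ.succ 1)
      (Matrix.of fun i j => X i.succ.succ j.succ.succ) := by
  rw [eq_blk X]
  simp only [qS, blk_mul]
  apply ext_blk <;> intros <;> simp [blk_apply, Matrix.one_apply]

theorem eq_zero_of_eq_neg_self {x : ℍ[R]} (h : x = -x) : x = 0 := by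
  have : (2 : ℝ) • x = 0 := by rw [two_smul]; nth_rewrite 2 [h]; simp
  calc x = (1 / 2 : ℝ) • (2 : ℝ) • x := by rw [smul_smul]; norm_num
    _ = 0 := by rw [this, smul_zero]

/-- Skew-Hermitian matrices that are odd under the symmetry at the origin. -/
theorem eq_qm {X : Matrix (Fin (m + 2)) (Fin (m + 2)) ℍ[R]} (hs : star X = -X)
    (ho : qS R m * X * qS R m = -X) : X = qm (X 0 1) fun j => X 0 j.succ.succ := by
  rw [qS_conj] at ho
  have ho' := fun i j => congrFun (congrFun ho i) j
  have hs' := fun i j => congrFun (congrFun hs i) j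
  have e : ∀ i j, X i j = -star (X j i) := fun i j => by
    rw [← neg_eq_iff_eq_neg, ← Matrix.neg_apply, ← hs' i j, Matrix.star_apply]
  apply ext_blk
  · exact eq_zero_of_eq_neg_self (ho' 0 0)
  · rfl
  · exact e 1 0
  · exact eq_zero_of_eq_neg_self (ho' 1 1)
  · exact fun j => rfl
  · exact fun j => eq_zero_of_eq_neg_self (ho' 1 j.succ.succ)
  · exact fun j => e j.succ.succ 0
  · exact fun j => eq_zero_of_eq_neg_self (ho' j.succ.succ 1)
  · exact fun i j => eq_zero_of_eq_neg_self (ho' i.succ.succ j.succ.succ)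

/-- Skew-Hermitian matrices that are even under the symmetry at the origin. -/
theorem eq_qh_add_qd {X : Matrix (Fin (m + 2)) (Fin (m + 2)) ℍ[R]} (hs : star X = -X)
    (ho : qS R m * X * qS R m = X) :
    ∃ (w : ℍ[R]) (z : Fin m → ℍ[R]) (q : ℍ[R]) (W : Matrix (Fin m) (Fin m) ℍ[R]),
      X = qh w z + qd q W ∧ star w = -w ∧ star q = -q ∧ star W = -W ∧
      q = (1 / 2 : ℝ) • (X 0 0 + X 1 1) ∧ ∀ i j, W i j = X i.succ.succ j.succ.succ := by
  rw [qS_conj] at ho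
  have ho' := fun i j => congrFun (congrFun ho i) j
  have hs' := fun i j => congrFun (congrFun hs i) j
  have e : ∀ i j, X i j = -star (X j i) := fun i j => by
    rw [← neg_eq_iff_eq_neg, ← Matrix.neg_apply, ← hs' i j, Matrix.star_apply]
  have e' : ∀ i j, star (X i j) = -X j i := fun i j => by rw [e j i, neg_neg]
  refine ⟨(1 / 2 : ℝ) • (X 0 0 - X 1 1), fun j => X 1 j.succ.succ, (1 / 2 : ℝ) • (X 0 0 + X 1 1),
    Matrix.of fun i j => X i.succ.succ j.succ.succ, ?_, ?_, ?_, ?_, rfl, fun i j => rfl⟩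
  · rw [qh, qd, blk_add]
    apply ext_blk <;> intros <;> simp only [blk_apply]
    · module
    · rw [add_zero]; exact eq_zero_of_eq_neg_self (ho' 0 1).symm
    · rw [add_zero]; exact eq_zero_of_eq_neg_self (ho' 1 0).symm
    · module
    · rw [Pi.zero_apply, add_zero]; exact eq_zero_of_eq_neg_self (ho' 0 _).symm
    · rw [Pi.zero_apply, add_zero]
    · rw [Pi.zero_apply, add_zero]; exact eq_zero_of_eq_neg_self (ho' _ 0).symm
    · rw [Pi.zero_apply, add_zero]; exact e _ _
    · simp
  · rw [Quaternion.star_smul, star_sub, e', e']; module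
  · rw [Quaternion.star_smul, star_add, e', e']; module
  · ext1 i j
    exact e' _ _

end Brackets

theorem eq_zero_of_eq_neg {M : Type*} [AddCommGroup M] [Module ℝ M] {x : M} (h : x = -x) : x = 0 := by
  have h2 : (2 : ℝ) • x = 0 := by rw [two_smul]; nth_rewrite 2 [h]; simp
  calc x = (1 / 2 : ℝ) • (2 : ℝ) • x := by rw [smul_smul]; norm_num
    _ = 0 := by rw [h2, smul_zero]

theorem smul_cancel {M : Type*} [AddCommGroup M] [Module ℝ M] {x y : M} {r : ℝ} (hr : r ≠ 0)
    (h : r • x = r • y) : x = y := by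
  simpa [smul_smul, hr] using congrArg (fun x => r⁻¹ • x) h

/-! ### The Lax recursion in quaternionic components -/

section LaxComponents

variable {R : Type} [CommRing R] [Algebra ℝ R] {m : ℕ}

/-- Matrices over `ℍ[R]`. -/
abbrev RMat (R : Type) [CommRing R] (m : ℕ) : Type := Matrix (Fin (m + 2)) (Fin (m + 2)) ℍ[R]

variable (δ : ℍ[R] →+ ℍ[R]) (u : ℍ[R]) (v : Fin m → ℍ[R])

/-- The covariant derivative `D_x + ad (u, v)`. -/
def covD : RMat R m →+ RMat R m where
  toFun X := X.map δ + (qh u v * X - X * qh u v)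
  map_zero' := by
    rw [Matrix.map_zero _ (map_zero δ)]
    simp
  map_add' X Y := by
    rw [Matrix.map_add _ (map_add δ), mul_add, add_mul]
    abel

theorem covD_apply (X : RMat R m) : covD δ u v X = X.map δ + (qh u v * X - X * qh u v) := rfl

/-- The hypotheses on a derivation of quaternions that is induced from a real derivation. -/
structure IsQDer (δ : ℍ[R] →+ ℍ[R]) : Prop where
  mul : ∀ x y, δ (x * y) = δ x * y + x * δ y
  star : ∀ x, δ (star x) = star (δ x)
  smul : ∀ (r : ℝ) x, δ (r • x) = r • δ x

variable {δ u v}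

theorem IsQDer.one (hδ : IsQDer δ) : δ 1 = 0 := by
  have := hδ.mul 1 1
  simpa using this

theorem map_der_mul (hδ : IsQDer δ) (X Y : RMat R m) :
    (X * Y).map δ = X.map δ * Y + X * Y.map δ := by
  ext1 i j
  simp only [Matrix.map_apply, Matrix.add_apply, Matrix.mul_apply]
  rw [← Finset.sum_add_distrib, map_sum]
  exact Finset.sum_congr rfl fun k _ => hδ.mul _ _

theorem covD_mul (hδ : IsQDer δ) (X Y : RMat R m) :
    covD δ u v (X * Y) = covD δ u v X * Y + X * covD δ u v Y := by
  simp only [covD_apply, map_der_mul hδ, mul_add, add_mul, mul_sub, sub_mul, mul_assoc]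
  abel

theorem covD_smul (hδ : IsQDer δ) (r : ℝ) (X : RMat R m) : covD δ u v (r • X) = r • covD δ u v X := by
  have : (r • X).map δ = r • X.map δ := Matrix.ext fun i j => hδ.smul r _
  rw [covD_apply, covD_apply, this, mul_smul_comm, smul_mul_assoc, smul_add, smul_sub]

theorem star_qh (hu : star u = -u) : star (qh u v) = -qh u v := by
  simp only [qh, blk_star, blk_neg]
  apply ext_blk <;> intros <;> simp [blk_apply, hu]

theorem star_qm (a : ℍ[R]) (b : Fin m → ℍ[R]) : star (qm a b) = -qm a b := by
  simp only [qm, blk_star, blk_neg]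
  apply ext_blk <;> intros <;> simp [blk_apply]

theorem qS_qh : qS R m * qh u v * qS R m = qh u v := by
  rw [qS_conj]
  apply ext_blk <;> intros <;> simp [blk_apply, qh]

theorem qS_qm (a : ℍ[R]) (b : Fin m → ℍ[R]) : qS R m * qm a b * qS R m = -qm a b := by
  rw [qS_conj]
  simp only [qm, blk_neg]
  apply ext_blk <;> intros <;> simp [blk_apply]

theorem star_covD (hδ : IsQDer δ) (hu : star u = -u) (X : RMat R m) :
    star (covD δ u v X) = covD δ u v (star X) := by
  have : star (X.map δ) = (star X).map δ := Matrix.ext fun i j => (hδ.star _).symm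
  rw [covD_apply, covD_apply, star_add, star_sub, star_mul, star_mul, star_qh hu, this, neg_mul,
    mul_neg]
  abel

/-- S has constant entries and commutes with the connection matrix (u, v) ∈ 𝔥, so it is covariantly
constant. -/
theorem covD_qS (hδ : IsQDer δ) (X : RMat R m) :
    covD δ u v (qS R m * X * qS R m) = qS R m * covD δ u v X * qS R m := by
  have h0 : (qS R m).map δ = 0 := by
    rw [qS, blk_map]
    apply ext_blk <;> intros <;> simp [blk_apply, hδ.one, Matrix.one_apply]
    split <;> simp [hδ.one]
  have hω : qh u v * qS R m = qS R m * qh u v := by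
    nth_rewrite 1 [← qS_qh (u := u) (v := v)]
    rw [mul_assoc, qS_sq, mul_one]
  have h1 : covD δ u v (qS R m) = 0 := by rw [covD_apply, h0, hω, sub_self, add_zero]
  rw [covD_mul hδ, covD_mul hδ, h1, zero_mul, zero_add, mul_zero, add_zero]

variable (δ u v) in
/-- The coefficients of the formal solution with leading term `E = (1, 0) ∈ 𝔪`. -/
def laxM (k : ℕ) : RMat R m := lax (covD δ u v) (qm 1 0) k

theorem laxM_zero : laxM δ u v 0 = qm 1 0 := lax_zero _ _

theorem laxM_rec (hδ : IsQDer δ) (k : ℕ) :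
    covD δ u v (laxM δ u v k) = -(qm 1 0 * laxM δ u v (k + 1) - laxM δ u v (k + 1) * qm 1 0) :=
  eq_neg_of_add_eq_zero_left (lax_rec (covD δ u v) (covD_mul hδ) E_cube k)

theorem star_laxM (hδ : IsQDer δ) (hu : star u = -u) (k : ℕ) :
    star (laxM δ u v k) = -laxM δ u v k :=
  star_lax (covD δ u v) (covD_mul hδ) (star_covD hδ hu) E_cube (star_qm 1 0) k

/-- With its companion for odd indices this places the coefficients alternately in 𝔪 and 𝔥, so that
two steps of the linear recursion make one step of the hierarchy. -/
theorem parity_laxM_even (hδ : IsQDer δ) (l : ℕ) :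
    qS R m * laxM δ u v (2 * l) * qS R m = -laxM δ u v (2 * l) := by
  have h := parity_lax (covD δ u v) (covD_mul hδ) qS_sq (covD_qS hδ) E_cube (qS_qm 1 0) (2 * l)
  rw [pow_succ, pow_mul, neg_one_sq, one_pow, one_mul, neg_one_smul] at h
  exact h

theorem parity_laxM_odd (hδ : IsQDer δ) (l : ℕ) :
    qS R m * laxM δ u v (2 * l + 1) * qS R m = laxM δ u v (2 * l + 1) := by
  have h := parity_lax (covD δ u v) (covD_mul hδ) qS_sq (covD_qS hδ) E_cube (qS_qm 1 0) (2 * l + 1)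
  rw [show 2 * l + 1 + 1 = 2 * (l + 1) by ring, pow_mul, neg_one_sq, one_pow, one_smul] at h
  exact h

theorem qm_map_der (hδ : IsQDer δ) (a : ℍ[R]) (b : Fin m → ℍ[R]) :
    (qm a b).map δ = qm (δ a) fun j => δ (b j) := by
  rw [qm, blk_map]
  apply ext_blk <;> intros <;> simp [blk_apply, qm, hδ.star]

theorem qh_qd_map_der (hδ : IsQDer δ) (w : ℍ[R]) (z : Fin m → ℍ[R]) (q : ℍ[R])
    (W : Matrix (Fin m) (Fin m) ℍ[R]) :
    (qh w z + qd q W).map δ = qh (δ w) (fun j => δ (z j)) + qd (δ q) (W.map δ) := by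
  rw [Matrix.map_add _ (map_add δ)]
  congr 1
  · rw [qh, blk_map]
    apply ext_blk <;> intros <;> simp [blk_apply, qh, hδ.star]
  · rw [qd, blk_map]
    apply ext_blk <;> intros <;> simp [blk_apply, qd]

theorem qm_add (a a' : ℍ[R]) (b b' : Fin m → ℍ[R]) :
    qm a b + qm a' b' = qm (a + a') fun j => b j + b' j := by
  simp only [qm, blk_add, star_add, neg_add, add_zero]
  apply ext_blk <;> intros <;> simp [blk_apply]

theorem qm_smul (r : ℝ) (a : ℍ[R]) (b : Fin m → ℍ[R]) : r • qm a b = qm (r • a) fun j => r • b j := by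
  simp only [qm, blk_smul, Quaternion.star_smul]
  apply ext_blk <;> intros <;> simp [blk_apply, Quaternion.star_smul]

theorem qh_add (a a' : ℍ[R]) (b b' : Fin m → ℍ[R]) :
    qh a b + qh a' b' = qh (a + a') fun j => b j + b' j := by
  simp only [qh, blk_add]
  apply ext_blk <;> intros <;> simp [blk_apply] <;> abel

theorem qh_smul (r : ℝ) (a : ℍ[R]) (b : Fin m → ℍ[R]) : r • qh a b = qh (r • a) fun j => r • b j := by
  simp only [qh, blk_smul]
  apply ext_blk <;> intros <;> simp [blk_apply, Quaternion.star_smul]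

theorem qd_add (q q' : ℍ[R]) (W W' : Matrix (Fin m) (Fin m) ℍ[R]) :
    qd q W + qd q' W' = qd (q + q') (W + W') := by
  simp only [qd, blk_add]
  apply ext_blk <;> intros <;> simp [blk_apply]

theorem qd_zero : qd (0 : ℍ[R]) (0 : Matrix (Fin m) (Fin m) ℍ[R]) = 0 := by
  apply ext_blk <;> intros <;> rfl

theorem qd_smul (r : ℝ) (q : ℍ[R]) (W : Matrix (Fin m) (Fin m) ℍ[R]) :
    r • qd q W = qd (r • q) (r • W) := by
  simp only [qd, blk_smul]
  apply ext_blk <;> intros <;> simp [blk_apply]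

theorem covD_qm (hδ : IsQDer δ) (hu : star u = -u) (a : ℍ[R]) (b : Fin m → ℍ[R]) :
    covD δ u v (qm a b) =
      qm (δ a + (u * a + a * u + herm b v)) fun j => δ (b j) + (u * b j - a * v j) := by
  rw [covD_apply, qm_map_der hδ, qh_qm hu, qm_add]

theorem qh_qd_inj {w w' : ℍ[R]} {z z' : Fin m → ℍ[R]} {q q' : ℍ[R]}
    {W W' : Matrix (Fin m) (Fin m) ℍ[R]} (h : qh w z + qd q W = qh w' z' + qd q' W') :
    w = w' ∧ z = z' ∧ q = q' ∧ W = W' := by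
  simp only [qh, qd, blk_add] at h
  obtain ⟨h1, -, -, h2, -, h3, -, -, h4⟩ := blk_inj h
  have e : w = w' := by
    refine smul_cancel (two_ne_zero (α := ℝ)) ?_
    calc (2 : ℝ) • w = (w + q) - (-w + q) := by module
      _ = (2 : ℝ) • w' := by rw [h1, h2]; module
  refine ⟨e, ?_, ?_, ?_⟩
  · ext1 j; simpa using congrFun h3 j
  · rw [e] at h1; exact add_left_cancel h1
  · ext1 i j; simpa using congrFun (congrFun h4 i) j

/-- The Hamiltonian operator `ℋ` in the Lax recursion. -/
theorem ham_of_lax (hδ : IsQDer δ) (hu : star u = -u) {w : ℍ[R]} (hw : star w = -w)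
    {z : Fin m → ℍ[R]} {q : ℍ[R]} (hq : star q = -q) {W : Matrix (Fin m) (Fin m) ℍ[R]}
    (hW : star W = -W) {a : ℍ[R]} {b : Fin m → ℍ[R]}
    (h : covD δ u v (qh w z + qd q W) = qm 1 0 * qm a b - qm a b * qm 1 0) :
    δ q = -(comm u w - (1 / 2 : ℝ) • commV v z) ∧ W.map δ = commM v z ∧
      a - star a = δ w + comm u q + (1 / 2 : ℝ) • commV v z ∧
      ∀ j, -b j = δ (z j) - q * v j + Matrix.vecMul v W j + w * v j - u * z j := by
  have h0 : qh (a - star a) (fun j => -b j) = qh (a - star a) (fun j => -b j) + qd 0 0 := by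
    rw [qd_zero, add_zero]
  rw [covD_apply, qh_qd_map_der hδ, qh_qh hu _ hw z hq hW, E_qm, h0, add_add_add_comm, qh_add,
    qd_add] at h
  obtain ⟨h1, h2, h3, h4⟩ := qh_qd_inj h
  refine ⟨eq_neg_of_add_eq_zero_left h3, ?_, ?_, fun j => ?_⟩
  · rw [← sub_eq_zero, sub_eq_add_neg]
    exact h4
  · rw [← h1]; simp only [add_assoc]
  · have := congrFun h2 j
    rw [← this, neg_mul]
    abel

theorem herm_neg_left (a b : Fin m → ℍ[R]) : herm (fun j => -a j) b = -herm a b := by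
  simp [herm]

theorem star_herm (a b : Fin m → ℍ[R]) : star (herm a b) = herm b a := by
  simp [herm, star_sum]

/-- Self-adjoint quaternions have vanishing imaginary components, as 2 is invertible, and the real
ones are central. -/
theorem commute_of_star_eq {p : ℍ[R]} (hp : star p = p) (x : ℍ[R]) : p * x = x * p := by
  have h1 := congrArg (fun q : ℍ[R] => q.imI) hp
  have h2 := congrArg (fun q : ℍ[R] => q.imJ) hp
  have h3 := congrArg (fun q : ℍ[R] => q.imK) hp
  simp only [Quaternion.imI_star, Quaternion.imJ_star, Quaternion.imK_star] at h1 h2 h3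
  have i1 := eq_zero_of_eq_neg h1.symm
  have i2 := eq_zero_of_eq_neg h2.symm
  have i3 := eq_zero_of_eq_neg h3.symm
  apply Quaternion.ext <;> simp [i1, i2, i3, mul_comm]

/-- The symplectic operator `𝒥` in the Lax recursion. -/
theorem sympl_of_lax (hδ : IsQDer δ) (hu : star u = -u) {p : ℍ[R]} (hp : star p = p) {h : ℍ[R]}
    (hh : star h = -h) {k : Fin m → ℍ[R]} {w : ℍ[R]} (hw : star w = -w) {z : Fin m → ℍ[R]}
    (e : covD δ u v (qm (p + (1 / 2 : ℝ) • h) fun j => -k j) = qm ((2 : ℝ) • w) fun j => -z j) :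
    δ p = hParDeriv u v h k ∧ symplS u v k (δ h) p = w ∧
      symplV u v h k (fun j => δ (k j)) p = z := by
  rw [covD_qm hδ hu] at e
  obtain ⟨e1, e2⟩ := qm_inj e
  have hpc := commute_of_star_eq hp
  rw [map_add, hδ.smul, herm_neg_left] at e1
  have e1' := congrArg star e1
  simp only [star_add, star_mul, Quaternion.star_smul, ← hδ.star, hp, hh, hu, star_neg, star_herm,
    hw, map_neg] at e1'
  refine ⟨?_, ?_, funext fun j => ?_⟩
  -- Adding the conjugate equation isolates the real part; the imaginary w drops out.
  · refine smul_cancel (two_ne_zero (α := ℝ)) ?_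
    have e3 := congrArg₂ (· + ·) e1 e1'
    rw [hParDeriv, acomm, acommV, ← sub_eq_zero]
    have e4 := sub_eq_zero.2 e3
    rw [← e4]
    simp only [mul_add, add_mul, mul_smul_comm, smul_mul_assoc, mul_neg, neg_mul, neg_neg, smul_neg,
      hpc]
    module
  -- Subtracting the conjugate equation isolates the imaginary part. Since h occurs as ½h and w as
  -- 2w, the result is D_x h + ⋯ = 4w, hence the ¼ in 𝒥.
  · refine smul_cancel (four_ne_zero (α := ℝ)) ?_
    have e3 := congrArg₂ (· - ·) e1 e1'
    rw [symplS, commV, ← sub_eq_zero]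
    have e4 := sub_eq_zero.2 e3
    rw [← e4]
    simp only [mul_add, add_mul, mul_smul_comm, smul_mul_assoc, mul_neg, neg_mul, neg_neg, smul_neg,
      hpc]
    module
  · have e3 := congrFun e2 j
    rw [map_neg] at e3
    rw [← neg_inj, ← e3, symplV]
    simp only [add_mul, smul_mul_assoc, mul_neg]
    abel

theorem star_sub_star (a : ℍ[R]) : star (a - star a) = -(a - star a) := by
  rw [star_sub, star_star, neg_sub]

theorem neg_one_pow_mul_self (l : ℕ) : (-1 : ℝ) ^ l * (-1 : ℝ) ^ l = 1 := by
  rw [← mul_pow]; simp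

theorem neg_one_pow_smul_smul {M : Type*} [AddCommGroup M] [Module ℝ M] (l : ℕ) (x : M) :
    (-1 : ℝ) ^ l • (-1 : ℝ) ^ l • x = x := by
  rw [smul_smul, neg_one_pow_mul_self, one_smul]

/-- The half-step given by ℋ: q_{2l+1} determines [E, q_{2l+2}], and parity puts q_{2l+2} in 𝔪. The
sign (−1)^l absorbs the minus of the recursion here; in the other half-step the convention −k for
the vector part of 𝔪 absorbs it. -/
theorem laxM_even (hδ : IsQDer δ) (hu : star u = -u) {l : ℕ} {w : ℍ[R]} (hw : star w = -w)
    {z : Fin m → ℍ[R]} {q : ℍ[R]} (hq : star q = -q) {W : Matrix (Fin m) (Fin m) ℍ[R]}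
    (hW : star W = -W) (h : laxM δ u v (2 * l + 1) = (-1 : ℝ) ^ l • (qh w z + qd q W)) :
    δ q = -(comm u w - (1 / 2 : ℝ) • commV v z) ∧ W.map δ = commM v z ∧
    ∃ a b, laxM δ u v (2 * l + 2) = (-1 : ℝ) ^ (l + 1) • qm a b ∧
      a = (-1 : ℝ) ^ (l + 1) • laxM δ u v (2 * l + 2) 0 1 ∧
      a - star a = δ w + comm u q + (1 / 2 : ℝ) • commV v z ∧
      ∀ j, -b j = δ (z j) - q * v j + Matrix.vecMul v W j + w * v j - u * z j := by
  have hX := eq_qm (star_laxM (v := v) hδ hu (2 * (l + 1))) (parity_laxM_even hδ (l + 1))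
  rw [show 2 * (l + 1) = 2 * l + 2 by ring] at hX
  set A := laxM δ u v (2 * l + 2) 0 1
  set B := fun j : Fin m => laxM δ u v (2 * l + 2) 0 j.succ.succ
  have hX' : laxM δ u v (2 * l + 2) =
      (-1 : ℝ) ^ (l + 1) • qm ((-1 : ℝ) ^ (l + 1) • A) fun j => (-1 : ℝ) ^ (l + 1) • B j := by
    rw [← qm_smul, neg_one_pow_smul_smul, ← hX]
  have hrec := laxM_rec (v := v) (u := u) hδ (2 * l + 1)
  rw [h, covD_smul hδ, hX', mul_smul_comm, smul_mul_assoc, ← smul_sub, pow_succ (-1 : ℝ) l,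
    mul_neg_one, neg_smul, neg_neg] at hrec
  have h1 := ham_of_lax hδ hu hw hq hW
    (smul_cancel (left_ne_zero_of_mul_eq_one (neg_one_pow_mul_self l)) hrec)
  rw [← mul_neg_one ((-1 : ℝ) ^ l), ← pow_succ] at h1
  exact ⟨h1.1, h1.2.1, _, _, hX', rfl, h1.2.2⟩

/-- The last two clauses express the 𝔥_∥ part through entries of the coefficient, so that its
constant terms can be controlled. -/
theorem laxM_odd (hδ : IsQDer δ) (hu : star u = -u) (l : ℕ) :
    ∃ (w : ℍ[R]) (z : Fin m → ℍ[R]) (q : ℍ[R]) (W : Matrix (Fin m) (Fin m) ℍ[R]),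
      laxM δ u v (2 * l + 1) = (-1 : ℝ) ^ l • (qh w z + qd q W) ∧
      star w = -w ∧ star q = -q ∧ star W = -W ∧
      q = (-1 : ℝ) ^ l • (1 / 2 : ℝ) • (laxM δ u v (2 * l + 1) 0 0 + laxM δ u v (2 * l + 1) 1 1) ∧
      ∀ i j, W i j = (-1 : ℝ) ^ l • laxM δ u v (2 * l + 1) i.succ.succ j.succ.succ := by
  obtain ⟨w, z, q, W, h1, h2, h3, h4, h5, h6⟩ :=
    eq_qh_add_qd (star_laxM (v := v) hδ hu (2 * l + 1)) (parity_laxM_odd hδ l)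
  refine ⟨(-1 : ℝ) ^ l • w, fun j => (-1 : ℝ) ^ l • z j, (-1 : ℝ) ^ l • q, (-1 : ℝ) ^ l • W,
    ?_, ?_, ?_, ?_, ?_, ?_⟩
  · rw [← qh_smul, ← qd_smul, ← smul_add, neg_one_pow_smul_smul, ← h1]
  · rw [Quaternion.star_smul, h2, smul_neg]
  · rw [Quaternion.star_smul, h3, smul_neg]
  · ext1 i j
    have := congrFun (congrFun h4 i) j
    rw [Matrix.star_apply, Matrix.smul_apply, Quaternion.star_smul, ← Matrix.star_apply, this,
      Matrix.neg_apply, Matrix.neg_apply, Matrix.smul_apply, smul_neg]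
  · rw [h5]
  · intro i j; rw [Matrix.smul_apply, h6]

theorem laxM_odd_succ (hδ : IsQDer δ) (hu : star u = -u) {l : ℕ} {p : ℍ[R]} (hp : star p = p)
    {h : ℍ[R]} (hh : star h = -h) {k : Fin m → ℍ[R]}
    (e : laxM δ u v (2 * l + 2) = (-1 : ℝ) ^ (l + 1) • qm (p + (1 / 2 : ℝ) • h) fun j => -k j)
    {w : ℍ[R]} (hw : star w = -w) {z : Fin m → ℍ[R]} {q : ℍ[R]}
    {W : Matrix (Fin m) (Fin m) ℍ[R]}
    (e' : laxM δ u v (2 * (l + 1) + 1) = (-1 : ℝ) ^ (l + 1) • (qh w z + qd q W)) :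
    δ p = hParDeriv u v h k ∧ symplS u v k (δ h) p = w ∧
      symplV u v h k (fun j => δ (k j)) p = z := by
  have hrec := laxM_rec (v := v) (u := u) hδ (2 * l + 2)
  rw [show 2 * l + 2 + 1 = 2 * (l + 1) + 1 by ring, e, e', covD_smul hδ, mul_smul_comm,
    smul_mul_assoc, ← smul_sub, E_qh hw, ← smul_neg] at hrec
  refine sympl_of_lax hδ hu hp hh hw ?_
  rw [smul_cancel (left_ne_zero_of_mul_eq_one (neg_one_pow_mul_self (l + 1))) hrec,
    ← neg_one_smul ℝ (qm _ _), qm_smul]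
  congr 1
  · module
  · ext1 j; module

/-- E is constant, so its covariant derivative is [(u, v), E], and the recursion equates this with
−[E, q₁]; ad E is injective on 𝔥_⊥. -/
theorem laxM_one (hδ : IsQDer δ) (hu : star u = -u) {w : ℍ[R]} (hw : star w = -w)
    {z : Fin m → ℍ[R]} {q : ℍ[R]} {W : Matrix (Fin m) (Fin m) ℍ[R]}
    (h : laxM δ u v 1 = qh w z + qd q W) : w = u ∧ z = v := by
  have hrec := laxM_rec (v := v) (u := u) hδ 0
  have hE : (qm 1 0 : RMat R m).map δ = 0 := by
    rw [qm_map_der hδ, hδ.one]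
    apply ext_blk <;> intros <;> simp [qm, blk_apply]
  have h0 : qh u v = qh u v + qd 0 0 := by rw [qd_zero, add_zero]
  rw [zero_add, h, E_qh hw, laxM_zero, covD_apply, hE, zero_add, ← neg_sub, neg_inj, h0, E_qh hu]
    at hrec
  obtain ⟨h1, h2⟩ := qm_inj hrec
  exact ⟨(smul_cancel (by norm_num) h1).symm, h2.symm⟩

end LaxComponents

/-! ### The hierarchy as a formal solution of the Lax equation -/

section Hierarchy

variable {m : ℕ}

theorem isQDer_qD : IsQDer (qDHom (m := m)) := ⟨qD_mul, qD_star, qD_smul⟩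

@[simp] theorem jetVar_fst_re (k : ℕ) : (jetVar m k).1.re = 0 := rfl
@[simp] theorem jetVar_fst_imI (k : ℕ) : (jetVar m k).1.imI = .X (.inl 0, k) := rfl
@[simp] theorem jetVar_fst_imJ (k : ℕ) : (jetVar m k).1.imJ = .X (.inl 1, k) := rfl
@[simp] theorem jetVar_fst_imK (k : ℕ) : (jetVar m k).1.imK = .X (.inl 2, k) := rfl
@[simp] theorem jetVar_snd_re (k : ℕ) (j : Fin m) : ((jetVar m k).2 j).re = .X (.inr (j, 0), k) := rfl
@[simp] theorem jetVar_snd_imI (k : ℕ) (j : Fin m) : ((jetVar m k).2 j).imI = .X (.inr (j, 1), k) :=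
  rfl
@[simp] theorem jetVar_snd_imJ (k : ℕ) (j : Fin m) : ((jetVar m k).2 j).imJ = .X (.inr (j, 2), k) :=
  rfl
@[simp] theorem jetVar_snd_imK (k : ℕ) (j : Fin m) : ((jetVar m k).2 j).imK = .X (.inr (j, 3), k) :=
  rfl

theorem star_jetVar (k : ℕ) : star (jetVar m k).1 = -(jetVar m k).1 := by
  apply Quaternion.ext <;> simp

theorem qD_jetVar (k : ℕ) : qD (jetVar m k).1 = (jetVar m (k + 1)).1 ∧
    ∀ j, qD ((jetVar m k).2 j) = (jetVar m (k + 1)).2 j := by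
  constructor
  · apply Quaternion.ext <;> simp [qD, totalD_X]
  · intro j
    apply Quaternion.ext <;> simp [qD, totalD_X]

theorem qcc_star (x : ℍ[DPoly m]) : qcc (star x) = star (qcc x) := qmapHom_star _ _

theorem qcc_jetVar (k : ℕ) : qcc (jetVar m k).1 = 0 ∧ ∀ j, qcc ((jetVar m k).2 j) = 0 := by
  constructor
  · apply Quaternion.ext <;> simp [qcc, qmapHom_apply]
  · intro j
    apply Quaternion.ext <;> simp [qcc, qmapHom_apply]

variable (m) in
/-- The coefficients of the formal solution as differential polynomials. -/
abbrev laxQ (k : ℕ) : RMat (DPoly m) m := laxM qDHom (jetVar m 0).1 (jetVar m 0).2 k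

theorem map_qm_one (f : ℍ[DPoly m] →ₐ[ℝ] ℍ[ℝ]) :
    f.mapMatrix (qm 1 0 : RMat (DPoly m) m) = qm 1 0 := by
  rw [AlgHom.mapMatrix_apply, qm, blk_map]
  apply ext_blk <;> intros <;> simp [blk_apply, qm]

theorem map_qh (f : ℍ[DPoly m] →ₐ[ℝ] ℍ[ℝ]) (hf : ∀ x, f (star x) = star (f x)) (u : ℍ[DPoly m])
    (v : Fin m → ℍ[DPoly m]) : f.mapMatrix (qh u v) = qh (f u) fun j => f (v j) := by
  rw [AlgHom.mapMatrix_apply, qh, blk_map]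
  apply ext_blk <;> intros <;> simp [blk_apply, qh, hf]

/-- Setting all jet variables to zero kills the connection matrix and every total derivative, so by
naturality the constant terms form the formal solution for D = 0, which is the constant E. This
matches the normalisation of D_x⁻¹. -/
theorem qcc_laxQ (k : ℕ) (i j : Fin (m + 2)) : qcc (laxQ m (k + 1) i j) = 0 := by
  have hω : (qcc (m := m)).mapMatrix (qh (jetVar m 0).1 (jetVar m 0).2) = 0 := by
    rw [map_qh _ qcc_star, (qcc_jetVar 0).1]
    simp only [(qcc_jetVar 0).2]
    apply ext_blk <;> intros <;> simp [blk_apply, qh]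
  have h : (qcc (m := m)).mapMatrix (laxQ m (k + 1)) = 0 := by
    rw [laxQ, laxM, map_lax (D' := fun _ => 0), map_qm_one]
    · exact lax_trivial E_cube k
    · intro X
      rw [covD_apply, map_add, map_sub, map_mul, map_mul, hω, zero_mul, mul_zero, sub_zero, add_zero]
      exact Matrix.ext fun i j => qcc_qD _
  exact congrFun (congrFun h i) j

variable (m) in
/-- The sequence `(w_(l), z_(l))` with `h_(l) = ℋ (w_(l), z_(l))`. -/
def hierW : ℕ → DPair m
  | 0 => jetVar m 0
  | l + 1 => symplOp (hier m l)

/-- At l = 0 the nonlocal terms vanish because C(u, u), C(v, v) and the matrix commutator of v with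
itself are zero, leaving the x-derivative of (u, v); later levels hold by definition. -/
theorem hamOp_hierW (l : ℕ) : hamOp (hierW m l) = hier m l := by
  rcases l with _ | l
  · have h1 : wParDeriv (jetVar m 0) = 0 := by simp [wParDeriv, comm, commV]
    have h2 : commM (jetVar m 0).2 (jetVar m 0).2 = 0 := by ext1 i j; simp [commM]
    have h3 : qDInv (0 : ℍ[DPoly m]) = 0 := qDInv_eq (map_zero _) qD_zero
    simp only [hamOp, hierW, hier, h1, h2, Matrix.map_zero _ h3, h3, Function.iterate_zero, id]
    refine Prod.ext ?_ (funext fun j => ?_)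
    · simp [comm, commV, (qD_jetVar 0).1]
    · simp [(qD_jetVar 0).2]
  · simp only [hierW, hier, Function.iterate_succ_apply']
    rfl

/-- The odd coefficients of the formal solution. -/
def OddForm (m l : ℕ) : Prop :=
  star (hierW m l).1 = -(hierW m l).1 ∧
  ∃ (q : ℍ[DPoly m]) (W : Matrix (Fin m) (Fin m) ℍ[DPoly m]),
    star q = -q ∧ star W = -W ∧ qcc q = 0 ∧ (∀ i j, qcc (W i j) = 0) ∧
    laxQ m (2 * l + 1) = (-1 : ℝ) ^ l • (qh (hierW m l).1 (hierW m l).2 + qd q W)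

/-- The even coefficients of the formal solution. -/
def EvenForm (m l : ℕ) : Prop :=
  star (hier m l).1 = -(hier m l).1 ∧ star (hPar (hier m l)) = hPar (hier m l) ∧
  qD (hPar (hier m l)) = hParDeriv (jetVar m 0).1 (jetVar m 0).2 (hier m l).1 (hier m l).2 ∧
  laxQ m (2 * l + 2) = (-1 : ℝ) ^ (l + 1) •
    qm (hPar (hier m l) + (1 / 2 : ℝ) • (hier m l).1) fun j => -(hier m l).2 j

/-- One turn of the recursion. The linear equation says that the 𝔥_∥ part (q, W) of q_{2l+1} is a
primitive of the integrands of ℋ, and that the real part p of q_{2l+2} is a primitive of the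
integrand of 𝒥. None of them has a constant term, so they are the values of D_x⁻¹, and locality is
obtained along the way. -/
theorem OddForm.step {l : ℕ} (h : OddForm m l) :
    IsTotalDerivative (wParDeriv (hierW m l)) ∧
    (∀ i j, IsTotalDerivative (commM (jetVar m 0).2 (hierW m l).2 i j)) ∧
    EvenForm m l ∧ OddForm m (l + 1) := by
  obtain ⟨hw, q, W, hq, hW, hq0, hW0, h⟩ := h
  have hu := star_jetVar (m := m) 0
  obtain ⟨h1, h2, a, b, h3, h4, h5, h6⟩ := laxM_even isQDer_qD hu hw hq hW h
  have hqD : qD q = wParDeriv (hierW m l) := h1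
  have hWI : (commM (jetVar m 0).2 (hierW m l).2).map qDInv = W := by
    rw [← h2]
    exact Matrix.ext fun i j => qDInv_eq (hW0 i j) rfl
  have hham : hier m l = (a - star a, fun j => -b j) := by
    rw [← hamOp_hierW, hamOp]
    simp only [hWI, qDInv_eq hq0 hqD]
    exact Prod.ext h5.symm (funext fun j => (h6 j).symm)
  have ha0 : qcc a = 0 := by
    rw [h4, map_smul, qcc_laxQ, smul_zero]
  have hh : star (hier m l).1 = -(hier m l).1 := by
    have e1 : (hier m l).1 = a - star a := by rw [hham]
    rw [e1, star_sub_star]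
  -- The real part of a; its imaginary part is ½h because h = a − ā.
  set p := (1 / 2 : ℝ) • (a + star a) with hpdef
  have hp : star p = p := by rw [hpdef, Quaternion.star_smul, star_add, star_star, add_comm]
  have hp0 : qcc p = 0 := by rw [hpdef, map_smul, map_add, qcc_star, ha0, star_zero, add_zero, smul_zero]
  have he : laxQ m (2 * l + 2) =
      (-1 : ℝ) ^ (l + 1) • qm (p + (1 / 2 : ℝ) • (hier m l).1) fun j => -(hier m l).2 j := by
    have e1 : p + (1 / 2 : ℝ) • (a - star a) = a := by rw [hpdef]; module
    refine h3.trans ?_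
    rw [hham]
    simp only [e1, neg_neg]
  obtain ⟨w, z, q', W', g1, g2, g3, g4, g5, g6⟩ :=
    laxM_odd (v := (jetVar m 0).2) isQDer_qD hu (l + 1)
  obtain ⟨f1, f2, f3⟩ := laxM_odd_succ isQDer_qD hu hp hh he g2 g1
  have hpar : hPar (hier m l) = p := qDInv_eq hp0 f1
  have hsy : symplOp (hier m l) = (w, z) := by
    rw [symplOp, hpar]
    exact Prod.ext f2 f3
  refine ⟨⟨q, hqD⟩, fun i j => ⟨W i j, ?_⟩, ⟨hh, ?_, ?_, ?_⟩, ?_, q', W', g3, g4, ?_, ?_, ?_⟩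
  · exact congrFun (congrFun h2 i) j
  · rw [hpar, hp]
  · rw [hpar]; exact f1
  · rw [hpar]; exact he
  · rw [hierW, hsy]; exact g2
  · rw [g5, map_smul, map_smul, map_add, qcc_laxQ, qcc_laxQ]; simp
  · intro i j; rw [g6, map_smul, qcc_laxQ, smul_zero]
  · rw [hierW, hsy]; exact g1

theorem oddForm_zero : OddForm m 0 := by
  have hu := star_jetVar (m := m) 0
  obtain ⟨w, z, q, W, g1, g2, g3, g4, g5, g6⟩ := laxM_odd (v := (jetVar m 0).2) isQDer_qD hu 0
  have h : laxQ m 1 = qh w z + qd q W := by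
    have := g1
    rwa [pow_zero, one_smul] at this
  obtain ⟨rfl, rfl⟩ := laxM_one isQDer_qD hu g2 h
  refine ⟨hu, q, W, g3, g4, ?_, ?_, g1⟩
  · rw [g5, map_smul, map_smul, map_add, qcc_laxQ, qcc_laxQ]; simp
  · intro i j; rw [g6, map_smul, qcc_laxQ, smul_zero]

theorem oddForm (l : ℕ) : OddForm m l := by
  induction l with
  | zero => exact oddForm_zero
  | succ l ih => exact ih.step.2.2.2

theorem evenForm (l : ℕ) : EvenForm m l := (oddForm l).step.2.2.1

theorem isLocalAt_hier (l : ℕ) : IsLocalAt (hier m l) := by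
  -- Level l + 1, since ℋ is applied to 𝒥h_(l) = w_(l+1).
  have h := (oddForm (m := m) (l + 1)).step
  exact ⟨⟨_, (evenForm l).2.2.1⟩, h.1, h.2.1⟩

end Hierarchy

/-! ### Linear ordinary differential equations -/

section LinearODE

open Set MeasureTheory Filter Topology
open scoped Interval

variable {E : Type*} [NormedAddCommGroup E] [NormedSpace ℝ E] [CompleteSpace E]

theorem IsOpenInterval.uIcc_subset {J : Set ℝ} (h : IsOpenInterval J) {a b : ℝ} (ha : a ∈ J)
    (hb : b ∈ J) : uIcc a b ⊆ J := h.2.1.uIcc_subset ha hb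

theorem IsOpenInterval.exists_Icc {J : Set ℝ} (h : IsOpenInterval J) {x y : ℝ} (hx : x ∈ J)
    (hy : y ∈ J) : ∃ a b, x ∈ Ioo a b ∧ y ∈ Ioo a b ∧ Icc a b ⊆ J := by
  have key : ∀ z ∈ J, ∃ a ∈ J, ∃ b ∈ J, a < z ∧ z < b := fun z hz => by
    obtain ⟨ε, hε, hb⟩ := Metric.isOpen_iff.1 h.1 z hz
    refine ⟨z - ε / 2, hb ?_, z + ε / 2, hb ?_, by linarith, by linarith⟩ <;>
      simp [Real.dist_eq, abs_of_pos hε, hε]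
  obtain ⟨a, ha, b, hb, h1, h2⟩ := key x hx
  obtain ⟨a', ha', b', hb', h1', h2'⟩ := key y hy
  refine ⟨min a a', max b b', ⟨min_lt_of_left_lt h1, lt_max_of_lt_left h2⟩,
    ⟨min_lt_of_right_lt h1', lt_max_of_lt_right h2'⟩, h.2.1.out ?_ ?_⟩
  · rcases min_choice a a' with h | h <;> rw [h] <;> assumption
  · rcases max_choice b b' with h | h <;> rw [h] <;> assumption

/-- Picard iterates of a linear equation. -/
def dysonTerm (A : ℝ → E →L[ℝ] E) (x₀ : ℝ) (y₀ : E) : ℕ → ℝ → E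
  | 0 => fun _ => y₀
  | n + 1 => fun x => ∫ s in x₀..x, A s (dysonTerm A x₀ y₀ n s)

theorem hasDerivAt_dysonTerm {J : Set ℝ} (hJ : IsOpenInterval J) {A : ℝ → E →L[ℝ] E}
    (hA : ContinuousOn A J) {x₀ : ℝ} (hx₀ : x₀ ∈ J) (y₀ : E) (n : ℕ) :
    ContinuousOn (dysonTerm A x₀ y₀ n) J ∧ ∀ x ∈ J,
      HasDerivAt (dysonTerm A x₀ y₀ (n + 1)) (A x (dysonTerm A x₀ y₀ n x)) x := by
  have key : ∀ n, ContinuousOn (dysonTerm A x₀ y₀ n) J → ∀ x ∈ J,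
      HasDerivAt (dysonTerm A x₀ y₀ (n + 1)) (A x (dysonTerm A x₀ y₀ n x)) x := by
    intro n hn x hx
    have hc : ContinuousOn (fun s => A s (dysonTerm A x₀ y₀ n s)) J := hA.clm_apply hn
    exact intervalIntegral.integral_hasDerivAt_right
      ((hc.mono (hJ.uIcc_subset hx₀ hx)).intervalIntegrable)
      (hc.stronglyMeasurableAtFilter hJ.1 x hx) (hc.continuousAt (hJ.1.mem_nhds hx))
  have hcont : ∀ n, ContinuousOn (dysonTerm A x₀ y₀ n) J := by
    intro n
    induction n with
    | zero => exact continuousOn_const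
    | succ n ih => exact fun x hx => (key n ih x hx).continuousAt.continuousWithinAt
  exact ⟨hcont n, key n (hcont n)⟩

/-- Integrating |s − x₀|ⁿ contributes a factor 1/(n + 1) at each iteration. The factorial decay
makes the Picard series converge on the whole interval, whatever the size of A, so no continuation
argument is needed. -/
theorem norm_dysonTerm_le {J : Set ℝ} (hJ : IsOpenInterval J) {A : ℝ → E →L[ℝ] E}
    (hA : ContinuousOn A J) {x₀ : ℝ} (hx₀ : x₀ ∈ J) (y₀ : E) {a b C : ℝ} (hab : Icc a b ⊆ J)
    (hx₀' : x₀ ∈ Icc a b) (hC : ∀ x ∈ Icc a b, ‖A x‖ ≤ C) (n : ℕ) :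
    ∀ x ∈ Icc a b, ‖dysonTerm A x₀ y₀ n x‖ ≤ ‖y₀‖ * (C ^ n * |x - x₀| ^ n / n.factorial) := by
  have hC0 : 0 ≤ C := (norm_nonneg _).trans (hC x₀ hx₀')
  induction n with
  | zero => intro x _; simp [dysonTerm]
  | succ n ih =>
    intro x hx
    have hsub : uIcc x₀ x ⊆ Icc a b := uIcc_subset_Icc hx₀' hx
    have hc : ContinuousOn (fun s => A s (dysonTerm A x₀ y₀ n s)) J :=
      hA.clm_apply (hasDerivAt_dysonTerm hJ hA hx₀ y₀ n).1
    calc ‖dysonTerm A x₀ y₀ (n + 1) x‖ ≤ ∫ s in Ι x₀ x, ‖A s (dysonTerm A x₀ y₀ n s)‖ :=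
          intervalIntegral.norm_integral_le_integral_norm_uIoc
      _ ≤ ∫ s in Ι x₀ x, ‖y₀‖ * (C ^ (n + 1) / n.factorial) * |s - x₀| ^ n := by
          refine setIntegral_mono_on ?_ ?_ measurableSet_uIoc ?_
          · exact (intervalIntegrable_iff.1
              ((hc.mono (hsub.trans hab)).norm.intervalIntegrable))
          · exact (intervalIntegrable_iff.1 (Continuous.intervalIntegrable (by fun_prop) _ _))
          · intro s hs
            have hs' := hsub (uIoc_subset_uIcc hs)
            calc ‖A s (dysonTerm A x₀ y₀ n s)‖ ≤ ‖A s‖ * ‖dysonTerm A x₀ y₀ n s‖ :=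
                  (A s).le_opNorm _
              _ ≤ C * (‖y₀‖ * (C ^ n * |s - x₀| ^ n / n.factorial)) :=
                  mul_le_mul (hC s hs') (ih s hs') (norm_nonneg _) hC0
              _ = _ := by ring
      _ = _ := by
          rw [integral_const_mul, integral_pow_abs_sub_uIoc, Nat.factorial_succ]
          have : (n.factorial : ℝ) ≠ 0 := by positivity
          push_cast
          field_simp

/-- Global solvability of linear differential equations on an open interval. -/
theorem exists_linear_ode {J : Set ℝ} (hJ : IsOpenInterval J) {A : ℝ → E →L[ℝ] E}
    (hA : ContinuousOn A J) {x₀ : ℝ} (hx₀ : x₀ ∈ J) (y₀ : E) :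
    ∃ f : ℝ → E, f x₀ = y₀ ∧ ∀ x ∈ J, HasDerivAt f (A x (f x)) x := by
  refine ⟨fun x => y₀ + ∑' n, dysonTerm A x₀ y₀ (n + 1) x, ?_, fun x hx => ?_⟩
  · simp [dysonTerm]
  · obtain ⟨a, b, hx', hx₀', hab⟩ := hJ.exists_Icc hx hx₀
    obtain ⟨C, hC⟩ := isCompact_Icc.exists_bound_of_continuousOn (hA.mono hab)
    have hC0 : 0 ≤ C := (norm_nonneg _).trans (hC x (Ioo_subset_Icc_self hx'))
    have hb : ∀ n, ∀ y ∈ Ioo a b, ‖dysonTerm A x₀ y₀ n y‖ ≤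
        ‖y₀‖ * ((C * (b - a)) ^ n / n.factorial) := fun n y hy => by
      refine (norm_dysonTerm_le hJ hA hx₀ y₀ hab (Ioo_subset_Icc_self hx₀') hC n y
        (Ioo_subset_Icc_self hy)).trans ?_
      rw [← mul_pow]
      have : |y - x₀| ≤ b - a := by
        rw [abs_le]; constructor <;> linarith [hy.1, hy.2, hx₀'.1, hx₀'.2]
      gcongr
    have hsum : Summable fun n : ℕ => ‖y₀‖ * ((C * (b - a)) ^ n / n.factorial) :=
      (Real.summable_pow_div_factorial _).mul_left _
    have hsx : Summable fun n => dysonTerm A x₀ y₀ n x :=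
      Summable.of_norm_bounded hsum fun n => hb n x hx'
    have hd := hasDerivAt_tsum_of_isPreconnected (hsum.mul_left C)
      (isOpen_Ioo (a := a) (b := b)) isPreconnected_Ioo
      (fun n y hy => (hasDerivAt_dysonTerm hJ hA hx₀ y₀ n).2 y (hab (Ioo_subset_Icc_self hy)))
      (fun n y hy => ((A y).le_opNorm _).trans
          (mul_le_mul (hC y (Ioo_subset_Icc_self hy)) (hb n y hy) (norm_nonneg _) hC0))
      hx' ((summable_nat_add_iff 1).2 hsx) hx'
    -- The derivative of term n + 1 is A applied to term n; the shift by one brings in y₀ as the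
    -- zeroth term.
    have e : A x (y₀ + ∑' n, dysonTerm A x₀ y₀ (n + 1) x) = ∑' n, A x (dysonTerm A x₀ y₀ n x) := by
      rw [← (A x).map_tsum hsx, hsx.tsum_eq_zero_add]
      rfl
    rw [e]
    exact hd.const_add y₀

-- For x < x₀ the forward Gronwall inequality is applied to r ↦ f(−r).
omit [CompleteSpace E] in
theorem norm_le_gronwallBound_uIcc {f f' : ℝ → E} {x₀ x K ε : ℝ}
    (hf : ∀ s ∈ uIcc x₀ x, HasDerivAt f (f' s) s)
    (hb : ∀ s ∈ uIcc x₀ x, ‖f' s‖ ≤ K * ‖f s‖ + ε) :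
    ‖f x‖ ≤ gronwallBound ‖f x₀‖ K ε |x - x₀| := by
  rcases le_total x₀ x with h | h
  · rw [uIcc_of_le h] at hf hb
    rw [abs_of_nonneg (sub_nonneg.2 h)]
    exact norm_le_gronwallBound_of_norm_deriv_right_le
      (fun s hs => (hf s hs).continuousAt.continuousWithinAt)
      (fun s hs => (hf s (Ico_subset_Icc_self hs)).hasDerivWithinAt) le_rfl
      (fun s hs => hb s (Ico_subset_Icc_self hs)) x ⟨h, le_rfl⟩
  · rw [uIcc_of_ge h] at hf hb
    rw [abs_of_nonpos (sub_nonpos.2 h)]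
    have hm : ∀ s ∈ Icc (-x₀) (-x), -s ∈ Icc x x₀ := fun s hs =>
      ⟨by linarith [hs.2], by linarith [hs.1]⟩
    have hd : ∀ s ∈ Icc (-x₀) (-x), HasDerivAt (fun r => f (-r)) (-f' (-s)) s := fun s hs => by
      have := (hf (-s) (hm s hs)).scomp s (hasDerivAt_neg s)
      rwa [neg_one_smul] at this
    have := norm_le_gronwallBound_of_norm_deriv_right_le (f := fun r => f (-r))
      (f' := fun s => -f' (-s)) (δ := ‖f x₀‖) (K := K) (ε := ε) (a := -x₀) (b := -x)
      (fun s hs => (hd s hs).continuousAt.continuousWithinAt)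
      (fun s hs => (hd s (Ico_subset_Icc_self hs)).hasDerivWithinAt) (by simp)
      (fun s hs => by simpa using hb (-s) (hm s (Ico_subset_Icc_self hs))) (-x)
      ⟨by linarith, le_rfl⟩
    simp only [neg_neg] at this
    rwa [show -(x - x₀) = -x - -x₀ by ring]

end LinearODE

/-! ### Smooth functions of two variables -/

section TwoVariables

open Set Filter Topology

variable {E : Type*} [NormedAddCommGroup E] [NormedSpace ℝ E]

/-- Smoothness of a function of two real variables on a product of open intervals. -/
def Smooth2 (I J : Set ℝ) (f : ℝ → ℝ → E) : Prop :=
  ContDiffOn ℝ ∞ (fun q : ℝ × ℝ => f q.1 q.2) (I ×ˢ J)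

variable {I J : Set ℝ} {f : ℝ → ℝ → E}

theorem Smooth2.contDiffAt (hI : IsOpen I) (hJ : IsOpen J) (hf : Smooth2 I J f) {t x : ℝ}
    (ht : t ∈ I) (hx : x ∈ J) : ContDiffAt ℝ ∞ (fun q : ℝ × ℝ => f q.1 q.2) (t, x) :=
  ContDiffOn.contDiffAt hf ((hI.prod hJ).mem_nhds ⟨ht, hx⟩)

theorem Smooth2.hasFDerivAt (hI : IsOpen I) (hJ : IsOpen J) (hf : Smooth2 I J f) {t x : ℝ}
    (ht : t ∈ I) (hx : x ∈ J) : HasFDerivAt (fun q : ℝ × ℝ => f q.1 q.2)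
      (fderiv ℝ (fun q : ℝ × ℝ => f q.1 q.2) (t, x)) (t, x) :=
  ((hf.contDiffAt hI hJ ht hx).differentiableAt (by simp)).hasFDerivAt

theorem Smooth2.hasDerivAt_fst' (hI : IsOpen I) (hJ : IsOpen J) (hf : Smooth2 I J f) {t x : ℝ}
    (ht : t ∈ I) (hx : x ∈ J) :
    HasDerivAt (fun s => f s x) (fderiv ℝ (fun q : ℝ × ℝ => f q.1 q.2) (t, x) (1, 0)) t :=
  HasFDerivAt.comp_hasDerivAt (f := fun s : ℝ => (s, x)) t (hf.hasFDerivAt hI hJ ht hx)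
    ((hasDerivAt_id t).prodMk (hasDerivAt_const t x))

theorem Smooth2.hasDerivAt_snd' (hI : IsOpen I) (hJ : IsOpen J) (hf : Smooth2 I J f) {t x : ℝ}
    (ht : t ∈ I) (hx : x ∈ J) :
    HasDerivAt (fun y => f t y) (fderiv ℝ (fun q : ℝ × ℝ => f q.1 q.2) (t, x) (0, 1)) x :=
  HasFDerivAt.comp_hasDerivAt (f := fun y : ℝ => (t, y)) x (hf.hasFDerivAt hI hJ ht hx)
    ((hasDerivAt_const x t).prodMk (hasDerivAt_id x))

theorem Smooth2.hasDerivAt_fst (hI : IsOpen I) (hJ : IsOpen J) (hf : Smooth2 I J f) {t x : ℝ}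
    (ht : t ∈ I) (hx : x ∈ J) : HasDerivAt (fun s => f s x) (deriv (fun s => f s x) t) t :=
  (hf.hasDerivAt_fst' hI hJ ht hx).differentiableAt.hasDerivAt

theorem Smooth2.hasDerivAt_snd (hI : IsOpen I) (hJ : IsOpen J) (hf : Smooth2 I J f) {t x : ℝ}
    (ht : t ∈ I) (hx : x ∈ J) : HasDerivAt (f t) (deriv (f t) x) x :=
  (hf.hasDerivAt_snd' hI hJ ht hx).differentiableAt.hasDerivAt

theorem Smooth2.congr {g : ℝ → ℝ → E} (hf : Smooth2 I J f) (h : ∀ t ∈ I, ∀ x ∈ J, g t x = f t x) :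
    Smooth2 I J g := ContDiffOn.congr hf fun q hq => h q.1 hq.1 q.2 hq.2

theorem Smooth2.fderiv_apply (hI : IsOpen I) (hJ : IsOpen J) (hf : Smooth2 I J f) (w : ℝ × ℝ) :
    Smooth2 I J fun t x => fderiv ℝ (fun q : ℝ × ℝ => f q.1 q.2) (t, x) w := by
  have h := ContDiffOn.fderiv_of_isOpen (m := ∞) (n := ∞) hf (hI.prod hJ) (by simp)
  exact h.clm_apply contDiffOn_const

theorem Smooth2.deriv_fst (hI : IsOpen I) (hJ : IsOpen J) (hf : Smooth2 I J f) :
    Smooth2 I J fun t x => deriv (fun s => f s x) t :=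
  (hf.fderiv_apply hI hJ (1, 0)).congr fun _ ht _ hx => (hf.hasDerivAt_fst' hI hJ ht hx).deriv

theorem Smooth2.deriv_snd (hI : IsOpen I) (hJ : IsOpen J) (hf : Smooth2 I J f) :
    Smooth2 I J fun t x => deriv (f t) x :=
  (hf.fderiv_apply hI hJ (0, 1)).congr fun _ ht _ hx => (hf.hasDerivAt_snd' hI hJ ht hx).deriv

/-- Applied to a reflection, a tangent field or a frame, equality of mixed partials gives
torsion-freeness and the zero curvature equations. -/
theorem Smooth2.deriv_comm (hI : IsOpen I) (hJ : IsOpen J) (hf : Smooth2 I J f) {t x : ℝ}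
    (ht : t ∈ I) (hx : x ∈ J) :
    deriv (fun s => deriv (f s) x) t = deriv (fun y => deriv (fun s => f s y) t) x := by
  set F := fun q : ℝ × ℝ => f q.1 q.2 with hF
  have hc := hf.contDiffAt hI hJ ht hx
  have hsymm : IsSymmSndFDerivAt ℝ F (t, x) := hc.isSymmSndFDerivAt (by
    simp only [minSmoothness_of_isRCLikeNormedField]; exact WithTop.coe_le_coe.2 le_top)
  have hd : HasFDerivAt (fderiv ℝ F) (fderiv ℝ (fderiv ℝ F) (t, x)) (t, x) :=
    ((hc.fderiv_right (m := 1) (by norm_num; exact WithTop.coe_le_coe.2 le_top)).differentiableAt (by simp)).hasFDerivAt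
  have h1 : deriv (fun s => deriv (f s) x) t = fderiv ℝ (fderiv ℝ F) (t, x) (1, 0) (0, 1) := by
    have e : (fun s => deriv (f s) x) =ᶠ[𝓝 t] fun s => fderiv ℝ F (s, x) (0, 1) := by
      filter_upwards [hI.mem_nhds ht] with s hs
      exact (hf.hasDerivAt_snd' hI hJ hs hx).deriv
    rw [e.deriv_eq]
    have h2 := HasFDerivAt.comp_hasDerivAt (f := fun s : ℝ => (s, x)) t hd
      ((hasDerivAt_id t).prodMk (hasDerivAt_const t x))
    exact (h2.clm_apply (hasDerivAt_const t ((0, 1) : ℝ × ℝ))).deriv.trans (by simp)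
  have h3 : deriv (fun y => deriv (fun s => f s y) t) x =
      fderiv ℝ (fderiv ℝ F) (t, x) (0, 1) (1, 0) := by
    have e : (fun y => deriv (fun s => f s y) t) =ᶠ[𝓝 x] fun y => fderiv ℝ F (t, y) (1, 0) := by
      filter_upwards [hJ.mem_nhds hx] with y hy
      exact (hf.hasDerivAt_fst' hI hJ ht hy).deriv
    rw [e.deriv_eq]
    have h2 := HasFDerivAt.comp_hasDerivAt (f := fun y : ℝ => (t, y)) x hd
      ((hasDerivAt_const x t).prodMk (hasDerivAt_id x))
    exact (h2.clm_apply (hasDerivAt_const x ((1, 0) : ℝ × ℝ))).deriv.trans (by simp)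
  rw [h1, h3, hsymm.eq]

theorem Smooth2.left (hf : Smooth2 I J f) {x : ℝ} (hx : x ∈ J) :
    ContDiffOn ℝ ∞ (fun s => f s x) I :=
  ContDiffOn.comp (g := fun q : ℝ × ℝ => f q.1 q.2) (f := fun s => (s, x)) hf
    (contDiffOn_id.prodMk contDiffOn_const) fun _ hs => ⟨hs, hx⟩

theorem Smooth2.right (hf : Smooth2 I J f) {t : ℝ} (ht : t ∈ I) : ContDiffOn ℝ ∞ (f t) J :=
  ContDiffOn.comp (g := fun q : ℝ × ℝ => f q.1 q.2) (f := fun y => (t, y)) hf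
    (contDiffOn_const.prodMk contDiffOn_id) fun _ hs => ⟨ht, hs⟩

/-- Functions with smooth partial derivatives, in the form of a linear system, are smooth. -/
theorem smooth2_of_system (hI : IsOpen I) (hJ : IsOpen J) {A B : ℝ → ℝ → E →L[ℝ] E}
    (hA : Smooth2 I J A) (hB : Smooth2 I J B)
    (hc : ContinuousOn (fun q : ℝ × ℝ => f q.1 q.2) (I ×ˢ J))
    (ht : ∀ t ∈ I, ∀ x ∈ J, HasDerivAt (fun s => f s x) (B t x (f t x)) t)
    (hx : ∀ t ∈ I, ∀ x ∈ J, HasDerivAt (f t) (A t x (f t x)) x) : Smooth2 I J f := by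
  have hO := hI.prod hJ
  set D : ℝ × ℝ → ℝ × ℝ →L[ℝ] E := fun q =>
    (ContinuousLinearMap.smulRight (1 : ℝ →L[ℝ] ℝ) (B q.1 q.2 (f q.1 q.2))).coprod
      (ContinuousLinearMap.smulRight (1 : ℝ →L[ℝ] ℝ) (A q.1 q.2 (f q.1 q.2))) with hD
  have hDs : ∀ n : WithTop ℕ∞, n ≤ ∞ → ContDiffOn ℝ n (fun q : ℝ × ℝ => f q.1 q.2) (I ×ˢ J) →
      ContDiffOn ℝ n D (I ×ˢ J) := fun n hn h => by
    have hA' := (hA.of_le hn).clm_apply h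
    have hB' := (hB.of_le hn).clm_apply h
    have e : ∀ q, D q = (ContinuousLinearMap.smulRightL ℝ (ℝ × ℝ) E
        (ContinuousLinearMap.fst ℝ ℝ ℝ)) (B q.1 q.2 (f q.1 q.2)) +
        (ContinuousLinearMap.smulRightL ℝ (ℝ × ℝ) E
        (ContinuousLinearMap.snd ℝ ℝ ℝ)) (A q.1 q.2 (f q.1 q.2)) := fun q => by
      ext <;> simp [hD]
    simp only [funext e]
    exact ((ContinuousLinearMap.contDiff _).comp_contDiffOn hB').add
      ((ContinuousLinearMap.contDiff _).comp_contDiffOn hA')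
  have hfd : ∀ q ∈ I ×ˢ J, HasFDerivAt (fun q : ℝ × ℝ => f q.1 q.2) (D q) q := by
    intro q hq
    have hcB := ContDiffOn.continuousOn (hB.of_le (m := 0) (by simp))
    have hcA := ContDiffOn.continuousOn (hA.of_le (m := 0) (by simp))
    have h := hasStrictFDerivAt_uncurry_coprod (𝕜 := ℝ) (u := q) (f := f)
      (f₁ := fun t x => ContinuousLinearMap.smulRight (1 : ℝ →L[ℝ] ℝ) (B t x (f t x)))
      (f₂ := fun t x => ContinuousLinearMap.smulRight (1 : ℝ →L[ℝ] ℝ) (A t x (f t x))) ?_ ?_ ?_ ?_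
    · exact h.hasFDerivAt
    · filter_upwards [hO.mem_nhds hq] with v hv
      exact (ht v.1 hv.1 v.2 hv.2).hasFDerivAt
    · filter_upwards [hO.mem_nhds hq] with v hv
      exact (hx v.1 hv.1 v.2 hv.2).hasFDerivAt
    · exact ((ContinuousLinearMap.smulRightL ℝ ℝ E 1).continuous.comp_continuousOn
        (hcB.clm_apply hc)).continuousAt (hO.mem_nhds hq)
    · exact ((ContinuousLinearMap.smulRightL ℝ ℝ E 1).continuous.comp_continuousOn
        (hcA.clm_apply hc)).continuousAt (hO.mem_nhds hq)
  -- Bootstrapping: the total derivative is built from A, B and f itself, so f of class Cⁿ has a Cⁿ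
  -- derivative.
  have hn : ∀ n : ℕ, ContDiffOn ℝ n (fun q : ℝ × ℝ => f q.1 q.2) (I ×ˢ J) := by
    intro n
    induction n with
    | zero => exact contDiffOn_zero.2 hc
    | succ n ih =>
      have := (contDiffOn_succ_iff_fderiv_of_isOpen (𝕜 := ℝ) (n := (n : WithTop ℕ∞))
        (f := fun q : ℝ × ℝ => f q.1 q.2) hO).2
        ⟨fun q hq => (hfd q hq).differentiableAt.differentiableWithinAt, by simp, ?_⟩
      · exact_mod_cast this
      · exact (hDs n (by exact WithTop.coe_le_coe.2 le_top) ih).congr fun q hq => (hfd q hq).fderiv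
  exact contDiffOn_infty.2 hn

end TwoVariables

/-! ### Compatible linear systems -/

section Compatible

open Set Filter Topology

variable {E : Type*} [NormedAddCommGroup E] [NormedSpace ℝ E] {I J : Set ℝ}

theorem Smooth2.continuousOn {f : ℝ → ℝ → E} (hf : Smooth2 I J f) :
    ContinuousOn (fun q : ℝ × ℝ => f q.1 q.2) (I ×ˢ J) := ContDiffOn.continuousOn hf

theorem Smooth2.exists_bound {f : ℝ → ℝ → E} (hf : Smooth2 I J f) {a b c d : ℝ}
    (hcd : Icc c d ⊆ I) (hab : Icc a b ⊆ J) :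
    ∃ C, ∀ t ∈ Icc c d, ∀ x ∈ Icc a b, ‖f t x‖ ≤ C := by
  obtain ⟨C, hC⟩ := (isCompact_Icc.prod isCompact_Icc).exists_bound_of_continuousOn
    (hf.continuousOn.mono (prod_mono hcd hab))
  exact ⟨C, fun t ht x hx => hC (t, x) ⟨ht, hx⟩⟩

/-- First order Taylor estimate in the first variable. -/
theorem Smooth2.exists_taylor_bound {f : ℝ → ℝ → E} (hI : IsOpen I) (hJ : IsOpen J)
    (hf : Smooth2 I J f) {a b c d : ℝ} (hcd : Icc c d ⊆ I) (hab : Icc a b ⊆ J) :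
    ∃ C, 0 ≤ C ∧ ∀ t ∈ Icc c d, ∀ t' ∈ Icc c d, ∀ x ∈ Icc a b, ‖f t' x - f t x‖ ≤ C * |t' - t| ∧
      ‖f t' x - f t x - (t' - t) • deriv (fun s => f s x) t‖ ≤ C * |t' - t| ^ 2 := by
  have hf' := hf.deriv_fst hI hJ
  obtain ⟨C₁, h₁⟩ := hf'.exists_bound hcd hab
  obtain ⟨C₂, h₂⟩ := (hf'.deriv_fst hI hJ).exists_bound hcd hab
  have mv : ∀ {g : ℝ → ℝ → E} {C : ℝ}, Smooth2 I J g →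
      (∀ t ∈ Icc c d, ∀ x ∈ Icc a b, ‖deriv (fun s => g s x) t‖ ≤ C) →
      ∀ t ∈ Icc c d, ∀ t' ∈ Icc c d, ∀ x ∈ Icc a b, ‖g t' x - g t x‖ ≤ C * |t' - t| := by
    intro g C hg hC t ht t' ht' x hx
    exact (convex_Icc c d).norm_image_sub_le_of_norm_hasDerivWithin_le
      (f := fun s => g s x) (fun s hs => (hg.hasDerivAt_fst hI hJ (hcd hs)
        (hab hx)).hasDerivWithinAt) (fun s hs => hC s hs x hx) ht ht'
  refine ⟨max 0 (max C₁ C₂), le_max_left _ _, fun t ht t' ht' x hx => ⟨?_, ?_⟩⟩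
  · refine (mv hf h₁ t ht t' ht' x hx).trans ?_
    gcongr
    exact (le_max_left _ _).trans (le_max_right _ _)
  · have hsub : uIcc t t' ⊆ Icc c d := uIcc_subset_Icc ht ht'
    -- Mean value inequality for s ↦ f(s, x) − (s − t)∂_t f(t, x), whose derivative is controlled by
    -- the first-order estimate for ∂_t f.
    have key := (convex_uIcc t t').norm_image_sub_le_of_norm_hasDerivWithin_le
      (f := fun s => f s x - (s - t) • deriv (fun s => f s x) t)
      (f' := fun s => deriv (fun s => f s x) s - (1 : ℝ) • deriv (fun s => f s x) t)
      (C := C₂ * |t' - t|)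
      (fun s hs => ((hf.hasDerivAt_fst hI hJ (hcd (hsub hs)) (hab hx)).sub
        (((hasDerivAt_id s).sub_const t).smul_const _)).hasDerivWithinAt)
      (fun s hs => by
        have hC₂ : 0 ≤ C₂ := (norm_nonneg _).trans (h₂ t ht x hx)
        rw [one_smul]
        refine (mv hf' h₂ t ht s (hsub hs) x hx).trans ?_
        gcongr C₂ * ?_
        exact abs_sub_left_of_mem_uIcc hs)
      left_mem_uIcc right_mem_uIcc
    have e : f t' x - (t' - t) • deriv (fun s => f s x) t -
        (f t x - (t - t) • deriv (fun s => f s x) t) =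
        f t' x - f t x - (t' - t) • deriv (fun s => f s x) t := by
      rw [sub_self, zero_smul]; abel
    rw [e, Real.norm_eq_abs] at key
    refine key.trans ?_
    rw [mul_assoc, ← pow_two]
    gcongr
    exact (le_max_right _ _).trans (le_max_right _ _)

/-- Requiring K ≥ 1 lets ε/K be replaced by ε and avoids the degenerate case K = 0. -/
theorem gronwallBound_le_of_pos {δ K ε x R : ℝ} (hδ : 0 ≤ δ) (hε : 0 ≤ ε) (hK : 1 ≤ K)
    (hxR : x ≤ R) : gronwallBound δ K ε x ≤ Real.exp (K * R) * (δ + ε) := by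
  rw [gronwallBound_of_K_ne_0 (by positivity)]
  have h1 : Real.exp (K * x) ≤ Real.exp (K * R) := by gcongr
  have h2 : ε / K ≤ ε := div_le_self hε hK
  have h3 := Real.exp_pos (K * x)
  have h4 : 0 ≤ ε / K := by positivity
  nlinarith [mul_le_mul_of_nonneg_left h1 hδ, mul_le_mul_of_nonneg_right h2 h3.le,
    mul_le_mul_of_nonneg_left h1 hε]

variable [CompleteSpace E]

/-- The equation in t is solved on the line x = x₀, and from there the equation in x for each t
separately. That the result also solves the equation in t off this line is shown without any theory
of dependence on parameters: the defect e = φ(t′) − φ(t) − (t′ − t)Bφ(t) satisfies |∂_y e| ≤ K|e| +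
O(|t′ − t|²) by compatibility, and Gronwall propagates its smallness from x₀. -/
theorem exists_compatible_system (hI : IsOpenInterval I) (hJ : IsOpenInterval J)
    {A B : ℝ → ℝ → E →L[ℝ] E} (hA : Smooth2 I J A) (hB : Smooth2 I J B)
    (hz : ∀ t ∈ I, ∀ x ∈ J, deriv (fun s => A s x) t + (A t x).comp (B t x) =
      deriv (B t) x + (B t x).comp (A t x)) {t₀ x₀ : ℝ} (ht₀ : t₀ ∈ I) (hx₀ : x₀ ∈ J) (y₀ : E) :
    ∃ φ : ℝ → ℝ → E, φ t₀ x₀ = y₀ ∧ Smooth2 I J φ ∧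
      (∀ t ∈ I, ∀ x ∈ J, HasDerivAt (fun s => φ s x) (B t x (φ t x)) t) ∧
      ∀ t ∈ I, ∀ x ∈ J, HasDerivAt (φ t) (A t x (φ t x)) x := by
  obtain ⟨φ₀, h₀, hφ₀⟩ := exists_linear_ode hI (A := fun t => B t x₀)
    (hB.left hx₀).continuousOn ht₀ y₀
  have hex : ∀ t, ∃ f : ℝ → E, t ∈ I → f x₀ = φ₀ t ∧ ∀ x ∈ J, HasDerivAt f (A t x (f x)) x := by
    intro t
    by_cases ht : t ∈ I
    · obtain ⟨f, hf⟩ := exists_linear_ode hJ (hA.right ht).continuousOn hx₀ (φ₀ t)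
      exact ⟨f, fun _ => hf⟩
    · exact ⟨0, fun h => absurd h ht⟩
  choose φ hφ using hex
  have hφx : ∀ t ∈ I, ∀ x ∈ J, HasDerivAt (φ t) (A t x (φ t x)) x := fun t ht => (hφ t ht).2
  -- the defect of the linear approximation in the first variable
  set e : ℝ → ℝ → ℝ → E := fun t t' y =>
    φ t' y - φ t y - (t' - t) • B t y (φ t y) with he
  have key : ∀ t ∈ I, ∀ x ∈ J, ∃ G M a b c d : ℝ, t ∈ Ioo c d ∧ Icc c d ⊆ I ∧ x ∈ Ioo a b ∧
      Icc a b ⊆ J ∧ (∀ y ∈ Icc a b, ‖B t y (φ t y)‖ ≤ M) ∧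
      ∀ t' ∈ Icc c d, ∀ y ∈ Icc a b, ‖e t t' y‖ ≤ G * (‖e t t' x₀‖ + |t' - t| ^ 2) := by
    intro t ht x hx
    obtain ⟨a, b, hx', hx₀', hab⟩ := hJ.exists_Icc hx hx₀
    obtain ⟨c, d, ht', -, hcd⟩ := hI.exists_Icc ht ht
    have htc := Ioo_subset_Icc_self ht'
    obtain ⟨K₀, hK₀⟩ := hA.exists_bound hcd hab
    obtain ⟨C, hC0, hC⟩ := hA.exists_taylor_bound hI.1 hJ.1 hcd hab
    have hφc : ContinuousOn (φ t) J := fun y hy => (hφx t ht y hy).continuousAt.continuousWithinAt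
    obtain ⟨M₁, hM₁⟩ := isCompact_Icc.exists_bound_of_continuousOn (hφc.mono hab)
    obtain ⟨M₂, hM₂⟩ := isCompact_Icc.exists_bound_of_continuousOn
      (((hB.right ht).continuousOn.clm_apply hφc).mono hab)
    have hM₁0 : 0 ≤ M₁ := (norm_nonneg _).trans (hM₁ x (Ioo_subset_Icc_self hx'))
    have hM₂0 : 0 ≤ M₂ := (norm_nonneg _).trans (hM₂ x (Ioo_subset_Icc_self hx'))
    set K := max 1 K₀
    set c₁ := C * M₁ + C * M₂
    have hc₁ : 0 ≤ c₁ := by positivity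
    refine ⟨Real.exp (K * (b - a)) * (1 + c₁), M₂, a, b, c, d, ht', hcd, hx', hab, hM₂, ?_⟩
    intro t' htt y hy
    have hsub : uIcc x₀ y ⊆ Icc a b := uIcc_subset_Icc (Ioo_subset_Icc_self hx₀') hy
    have hder : ∀ s ∈ uIcc x₀ y, HasDerivAt (e t t')
        (A t' s (φ t' s) - A t s (φ t s) -
          (t' - t) • (deriv (B t) s (φ t s) + B t s (A t s (φ t s)))) s := fun s hs =>
      ((hφx t' (hcd htt) s (hab (hsub hs))).sub (hφx t ht s (hab (hsub hs)))).sub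
        (((hB.hasDerivAt_snd hI.1 hJ.1 ht (hab (hsub hs))).clm_apply
          (hφx t ht s (hab (hsub hs)))).const_smul (t' - t))
    have hbd : ∀ s ∈ uIcc x₀ y, ‖A t' s (φ t' s) - A t s (φ t s) -
          (t' - t) • (deriv (B t) s (φ t s) + B t s (A t s (φ t s)))‖ ≤
          K * ‖e t t' s‖ + c₁ * |t' - t| ^ 2 := by
      intro s hs
      have hs' := hsub hs
      have hzs := congrArg (fun L => L (φ t s)) (hz t ht s (hab hs'))
      simp only [add_apply, ContinuousLinearMap.comp_apply] at hzs
      obtain ⟨hl, hq⟩ := hC t htc t' htt s hs'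
      -- Compatibility replaces B_x + BA by A_t + AB; what remains is A applied to the defect, plus
      -- terms of second order in t′ − t.
      have e1 : A t' s (φ t' s) - A t s (φ t s) -
          (t' - t) • (deriv (B t) s (φ t s) + B t s (A t s (φ t s))) =
          A t' s (e t t' s) + (A t' s - A t s - (t' - t) • deriv (fun r => A r s) t) (φ t s) +
          (t' - t) • (A t' s - A t s) (B t s (φ t s)) := by
        rw [← hzs]
        simp only [he, map_sub, map_smul, sub_apply,
          smul_apply, smul_add, smul_sub]
        abel
      rw [e1]
      refine (norm_add_le _ _).trans ((add_le_add (norm_add_le _ _) le_rfl).trans ?_)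
      have b1 : ‖A t' s (e t t' s)‖ ≤ K * ‖e t t' s‖ := ((A t' s).le_opNorm _).trans
        (mul_le_mul_of_nonneg_right ((hK₀ t' htt s hs').trans (le_max_right _ _)) (norm_nonneg _))
      have b2 : ‖(A t' s - A t s - (t' - t) • deriv (fun r => A r s) t) (φ t s)‖ ≤
          C * |t' - t| ^ 2 * M₁ := (ContinuousLinearMap.le_opNorm _ _).trans
        (mul_le_mul hq (hM₁ s hs') (norm_nonneg _) (by positivity))
      have b3 : ‖(t' - t) • (A t' s - A t s) (B t s (φ t s))‖ ≤ |t' - t| * (C * |t' - t| * M₂) := by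
        rw [norm_smul, Real.norm_eq_abs]
        exact mul_le_mul_of_nonneg_left ((ContinuousLinearMap.le_opNorm _ _).trans
          (mul_le_mul hl (hM₂ s hs') (norm_nonneg _) (by positivity))) (abs_nonneg _)
      calc _ ≤ K * ‖e t t' s‖ + C * |t' - t| ^ 2 * M₁ + |t' - t| * (C * |t' - t| * M₂) := by gcongr
        _ = _ := by ring
    have hyx : |y - x₀| ≤ b - a := by
      rw [abs_le]; constructor <;> linarith [hy.1, hy.2, hx₀'.1, hx₀'.2]
    refine (norm_le_gronwallBound_uIcc hder hbd).trans ((gronwallBound_le_of_pos (norm_nonneg _)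
      (by positivity) (le_max_left _ _) hyx).trans ?_)
    rw [mul_assoc]
    gcongr
    nlinarith [norm_nonneg (e t t' x₀), sq_nonneg |t' - t|]
  -- On the line x = x₀ the defect is o(t′ − t) because the initial values solve the equation in t.
  have he₀ : ∀ t ∈ I, (fun t' => e t t' x₀) =o[𝓝 t] fun t' => t' - t := fun t ht => by
    have h := (hasDerivAt_iff_isLittleO.1 (hφ₀ t ht))
    refine h.congr' ?_ EventuallyEq.rfl
    filter_upwards [hI.1.mem_nhds ht] with t' ht'
    simp only [he, (hφ t ht).1, (hφ t' ht').1]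
  have hsq : ∀ t : ℝ, (fun t' : ℝ => |t' - t| ^ 2) =o[𝓝 t] fun t' => t' - t := fun t => by
    have h : (fun s : ℝ => |s - t|) =o[𝓝 t] fun _ => (1 : ℝ) := by
      rw [Asymptotics.isLittleO_one_iff]
      exact Continuous.tendsto' (by fun_prop) _ _ (by simp)
    simpa [pow_two, abs_mul_abs_self] using
      (h.mul_isBigO (Asymptotics.isBigO_refl (fun s => |s - t|) (𝓝 t))).trans_isBigO
      (Asymptotics.IsBigO.of_bound 1 (by simp))
  have hφt : ∀ t ∈ I, ∀ x ∈ J, HasDerivAt (fun s => φ s x) (B t x (φ t x)) t := by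
    intro t ht x hx
    obtain ⟨G, M, a, b, c, d, ht', -, hx', -, -, hG⟩ := key t ht x hx
    rw [hasDerivAt_iff_isLittleO]
    refine Asymptotics.IsBigO.trans_isLittleO (g := fun t' => ‖e t t' x₀‖ + |t' - t| ^ 2)
      (Asymptotics.IsBigO.of_bound G ?_) ((he₀ t ht).norm_left.add (hsq t))
    filter_upwards [Icc_mem_nhds ht'.1 ht'.2] with t' htt
    rw [Real.norm_of_nonneg (by positivity)]
    exact hG t' htt x (Ioo_subset_Icc_self hx')
  -- The bound on the defect is uniform in y, which turns continuity in each variable into the joint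
  -- continuity that `smooth2_of_system` requires.
  have hc : ContinuousOn (fun q : ℝ × ℝ => φ q.1 q.2) (I ×ˢ J) := by
    rintro ⟨t, x⟩ ⟨ht, hx⟩
    apply ContinuousAt.continuousWithinAt
    obtain ⟨G, M, a, b, c, d, ht', -, hx', -, hM, hG⟩ := key t ht x hx
    have hb : Tendsto (fun q : ℝ × ℝ => G * (‖e t q.1 x₀‖ + |q.1 - t| ^ 2) + |q.1 - t| * M +
        ‖φ t q.2 - φ t x‖) (𝓝 (t, x)) (𝓝 (G * (0 + 0) + 0 * M + 0)) := by
      have t1 : Tendsto (fun q : ℝ × ℝ => q.1) (𝓝 (t, x)) (𝓝 t) := continuous_fst.tendsto (t, x)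
      have t2 : Tendsto (fun q : ℝ × ℝ => q.2) (𝓝 (t, x)) (𝓝 x) := continuous_snd.tendsto (t, x)
      have s0 : Tendsto (fun s : ℝ => s - t) (𝓝 t) (𝓝 0) :=
        Continuous.tendsto' (by fun_prop) _ _ (by simp)
      have s1 : Tendsto (fun s => ‖e t s x₀‖) (𝓝 t) (𝓝 0) := by
        simpa using ((he₀ t ht).isBigO.trans_tendsto s0).norm
      have s2 : Tendsto (fun s : ℝ => |s - t|) (𝓝 t) (𝓝 0) := by simpa using s0.abs
      have s3 : Tendsto (fun s : ℝ => |s - t| ^ 2) (𝓝 t) (𝓝 0) := by simpa using s2.pow 2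
      have s4 : Tendsto (fun y => ‖φ t y - φ t x‖) (𝓝 x) (𝓝 0) := by
        simpa using ((hφx t ht x hx).continuousAt.tendsto.sub_const (φ t x)).norm
      exact (((((s1.comp t1).add (s3.comp t1)).const_mul G)).add
        ((s2.comp t1).mul_const M)).add (s4.comp t2)
    rw [show G * (0 + 0) + 0 * M + 0 = 0 by ring] at hb
    rw [ContinuousAt, tendsto_iff_norm_sub_tendsto_zero]
    refine squeeze_zero' (Eventually.of_forall fun _ => norm_nonneg _) ?_ hb
    filter_upwards [prod_mem_nhds (Icc_mem_nhds ht'.1 ht'.2) (Icc_mem_nhds hx'.1 hx'.2)]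
      with q hq
    have e1 : φ q.1 q.2 - φ t x =
        e t q.1 q.2 + (q.1 - t) • B t q.2 (φ t q.2) + (φ t q.2 - φ t x) := by
      simp only [he]; abel
    rw [e1]
    refine (norm_add_le _ _).trans ((add_le_add (norm_add_le _ _) le_rfl).trans ?_)
    rw [norm_smul, Real.norm_eq_abs]
    have := hG q.1 hq.1 q.2 hq.2
    have := mul_le_mul_of_nonneg_left (hM q.2 hq.2) (abs_nonneg (q.1 - t))
    gcongr
  exact ⟨φ, by rw [(hφ t₀ ht₀).1, h₀], smooth2_of_system hI.1 hJ.1 hA hB hc hφt hφx, hφt, hφx⟩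

/-- A function on an open interval with vanishing derivative is constant. -/
theorem IsOpenInterval.eq_of_hasDerivAt_zero {F : Type*} [NormedAddCommGroup F] [NormedSpace ℝ F]
    (hJ : IsOpenInterval J) {f : ℝ → F} (hf : ∀ x ∈ J, HasDerivAt f 0 x) {x y : ℝ}
    (hx : x ∈ J) (hy : y ∈ J) : f x = f y := by
  have := hJ.2.1.convex.norm_image_sub_le_of_norm_hasDerivWithin_le (C := 0)
    (fun s hs => (hf s hs).hasDerivWithinAt) (fun s _ => by simp) hx hy
  rw [zero_mul, norm_le_zero_iff, sub_eq_zero] at this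
  exact this.symm

end Compatible

/-! ### Calculus of quaternionic matrices -/

section MatrixCalculus

open Set Filter Topology

variable {m : ℕ}

instance (g : UGroup m) : CoeT (UGroup m) g (Mat m) := ⟨Subtype.val g⟩

/-- Matrix multiplication as a continuous bilinear map. -/
def mulL (m : ℕ) : Mat m →L[ℝ] Mat m →L[ℝ] Mat m :=
  LinearMap.toContinuousLinearMap
    ((LinearMap.toContinuousLinearMap : (Mat m →ₗ[ℝ] Mat m) ≃ₗ[ℝ] _).toLinearMap ∘ₗ
      LinearMap.mul ℝ (Mat m))

/-- Conjugate transposition as a continuous linear map. -/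
def starL (m : ℕ) : Mat m →L[ℝ] Mat m :=
  LinearMap.toContinuousLinearMap
    { toFun := star
      map_add' := star_add
      map_smul' := fun r X => by
        ext1 i j
        exact Quaternion.star_smul r _ }

theorem star_smul_mat (r : ℝ) (X : Mat m) : star (r • X) = r • star X := (starL m).map_smul r X

theorem ContDiffOn.matMul {F : Type*} [NormedAddCommGroup F] [NormedSpace ℝ F] {s : Set F}
    {A B : F → Mat m} (hA : ContDiffOn ℝ ∞ A s) (hB : ContDiffOn ℝ ∞ B s) :
    ContDiffOn ℝ ∞ (fun x => A x * B x) s := by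
  have h := ContDiffOn.clm_apply (ContDiff.comp_contDiffOn (mulL m).contDiff hA) hB
  exact h

theorem ContDiffOn.matStar {F : Type*} [NormedAddCommGroup F] [NormedSpace ℝ F] {s : Set F}
    {A : F → Mat m} (hA : ContDiffOn ℝ ∞ A s) : ContDiffOn ℝ ∞ (fun x => star (A x)) s :=
  (starL m).contDiff.comp_contDiffOn hA

variable {I J : Set ℝ} {A B : ℝ → ℝ → Mat m}

theorem Smooth2.mul (hA : Smooth2 I J A) (hB : Smooth2 I J B) :
    Smooth2 I J fun t x => A t x * B t x := ContDiffOn.matMul hA hB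

theorem Smooth2.star (hA : Smooth2 I J A) : Smooth2 I J fun t x => star (A t x) :=
  ContDiffOn.matStar hA

theorem Smooth2.add (hA : Smooth2 I J A) (hB : Smooth2 I J B) :
    Smooth2 I J fun t x => A t x + B t x := ContDiffOn.add hA hB

theorem Smooth2.sub (hA : Smooth2 I J A) (hB : Smooth2 I J B) :
    Smooth2 I J fun t x => A t x - B t x := ContDiffOn.sub hA hB

theorem Smooth2.const_smul (r : ℝ) (hA : Smooth2 I J A) : Smooth2 I J fun t x => r • A t x :=
  ContDiffOn.const_smul r hA

theorem smooth2_const (X : Mat m) : Smooth2 I J fun _ _ => X := contDiffOn_const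

theorem Smooth2.adInvPot (hA : Smooth2 I J A) (hB : Smooth2 I J B) :
    Smooth2 I J fun t x => adInvPot (A t x) (B t x) := by
  have h {X : ℝ → ℝ → Mat m} (hX : Smooth2 I J X) :
      Smooth2 I J fun t x => A t x * X t x - X t x * A t x := (hA.mul hX).sub (hX.mul hA)
  exact ((h (h hB)).const_smul _).sub (hB.const_smul _)

theorem deriv_clm_comp (L : Mat m ≃L[ℝ] Mat m) (f : ℝ → Mat m) (s : ℝ) :
    deriv (fun r => L (f r)) s = L (deriv f s) := by
  have := L.comp_fderiv (f := f) (x := s)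
  exact congrArg (fun K : ℝ →L[ℝ] Mat m => K 1) this

/-- Left multiplication is an endomorphism of a finite-dimensional real space, where one-sided
inverses are two-sided. -/
theorem mul_eq_one_symm {X Y : Mat m} (h : X * Y = 1) : Y * X = 1 := by
  have h1 : LinearMap.mulLeft ℝ X * LinearMap.mulLeft ℝ Y = 1 := by
    rw [Module.End.mul_eq_comp, ← LinearMap.mulLeft_mul, h]
    exact LinearMap.mulLeft_one ℝ (Mat m)
  have h2 := congrArg (fun L : Module.End ℝ (Mat m) => L 1) (mul_eq_one_comm.1 h1)
  simpa using h2

theorem re_sum {ι : Type*} (s : Finset ι) (f : ι → ℍ) : (∑ i ∈ s, f i).re = ∑ i ∈ s, (f i).re :=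
  map_sum ({ toFun := fun q : ℍ => q.re, map_zero' := rfl, map_add' := fun _ _ => rfl } : ℍ →+ ℝ)
    f s

/-- Only the real part of the trace is cyclic over ℍ, because Re(pq) = Re(qp). -/
theorem re_trace_mul_comm (X Y : Mat m) : (X * Y).trace.re = (Y * X).trace.re := by
  have hre : ∀ Z : Mat m, Z.trace.re = ∑ i, (Z i i).re := fun Z => re_sum _ _
  rw [hre, hre]
  simp only [Matrix.mul_apply, re_sum]
  rw [Finset.sum_comm]
  refine Finset.sum_congr rfl fun i _ => Finset.sum_congr rfl fun j _ => ?_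
  simp only [Quaternion.re_mul]
  ring

end MatrixCalculus

/-! ### Geometry of the projective space -/

section Reflection

open Set Filter Topology

variable {m : ℕ}

theorem star_symmS : star (symmS m) = symmS m := by
  rw [symmS, Matrix.star_eq_conjTranspose, Matrix.diagonal_conjTranspose]
  congr 1
  ext1 i
  by_cases h : i = 0 <;> simp [h]

theorem UGroup.mul_star (g : UGroup m) : (g : Mat m) * star (g : Mat m) = 1 :=
  Unitary.mul_star_self_of_mem g.2

theorem UGroup.star_mul (g : UGroup m) : star (g : Mat m) * (g : Mat m) = 1 :=
  Unitary.star_mul_self_of_mem g.2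

theorem UGroup.star_mul_cancel (g : UGroup m) (X : Mat m) :
    star (g : Mat m) * ((g : Mat m) * X) = X := by rw [← mul_assoc, g.star_mul, one_mul]

theorem UGroup.mul_star_cancel (g : UGroup m) (X : Mat m) :
    (g : Mat m) * (star (g : Mat m) * X) = X := by rw [← mul_assoc, g.mul_star, one_mul]

/-- Conjugation by a unitary matrix. -/
def conj (g : UGroup m) : Mat m →ₐ[ℝ] Mat m where
  toFun X := (g : Mat m) * X * star (g : Mat m)
  map_one' := by rw [mul_one, g.mul_star]
  map_mul' X Y := by simp only [mul_assoc, g.star_mul_cancel]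
  map_zero' := by simp
  map_add' X Y := by rw [mul_add, add_mul]
  commutes' r := by
    rw [Algebra.algebraMap_eq_smul_one, mul_smul_comm, smul_mul_assoc, mul_one, g.mul_star]

theorem conj_apply (g : UGroup m) (X : Mat m) : conj g X = (g : Mat m) * X * star (g : Mat m) := rfl

theorem star_conj (g : UGroup m) (X : Mat m) : star (conj g X) = conj g (star X) := by
  simp only [conj_apply, StarMul.star_mul, star_star, mul_assoc]

theorem coframe_conj (g : UGroup m) (X : Mat m) : coframe g (conj g X) = X := by
  rw [coframe, conj_apply, mul_assoc, mul_assoc, mul_assoc, g.star_mul, mul_one, g.star_mul_cancel]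

theorem conj_coframe (g : UGroup m) (X : Mat m) : conj g (coframe g X) = X := by
  rw [coframe, conj_apply, mul_assoc, mul_assoc, mul_assoc, g.mul_star, mul_one, g.mul_star_cancel]

theorem coframe_eq_conj (g : UGroup m) (X : Mat m) : coframe g X = conj g⁻¹ X := by
  rw [coframe, conj_apply]
  have h : ((g⁻¹ : UGroup m) : Mat m) = star (g : Mat m) := rfl
  rw [h, star_star]

theorem reflection_mk (g : UGroup m) : reflection (g : HP m) = conj g (symmS m) := rfl

theorem conj_mul (g k : UGroup m) (X : Mat m) : conj (g * k) X = conj g (conj k X) := by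
  simp only [conj_apply, Submonoid.coe_mul, StarMul.star_mul, mul_assoc]

theorem reflection_smul (g : UGroup m) (p : HP m) : reflection (g • p) = conj g (reflection p) := by
  induction p using QuotientGroup.induction_on with
  | H k =>
    rw [reflection_mk, ← conj_mul]
    rfl

theorem reflection_sq (p : HP m) : reflection p * reflection p = 1 := by
  induction p using QuotientGroup.induction_on with
  | H k => rw [reflection_mk, ← map_mul, symmS_sq, map_one]

theorem star_reflection (p : HP m) : star (reflection p) = reflection p := by
  induction p using QuotientGroup.induction_on with
  | H k => rw [reflection_mk, star_conj, star_symmS]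

theorem mem_isotropy_of_comm {g : UGroup m} (h : (g : Mat m) * symmS m = symmS m * (g : Mat m)) :
    g ∈ isotropy m := by
  intro j hj
  have hx : ∀ x : ℍ, x = -x → x = 0 := fun x hx => eq_zero_of_eq_neg hx
  constructor
  · have := congrFun (congrFun h 0) j
    rw [symmS, Matrix.mul_diagonal, Matrix.diagonal_mul] at this
    exact hx _ (by simpa [hj] using this)
  · have := congrFun (congrFun h j) 0
    rw [symmS, Matrix.mul_diagonal, Matrix.diagonal_mul] at this
    exact hx _ (by simpa [hj] using this.symm)

/-- The centraliser of S in the unitary group is exactly the isotropy group, so gH is recovered from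
gSg⁻¹. -/
theorem reflection_injective : Function.Injective (reflection : HP m → Mat m) := by
  intro p q h
  induction p using QuotientGroup.induction_on with
  | H a =>
    induction q using QuotientGroup.induction_on with
    | H b =>
      refine QuotientGroup.eq.2 (mem_isotropy_of_comm ?_)
      have h1 : conj a⁻¹ (conj b (symmS m)) = symmS m := by
        rw [← reflection_mk, ← h, reflection_mk, ← coframe_eq_conj, coframe_conj]
      rw [← conj_mul, conj_apply] at h1
      nth_rewrite 2 [← h1]
      rw [mul_assoc, UGroup.star_mul, mul_one]

theorem IsTangent.mul_comm {p : HP m} {Z : Mat m} (h : IsTangent p Z) :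
    reflection p * Z = -(Z * reflection p) := by
  rw [← neg_mul, ← h.2, mul_assoc _ (reflection p), reflection_sq, mul_one]

theorem isTangent_tangentPart {p : HP m} {Z : Mat m} (h : star Z = -Z) :
    IsTangent p (tangentPart p Z) := by
  have hR := reflection_sq p
  constructor
  · rw [tangentPart, star_smul_mat, star_sub, StarMul.star_mul, StarMul.star_mul, star_reflection, h,
      ← smul_neg]
    congr 1
    noncomm_ring
  · have e : reflection p * (reflection p * Z * reflection p) * reflection p = Z := by
      calc _ = reflection p * reflection p * Z * (reflection p * reflection p) := by
            simp only [mul_assoc]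
        _ = Z := by rw [hR]; simp
    rw [tangentPart, mul_smul_comm, smul_mul_assoc, mul_sub, sub_mul, e, ← smul_neg, neg_sub]

theorem tangentPart_eq {p : HP m} {Z : Mat m} (h : IsTangent p Z) : tangentPart p Z = Z := by
  rw [tangentPart, h.2, sub_neg_eq_add, ← two_smul ℝ, smul_smul]
  norm_num

theorem tangentPart_smul (g : UGroup m) (p : HP m) (Z : Mat m) :
    tangentPart (g • p) (conj g Z) = conj g (tangentPart p Z) := by
  simp only [tangentPart, reflection_smul, map_smul, map_sub, map_mul]

/-- Conjugation by g reduces to the origin, where the skew-Hermitian matrices that are odd under S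
are the pairs (a, b). -/
theorem isTangent_mk {g : UGroup m} {Z : Mat m} :
    IsTangent (g : HP m) Z ↔ ∃ a b, Z = conj g (qm a b) := by
  constructor
  · intro h
    refine ⟨coframe g Z 0 1, fun j => coframe g Z 0 j.succ.succ, ?_⟩
    rw [← eq_qm (X := coframe g Z), conj_coframe]
    · rw [coframe_eq_conj, star_conj, h.1, map_neg]
    · rw [← symmS_eq, ← coframe_conj g (symmS m), ← reflection_mk, coframe_eq_conj,
        coframe_eq_conj, ← map_mul, ← map_mul, h.2, map_neg]
  · rintro ⟨a, b, rfl⟩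
    refine ⟨by rw [star_conj, star_qm, map_neg], ?_⟩
    rw [reflection_mk, ← map_mul, ← map_mul, symmS_eq, qS_qm, map_neg]

theorem metric_comm (X Y : Mat m) : metric X Y = metric Y X := by
  rw [metric, metric, killing, killing, re_trace_mul_comm]

theorem metric_conj (g : UGroup m) (X Y : Mat m) : metric (conj g X) (conj g Y) = metric X Y := by
  rw [metric, metric, killing, killing, ← map_mul, conj_apply, re_trace_mul_comm, g.star_mul_cancel]

theorem metric_qm (a c : ℍ) (b d : Fin m → ℍ) :
    metric (qm a b) (qm c d) = chi m * (a * star c + herm b d).re := by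
  have h : (qm a b * qm c d).trace.re = -2 * (a * star c + herm b d).re := by
    rw [qm, qm, blk_mul, Matrix.trace, Fin.sum_univ_succ, Fin.sum_univ_succ]
    simp only [Matrix.diag_apply]
    obtain ⟨h1, -, -, h4, -, -, -, -, h9⟩ := blk_apply (0 * 0 + a * -star c + ∑ k, b k * -star (d k))
      (0 * c + a * 0 + ∑ k, b k * (0 : Fin m → ℍ) k)
      (-star a * 0 + 0 * -star c + ∑ k, (0 : Fin m → ℍ) k * -star (d k))
      (-star a * c + 0 * 0 + ∑ k, (0 : Fin m → ℍ) k * (0 : Fin m → ℍ) k)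
      (fun j => 0 * d j + a * (0 : Fin m → ℍ) j + ∑ k, b k * (0 : Matrix (Fin m) (Fin m) ℍ) k j)
      (fun j => -star a * d j + 0 * (0 : Fin m → ℍ) j +
        ∑ k, (0 : Fin m → ℍ) k * (0 : Matrix (Fin m) (Fin m) ℍ) k j)
      (fun i => -star (b i) * 0 + (0 : Fin m → ℍ) i * -star c +
        ∑ k, (0 : Matrix (Fin m) (Fin m) ℍ) i k * -star (d k))
      (fun i => -star (b i) * c + (0 : Fin m → ℍ) i * 0 +
        ∑ k, (0 : Matrix (Fin m) (Fin m) ℍ) i k * (0 : Fin m → ℍ) k)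
      (Matrix.of fun i j => -star (b i) * d j + (0 : Fin m → ℍ) i * (0 : Fin m → ℍ) j +
        ∑ k, (0 : Matrix (Fin m) (Fin m) ℍ) i k * (0 : Matrix (Fin m) (Fin m) ℍ) k j)
    rw [h1, show (Fin.succ 0 : Fin (m + 2)) = 1 from rfl, h4]
    simp only [h9, Matrix.of_apply, herm]
    simp [Finset.sum_neg_distrib, Finset.sum_add_distrib, Finset.mul_sum]
    have e : (∑ x, star (b x) * d x).re = (∑ x, b x * star (d x)).re := by
      rw [re_sum, re_sum]
      refine Finset.sum_congr rfl fun k _ => ?_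
      simp only [Quaternion.re_mul, Quaternion.re_star, Quaternion.imI_star, Quaternion.imJ_star,
        Quaternion.imK_star]
      ring
    rw [e]
    ring
  rw [metric, killing, h, chi]
  ring

end Reflection

/-! ### Velocities and covariant derivatives -/

section Curves

open Set Filter Topology

variable {m : ℕ}

theorem half_smul_add_self {M : Type*} [AddCommGroup M] [Module ℝ M] (x : M) :
    (1 / 2 : ℝ) • (x + x) = x := by
  rw [← two_smul ℝ, smul_smul]
  norm_num

/-- Differentiating R² = 1 shows that R′ anticommutes with R; hence T = ½R′R is skew and odd, and R′
= [T, R]. -/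
theorem velocity_spec {c : ℝ → HP m} {s : ℝ}
    (hc : DifferentiableAt ℝ (fun r => reflection (c r)) s) :
    IsTangent (c s) (velocity c s) ∧ HasDerivAt (fun r => reflection (c r))
      (velocity c s * reflection (c s) - reflection (c s) * velocity c s) s := by
  have h := hc.hasDerivAt
  set D := deriv (fun r => reflection (c r)) s with hD
  have hR := reflection_sq (c s)
  have h1 : D * reflection (c s) + reflection (c s) * D = 0 := by
    have := hasDerivAt_mul h h
    simp only [reflection_sq] at this
    exact this.unique (hasDerivAt_const s 1)
  have h2 : star D = D := by
    have := hasDerivAt_star h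
    simp only [star_reflection] at this
    exact this.unique h
  have h1' : reflection (c s) * D = -(D * reflection (c s)) := eq_neg_of_add_eq_zero_right h1
  have hv : velocity c s = (1 / 2 : ℝ) • (D * reflection (c s)) := rfl
  constructor
  · rw [hv]
    constructor
    · rw [star_smul_mat, StarMul.star_mul, h2, star_reflection, h1', smul_neg]
    · rw [mul_smul_comm, smul_mul_assoc, ← mul_assoc, h1', neg_mul, neg_mul, smul_neg, mul_assoc D,
        hR, mul_one]
  · have e : velocity c s * reflection (c s) - reflection (c s) * velocity c s = D := by
      rw [hv, mul_smul_comm, smul_mul_assoc, ← smul_sub, ← mul_assoc, h1', neg_mul, sub_neg_eq_add,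
        mul_assoc, hR, mul_one, half_smul_add_self]
    rw [e]
    exact h

/-- The covariant derivative in terms of the ambient derivative. -/
theorem covDeriv_eq {c : ℝ → HP m} {V : ℝ → Mat m} {V' : Mat m} {s : ℝ}
    (hc : DifferentiableAt ℝ (fun r => reflection (c r)) s) (hV : HasDerivAt V V' s)
    (ht : ∀ᶠ r in 𝓝 s, IsTangent (c r) (V r)) :
    IsTangent (c s) (covDeriv c V s) ∧
      covDeriv c V s = V' - (velocity c s * V s - V s * velocity c s) := by
  obtain ⟨hT, hd⟩ := velocity_spec hc
  have hVd : deriv V s = V' := hV.deriv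
  have hs : star V' = -V' := by
    have h1 : (fun r => star (V r)) =ᶠ[𝓝 s] fun r => -V r := by
      filter_upwards [ht] with r hr using hr.1
    exact (hasDerivAt_star hV).unique (hV.neg.congr_of_eventuallyEq h1)
  -- Obtained by differentiating RVR = −V and inserting R′ = [T, R].
  have hp : reflection (c s) * V' * reflection (c s) =
      -V' + (2 : ℝ) • (velocity c s * V s - V s * velocity c s) := by
    have h1 : (fun r => reflection (c r) * V r * reflection (c r)) =ᶠ[𝓝 s] fun r => -V r := by
      filter_upwards [ht] with r hr using hr.2
    have h2 := (hasDerivAt_mul (hasDerivAt_mul hd hV) hd).unique (hV.neg.congr_of_eventuallyEq h1)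
    have hR := reflection_sq (c s)
    have hRT := hT.mul_comm
    have hRV := ht.self_of_nhds.mul_comm
    set R := reflection (c s)
    set T := velocity c s
    set X := V s
    have hXR : X * R = -(R * X) := by rw [hRV, neg_neg]
    have hTR : T * R = -(R * T) := by rw [hRT, neg_neg]
    have e1 : (T * R - R * T) * X * R = (2 : ℝ) • -(T * X) := by
      rw [hRT, sub_neg_eq_add, ← two_smul ℝ, smul_mul_assoc, smul_mul_assoc]
      congr 1
      rw [mul_assoc T, hRV, mul_neg, neg_mul, mul_assoc, mul_assoc, hR, mul_one]
    have e2 : R * X * (T * R - R * T) = (2 : ℝ) • (X * T) := by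
      rw [hTR, ← neg_add', ← two_smul ℝ, mul_neg, mul_smul_comm, ← smul_neg]
      congr 1
      rw [← mul_assoc, hRV, neg_mul, neg_mul, mul_assoc X, hR, mul_one, neg_neg]
    rw [add_mul, e1, e2] at h2
    rw [smul_sub, ← h2]
    simp only [smul_neg]
    abel
  have hcd : covDeriv c V s = tangentPart (c s) V' := by rw [covDeriv, hVd]
  refine ⟨by rw [hcd]; exact isTangent_tangentPart hs, ?_⟩
  rw [hcd, tangentPart, hp]
  rw [sub_add_eq_sub_sub, sub_neg_eq_add, smul_sub, half_smul_add_self, smul_smul]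
  norm_num

/-- Conjugation by a unitary matrix as a continuous linear equivalence. -/
def conjL (g : UGroup m) : Mat m ≃L[ℝ] Mat m :=
  LinearEquiv.toContinuousLinearEquiv
    { (conj g).toLinearMap with
      invFun := coframe g
      left_inv := coframe_conj g
      right_inv := conj_coframe g }

theorem conjL_apply (g : UGroup m) (X : Mat m) : conjL g X = conj g X := rfl

theorem velocity_smul (g : UGroup m) (c : ℝ → HP m) (s : ℝ) :
    velocity (fun r => g • c r) s = conj g (velocity c s) := by
  have h := deriv_clm_comp (conjL g) (fun r => reflection (c r)) s
  simp only [conjL_apply] at h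
  simp only [velocity, reflection_smul, h, map_smul, map_mul]

theorem covDeriv_smul (g : UGroup m) (c : ℝ → HP m) (V : ℝ → Mat m) (s : ℝ) :
    covDeriv (fun r => g • c r) (fun r => conj g (V r)) s = conj g (covDeriv c V s) := by
  have h := deriv_clm_comp (conjL g) V s
  simp only [conjL_apply] at h
  rw [covDeriv, h, tangentPart_smul, covDeriv]

theorem covJet_smul (g : UGroup m) (c : ℝ → HP m) (k : ℕ) (s : ℝ) :
    covJet (fun r => g • c r) k s = conj g (covJet c k s) := by
  induction k generalizing s with
  | zero => exact velocity_smul g c s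
  | succ k ih =>
    have e : covJet (fun r => g • c r) k = fun r => conj g (covJet c k r) := funext ih
    rw [covJet, e, covDeriv_smul, covJet]

theorem IsNonStretching.smul {γ : ℝ → ℝ → HP m} {I J : Set ℝ} (h : IsNonStretching γ I J)
    (g : UGroup m) : IsNonStretching (fun t x => g • γ t x) I J := by
  refine ⟨?_, fun t ht x hx => ?_⟩
  · simp only [reflection_smul]
    exact (conjL g).contDiff.comp_contDiffOn h.1
  · rw [velocity_smul, metric_conj]
    exact h.2 t ht x hx

/-- A single curve as a constant flow. -/
theorem IsUnitSpeed.isNonStretching {c : ℝ → HP m} {J : Set ℝ} (h : IsUnitSpeed c J) :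
    IsNonStretching (fun _ => c) univ J :=
  ⟨ContDiffOn.comp (g := fun x => reflection (c x)) (f := fun q : ℝ × ℝ => q.2) h.1 contDiffOn_snd
    fun _ hq => hq.2, fun _ _ => h.2⟩

theorem IsNonStretching.isUnitSpeed {γ : ℝ → ℝ → HP m} {I J : Set ℝ} (h : IsNonStretching γ I J)
    {t : ℝ} (ht : t ∈ I) : IsUnitSpeed (γ t) J :=
  ⟨Smooth2.right (f := fun t x => reflection (γ t x)) h.1 ht, h.2 t ht⟩

variable {γ : ℝ → ℝ → HP m} {I J : Set ℝ}

theorem smooth2_velocity_snd (hI : IsOpen I) (hJ : IsOpen J)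
    (h : Smooth2 I J fun t x => reflection (γ t x)) : Smooth2 I J fun t => velocity (γ t) :=
  ((h.deriv_snd hI hJ).mul h).const_smul _

theorem smooth2_velocity_fst (hI : IsOpen I) (hJ : IsOpen J)
    (h : Smooth2 I J fun t x => reflection (γ t x)) :
    Smooth2 I J fun t x => velocity (fun s => γ s x) t :=
  ((h.deriv_fst hI hJ).mul h).const_smul _

theorem smooth2_covDeriv (hI : IsOpen I) (hJ : IsOpen J)
    (h : Smooth2 I J fun t x => reflection (γ t x)) {V : ℝ → ℝ → Mat m} (hV : Smooth2 I J V) :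
    Smooth2 I J fun t => covDeriv (γ t) (V t) :=
  ((hV.deriv_snd hI hJ).sub ((h.mul (hV.deriv_snd hI hJ)).mul h)).const_smul _

theorem smooth2_covJet (hI : IsOpen I) (hJ : IsOpen J)
    (h : Smooth2 I J fun t x => reflection (γ t x)) (k : ℕ) :
    Smooth2 I J fun t => covJet (γ t) k := by
  induction k with
  | zero => exact smooth2_velocity_snd hI hJ h
  | succ k ih => exact smooth2_covDeriv hI hJ h ih

/-- Here R_t = [Y, R] and R_x = [T, R]. Equality of the mixed partials of R says that T′ − Y′ + [T,
Y] commutes with R, and so does [T, Y]. The difference X of the two covariant derivatives therefore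
both commutes and anticommutes with the invertible R, so it is zero. -/
theorem eq_of_torsion {A : Type*} [Ring A] [Algebra ℝ A] {R T Y T' Y' : A} (hR : R * R = 1)
    (hRT : R * T = -(T * R)) (hRY : R * Y = -(Y * R))
    (hX : R * (T' - (Y * T - T * Y)) = -((T' - (Y * T - T * Y)) * R))
    (hX' : R * (Y' - (T * Y - Y * T)) = -((Y' - (T * Y - Y * T)) * R))
    (e : T' * R + T * (Y * R - R * Y) - ((Y * R - R * Y) * T + R * T') =
      Y' * R + Y * (T * R - R * T) - ((T * R - R * T) * Y + R * Y')) :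
    T' = Y' - (T * Y - Y * T) + (Y * T - T * Y) := by
  have hcomm : R * (T * Y - Y * T) = (T * Y - Y * T) * R := by
    rw [mul_sub, sub_mul, ← mul_assoc, hRT, ← mul_assoc, hRY, neg_mul, neg_mul, mul_assoc T,
      hRY, mul_assoc Y, hRT, mul_assoc T, mul_assoc Y]
    simp
  have e3 : (T' - Y' + (T * Y - Y * T)) * R = R * (T' - Y' + (T * Y - Y * T)) := by
    rw [← sub_eq_zero] at e ⊢
    rw [← e]
    noncomm_ring
  set X := T' - (Y * T - T * Y) - (Y' - (T * Y - Y * T)) with hXdef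
  have hXc : X * R = R * X := by
    have : X = T' - Y' + (T * Y - Y * T) + (T * Y - Y * T) := by rw [hXdef]; abel
    rw [this, add_mul, mul_add, e3, hcomm]
  have hXa : R * X = -(X * R) := by
    rw [hXdef, mul_sub, sub_mul, hX, hX']
    abel
  have hX0 : X = 0 := by
    have h0 : X * R = 0 := eq_zero_of_eq_neg (by rw [← hXa, hXc])
    rw [← mul_one X, ← hR, ← mul_assoc, h0, zero_mul]
  rw [hXdef, sub_eq_zero] at hX0
  rw [← hX0]; abel

/-- The structure equations for the tangent vectors of a surface. -/
theorem torsion_free (hI : IsOpen I) (hJ : IsOpen J)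
    (h : Smooth2 I J fun t x => reflection (γ t x)) {t x : ℝ} (ht : t ∈ I) (hx : x ∈ J) :
    HasDerivAt (fun s => velocity (γ s) x)
      (covDeriv (γ t) (fun y => velocity (fun s => γ s y) t) x +
        (velocity (fun s => γ s x) t * velocity (γ t) x -
          velocity (γ t) x * velocity (fun s => γ s x) t)) t := by
  have hT := (smooth2_velocity_snd hI hJ h).hasDerivAt_fst hI hJ ht hx
  have hY := (smooth2_velocity_fst hI hJ h).hasDerivAt_snd hI hJ ht hx
  have dx : ∀ s ∈ I, ∀ y ∈ J, DifferentiableAt ℝ (fun r => reflection (γ s r)) y :=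
    fun s hs y hy => (h.hasDerivAt_snd hI hJ hs hy).differentiableAt
  have dt : ∀ s ∈ I, ∀ y ∈ J, DifferentiableAt ℝ (fun r => reflection (γ r y)) s :=
    fun s hs y hy => (h.hasDerivAt_fst hI hJ hs hy).differentiableAt
  have hYt : ∀ᶠ y in 𝓝 x, IsTangent (γ t y) (velocity (fun s => γ s y) t) := by
    filter_upwards [hJ.mem_nhds hx] with y hy
    exact (velocity_spec (c := fun s => γ s y) (dt t ht y hy)).1
  obtain ⟨-, hcd⟩ := covDeriv_eq (dx t ht x hx) hY hYt
  rw [hcd]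
  set T' := deriv (fun s => velocity (γ s) x) t
  set Y' := deriv (fun y => velocity (fun s => γ s y) t) x
  obtain ⟨tT, hRx⟩ := velocity_spec (dx t ht x hx)
  obtain ⟨tY, hRt⟩ := velocity_spec (c := fun s => γ s x) (dt t ht x hx)
  have e1 := h.deriv_comm hI hJ ht hx
  have f1 : (fun s => deriv (fun r => reflection (γ s r)) x) =ᶠ[𝓝 t] fun s =>
      velocity (γ s) x * reflection (γ s x) - reflection (γ s x) * velocity (γ s) x := by
    filter_upwards [hI.mem_nhds ht] with s hs
    exact (velocity_spec (dx s hs x hx)).2.deriv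
  have f2 : (fun y => deriv (fun s => reflection (γ s y)) t) =ᶠ[𝓝 x] fun y =>
      velocity (fun s => γ s y) t * reflection (γ t y) -
        reflection (γ t y) * velocity (fun s => γ s y) t := by
    filter_upwards [hJ.mem_nhds hx] with y hy
    exact (velocity_spec (c := fun s => γ s y) (dt t ht y hy)).2.deriv
  have g1 := ((hasDerivAt_mul hT hRt).sub (hasDerivAt_mul hRt hT)).congr_of_eventuallyEq f1
  have g2 := ((hasDerivAt_mul hY hRx).sub (hasDerivAt_mul hRx hY)).congr_of_eventuallyEq f2
  have e2 := g1.deriv.symm.trans (e1.trans g2.deriv)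
  have hTt : ∀ᶠ s in 𝓝 t, IsTangent (γ s x) (velocity (γ s) x) := by
    filter_upwards [hI.mem_nhds ht] with s hs
    exact (velocity_spec (dx s hs x hx)).1
  obtain ⟨tX, hX⟩ := covDeriv_eq (c := fun s => γ s x) (dt t ht x hx) hT hTt
  have tX' := (covDeriv_eq (dx t ht x hx) hY hYt).1
  rw [hcd] at tX'
  rw [hX] at tX
  have key := eq_of_torsion (reflection_sq (γ t x)) tT.mul_comm tY.mul_comm tX.mul_comm
    tX'.mul_comm e2
  rw [← key]
  exact hT

end Curves

/-! ### Transitivity on unit tangent vectors -/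

section Transitivity

open Matrix

variable {m : ℕ}

/-- A row vector as a matrix. -/
def rowMat (y : Fin (m + 2) → ℍ) : Matrix (Fin 1) (Fin (m + 2)) ℍ := Matrix.of fun _ => y

/-- The reflection in the hyperplane orthogonal to a row vector. -/
def householder (β : ℝ) (F : Matrix (Fin 1) (Fin (m + 2)) ℍ) : Mat m := 1 - β • (Fᴴ * F)

/-- K sends f to −y and fixes e. Such a reflection requires ⟨f, y⟩ = r to be real, and using f + y
in place of f − y keeps the squared length 2(1 + r) away from zero. -/
theorem householder_spec {e f y : Matrix (Fin 1) (Fin (m + 2)) ℍ} {r : ℝ} (hr : 0 ≤ r)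
    (hff : f * fᴴ = 1) (hyy : y * yᴴ = 1) (hfy : f * yᴴ = r • 1) (hyf : y * fᴴ = r • 1)
    (hef : e * fᴴ = 0) (hey : e * yᴴ = 0) :
    let K := householder (1 / (1 + r)) (f + y)
    star K = K ∧ K * K = 1 ∧ K * (eᴴ * f - fᴴ * e) * K = -(eᴴ * y - yᴴ * e) := by
  intro K
  have hr' : (1 + r) ≠ 0 := by positivity
  have hFF : (f + y) * (f + y)ᴴ = (2 * (1 + r)) • (1 : Matrix (Fin 1) (Fin 1) ℍ) := by
    rw [conjTranspose_add, Matrix.add_mul, Matrix.mul_add, Matrix.mul_add, hff, hyy, hfy, hyf]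
    module
  have hfF : f * (f + y)ᴴ = (1 + r) • (1 : Matrix (Fin 1) (Fin 1) ℍ) := by
    rw [conjTranspose_add, Matrix.mul_add, hff, hfy]
    module
  have heF : e * (f + y)ᴴ = 0 := by rw [conjTranspose_add, Matrix.mul_add, hef, hey, add_zero]
  have hK : star K = K := by
    simp only [K, householder]
    rw [star_sub, star_one, star_smul_mat, star_eq_conjTranspose, conjTranspose_mul,
      conjTranspose_conjTranspose]
  have hKe : e * K = e := by
    simp only [K, householder]
    rw [Matrix.mul_sub, Matrix.mul_one, Matrix.mul_smul, ← Matrix.mul_assoc, heF, Matrix.zero_mul,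
      smul_zero, sub_zero]
  have hKf : f * K = -y := by
    simp only [K, householder]
    rw [Matrix.mul_sub, Matrix.mul_one, Matrix.mul_smul, ← Matrix.mul_assoc, hfF, Matrix.smul_mul,
      Matrix.one_mul, smul_smul, one_div_mul_cancel hr', one_smul]
    abel
  have hKe' : K * eᴴ = eᴴ := by
    have := congrArg conjTranspose hKe
    rwa [conjTranspose_mul, ← star_eq_conjTranspose K, hK] at this
  have hKf' : K * fᴴ = -yᴴ := by
    have := congrArg conjTranspose hKf
    rwa [conjTranspose_mul, ← star_eq_conjTranspose K, hK, conjTranspose_neg] at this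
  refine ⟨hK, ?_, ?_⟩
  · have h1 : (f + y)ᴴ * (f + y) * ((f + y)ᴴ * (f + y)) =
        (2 * (1 + r)) • ((f + y)ᴴ * (f + y)) := by
      rw [Matrix.mul_assoc, ← Matrix.mul_assoc (f + y), hFF, Matrix.smul_mul, Matrix.one_mul,
        Matrix.mul_smul]
    simp only [K, householder]
    rw [Matrix.sub_mul, Matrix.one_mul, Matrix.mul_sub, Matrix.mul_one, smul_mul_smul_comm, h1,
      smul_smul]
    have : 1 / (1 + r) * (1 / (1 + r)) * (2 * (1 + r)) = 2 * (1 / (1 + r)) := by field_simp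
    rw [this]
    module
  · rw [Matrix.mul_sub, Matrix.sub_mul, ← Matrix.mul_assoc, hKe', Matrix.mul_assoc, hKf,
      ← Matrix.mul_assoc K, hKf', Matrix.mul_assoc _ e, hKe]
    simp only [Matrix.mul_neg, Matrix.neg_mul]
    abel

theorem herm_self (b : Fin m → ℍ) : herm b b = ((∑ j, Quaternion.normSq (b j) : ℝ) : ℍ) := by
  simp only [herm, Quaternion.self_mul_star]
  exact (map_sum (algebraMap ℝ ℍ) _ _).symm

theorem coe_smul_one (r : ℝ) : (r : ℍ) = r • (1 : ℍ) := by
  rw [← Quaternion.coe_mul_eq_smul, mul_one]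

theorem rowMat_mul (x y : Fin (m + 2) → ℍ) :
    rowMat x * (rowMat y)ᴴ = Matrix.of fun _ _ => ∑ k, x k * star (y k) := by
  ext1 i j
  simp [rowMat, Matrix.mul_apply]

theorem rowMat_qm (a : ℍ) (b : Fin m → ℍ) :
    (rowMat (Pi.single 0 1))ᴴ * rowMat (Fin.cons 0 (Fin.cons a b)) -
      (rowMat (Fin.cons 0 (Fin.cons a b)))ᴴ * rowMat (Pi.single 0 1) = qm a b := by
  have h1 : ∀ j : Fin m, (j.succ.succ : Fin (m + 2)) ≠ 0 := fun j => Fin.succ_ne_zero _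
  have h10 : (1 : Fin (m + 2)) ≠ 0 := by simp
  have c0 : (Fin.cons 0 (Fin.cons a b) : Fin (m + 2) → ℍ) 0 = 0 := rfl
  have c1 : (Fin.cons 0 (Fin.cons a b) : Fin (m + 2) → ℍ) 1 = a := rfl
  have c2 : ∀ j : Fin m, (Fin.cons 0 (Fin.cons a b) : Fin (m + 2) → ℍ) j.succ.succ = b j :=
    fun j => rfl
  obtain ⟨q1, q2, q3, q4, q5, q6, q7, q8, q9⟩ := blk_apply 0 a (-star a) 0 b 0
    (fun j => -star (b j)) 0 (0 : Matrix (Fin m) (Fin m) ℍ)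
  apply ext_blk <;> intros <;>
    simp only [qm, q1, q2, q3, q4, q5, q6, q7, q8, q9] <;>
    simp [rowMat, Matrix.mul_apply, Pi.single_apply, h1, h10, c0, c1, c2]

/-- `diag(α, 1, …, 1)`. -/
def phase (α : ℍ) : Mat m := blk α 0 0 1 0 0 0 0 1

theorem phase_mul_star {α : ℍ} (h : α * star α = 1) : (phase α : Mat m) * star (phase α) = 1 := by
  rw [phase, blk_star, blk_mul, eq_blk (1 : Mat m)]
  have h1 : ∀ j : Fin m, (j.succ.succ : Fin (m + 2)) ≠ 0 := fun j => Fin.succ_ne_zero _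
  have h2 : ∀ j : Fin m, (j.succ.succ : Fin (m + 2)) ≠ 1 := fun j => by
    rw [← Fin.succ_zero_eq_one]; exact fun e => Fin.succ_ne_zero _ (Fin.succ_injective _ e)
  congr 1 <;> simp [h, funext_iff, h1, h2, (h1 _).symm, (h2 _).symm]
  intro i j
  by_cases h : i = j <;> simp [Matrix.one_apply, Fin.succ_inj, eq_comm, h]

theorem conj_phase (α a : ℍ) (b : Fin m → ℍ) :
    phase α * qm a b * star (phase α) = qm (α * a) fun j => α * b j := by
  rw [phase, qm, qm, blk_star, blk_mul, blk_mul]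
  congr 1 <;> simp [funext_iff, Matrix.one_apply]
  · intro x
    rw [Finset.sum_eq_single x (fun k _ hk => by simp [hk.symm]) (by simp)]
    simp
  · rfl

/-- Polar form, with phase 1 at a = 0. Removing the phase makes the first entry real and
nonnegative, as `householder_spec` demands. -/
theorem exists_phase (a : ℍ) : ∃ (α : ℍ) (r : ℝ), 0 ≤ r ∧ α * star α = 1 ∧ star α * α = 1 ∧
    star α * a = (r : ℍ) := by
  have h1 : ∀ q : ℍ, ‖q‖ = 1 → q * star q = 1 ∧ star q * q = 1 := fun q hq => by
    rw [Quaternion.self_mul_star, Quaternion.star_mul_self, Quaternion.normSq_eq_norm_mul_self, hq]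
    simp
  rcases eq_or_ne a 0 with rfl | ha
  · exact ⟨1, 0, le_rfl, by simp, by simp, by simp⟩
  · have hn : ‖a‖ ≠ 0 := norm_ne_zero_iff.2 ha
    obtain ⟨h2, h3⟩ := h1 (‖a‖⁻¹ • a) (by rw [norm_smul, norm_inv, norm_norm, inv_mul_cancel₀ hn])
    refine ⟨‖a‖⁻¹ • a, ‖a‖, norm_nonneg _, h2, h3, ?_⟩
    rw [Quaternion.star_smul, smul_mul_assoc, Quaternion.star_mul_self,
      Quaternion.normSq_eq_norm_mul_self, ← Quaternion.coe_smul, smul_eq_mul,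
      inv_mul_cancel_left₀ hn]

theorem mem_unitary_of_mul_star {X : Mat m} (h : X * star X = 1) : X ∈ unitary (Mat m) :=
  Unitary.mem_iff.2 ⟨mul_eq_one_symm h, h⟩

/-- The isotropy group acts transitively on unit vectors in `𝔪`. -/
theorem exists_isotropy_of_unit {a : ℍ} {b : Fin m → ℍ} (h : (a * star a + herm b b).re = 1) :
    ∃ g ∈ isotropy m, qm a b = conj g (qm 1 0) := by
  obtain ⟨α, r, hr, hα, hα', ha⟩ := exists_phase a
  set b' : Fin m → ℍ := fun j => star α * b j with hb'
  set D : UGroup m := ⟨phase α, mem_unitary_of_mul_star (phase_mul_star hα)⟩ with hD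
  have hDq : qm a b = conj D (qm (r : ℍ) b') := by
    rw [conj_apply]
    change _ = phase α * _ * star (phase α)
    rw [conj_phase, ← ha, hb']
    simp only [← mul_assoc, hα, one_mul]
  set y := rowMat (Fin.cons 0 (Fin.cons (r : ℍ) b') : Fin (m + 2) → ℍ) with hy
  set e := rowMat (Pi.single 0 1 : Fin (m + 2) → ℍ) with he
  set f := rowMat (Fin.cons 0 (Fin.cons 1 0) : Fin (m + 2) → ℍ) with hf
  have hnorm : (r : ℍ) * star (r : ℍ) + herm b' b' = 1 := by
    have e1 : herm b' b' = star α * herm b b * α := by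
      simp only [herm, hb', Finset.mul_sum, Finset.sum_mul, StarMul.star_mul, star_star, mul_assoc]
    have e2 : (r : ℍ) * star (r : ℍ) = star α * (a * star a) * α := by
      rw [← ha, StarMul.star_mul, star_star]; simp only [mul_assoc]
    have e3 : a * star a + herm b b = 1 := by
      rw [herm_self, Quaternion.self_mul_star, ← Quaternion.coe_add] at h ⊢
      rw [Quaternion.re_coe] at h
      rw [h]; rfl
    rw [e1, e2, ← add_mul, ← mul_add, e3, mul_one, hα']
  have hyy : y * yᴴ = 1 := by
    rw [hy, rowMat_mul]
    ext1 i j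
    rw [Subsingleton.elim j i, Matrix.one_apply_eq, Matrix.of_apply, Fin.sum_univ_succ,
      Fin.sum_univ_succ]
    simpa [herm] using hnorm
  have hff : f * fᴴ = 1 := by
    rw [hf, rowMat_mul]
    ext1 i j
    rw [Subsingleton.elim j i, Matrix.one_apply_eq, Matrix.of_apply, Fin.sum_univ_succ,
      Fin.sum_univ_succ]
    simp
  have hfy : f * yᴴ = r • 1 := by
    rw [hf, hy, rowMat_mul]
    ext1 i j
    rw [Subsingleton.elim j i, Matrix.smul_apply, Matrix.one_apply_eq, Matrix.of_apply,
      Fin.sum_univ_succ, Fin.sum_univ_succ, ← coe_smul_one]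
    simp
  have hyf : y * fᴴ = r • 1 := by
    rw [hf, hy, rowMat_mul]
    ext1 i j
    rw [Subsingleton.elim j i, Matrix.smul_apply, Matrix.one_apply_eq, Matrix.of_apply,
      Fin.sum_univ_succ, Fin.sum_univ_succ, ← coe_smul_one]
    simp
  have hef : e * fᴴ = 0 := by
    rw [he, hf, rowMat_mul]
    ext1 i j
    rw [Matrix.of_apply, Fin.sum_univ_succ]
    simp
  have hey : e * yᴴ = 0 := by
    rw [he, hy, rowMat_mul]
    ext1 i j
    rw [Matrix.of_apply, Fin.sum_univ_succ]
    simp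
  obtain ⟨k1, k2, k3⟩ := householder_spec hr hff hyy hfy hyf hef hey
  rw [rowMat_qm, rowMat_qm] at k3
  set K : UGroup m := ⟨householder (1 / (1 + r)) (f + y),
    mem_unitary_of_mul_star (by rw [k1, k2])⟩ with hK
  -- K maps the base vector to −(r, b′); S acts as −1 on 𝔪 and cancels this sign.
  set S : UGroup m := ⟨symmS m, mem_unitary_of_mul_star (by rw [star_symmS, symmS_sq])⟩ with hS
  have hKq : qm (r : ℍ) b' = conj K (conj S (qm 1 0)) := by
    have e1 : conj S (qm 1 0) = -qm 1 0 := by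
      rw [conj_apply]
      change symmS m * _ * star (symmS m) = _
      rw [star_symmS, symmS_eq, qS_qm]
    rw [e1, map_neg, conj_apply]
    change _ = -(householder (1 / (1 + r)) (f + y) * _ * star (householder (1 / (1 + r)) (f + y)))
    rw [k1, k3, neg_neg]
  refine ⟨D * (K * S), mul_mem ?_ (mul_mem ?_ ?_), by rw [conj_mul, conj_mul, ← hKq, hDq]⟩
  · apply mem_isotropy_of_comm
    change phase α * symmS m = symmS m * phase α
    rw [symmS_eq, phase, qS, blk_mul, blk_mul]
    congr 1 <;> simp [funext_iff, Matrix.one_apply]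
  · intro j hj
    have hFj : (f + y) 0 0 = 0 := by simp [hf, hy, rowMat]
    have e1 : ∀ i j, (householder (1 / (1 + r)) (f + y) : Mat m) i j =
        (1 : Mat m) i j - (1 / (1 + r)) • (star ((f + y) 0 i) * (f + y) 0 j) := fun i j => by
      simp [householder, Matrix.mul_apply]
    change householder (1 / (1 + r)) (f + y) 0 j = 0 ∧ householder (1 / (1 + r)) (f + y) j 0 = 0
    rw [e1, e1, hFj, Matrix.one_apply_ne hj, Matrix.one_apply_ne hj.symm]
    simp
  · exact mem_isotropy_of_comm rfl

theorem chi_pos : 0 < chi m := by rw [chi]; positivity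

theorem sqrt_chi_pos : 0 < √(chi m) := Real.sqrt_pos.2 chi_pos

/-- The metric on 𝔪 is χ times the standard one, so scaling by √χ reduces to transitivity of the
isotropy group on standard unit vectors. In particular √χ γ_x is conjugate to E at each point of a
unit-speed curve. -/
theorem exists_frame_of_unit {p : HP m} {T : Mat m} (hT : IsTangent p T) (h1 : metric T T = 1) :
    ∃ g : UGroup m, p = (g : HP m) ∧ T = conj g ((1 / √(chi m)) • qm 1 0) := by
  induction p using QuotientGroup.induction_on with
  | H k =>
    obtain ⟨a, b, rfl⟩ := isTangent_mk.1 hT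
    rw [metric_conj, metric_qm] at h1
    have hc := sqrt_chi_pos (m := m)
    have hs : √(chi m) * √(chi m) = chi m := Real.mul_self_sqrt chi_pos.le
    obtain ⟨g, hg, hgq⟩ := exists_isotropy_of_unit (m := m) (a := √(chi m) • a)
      (b := fun j => √(chi m) • b j) (by
        have e1 : herm (fun j => √(chi m) • b j) (fun j => √(chi m) • b j) =
            (√(chi m) * √(chi m)) • herm b b := by
          simp only [herm, Quaternion.star_smul, smul_mul_smul_comm, Finset.smul_sum]
        rw [e1, Quaternion.star_smul, smul_mul_smul_comm, ← smul_add, hs, Quaternion.re_smul,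
          smul_eq_mul, h1])
    refine ⟨k * g, ?_, ?_⟩
    · rw [eq_comm, QuotientGroup.mk_mul_of_mem k hg]
    · rw [conj_mul, map_smul, ← hgq, ← qm_smul, smul_smul, one_div_mul_cancel hc.ne', one_smul]

end Transitivity

/-! ### Parallel frames along flows -/

section Frames

open Set Filter Topology

variable {m : ℕ}

theorem mPart_qm_add_qh (r : ℝ) (a : ℍ) (b : Fin m → ℍ) (w : ℍ) (z : Fin m → ℍ) :
    mPart (r • qm a b + qh w z) = r • qm a b ∧ hPart (r • qm a b + qh w z) = qh w z := by
  rw [mPart, hPart, symmS_eq, mul_add, add_mul, mul_smul_comm, smul_mul_assoc, qS_qm, qS_qh]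
  constructor
  · rw [show r • qm a b + qh w z - (r • -qm a b + qh w z) = r • qm a b + r • qm a b by
      rw [smul_neg]; abel, half_smul_add_self]
  · rw [show r • qm a b + qh w z + (r • -qm a b + qh w z) = qh w z + qh w z by
      rw [smul_neg]; abel, half_smul_add_self]

theorem mPart_add_hPart (X : Mat m) : mPart X + hPart X = X := by
  rw [mPart, hPart, ← smul_add, show X - symmS m * X * symmS m + (X + symmS m * X * symmS m) = X + X
    by abel, half_smul_add_self]

theorem star_comm_of_skew {A : Type*} [Ring A] [StarRing A] {x y : A} (hx : star x = -x)
    (hy : star y = -y) : star (x * y - y * x) = -(x * y - y * x) := by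
  rw [star_sub, star_mul, star_mul, hx, hy]
  noncomm_ring

theorem star_adInvPot {x y : Mat m} (hx : star x = -x) (hy : star y = -y) :
    star (adInvPot x y) = -adInvPot x y := by
  rw [adInvPot, star_sub, star_smul_mat, star_smul_mat,
    star_comm_of_skew hx (star_comm_of_skew hx hy), hy]
  simp only [smul_neg]
  abel

theorem adInv_neg_neg {A : Type*} [Ring A] [Algebra ℝ A] (x y : A) :
    adInv (-x) (-y) = adInv x y ∧ adInvPot (-x) (-y) = -adInvPot x y := by
  constructor
  · simp only [adInv, neg_mul, mul_neg, neg_neg, neg_sub, sub_neg_eq_add]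
    congr 2
    noncomm_ring
  · simp only [adInvPot, neg_mul, mul_neg, neg_neg, neg_sub, sub_neg_eq_add, smul_neg]
    module

/-- The geodesic symmetry as a unitary matrix. -/
def reflU (p : HP m) : UGroup m :=
  ⟨reflection p, mem_unitary_of_mul_star (by rw [star_reflection, reflection_sq])⟩

theorem conj_reflU (p : HP m) (X : Mat m) :
    conj (reflU p) X = reflection p * X * reflection p := by
  rw [conj_apply]
  change reflection p * X * star (reflection p) = _
  rw [star_reflection]

/-- `adInvPot` has odd total degree in its two arguments, and conjugation by the reflection negates
both. -/
theorem isTangent_adInvPot {p : HP m} {x y : Mat m} (hx : IsTangent p x) (hy : IsTangent p y) :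
    IsTangent p (adInvPot x y) := by
  refine ⟨star_adInvPot hx.1 hy.1, ?_⟩
  have e : ∀ w z : Mat m, conj (reflU p) (adInvPot w z) =
      adInvPot (conj (reflU p) w) (conj (reflU p) z) := fun w z => by
    simp only [adInvPot, map_sub, map_smul, map_mul]
  rw [← conj_reflU, e, conj_reflU, conj_reflU, hx.2, hy.2, (adInv_neg_neg _ _).2]

theorem IsTangent.comm_even {p : HP m} {x y : Mat m} (hx : IsTangent p x) (hy : IsTangent p y) :
    reflection p * (x * y - y * x) = (x * y - y * x) * reflection p := by
  have h1 := hx.mul_comm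
  have h2 := hy.mul_comm
  rw [mul_sub, sub_mul, ← mul_assoc, h1, ← mul_assoc, h2, neg_mul, neg_mul, mul_assoc x,
      h2, mul_assoc y, h1, mul_assoc x, mul_assoc y]
  simp

theorem IsTangent.smul {p : HP m} {x : Mat m} (hx : IsTangent p x) (r : ℝ) :
    IsTangent p (r • x) :=
  ⟨by rw [star_smul_mat, hx.1, smul_neg], by rw [mul_smul_comm, smul_mul_assoc, hx.2, smul_neg]⟩

variable {I J : Set ℝ}

theorem Smooth2.entry {A : ℝ → ℝ → Mat m} (hA : Smooth2 I J A) (i j : Fin (m + 2)) :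
    Smooth2 I J fun t x => A t x i j :=
  (LinearMap.toContinuousLinearMap (Matrix.entryLinearMap ℝ ℍ i j)).contDiff.comp_contDiffOn hA

theorem smooth2_pi {ι F : Type*} [Fintype ι] [NormedAddCommGroup F] [NormedSpace ℝ F]
    {v : ℝ → ℝ → ι → F} (h : ∀ j, Smooth2 I J fun t x => v t x j) : Smooth2 I J v :=
  contDiffOn_pi.2 h

/-- Conjugation-invariants of a linear system are constant. -/
theorem conj_const (hI : IsOpenInterval I) (hJ : IsOpenInterval J) {M N φ X : ℝ → ℝ → Mat m}
    (hM : ∀ t ∈ I, ∀ x ∈ J, star (M t x) = -M t x) (hN : ∀ t ∈ I, ∀ x ∈ J, star (N t x) = -N t x)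
    (hφt : ∀ t ∈ I, ∀ x ∈ J, HasDerivAt (fun s => φ s x) (N t x * φ t x) t)
    (hφx : ∀ t ∈ I, ∀ x ∈ J, HasDerivAt (φ t) (M t x * φ t x) x)
    (hXt : ∀ t ∈ I, ∀ x ∈ J, HasDerivAt (fun s => X s x) (N t x * X t x - X t x * N t x) t)
    (hXx : ∀ t ∈ I, ∀ x ∈ J, HasDerivAt (X t) (M t x * X t x - X t x * M t x) x)
    {t₀ x₀ t x : ℝ} (ht₀ : t₀ ∈ I) (hx₀ : x₀ ∈ J) (ht : t ∈ I) (hx : x ∈ J) :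
    star (φ t x) * X t x * φ t x = star (φ t₀ x₀) * X t₀ x₀ * φ t₀ x₀ := by
  have key : ∀ {f g : ℝ → Mat m} {K : Mat m} {s : ℝ}, star K = -K → HasDerivAt f (K * f s) s →
      HasDerivAt g (K * g s - g s * K) s →
      HasDerivAt (fun r => star (f r) * g r * f r) 0 s := fun {f g K s} hK hf hg => by
    have h := hasDerivAt_mul (hasDerivAt_mul (hasDerivAt_star hf) hg) hf
    convert h using 1
    rw [star_mul, hK]
    noncomm_ring
  rw [hJ.eq_of_hasDerivAt_zero (f := fun y => star (φ t y) * X t y * φ t y)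
    (fun y hy => key (hM t ht y hy) (hφx t ht y hy) (hXx t ht y hy)) hx hx₀]
  exact hI.eq_of_hasDerivAt_zero (f := fun s => star (φ s x₀) * X s x₀ * φ s x₀)
    (fun s hs => key (hN s hs x₀ hx₀) (hφt s hs x₀ hx₀) (hXt s hs x₀ hx₀)) ht ht₀

/-- Compatible linear systems whose coefficients act through a bilinear map. -/
theorem exists_compatible_bilinear {E : Type*} [NormedAddCommGroup E] [NormedSpace ℝ E]
    [FiniteDimensional ℝ E] (μ : E →ₗ[ℝ] E →ₗ[ℝ] E) (hI : IsOpenInterval I) (hJ : IsOpenInterval J)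
    {M N : ℝ → ℝ → E} (hM : Smooth2 I J M) (hN : Smooth2 I J N)
    (hz : ∀ t ∈ I, ∀ x ∈ J, ∀ y, μ (deriv (fun s => M s x) t) y + μ (M t x) (μ (N t x) y) =
      μ (deriv (N t) x) y + μ (N t x) (μ (M t x) y)) {t₀ x₀ : ℝ} (ht₀ : t₀ ∈ I) (hx₀ : x₀ ∈ J)
    (y₀ : E) :
    ∃ φ : ℝ → ℝ → E, φ t₀ x₀ = y₀ ∧ Smooth2 I J φ ∧
      (∀ t ∈ I, ∀ x ∈ J, HasDerivAt (fun s => φ s x) (μ (N t x) (φ t x)) t) ∧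
      ∀ t ∈ I, ∀ x ∈ J, HasDerivAt (φ t) (μ (M t x) (φ t x)) x := by
  have : CompleteSpace E := FiniteDimensional.complete ℝ E
  let L : E →L[ℝ] E →L[ℝ] E := LinearMap.toContinuousLinearMap
    ((LinearMap.toContinuousLinearMap : (E →ₗ[ℝ] E) ≃ₗ[ℝ] _).toLinearMap ∘ₗ μ)
  have hL : ∀ {f : ℝ → E} {f' : E} {s : ℝ}, HasDerivAt f f' s →
      deriv (fun r => L (f r)) s = L f' := fun hf => (L.hasFDerivAt.comp_hasDerivAt _ hf).deriv
  obtain ⟨φ, h⟩ := exists_compatible_system hI hJ (A := fun t x => L (M t x))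
    (B := fun t x => L (N t x)) (ContDiff.comp_contDiffOn L.contDiff hM)
    (ContDiff.comp_contDiffOn L.contDiff hN) (fun t ht x hx => by
      rw [hL (hM.hasDerivAt_fst hI.1 hJ.1 ht hx), hL (hN.hasDerivAt_snd hI.1 hJ.1 ht hx)]
      ext1 y
      exact hz t ht x hx y) ht₀ hx₀ y₀
  exact ⟨φ, h⟩

/-- The hypothesis is T_xt = T_tx for T_x = [M, T] and T_t = [N, T]; the Jacobi identity turns it
into the statement that the curvature commutes with T. -/
theorem comm_jacobi {A : Type*} [Ring A] {M N T M' N' : A}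
    (h : M' * T + M * (N * T - T * N) - ((N * T - T * N) * M + T * M') =
      N' * T + N * (M * T - T * M) - ((M * T - T * M) * N + T * N')) :
    T * (M' - N' + (M * N - N * M)) - (M' - N' + (M * N - N * M)) * T = 0 := by
  rw [← sub_eq_zero] at h
  rw [← neg_eq_zero, ← h]
  noncomm_ring

set_option maxHeartbeats 1000000 in
/-- Existence of a moving frame with prescribed time evolution. -/
theorem exists_flow_frame (hI : IsOpenInterval I) (hJ : IsOpenInterval J) {γ : ℝ → ℝ → HP m}
    (hγ : IsNonStretching γ I J) {N : ℝ → ℝ → Mat m} (hN : Smooth2 I J N)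
    (hNs : ∀ t ∈ I, ∀ x ∈ J, star (N t x) = -N t x)
    (hRt : ∀ t ∈ I, ∀ x ∈ J, HasDerivAt (fun s => reflection (γ s x))
      (N t x * reflection (γ t x) - reflection (γ t x) * N t x) t)
    (hTt : ∀ t ∈ I, ∀ x ∈ J, HasDerivAt (fun s => velocity (γ s) x)
      (N t x * velocity (γ t) x - velocity (γ t) x * N t x) t)
    (hNx : ∀ t ∈ I, ∀ x ∈ J, ∃ W, deriv (N t) x = velocity (γ t) x * W - W * velocity (γ t) x) :
    ∃ ψ u v, IsParallelFlowFrame γ I J ψ u v ∧ Smooth2 I J u ∧ Smooth2 I J v ∧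
      ∀ t ∈ I, ∀ x ∈ J, HasDerivAt (fun s => (ψ s x : Mat m)) (N t x * ψ t x) t := by
  have hR : Smooth2 I J fun t x => reflection (γ t x) := hγ.1
  obtain ⟨t₀, ht₀⟩ := hI.2.2
  obtain ⟨x₀, hx₀⟩ := hJ.2.2
  have hc := sqrt_chi_pos (m := m)
  set T : ℝ → ℝ → Mat m := fun t => velocity (γ t) with hTdef
  have hT : Smooth2 I J T := smooth2_velocity_snd hI.1 hJ.1 hR
  have hRd : ∀ t ∈ I, ∀ x ∈ J, DifferentiableAt ℝ (fun r => reflection (γ t r)) x :=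
    fun t ht x hx => (hR.hasDerivAt_snd hI.1 hJ.1 ht hx).differentiableAt
  have hTtan : ∀ t ∈ I, ∀ x ∈ J, IsTangent (γ t x) (T t x) := fun t ht x hx =>
    (velocity_spec (hRd t ht x hx)).1
  set z : ℝ → ℝ → Mat m := fun t x => √(chi m) • T t x with hzdef
  have hz : Smooth2 I J z := hT.const_smul _
  -- z is conjugate to E at every point and inherits E³ = −E.
  have hz3 : ∀ t ∈ I, ∀ x ∈ J, z t x * z t x * z t x = -z t x := fun t ht x hx => by
    obtain ⟨g, -, hg⟩ := exists_frame_of_unit (hTtan t ht x hx) (hγ.2 t ht x hx)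
    have : z t x = conj g (qm 1 0) := by
      simp only [hzdef, hg, map_smul, smul_smul]
      rw [mul_one_div_cancel hc.ne', one_smul]
    rw [this, ← map_mul, ← map_mul, E_cube, map_neg]
  set y : ℝ → ℝ → Mat m := fun t x => deriv (z t) x with hydef
  have hy : Smooth2 I J y := hz.deriv_snd hI.1 hJ.1
  have hzx : ∀ t ∈ I, ∀ x ∈ J, HasDerivAt (z t) (y t x) x := fun t ht x hx =>
    hz.hasDerivAt_snd hI.1 hJ.1 ht hx
  have hTx : ∀ t ∈ I, ∀ x ∈ J, HasDerivAt (T t) ((1 / √(chi m)) • y t x) x := fun t ht x hx => by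
    have h := (hzx t ht x hx).const_smul (1 / √(chi m))
    refine h.congr_of_eventuallyEq (Eventually.of_forall fun r => ?_)
    simp only [hzdef, Pi.smul_apply, smul_smul, one_div_mul_cancel hc.ne', one_smul]
  have hycub : ∀ t ∈ I, ∀ x ∈ J, y t x * z t x * z t x + z t x * y t x * z t x +
      z t x * z t x * y t x + y t x = 0 := fun t ht x hx => by
    have h1 := (hasDerivAt_mul (hasDerivAt_mul (hzx t ht x hx) (hzx t ht x hx)) (hzx t ht x hx)).add
      (hzx t ht x hx)
    have h2 : ((fun r => z t r * z t r * z t r) + z t) =ᶠ[𝓝 x] fun _ => 0 := by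
      filter_upwards [hJ.1.mem_nhds hx] with r hr
      rw [Pi.add_apply, hz3 t ht r hr, neg_add_cancel]
    have h3 := h1.unique ((hasDerivAt_const x (0 : Mat m)).congr_of_eventuallyEq h2)
    rw [← h3, add_mul]
  have hytan : ∀ t ∈ I, ∀ x ∈ J, IsTangent (γ t x) (y t x) := fun t ht x hx => by
    have h1 := hTx t ht x hx
    obtain ⟨h2, h3⟩ := covDeriv_eq (hRd t ht x hx) h1 (by
      filter_upwards [hJ.1.mem_nhds hx] with r hr using hTtan t ht r hr)
    rw [h3, sub_self, sub_zero] at h2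
    have := h2.smul (√(chi m))
    rwa [smul_smul, mul_one_div_cancel hc.ne', one_smul] at this
  have hztan : ∀ t ∈ I, ∀ x ∈ J, IsTangent (γ t x) (z t x) := fun t ht x hx =>
    (hTtan t ht x hx).smul _
  -- In a frame with z = E, the bracket Ω = [z, P] lies in [E, 𝔪] = 𝔥_⊥. This is what makes the
  -- resulting frame parallel.
  set P : ℝ → ℝ → Mat m := fun t x => adInvPot (z t x) (y t x) with hPdef
  have hP : Smooth2 I J P := hz.adInvPot hy
  have hPtan : ∀ t ∈ I, ∀ x ∈ J, IsTangent (γ t x) (P t x) := fun t ht x hx =>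
    isTangent_adInvPot (hztan t ht x hx) (hytan t ht x hx)
  set Ω : ℝ → ℝ → Mat m := fun t x => z t x * P t x - P t x * z t x with hΩdef
  have hΩ : Smooth2 I J Ω := (hz.mul hP).sub (hP.mul hz)
  have hΩz : ∀ t ∈ I, ∀ x ∈ J, z t x * Ω t x - Ω t x * z t x = y t x := fun t ht x hx => by
    have := ad_adInv_of_cubic (hz3 t ht x hx) (hycub t ht x hx)
    rwa [adInv_eq_comm] at this
  -- Ω is even, so T − Ω moves the reflection exactly as T does, while [T − Ω, T] = [T, Ω] = T_x.
  set M : ℝ → ℝ → Mat m := fun t x => T t x - Ω t x with hMdef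
  have hM : Smooth2 I J M := hT.sub hΩ
  have hMs : ∀ t ∈ I, ∀ x ∈ J, star (M t x) = -M t x := fun t ht x hx => by
    simp only [hMdef, hΩdef]
    rw [star_sub, star_comm_of_skew (hztan t ht x hx).1 (hPtan t ht x hx).1, (hTtan t ht x hx).1]
    abel
  have hRx : ∀ t ∈ I, ∀ x ∈ J, HasDerivAt (fun r => reflection (γ t r))
      (M t x * reflection (γ t x) - reflection (γ t x) * M t x) x := fun t ht x hx => by
    have h1 := (velocity_spec (hRd t ht x hx)).2
    have h2 := (hztan t ht x hx).comm_even (hPtan t ht x hx)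
    have h3 : M t x * reflection (γ t x) - reflection (γ t x) * M t x =
        velocity (γ t) x * reflection (γ t x) - reflection (γ t x) * velocity (γ t) x := by
      simp only [hMdef, hΩdef, sub_mul, mul_sub] at h2 ⊢
      rw [h2]
      abel
    rw [h3]
    exact h1
  have hTx' : ∀ t ∈ I, ∀ x ∈ J, HasDerivAt (T t) (M t x * T t x - T t x * M t x) x :=
      fun t ht x hx => by
    have h1 := hTx t ht x hx
    have h2 : M t x * T t x - T t x * M t x = (1 / √(chi m)) • y t x := by
      rw [← hΩz t ht x hx]
      simp only [hMdef, hzdef, smul_mul_assoc, mul_smul_comm, ← smul_sub, smul_smul,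
        one_div_mul_cancel hc.ne', one_smul]
      noncomm_ring
    rw [h2]
    exact h1
  -- The curvature commutes with T because the mixed partials of T agree, and it lies in the image
  -- of ad z: M_t − [N, M] is, as z evolves by [N, z] and Ω = [z, P], and N_x is by hypothesis.
  -- Semisimplicity of ad z makes it vanish.
  have hflat : ∀ t ∈ I, ∀ x ∈ J, deriv (fun s => M s x) t - deriv (N t) x +
      (M t x * N t x - N t x * M t x) = 0 := fun t ht x hx => by
    have hMt := hM.hasDerivAt_fst hI.1 hJ.1 ht hx
    have hNx' := hN.hasDerivAt_snd hI.1 hJ.1 ht hx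
    have hzt : HasDerivAt (fun s => z s x) (N t x * z t x - z t x * N t x) t := by
      have e : N t x * z t x - z t x * N t x =
          √(chi m) • (N t x * velocity (γ t) x - velocity (γ t) x * N t x) := by
        simp only [hzdef, hTdef, smul_sub, smul_mul_assoc, mul_smul_comm]
      rw [e]
      exact (hTt t ht x hx).const_smul (√(chi m))
    have hPt := hP.hasDerivAt_fst hI.1 hJ.1 ht hx
    have hMt' := hMt.unique ((hTt t ht x hx).sub ((hasDerivAt_mul hzt hPt).sub
      (hasDerivAt_mul hPt hzt)))
    obtain ⟨W, hW⟩ := hNx t ht x hx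
    set M' := deriv (fun s => M s x) t
    set N' := deriv (N t) x
    set P' := deriv (fun s => P s x) t
    have h1 : T t x * (M' - N' + (M t x * N t x - N t x * M t x)) -
        (M' - N' + (M t x * N t x - N t x * M t x)) * T t x = 0 := by
      have e0 := hT.deriv_comm hI.1 hJ.1 ht hx
      have f1 : (fun s => deriv (T s) x) =ᶠ[𝓝 t] fun s => M s x * T s x - T s x * M s x := by
        filter_upwards [hI.1.mem_nhds ht] with s hs using (hTx' s hs x hx).deriv
      have f2 : (fun r => deriv (fun s => T s r) t) =ᶠ[𝓝 x]
          fun r => N t r * T t r - T t r * N t r := by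
        filter_upwards [hJ.1.mem_nhds hx] with r hr using (hTt t ht r hr).deriv
      have g1 := ((hasDerivAt_mul hMt (hTt t ht x hx)).sub
        (hasDerivAt_mul (hTt t ht x hx) hMt)).congr_of_eventuallyEq f1
      have g2 := ((hasDerivAt_mul hNx' (hTx' t ht x hx)).sub
        (hasDerivAt_mul (hTx' t ht x hx) hNx')).congr_of_eventuallyEq f2
      exact comm_jacobi (g1.deriv.symm.trans (e0.trans g2.deriv))
    have h2 : M' - N' + (M t x * N t x - N t x * M t x) =
        z t x * (-(P' - (N t x * P t x - P t x * N t x)) - (1 / √(chi m)) • W) -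
        (-(P' - (N t x * P t x - P t x * N t x)) - (1 / √(chi m)) • W) * z t x := by
      have e1 : T t x * W - W * T t x =
          z t x * ((1 / √(chi m)) • W) - ((1 / √(chi m)) • W) * z t x := by
        simp only [hzdef, smul_mul_assoc, mul_smul_comm, smul_smul, one_div_mul_cancel hc.ne',
          mul_one_div_cancel hc.ne', one_smul]
      have hW' : N' = T t x * W - W * T t x := hW
      have hM' : M' = N t x * T t x - T t x * N t x - ((N t x * z t x - z t x * N t x) * P t x +
          z t x * P' - (P' * z t x + P t x * (N t x * z t x - z t x * N t x))) := hMt'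
      rw [hM', hW', e1]
      simp only [hMdef, hΩdef, hTdef]
      noncomm_ring
    rw [h2]
    refine ad_eq_zero_of_ad_ad (hz3 t ht x hx) ?_
    rw [← h2]
    have : ∀ F : Mat m, z t x * F - F * z t x = √(chi m) • (T t x * F - F * T t x) := fun F => by
      simp only [hzdef, smul_mul_assoc, mul_smul_comm, smul_sub]
    rw [this, h1, smul_zero]
  obtain ⟨g₀, hg₀, hTg₀⟩ := exists_frame_of_unit (hTtan t₀ ht₀ x₀ hx₀) (hγ.2 t₀ ht₀ x₀ hx₀)
  obtain ⟨φ, hφ₀, hφ, hφt, hφx⟩ := exists_compatible_bilinear (LinearMap.mul ℝ (Mat m)) hI hJ hM hN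
    (fun t ht x hx X => by
      have h := hflat t ht x hx
      have h' : deriv (fun s => M s x) t + M t x * N t x = deriv (N t) x + N t x * M t x := by
        rw [← sub_eq_zero, ← h]; abel
      change deriv (fun s => M s x) t * X + M t x * (N t x * X) =
        deriv (N t) x * X + N t x * (M t x * X)
      rw [← mul_assoc, ← mul_assoc, ← add_mul, ← add_mul, h'])
    ht₀ hx₀ (g₀ : Mat m)
  simp only [LinearMap.mul_apply'] at hφt hφx
  have hφ1 : ∀ t ∈ I, ∀ x ∈ J, star (φ t x) * φ t x = 1 := fun t ht x hx => by
    have := conj_const hI hJ hMs hNs hφt hφx (X := fun _ _ => 1)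
      (fun t _ x _ => by
        rw [mul_one, one_mul, sub_self]; exact hasDerivAt_const t (1 : Mat m))
      (fun t _ x _ => by
        rw [mul_one, one_mul, sub_self]; exact hasDerivAt_const x (1 : Mat m)) ht₀ hx₀ ht hx
    simpa [hφ₀, g₀.star_mul] using this
  have hφR : ∀ t ∈ I, ∀ x ∈ J, star (φ t x) * reflection (γ t x) * φ t x = symmS m :=
      fun t ht x hx => by
    rw [conj_const hI hJ hMs hNs hφt hφx hRt hRx ht₀ hx₀ ht hx, hφ₀, hg₀, reflection_mk]
    exact coframe_conj g₀ _
  have hφT : ∀ t ∈ I, ∀ x ∈ J, star (φ t x) * T t x * φ t x = (1 / √(chi m)) • qm 1 0 :=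
      fun t ht x hx => by
    have hT₀ : velocity (γ t₀) x₀ = _ := hTg₀
    rw [conj_const hI hJ hMs hNs hφt hφx hTt hTx' ht₀ hx₀ ht hx, hφ₀, hT₀]
    exact coframe_conj g₀ _
  classical
  -- Unitarity is established on I × J only; the identity is a default value elsewhere.
  set ψ : ℝ → ℝ → UGroup m := fun t x => if h : φ t x ∈ unitary (Mat m) then ⟨φ t x, h⟩ else 1
    with hψdef
  have hψ : ∀ t ∈ I, ∀ x ∈ J, (ψ t x : Mat m) = φ t x := fun t ht x hx => by
    have h : φ t x ∈ unitary (Mat m) :=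
      Unitary.mem_iff.2 ⟨hφ1 t ht x hx, mul_eq_one_symm (hφ1 t ht x hx)⟩
    simp only [hψdef, dif_pos h]
  clear_value ψ
  set Q : ℝ → ℝ → Mat m := fun t x => star (φ t x) * M t x * φ t x with hQdef
  have hQ : Smooth2 I J Q := (hφ.star.mul hM).mul hφ
  have hQf : ∀ t ∈ I, ∀ x ∈ J, γ t x = (ψ t x : HP m) ∧ ∃ w z, star w = -w ∧
      Q t x = (1 / √(chi m)) • qm 1 0 + qh w z := fun t ht x hx => by
    have hp : γ t x = (ψ t x : HP m) := by
      apply reflection_injective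
      have h := conj_coframe (ψ t x) (reflection (γ t x))
      rw [coframe, hψ t ht x hx, hφR t ht x hx] at h
      rw [reflection_mk, h]
    refine ⟨hp, ?_⟩
    have h1 : coframe (ψ t x) (T t x) = (1 / √(chi m)) • qm 1 0 := by
      rw [coframe, hψ t ht x hx, hφT t ht x hx]
    have h2 : coframe (ψ t x) (z t x) = qm 1 0 := by
      have e : coframe (ψ t x) (z t x) = √(chi m) • coframe (ψ t x) (T t x) := by
        simp only [coframe_eq_conj, hzdef, map_smul]
      rw [e, h1, smul_smul, mul_one_div_cancel hc.ne', one_smul]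
    have hPt := hPtan t ht x hx
    rw [hp] at hPt
    obtain ⟨a, b, hab⟩ := isTangent_mk.1 hPt
    have h3 : coframe (ψ t x) (P t x) = qm a b := by rw [hab, coframe_conj]
    refine ⟨-(a - star a), b, by simp, ?_⟩
    have h4 : Q t x = coframe (ψ t x) (T t x) - (coframe (ψ t x) (z t x) * coframe (ψ t x) (P t x) -
        coframe (ψ t x) (P t x) * coframe (ψ t x) (z t x)) := by
      have : Q t x = coframe (ψ t x) (M t x) := by rw [coframe, hψ t ht x hx]
      rw [this]
      simp only [coframe_eq_conj, hMdef, hΩdef, map_sub, map_mul]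
    rw [h4, h1, h2, h3, E_qm, sub_eq_add_neg]
    congr 1
    rw [← neg_one_smul ℝ, qh_smul]
    simp
  refine ⟨ψ, fun t x => Q t x 0 0, fun t x j => Q t x 1 j.succ.succ, ⟨?_, ?_⟩, ?_, ?_, ?_⟩
  · exact hφ.congr hψ
  · intro t ht
    refine ⟨(hφ.congr hψ).right ht, fun x hx => ?_⟩
    obtain ⟨hp, w, k, hw, hQe⟩ := hQf t ht x hx
    obtain ⟨q1, -, -, -, -, q6, -, -, -⟩ := blk_apply w 0 0 (-w) 0 k 0 (fun j => -star (k j))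
      (0 : Matrix (Fin m) (Fin m) ℍ)
    obtain ⟨p1, -, -, -, -, p6, -, -, -⟩ := blk_apply 0 (1 : ℍ) (-star 1) 0 (0 : Fin m → ℍ) 0
      (fun j => -star ((0 : Fin m → ℍ) j)) 0 (0 : Matrix (Fin m) (Fin m) ℍ)
    have e0 : Q t x 0 0 = w := by
      rw [hQe, Matrix.add_apply, Matrix.smul_apply, qm, qh, q1, p1]; simp
    have e1 : (fun j : Fin m => Q t x 1 j.succ.succ) = k := by
      funext j
      rw [hQe, Matrix.add_apply, Matrix.smul_apply, qm, qh, q6, p6]; simp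
    have hmc : mcForm (ψ t) x = Q t x := by
      have : deriv (fun r => (ψ t r : Mat m)) x = M t x * φ t x := by
        have h : (fun r => (ψ t r : Mat m)) =ᶠ[𝓝 x] φ t := by
          filter_upwards [hJ.1.mem_nhds hx] with r hr using hψ t ht r hr
        exact h.deriv_eq.trans (hφx t ht x hx).deriv
      rw [mcForm, this, hψ t ht x hx, ← mul_assoc]
    obtain ⟨r1, r2⟩ := mPart_qm_add_qh (1 / √(chi m)) 1 0 w k
    refine ⟨hp, ?_, ?_, ?_⟩
    · change (Q t x 0 0).re = 0
      rw [e0]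
      have := congrArg (fun q : ℍ => q.re) hw
      simp only [Quaternion.re_star, Quaternion.re_neg] at this
      linarith
    · rw [hmc, hQe, r1, mMat_eq]
    · change hPart _ = hMat (Q t x 0 0) fun j : Fin m => Q t x 1 j.succ.succ
      rw [hmc, e0, e1, hMat_eq, hQe, r2]
  · exact hQ.entry 0 0
  · exact smooth2_pi fun j => hQ.entry 1 j.succ.succ
  · intro t ht x hx
    have h : (fun s : ℝ => (ψ s x : Mat m)) =ᶠ[𝓝 t] fun s => φ s x := by
      filter_upwards [hI.1.mem_nhds ht] with s hs using hψ s hs x hx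
    rw [hψ t ht x hx]
    exact (hφt t ht x hx).congr_of_eventuallyEq h

end Frames

/-! ### Curve operators -/

section JetAlgebra

/-- Noncommutative polynomials in the jet variables `z_k = ∇_x^k γ_x`. -/
abbrev JetAlg : Type := FreeAlgebra ℝ ℕ

/-- The algebra homomorphism `1 + ε ∇`. -/
def jetAlgLift : JetAlg →ₐ[ℝ] TrivSqZeroExt JetAlg JetAlg :=
  FreeAlgebra.lift ℝ fun k => TrivSqZeroExt.inl (FreeAlgebra.ι ℝ k) +
    TrivSqZeroExt.inr (FreeAlgebra.ι ℝ (k + 1))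

theorem fst_jetAlgLift (a : JetAlg) : (jetAlgLift a).fst = a := by
  have : (TrivSqZeroExt.fstHom ℝ JetAlg JetAlg).comp jetAlgLift = AlgHom.id ℝ JetAlg := by
    ext k
    simp [jetAlgLift]
  exact congrArg (fun f => f a) this

/-- The derivation `∇ z_k = z_{k+1}`. -/
def jetD : JetAlg →+ JetAlg where
  toFun a := (jetAlgLift a).snd
  map_zero' := by simp
  map_add' x y := by simp

theorem jetD_ι (k : ℕ) : jetD (FreeAlgebra.ι ℝ k) = FreeAlgebra.ι ℝ (k + 1) := by
  simp [jetD, jetAlgLift]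

theorem jetD_mul (x y : JetAlg) : jetD (x * y) = jetD x * y + x * jetD y := by
  simp [jetD, fst_jetAlgLift, add_comm]

theorem jetD_algebraMap (r : ℝ) : jetD (algebraMap ℝ JetAlg r) = 0 := by
  simp [jetD, TrivSqZeroExt.algebraMap_eq_inl']

variable {B : Type*} [Ring B] [Algebra ℝ B]

/-- Two derivations along the same homomorphism agree once they agree on generators. This is the
intertwining hypothesis of `map_lax` for jets. -/
theorem map_jetD (D : B →+ B) (hD : ∀ x y, D (x * y) = D x * y + x * D y)
    (hr : ∀ r : ℝ, D (algebraMap ℝ B r) = 0) (b : B) (a : JetAlg) :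
    FreeAlgebra.lift ℝ (fun k => D^[k] b) (jetD a) =
      D (FreeAlgebra.lift ℝ (fun k => D^[k] b) a) := by
  induction a using FreeAlgebra.induction with
  | grade0 r => rw [jetD_algebraMap, map_zero, AlgHom.commutes, hr]
  | grade1 k => rw [jetD_ι, FreeAlgebra.lift_ι_apply, FreeAlgebra.lift_ι_apply,
      Function.iterate_succ_apply']
  | mul x y hx hy => rw [jetD_mul, map_add, map_mul, map_mul, map_mul, hx, hy, hD]
  | add x y hx hy => simp only [map_add, hx, hy]

/-- A noncommutative polynomial involves finitely many variables; the bound becomes the order of the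
curve operator. -/
theorem exists_order (a : JetAlg) : ∃ n : ℕ, ∀ {m : ℕ} (X X' : ℕ → Mat m),
    (∀ i ≤ n, X i = X' i) → FreeAlgebra.lift ℝ X a = FreeAlgebra.lift ℝ X' a := by
  induction a using FreeAlgebra.induction with
  | grade0 r => exact ⟨0, fun X X' _ => by simp⟩
  | grade1 k => exact ⟨k, fun X X' h => by simpa using h k le_rfl⟩
  | mul x y hx hy =>
    obtain ⟨p, hp⟩ := hx
    obtain ⟨q, hq⟩ := hy
    exact ⟨max p q, fun X X' h => by
      rw [map_mul, map_mul, hp X X' fun i hi => h i (hi.trans (le_max_left _ _)),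
        hq X X' fun i hi => h i (hi.trans (le_max_right _ _))]⟩
  | add x y hx hy =>
    obtain ⟨p, hp⟩ := hx
    obtain ⟨q, hq⟩ := hy
    exact ⟨max p q, fun X X' h => by
      rw [map_add, map_add, hp X X' fun i hi => h i (hi.trans (le_max_left _ _)),
        hq X X' fun i hi => h i (hi.trans (le_max_right _ _))]⟩

variable {m : ℕ}

theorem contDiffOn_lift {F : Type*} [NormedAddCommGroup F] [NormedSpace ℝ F] {s : Set F}
    {X : F → ℕ → Mat m} (hX : ∀ k, ContDiffOn ℝ ∞ (fun x => X x k) s) (a : JetAlg) :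
    ContDiffOn ℝ ∞ (fun x => FreeAlgebra.lift ℝ (X x) a) s := by
  induction a using FreeAlgebra.induction with
  | grade0 r => simpa using contDiffOn_const
  | grade1 k => simpa using hX k
  | mul x y hx hy =>
    simp only [map_mul]
    exact ContDiffOn.matMul hx hy
  | add x y hx hy =>
    simp only [map_add]
    exact ContDiffOn.add hx hy

/-- Conjugation by a unitary matrix is an algebra automorphism and so commutes with every
noncommutative polynomial. The isometry invariance of the curve flows comes from this. -/
theorem lift_conj (g : UGroup m) (X : ℕ → Mat m) (a : JetAlg) :
    FreeAlgebra.lift ℝ (fun k => conj g (X k)) a = conj g (FreeAlgebra.lift ℝ X a) := by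
  have : FreeAlgebra.lift ℝ (fun k => conj g (X k)) = (conj g).comp (FreeAlgebra.lift ℝ X) :=
    FreeAlgebra.hom_ext (funext fun k => by simp)
  rw [this]
  rfl

variable (m) in
/-- The coefficients of the formal solution of the Lax equation as polynomials in the jets. -/
def jetLax (k : ℕ) : JetAlg := lax jetD (√(chi m) • FreeAlgebra.ι ℝ 0) k

/-- Extension of a tuple by zero. -/
def extZero {n : ℕ} (Z : Fin (n + 1) → Mat m) (k : ℕ) : Mat m :=
  if h : k < n + 1 then Z ⟨k, h⟩ else 0

/-- The tangent vector obtained by evaluating a polynomial on jets. -/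
def jetVector (p : HP m) (X : ℕ → Mat m) (a : JetAlg) : Mat m :=
  tangentPart p ((1 / 2 : ℝ) • (FreeAlgebra.lift ℝ X a - star (FreeAlgebra.lift ℝ X a)))

theorem isTangent_jetVector (p : HP m) (X : ℕ → Mat m) (a : JetAlg) :
    IsTangent p (jetVector p X a) := by
  apply isTangent_tangentPart
  rw [star_smul_mat, star_sub, star_star, ← smul_neg, neg_sub]

theorem jetVector_smul (g : UGroup m) (p : HP m) (X : ℕ → Mat m) (a : JetAlg) :
    jetVector (g • p) (fun k => conj g (X k)) a = conj g (jetVector p X a) := by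
  rw [jetVector, jetVector, lift_conj, star_conj, ← map_sub, ← map_smul, tangentPart_smul]

/-- The projection in `jetVector` only serves to give a tangent value on arbitrary arguments; on the
jets of a unit-speed curve the Lax polynomials of even index are already tangent. -/
theorem jetVector_eq {p : HP m} {X : ℕ → Mat m} {a : JetAlg}
    (h : IsTangent p (FreeAlgebra.lift ℝ X a)) : jetVector p X a = FreeAlgebra.lift ℝ X a := by
  rw [jetVector, h.1, sub_neg_eq_add, half_smul_add_self, tangentPart_eq h]

/-- The curve operator of a polynomial in the jets. -/
def jetOperator (m : ℕ) (a : JetAlg) : CurveOperator m where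
  order := (exists_order a).choose
  toFun p Z := jetVector p (extZero Z) a
  smooth p := by
    have h : ContDiffOn ℝ ∞ (fun Z : Fin ((exists_order a).choose + 1) → Mat m =>
        FreeAlgebra.lift ℝ (extZero Z) a) Set.univ := by
      refine contDiffOn_lift (fun k => ?_) a
      by_cases hk : k < (exists_order a).choose + 1
      · simp only [extZero, dif_pos hk]
        exact (contDiff_apply ℝ (Mat m) (⟨k, hk⟩ : Fin _)).contDiffOn
      · simp only [extZero, dif_neg hk]
        exact contDiffOn_const
    have h' := ContDiffOn.const_smul (1 / 2 : ℝ) (ContDiffOn.sub h (ContDiffOn.matStar h))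
    rw [← contDiffOn_univ]
    exact ContDiffOn.const_smul (1 / 2 : ℝ)
      (ContDiffOn.sub h' (ContDiffOn.matMul (ContDiffOn.matMul contDiffOn_const h')
        contDiffOn_const))
  tangent p Z _ := isTangent_jetVector p _ a

theorem jetOperator_along (a : JetAlg) (c : ℝ → HP m) (x : ℝ) :
    (jetOperator m a).along c x = jetVector (c x) (fun k => covJet c k x) a := by
  have h := (exists_order a).choose_spec
    (extZero (n := (exists_order a).choose) fun i => covJet c i x) (fun k => covJet c k x)
    fun i hi => by rw [extZero, dif_pos (Nat.lt_succ_of_le hi)]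
  change jetVector (c x) (extZero (n := (exists_order a).choose) fun i => covJet c i x) a = _
  rw [jetVector, h, jetVector]

theorem jetOperator_isInvariant (a : JetAlg) : (jetOperator m a).IsInvariant := by
  intro g p Z _
  have h : extZero (n := (jetOperator m a).order) (fun i => (g : Mat m) * Z i * star (g : Mat m)) =
      fun k => conj g (extZero Z k) := by
    funext k
    by_cases hk : k < (jetOperator m a).order + 1
    · simp only [extZero, dif_pos hk]; rfl
    · simp only [extZero, dif_neg hk, map_zero]
  exact (congrArg (fun W => jetVector (g • p) W a) h).trans (jetVector_smul g p _ a)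

theorem jetOperator_along_smul (a : JetAlg) (g : UGroup m) (c : ℝ → HP m) (x : ℝ) :
    (jetOperator m a).along (fun y => g • c y) x = conj g ((jetOperator m a).along c x) := by
  rw [jetOperator_along, jetOperator_along, ← jetVector_smul]
  simp only [covJet_smul]

theorem jetOperator_flow_smul (a : JetAlg) (g : UGroup m) {I J : Set ℝ} {γ : ℝ → ℝ → HP m}
    (h : IsCurveFlow (jetOperator m a) γ I J) :
    IsCurveFlow (jetOperator m a) (fun t x => g • γ t x) I J := by
  refine ⟨h.1.smul g, fun t ht x hx => ?_⟩
  rw [velocity_smul g (fun s => γ s x) t, h.2 t ht x hx, jetOperator_along_smul]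

end JetAlgebra

/-! ### Evaluation of differential polynomials -/

section Evaluation

open Set Filter Topology

variable {m : ℕ}

/-- Evaluation of differential polynomials as a homomorphism. -/
def evalHom (u : ℝ → ℍ) (v : ℝ → Fin m → ℍ) (x : ℝ) : ℍ[DPoly m] →ₐ[ℝ] ℍ[ℝ] :=
  qmapHom (MvPolynomial.aeval fun i : Coord m × ℕ => iteratedDeriv i.2 (coordFun u v i.1) x)

theorem evalHom_apply (u : ℝ → ℍ) (v : ℝ → Fin m → ℍ) (x : ℝ) (q : ℍ[DPoly m]) :
    evalHom u v x q = evalJet u v x q := rfl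

theorem evalHom_star (u : ℝ → ℍ) (v : ℝ → Fin m → ℍ) (x : ℝ) (q : ℍ[DPoly m]) :
    evalHom u v x (star q) = star (evalHom u v x q) := qmapHom_star _ q

theorem map_qm (f : ℍ[DPoly m] →ₐ[ℝ] ℍ[ℝ]) (hf : ∀ x, f (star x) = star (f x)) (a : ℍ[DPoly m])
    (b : Fin m → ℍ[DPoly m]) : f.mapMatrix (qm a b) = qm (f a) fun j => f (b j) := by
  rw [AlgHom.mapMatrix_apply, qm, blk_map, qm]
  simp only [map_zero, map_neg, hf]
  congr 1 <;> funext <;> simp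

theorem map_qS (f : ℍ[DPoly m] →ₐ[ℝ] ℍ[ℝ]) : f.mapMatrix (qS (DPoly m) m) = qS ℝ m := by
  rw [AlgHom.mapMatrix_apply, qS, blk_map, qS]
  rw [Matrix.map_one _ (map_zero f) (map_one f)]
  congr 1 <;> first | (simp; done) | (simp; rfl)

theorem map_star (f : ℍ[DPoly m] →ₐ[ℝ] ℍ[ℝ]) (hf : ∀ x, f (star x) = star (f x))
    (X : RMat (DPoly m) m) : f.mapMatrix (star X) = star (f.mapMatrix X) := by
  ext1 i j
  exact hf _

/-- The real components of a quaternion as continuous linear maps. -/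
def coordL (i : Fin 4) : ℍ →L[ℝ] ℝ :=
  LinearMap.toContinuousLinearMap
    { toFun := fun q => ![q.re, q.imI, q.imJ, q.imK] i
      map_add' := fun x y => by fin_cases i <;> simp
      map_smul' := fun r x => by fin_cases i <;> simp }

theorem smooth2_coordFun {I J : Set ℝ} {u : ℝ → ℝ → ℍ} {v : ℝ → ℝ → Fin m → ℍ}
    (hu : Smooth2 I J u) (hv : Smooth2 I J v) (c : Coord m) :
    Smooth2 I J fun t => coordFun (u t) (v t) c := by
  rcases c with i | ⟨j, i⟩
  · have h := (coordL i.succ).contDiff.comp_contDiffOn (n := ∞) hu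
    refine ContDiffOn.congr h fun q _ => ?_
    fin_cases i <;> rfl
  · have hj : Smooth2 I J fun t x => v t x j := contDiffOn_pi.1 hv j
    exact (coordL i).contDiff.comp_contDiffOn (n := ∞) hj

theorem Smooth2.iteratedDeriv {I J : Set ℝ} (hI : IsOpen I) (hJ : IsOpen J) {f : ℝ → ℝ → ℝ}
    (hf : Smooth2 I J f) (k : ℕ) : Smooth2 I J fun t => iteratedDeriv k (f t) := by
  induction k with
  | zero => simpa using hf
  | succ k ih =>
    simp only [iteratedDeriv_succ]
    exact ih.deriv_snd hI hJ

theorem smooth2_aeval {I J : Set ℝ} {σ : Type*} {f : ℝ → ℝ → σ → ℝ}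
    (hf : ∀ i, Smooth2 I J fun t x => f t x i) (p : MvPolynomial σ ℝ) :
    Smooth2 I J fun t x => MvPolynomial.aeval (f t x) p := by
  induction p using MvPolynomial.induction_on with
  | C r =>
    simp only [MvPolynomial.aeval_C]
    exact contDiffOn_const
  | add p q hp hq =>
    simp only [map_add]
    exact ContDiffOn.add hp hq
  | mul_X p i hp =>
    simp only [map_mul, MvPolynomial.aeval_X]
    exact ContDiffOn.mul hp (hf i)

/-- The quaternion units. -/
def unitI : ℍ := ⟨0, 1, 0, 0⟩

/-- The quaternion units. -/
def unitJ : ℍ := ⟨0, 0, 1, 0⟩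

/-- The quaternion units. -/
def unitK : ℍ := ⟨0, 0, 0, 1⟩

theorem unit_components : (unitI.re = 0 ∧ unitI.imI = 1 ∧ unitI.imJ = 0 ∧ unitI.imK = 0) ∧
    (unitJ.re = 0 ∧ unitJ.imI = 0 ∧ unitJ.imJ = 1 ∧ unitJ.imK = 0) ∧
    unitK.re = 0 ∧ unitK.imI = 0 ∧ unitK.imJ = 0 ∧ unitK.imK = 1 :=
  ⟨⟨rfl, rfl, rfl, rfl⟩, ⟨rfl, rfl, rfl, rfl⟩, rfl, rfl, rfl, rfl⟩

theorem eq_sum_units (q : ℍ) : q = q.re • (1 : ℍ) + q.imI • unitI +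
    q.imJ • unitJ + q.imK • unitK := by
  apply Quaternion.ext <;> simp [unit_components]

theorem smooth2_quaternion {I J : Set ℝ} {f : ℝ → ℝ → ℍ} (h0 : Smooth2 I J fun t x => (f t x).re)
    (h1 : Smooth2 I J fun t x => (f t x).imI) (h2 : Smooth2 I J fun t x => (f t x).imJ)
    (h3 : Smooth2 I J fun t x => (f t x).imK) : Smooth2 I J f := by
  have h := (((ContDiffOn.smul h0 (contDiffOn_const (c := (1 : ℍ)))).add
    (ContDiffOn.smul h1 (contDiffOn_const (c := unitI)))).add
    (ContDiffOn.smul h2 (contDiffOn_const (c := unitJ)))).add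
    (ContDiffOn.smul h3 (contDiffOn_const (c := unitK)))
  exact ContDiffOn.congr h fun q _ => eq_sum_units _

theorem hasDerivAt_quaternion {f : ℝ → ℍ} {f' : ℍ} {s : ℝ}
    (h0 : HasDerivAt (fun x => (f x).re) f'.re s) (h1 : HasDerivAt (fun x => (f x).imI) f'.imI s)
    (h2 : HasDerivAt (fun x => (f x).imJ) f'.imJ s)
    (h3 : HasDerivAt (fun x => (f x).imK) f'.imK s) : HasDerivAt f f' s := by
  have h := (((h0.smul_const (1 : ℍ)).add (h1.smul_const unitI)).add
    (h2.smul_const unitJ)).add (h3.smul_const unitK)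
  rw [← eq_sum_units] at h
  exact h.congr_of_eventuallyEq (Eventually.of_forall fun x => eq_sum_units _)

theorem smooth2_evalJet {I J : Set ℝ} (hI : IsOpen I) (hJ : IsOpen J) {u : ℝ → ℝ → ℍ}
    {v : ℝ → ℝ → Fin m → ℍ} (hu : Smooth2 I J u) (hv : Smooth2 I J v) (q : ℍ[DPoly m]) :
    Smooth2 I J fun t x => evalJet (u t) (v t) x q := by
  have h := fun p : DPoly m => smooth2_aeval (I := I) (J := J)
    (f := fun t x (i : Coord m × ℕ) => _root_.iteratedDeriv i.2 (coordFun (u t) (v t) i.1) x)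
    (fun i => (smooth2_coordFun hu hv i.1).iteratedDeriv hI hJ i.2) p
  exact smooth2_quaternion (h _) (h _) (h _) (h _)

/-- D_x and d/dx obey the same Leibniz rule and agree on the jet variables. -/
theorem hasDerivAt_aeval_totalD {f : Coord m × ℕ → ℝ → ℝ} {s : ℝ}
    (hf : ∀ i, HasDerivAt (f i) (f (i.1, i.2 + 1) s) s) (p : DPoly m) :
    HasDerivAt (fun x => MvPolynomial.aeval (fun i => f i x) p)
      (MvPolynomial.aeval (fun i => f i s) (totalD m p)) s := by
  induction p using MvPolynomial.induction_on with
  | C r =>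
    have : totalD m (MvPolynomial.C r) = 0 := (totalD m).map_algebraMap r
    rw [this]
    simpa using hasDerivAt_const s r
  | add p q hp hq =>
    simp only [map_add]
    exact hp.add hq
  | mul_X p i hp =>
    rw [Derivation.leibniz, totalD_X]
    have := hp.mul (hf i)
    simp only [map_add, map_mul, smul_eq_mul, MvPolynomial.aeval_X]
    refine HasDerivAt.congr_deriv this ?_
    ring

theorem hasDerivAt_evalJet {J : Set ℝ} (hJ : IsOpen J) {u : ℝ → ℍ} {v : ℝ → Fin m → ℍ}
    (hu : ContDiffOn ℝ ∞ u J) (hv : ContDiffOn ℝ ∞ v J) {x : ℝ} (hx : x ∈ J) (q : ℍ[DPoly m]) :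
    HasDerivAt (fun y => evalJet u v y q) (evalJet u v x (qD q)) x := by
  have hu' : Smooth2 univ J fun _ => u := ContDiffOn.comp (g := u) (f := fun q : ℝ × ℝ => q.2) hu
    contDiffOn_snd fun _ hq => hq.2
  have hv' : Smooth2 univ J fun _ => v := ContDiffOn.comp (g := v) (f := fun q : ℝ × ℝ => q.2) hv
    contDiffOn_snd fun _ hq => hq.2
  have h := fun p : DPoly m => hasDerivAt_aeval_totalD (s := x)
    (f := fun i y => _root_.iteratedDeriv i.2 (coordFun u v i.1) y) (fun i => by
      have := ((smooth2_coordFun hu' hv' i.1).iteratedDeriv isOpen_univ hJ i.2).hasDerivAt_snd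
        isOpen_univ hJ (mem_univ 0) hx
      simpa only [iteratedDeriv_succ] using this) p
  exact hasDerivAt_quaternion (h _) (h _) (h _) (h _)

/-- Evaluation of matrices of differential polynomials. -/
def evalMat (u : ℝ → ℍ) (v : ℝ → Fin m → ℍ) (x : ℝ) : RMat (DPoly m) m →ₐ[ℝ] Mat m :=
  (evalHom u v x).mapMatrix

theorem hasDerivAt_evalMat {J : Set ℝ} (hJ : IsOpen J) {u : ℝ → ℍ} {v : ℝ → Fin m → ℍ}
    (hu : ContDiffOn ℝ ∞ u J) (hv : ContDiffOn ℝ ∞ v J) {x : ℝ} (hx : x ∈ J)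
    (X : RMat (DPoly m) m) :
    HasDerivAt (fun y => evalMat u v y X) (evalMat u v x (X.map qDHom)) x :=
  hasDerivAt_pi.2 fun i => hasDerivAt_pi.2 fun j => hasDerivAt_evalJet hJ hu hv hx (X i j)

theorem smooth2_evalMat {I J : Set ℝ} (hI : IsOpen I) (hJ : IsOpen J) {u : ℝ → ℝ → ℍ}
    {v : ℝ → ℝ → Fin m → ℍ} (hu : Smooth2 I J u) (hv : Smooth2 I J v) (X : RMat (DPoly m) m) :
    Smooth2 I J fun t x => evalMat (u t) (v t) x X :=
  smooth2_pi fun i => smooth2_pi fun j => smooth2_evalJet hI hJ hu hv (X i j)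

theorem evalMat_star (u : ℝ → ℍ) (v : ℝ → Fin m → ℍ) (x : ℝ) (X : RMat (DPoly m) m) :
    evalMat u v x (star X) = star (evalMat u v x X) := map_star _ (evalHom_star u v x) X

theorem evalMat_qm (u : ℝ → ℍ) (v : ℝ → Fin m → ℍ) (x : ℝ) (a : ℍ[DPoly m])
    (b : Fin m → ℍ[DPoly m]) : evalMat u v x (qm a b) =
      qm (evalJet u v x a) fun j => evalJet u v x (b j) := map_qm _ (evalHom_star u v x) a b

theorem evalMat_qh (u : ℝ → ℍ) (v : ℝ → Fin m → ℍ) (x : ℝ) (a : ℍ[DPoly m])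
    (b : Fin m → ℍ[DPoly m]) : evalMat u v x (qh a b) =
      qh (evalJet u v x a) fun j => evalJet u v x (b j) := map_qh _ (evalHom_star u v x) a b

theorem evalMat_qm_one (u : ℝ → ℍ) (v : ℝ → Fin m → ℍ) (x : ℝ) :
    evalMat u v x (qm 1 0) = qm 1 0 := map_qm_one _

theorem evalMat_qS (u : ℝ → ℍ) (v : ℝ → Fin m → ℍ) (x : ℝ) :
    evalMat u v x (qS (DPoly m) m) = symmS m := by rw [symmS_eq]; exact map_qS _

/-- The jet variables evaluate to the derivatives. -/
theorem evalJet_jetVar_zero {u : ℝ → ℍ} {v : ℝ → Fin m → ℍ} {x : ℝ} (hu : (u x).re = 0) :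
    evalJet u v x (jetVar m 0).1 = u x ∧ ∀ j, evalJet u v x ((jetVar m 0).2 j) = v x j := by
  refine ⟨?_, fun j => ?_⟩ <;> apply Quaternion.ext <;> change MvPolynomial.aeval _ _ = _ <;>
    simp [jetVar, coordFun, hu]

end Evaluation

/-! ### Jets in parallel frames -/

section FrameJets

open Set Filter Topology

variable {m : ℕ}

theorem frame_entries (r : ℝ) (w : ℍ) (k : Fin m → ℍ) :
    (r • qm 1 0 + qh w k : Mat m) 0 0 = w ∧
      ∀ j : Fin m, (r • qm 1 0 + qh w k : Mat m) 1 j.succ.succ = k j := by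
  obtain ⟨q1, -, -, -, -, q6, -, -, -⟩ := blk_apply w 0 0 (-w) 0 k 0 (fun j => -star (k j))
    (0 : Matrix (Fin m) (Fin m) ℍ)
  obtain ⟨p1, -, -, -, -, p6, -, -, -⟩ := blk_apply 0 (1 : ℍ) (-star 1) 0 (0 : Fin m → ℍ) 0
    (fun j => -star ((0 : Fin m → ℍ) j)) 0 (0 : Matrix (Fin m) (Fin m) ℍ)
  constructor
  · rw [Matrix.add_apply, Matrix.smul_apply, qm, qh, q1, p1]; simp
  · intro j
    rw [Matrix.add_apply, Matrix.smul_apply, qm, qh, q6, p6]; simp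

theorem star_eq_neg_of_re {q : ℍ} (h : q.re = 0) : star q = -q := by
  apply Quaternion.ext <;> simp [h]

theorem re_eq_zero_of_star {q : ℍ} (h : star q = -q) : q.re = 0 := by
  have := congrArg (fun q : ℍ => q.re) h
  simp only [Quaternion.re_star, Quaternion.re_neg] at this
  linarith

variable {c : ℝ → HP m} {J : Set ℝ} {ψ : ℝ → UGroup m} {u : ℝ → ℍ} {v : ℝ → Fin m → ℍ}

/-- The matrix of a parallel frame. -/
def frameMat (u : ℍ) (v : Fin m → ℍ) : Mat m := (1 / √(chi m)) • qm 1 0 + qh u v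

theorem IsParallelFrame.mcForm (h : IsParallelFrame c J ψ u v) {x : ℝ} (hx : x ∈ J) :
    mcForm ψ x = frameMat (u x) (v x) := by
  obtain ⟨-, -, h1, h2⟩ := h.2 x hx
  rw [← mPart_add_hPart (QuatFlow.mcForm ψ x), h1, h2, mMat_eq, hMat_eq, frameMat]

theorem IsParallelFrame.hasDerivAt (hJ : IsOpen J) (h : IsParallelFrame c J ψ u v) {x : ℝ}
    (hx : x ∈ J) :
    HasDerivAt (fun r => (ψ r : Mat m)) ((ψ x : Mat m) * frameMat (u x) (v x)) x := by
  rw [← h.mcForm hx, QuatFlow.mcForm, (ψ x).mul_star_cancel]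
  exact ((h.1.contDiffAt (hJ.mem_nhds hx)).differentiableAt (by simp)).hasDerivAt

theorem IsParallelFrame.star_u (h : IsParallelFrame c J ψ u v) {x : ℝ} (hx : x ∈ J) :
    star (u x) = -u x := star_eq_neg_of_re (h.2 x hx).2.1

theorem IsParallelFrame.smooth (hJ : IsOpen J) (h : IsParallelFrame c J ψ u v) :
    ContDiffOn ℝ ∞ u J ∧ ContDiffOn ℝ ∞ v J := by
  have hψ : Smooth2 univ J fun _ x => (ψ x : Mat m) :=
    ContDiffOn.comp (g := fun x => (ψ x : Mat m)) (f := fun q : ℝ × ℝ => q.2) h.1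
      contDiffOn_snd fun _ hq => hq.2
  have hQ : Smooth2 univ J fun _ => QuatFlow.mcForm ψ :=
    hψ.star.mul (hψ.deriv_snd isOpen_univ hJ)
  have hQ' : Smooth2 univ J fun _ x => frameMat (u x) (v x) :=
    hQ.congr fun _ _ x hx => (h.mcForm hx).symm
  have hu : Smooth2 univ J fun _ => u := (hQ'.entry 0 0).congr fun _ _ x _ =>
    (frame_entries _ (u x) (v x)).1.symm
  have hv : Smooth2 univ J fun _ => v := smooth2_pi fun j => (hQ'.entry 1 j.succ.succ).congr
    fun _ _ x _ => ((frame_entries _ (u x) (v x)).2 j).symm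
  exact ⟨hu.right (mem_univ 0), hv.right (mem_univ 0)⟩

variable (m) in
/-- The covariant derivative of differential polynomials in a parallel frame. -/
abbrev covQ : RMat (DPoly m) m →+ RMat (DPoly m) m :=
  covD qDHom (jetVar m 0).1 (jetVar m 0).2

theorem covQ_algebraMap (r : ℝ) : covQ m (algebraMap ℝ (RMat (DPoly m) m) r) = 0 := by
  have h1 : covQ m 1 = 0 := by
    have := covD_mul (u := (jetVar m 0).1) (v := (jetVar m 0).2) isQDer_qD (1 : RMat (DPoly m) m) 1
    rw [mul_one, mul_one, one_mul] at this
    exact left_eq_add.1 this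
  rw [Algebra.algebraMap_eq_smul_one, covD_smul isQDer_qD, h1, smul_zero]

theorem evalMat_covQ {x : ℝ} (hu : (u x).re = 0) (X : RMat (DPoly m) m) :
    evalMat u v x (covQ m X) = evalMat u v x (X.map qDHom) +
      (qh (u x) (v x) * evalMat u v x X - evalMat u v x X * qh (u x) (v x)) := by
  obtain ⟨h1, h2⟩ := evalJet_jetVar_zero (v := v) hu
  rw [covD_apply, map_add, map_sub, map_mul, map_mul, evalMat_qh, h1, funext h2]

/-- The jets in a parallel frame, as differential polynomials. -/
def covJetQ (m k : ℕ) : RMat (DPoly m) m := (covQ m)^[k] ((1 / √(chi m)) • qm 1 0)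

theorem parity_covJetQ (k : ℕ) :
    qS (DPoly m) m * covJetQ m k * qS (DPoly m) m = -covJetQ m k := by
  induction k with
  | zero =>
    rw [covJetQ, Function.iterate_zero, id, mul_smul_comm, smul_mul_assoc, qS_qm, smul_neg]
  | succ k ih =>
    have e : covJetQ m (k + 1) = covQ m (covJetQ m k) := Function.iterate_succ_apply' _ _ _
    rw [e, ← covD_qS isQDer_qD, ih, map_neg]

/-- In a frame ∇_x is y ↦ y′ + [ω, y], which is the evaluation of `covQ`; `parity_covJetQ` supplies
the oddness that `covDeriv_of_lift` needs. -/
theorem covJet_frame (hJ : IsOpen J) (h : IsParallelFrame c J ψ u v) (k : ℕ) :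
    ∀ x ∈ J, covJet c k x = conj (ψ x) (evalMat u v x (covJetQ m k)) := by
  have hc : ∀ x ∈ J, ∀ᶠ r in 𝓝 x, c r = (ψ r : HP m) := fun x hx => by
    filter_upwards [hJ.mem_nhds hx] with r hr using (h.2 r hr).1
  obtain ⟨hu, hv⟩ := h.smooth hJ
  induction k with
  | zero =>
    intro x hx
    have h1 := velocity_of_lift (h.hasDerivAt hJ hx) (hc x hx)
    rw [(ψ x).star_mul_cancel, frameMat, (mPart_qm_add_qh _ _ _ _ _).1] at h1
    rw [covJetQ, Function.iterate_zero, id, map_smul, evalMat_qm_one]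
    exact h1
  | succ k ih =>
    intro x hx
    have h1 := covDeriv_of_lift (V := covJet c k) (h.hasDerivAt hJ hx) (h.2 x hx).1
      (hasDerivAt_evalMat hJ hu hv hx (covJetQ m k)) (fun r => by
        rw [← evalMat_qS u v r, ← map_mul, ← map_mul, parity_covJetQ, map_neg]) (by
        filter_upwards [hJ.mem_nhds hx] with r hr using ih r hr)
    rw [(ψ x).star_mul_cancel, frameMat, (mPart_qm_add_qh _ _ _ _ _).2, Ring.lie_def,
      ← evalMat_covQ (h.2 x hx).2.1] at h1
    have e : covJetQ m (k + 1) = covQ m (covJetQ m k) := Function.iterate_succ_apply' _ _ _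
    rw [e]
    exact h1

/-- The coefficients of the formal solution of the Lax equation along a curve. -/
def curveLax (c : ℝ → HP m) (k : ℕ) (x : ℝ) : Mat m :=
  FreeAlgebra.lift ℝ (fun j => covJet c j x) (jetLax m k)

/-- Naturality of the formal solution. The factor √χ in the leading term rescales the unit tangent
χ^{-1/2}E to E. -/
theorem lift_jetLax (k : ℕ) :
    FreeAlgebra.lift ℝ (fun j => covJetQ m j) (jetLax m k) = laxQ m k := by
  have h := map_lax (FreeAlgebra.lift ℝ fun j => covJetQ m j) (D := jetD) (D' := covQ m)
    (map_jetD (covQ m) (covD_mul isQDer_qD) covQ_algebraMap _) (√(chi m) • FreeAlgebra.ι ℝ 0) k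
  rw [map_smul, FreeAlgebra.lift_ι_apply] at h
  have e : √(chi m) • covJetQ m 0 = qm 1 0 := by
    rw [covJetQ, Function.iterate_zero, id, smul_smul, mul_one_div_cancel sqrt_chi_pos.ne',
      one_smul]
  rw [e] at h
  exact h

theorem curveLax_frame (hJ : IsOpen J) (h : IsParallelFrame c J ψ u v) (k : ℕ) {x : ℝ}
    (hx : x ∈ J) : curveLax c k x = conj (ψ x) (evalMat u v x (laxQ m k)) := by
  rw [← lift_jetLax, curveLax]
  have e : (FreeAlgebra.lift ℝ fun j => covJet c j x) =
      ((conj (ψ x)).comp (evalMat u v x)).comp (FreeAlgebra.lift ℝ fun j => covJetQ m j) :=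
    FreeAlgebra.hom_ext (funext fun k => by
      simp only [Function.comp_apply, FreeAlgebra.lift_ι_apply, AlgHom.comp_apply]
      exact covJet_frame hJ h k x hx)
  rw [e]
  rfl

/-- The Lax equation for the evaluated coefficients. -/
theorem evalMat_laxQ_map {x : ℝ} (hu : (u x).re = 0) (k : ℕ) :
    evalMat u v x ((laxQ m k).map qDHom) =
      -(qm 1 0 * evalMat u v x (laxQ m (k + 1)) - evalMat u v x (laxQ m (k + 1)) * qm 1 0) -
      (qh (u x) (v x) * evalMat u v x (laxQ m k) - evalMat u v x (laxQ m k) * qh (u x) (v x)) := by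
  have h1 := evalMat_covQ (v := v) hu (laxQ m k)
  rw [laxM_rec isQDer_qD, map_neg, map_sub, map_mul, map_mul, evalMat_qm_one] at h1
  rw [h1]
  abel

theorem star_evalMat_laxQ (x : ℝ) (k : ℕ) :
    star (evalMat u v x (laxQ m k)) = -evalMat u v x (laxQ m k) := by
  rw [← evalMat_star, star_laxM isQDer_qD (star_jetVar 0), map_neg]

theorem parity_evalMat_laxQ (x : ℝ) (l : ℕ) :
    symmS m * evalMat u v x (laxQ m (2 * l)) * symmS m = -evalMat u v x (laxQ m (2 * l)) ∧
    symmS m * evalMat u v x (laxQ m (2 * l + 1)) * symmS m =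
      evalMat u v x (laxQ m (2 * l + 1)) := by
  rw [← evalMat_qS u v x, ← map_mul, ← map_mul, ← map_mul, ← map_mul,
    parity_laxM_even isQDer_qD, parity_laxM_odd isQDer_qD, map_neg]
  exact ⟨rfl, rfl⟩

theorem velocity_frame (hJ : IsOpen J) (h : IsParallelFrame c J ψ u v) {x : ℝ} (hx : x ∈ J) :
    velocity c x = conj (ψ x) ((1 / √(chi m)) • qm 1 0) := by
  have := covJet_frame hJ h 0 x hx
  rw [covJetQ, Function.iterate_zero, id, map_smul, evalMat_qm_one] at this
  exact this

/-- The first bracket is the Lax equation with √χ γ_x in the role of E. The second is the χ^{-1/2}E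
part of the motion of the frame; its (u, v) part cancels against the connection term of ∇. -/
theorem hasDerivAt_curveLax (hJ : IsOpen J) (h : IsParallelFrame c J ψ u v) (k : ℕ) {x : ℝ}
    (hx : x ∈ J) :
    HasDerivAt (curveLax c k)
      (-(√(chi m)) • (velocity c x * curveLax c (k + 1) x - curveLax c (k + 1) x * velocity c x) +
        (velocity c x * curveLax c k x - curveLax c k x * velocity c x)) x := by
  obtain ⟨hu, hv⟩ := h.smooth hJ
  have hψ := h.hasDerivAt hJ hx
  have hQ := hasDerivAt_evalMat hJ hu hv hx (laxQ m k)
  have hd := hasDerivAt_mul (hasDerivAt_mul hψ hQ) (hasDerivAt_star hψ)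
  have he : curveLax c k =ᶠ[𝓝 x] fun r => (ψ r : Mat m) * evalMat u v r (laxQ m k) *
      star (ψ r : Mat m) := by
    filter_upwards [hJ.mem_nhds hx] with r hr using curveLax_frame hJ h k hr
  refine (hd.congr_of_eventuallyEq he).congr_deriv ?_
  have hM : star (frameMat (u x) (v x)) = -frameMat (u x) (v x) := by
    rw [frameMat, star_add, star_smul_mat, star_qm, star_qh (h.star_u hx), smul_neg, neg_add]
  rw [velocity_frame hJ h hx, curveLax_frame hJ h k hx, curveLax_frame hJ h (k + 1) hx,
    evalMat_laxQ_map (h.2 x hx).2.1, star_mul, hM]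
  simp only [← map_mul, ← map_sub, ← map_smul, ← map_add]
  rw [conj_apply]
  have e : ∀ X Y F : Mat m, (ψ x : Mat m) * F * X * star (ψ x : Mat m) +
      (ψ x : Mat m) * Y * star (ψ x : Mat m) + (ψ x : Mat m) * X * (-F * star (ψ x : Mat m)) =
      (ψ x : Mat m) * (Y + (F * X - X * F)) * star (ψ x : Mat m) := fun X Y F => by noncomm_ring
  rw [add_mul, e]
  congr 2
  have hs : -√(chi m) • ((1 / √(chi m)) • qm 1 0 * evalMat u v x (laxQ m (k + 1)) -
      evalMat u v x (laxQ m (k + 1)) * (1 / √(chi m)) • qm 1 0) =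
      -(qm 1 0 * evalMat u v x (laxQ m (k + 1)) - evalMat u v x (laxQ m (k + 1)) * qm 1 0) := by
    rw [smul_mul_assoc, mul_smul_comm, ← smul_sub, smul_smul, neg_mul,
      mul_one_div_cancel sqrt_chi_pos.ne', neg_one_smul]
  rw [hs, frameMat]
  noncomm_ring

theorem isOpenInterval_univ : IsOpenInterval (univ : Set ℝ) :=
  ⟨isOpen_univ, ordConnected_univ, univ_nonempty⟩

/-- Every unit speed curve has a parallel frame. -/
theorem IsUnitSpeed.exists_parallelFrame (hJ : IsOpenInterval J) (h : IsUnitSpeed c J) :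
    ∃ ψ u v, IsParallelFrame c J ψ u v := by
  -- The curve is treated as a flow that does not move, with generator N = 0.
  obtain ⟨ψ, u, v, h1, -⟩ := exists_flow_frame isOpenInterval_univ hJ h.isNonStretching
    (N := fun _ _ => 0) (smooth2_const 0) (fun _ _ _ _ => by simp)
    (fun t _ x _ => by
      rw [zero_mul, mul_zero, sub_zero]
      exact hasDerivAt_const t _)
    (fun t _ x _ => by
      rw [zero_mul, mul_zero, sub_zero]
      exact hasDerivAt_const t _)
    (fun t _ x _ => ⟨0, by rw [zero_mul, mul_zero, sub_zero]; exact (hasDerivAt_const x _).deriv⟩)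
  exact ⟨ψ 0, u 0, v 0, h1.2 0 (mem_univ 0)⟩

end FrameJets

/-! ### The zero curvature equation of a flow of frames -/

section FlowFrames

open Set Filter Topology

variable {m : ℕ} {I J : Set ℝ}

theorem hasDerivAt_qh {u : ℝ → ℍ} {v : ℝ → Fin m → ℍ} {a : ℍ} {b : Fin m → ℍ} {s : ℝ}
    (hu : HasDerivAt u a s) (hv : ∀ j, HasDerivAt (fun r => v r j) (b j) s) :
    HasDerivAt (fun r => (qh (u r) (v r) : Mat m)) (qh a b) s := by
  let L : (ℍ × (Fin m → ℍ)) →ₗ[ℝ] Mat m :=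
    { toFun := fun p => qh p.1 p.2
      map_add' := fun p q => (qh_add p.1 q.1 p.2 q.2).symm
      map_smul' := fun r p => (qh_smul r p.1 p.2).symm }
  exact L.toContinuousLinearMap.hasFDerivAt.comp_hasDerivAt s (hu.prodMk (hasDerivAt_pi.2 hv))

theorem hasDerivAt_qm {u : ℝ → ℍ} {v : ℝ → Fin m → ℍ} {a : ℍ} {b : Fin m → ℍ} {s : ℝ}
    (hu : HasDerivAt u a s) (hv : ∀ j, HasDerivAt (fun r => v r j) (b j) s) :
    HasDerivAt (fun r => (qm (u r) (v r) : Mat m)) (qm a b) s := by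
  let L : (ℍ × (Fin m → ℍ)) →ₗ[ℝ] Mat m :=
    { toFun := fun p => qm p.1 p.2
      map_add' := fun p q => (qm_add p.1 q.1 p.2 q.2).symm
      map_smul' := fun r p => (qm_smul r p.1 p.2).symm }
  exact L.toContinuousLinearMap.hasFDerivAt.comp_hasDerivAt s (hu.prodMk (hasDerivAt_pi.2 hv))

theorem smooth2_qh {u : ℝ → ℝ → ℍ} {v : ℝ → ℝ → Fin m → ℍ} (hu : Smooth2 I J u)
    (hv : Smooth2 I J v) : Smooth2 I J fun t x => (qh (u t x) (v t x) : Mat m) := by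
  let L : (ℍ × (Fin m → ℍ)) →ₗ[ℝ] Mat m :=
    { toFun := fun p => qh p.1 p.2
      map_add' := fun p q => (qh_add p.1 q.1 p.2 q.2).symm
      map_smul' := fun r p => (qh_smul r p.1 p.2).symm }
  exact L.toContinuousLinearMap.contDiff.comp_contDiffOn (ContDiffOn.prodMk hu hv)

theorem smooth2_qm {u : ℝ → ℝ → ℍ} {v : ℝ → ℝ → Fin m → ℍ} (hu : Smooth2 I J u)
    (hv : Smooth2 I J v) : Smooth2 I J fun t x => (qm (u t x) (v t x) : Mat m) := by
  let L : (ℍ × (Fin m → ℍ)) →ₗ[ℝ] Mat m :=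
    { toFun := fun p => qm p.1 p.2
      map_add' := fun p q => (qm_add p.1 q.1 p.2 q.2).symm
      map_smul' := fun r p => (qm_smul r p.1 p.2).symm }
  exact L.toContinuousLinearMap.contDiff.comp_contDiffOn (ContDiffOn.prodMk hu hv)

theorem qh_inj {a a' : ℍ} {b b' : Fin m → ℍ} (h : (qh a b : Mat m) = qh a' b') : a = a' ∧ b = b' := by
  obtain ⟨h1, h2, -⟩ := qh_qd_inj (congrArg (· + qd (0 : ℍ) (0 : Matrix (Fin m) (Fin m) ℍ)) h)
  exact ⟨h1, h2⟩

theorem hasDerivAt_frameMat {u : ℝ → ℍ} {v : ℝ → Fin m → ℍ} {a : ℍ} {b : Fin m → ℍ} {s : ℝ}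
    (hu : HasDerivAt u a s) (hv : ∀ j, HasDerivAt (fun r => v r j) (b j) s) :
    HasDerivAt (fun r => frameMat (u r) (v r)) (qh a b) s :=
  (hasDerivAt_qh hu hv).const_add _

theorem smooth2_frameMat {u : ℝ → ℝ → ℍ} {v : ℝ → ℝ → Fin m → ℍ} (hu : Smooth2 I J u)
    (hv : Smooth2 I J v) : Smooth2 I J fun t x => frameMat (u t x) (v t x) :=
  (smooth2_const _).add (smooth2_qh hu hv)

theorem star_frameMat {u : ℍ} (hu : star u = -u) (v : Fin m → ℍ) :
    star (frameMat u v) = -frameMat u v := by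
  rw [frameMat, star_add, star_smul_mat, star_qm, star_qh hu, smul_neg, neg_add]

theorem Smooth2.component {v : ℝ → ℝ → Fin m → ℍ} (hv : Smooth2 I J v) (j : Fin m) :
    Smooth2 I J fun t x => v t x j := contDiffOn_pi.1 hv j

set_option maxHeartbeats 1000000 in
/-- The compatibility condition of `ψ_x = ψ M`, `ψ_t = ψ V`. -/
theorem zero_curvature (hI : IsOpen I) (hJ : IsOpen J) {ψ : ℝ → ℝ → UGroup m}
    (hψ : Smooth2 I J fun t x => (ψ t x : Mat m)) {M V : ℝ → ℝ → Mat m} (hM : Smooth2 I J M)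
    (hV : Smooth2 I J V)
    (hx : ∀ t ∈ I, ∀ x ∈ J, HasDerivAt (fun y => (ψ t y : Mat m)) (ψ t x * M t x) x)
    (ht : ∀ t ∈ I, ∀ x ∈ J, HasDerivAt (fun s => (ψ s x : Mat m)) (ψ t x * V t x) t)
    {t x : ℝ} (htI : t ∈ I) (hxJ : x ∈ J) :
    deriv (fun s => M s x) t = deriv (V t) x + (M t x * V t x - V t x * M t x) := by
  have e0 := hψ.deriv_comm hI hJ htI hxJ
  have f1 : (fun s => deriv (fun y => (ψ s y : Mat m)) x) =ᶠ[𝓝 t]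
      fun s => (ψ s x : Mat m) * M s x := by
    filter_upwards [hI.mem_nhds htI] with s hs using (hx s hs x hxJ).deriv
  have f2 : (fun r => deriv (fun s => (ψ s r : Mat m)) t) =ᶠ[𝓝 x]
      fun r => (ψ t r : Mat m) * V t r := by
    filter_upwards [hJ.mem_nhds hxJ] with r hr using (ht t htI r hr).deriv
  have g1 := (hasDerivAt_mul (ht t htI x hxJ)
    (hM.hasDerivAt_fst hI hJ htI hxJ)).congr_of_eventuallyEq f1
  have g2 := (hasDerivAt_mul (hx t htI x hxJ)
    (hV.hasDerivAt_snd hI hJ htI hxJ)).congr_of_eventuallyEq f2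
  have e := congrArg (fun X => star (ψ t x : Mat m) * X) (g1.deriv.symm.trans (e0.trans g2.deriv))
  simp only [mul_add, mul_assoc, UGroup.star_mul_cancel] at e
  have key : ∀ {a b c d : Mat m}, a + b = c + d → b = d + (c - a) := fun {a b c d} h => by
    rw [add_sub, add_comm d, ← h, add_sub_cancel_left]
  exact key e

/-- The evolution of the covariants of a flow of parallel frames. -/
theorem IsParallelFlowFrame.evolution (hI : IsOpen I) (hJ : IsOpen J) {γ : ℝ → ℝ → HP m}
    {ψ : ℝ → ℝ → UGroup m} {u : ℝ → ℝ → ℍ} {v : ℝ → ℝ → Fin m → ℍ}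
    (h : IsParallelFlowFrame γ I J ψ u v) (hu : Smooth2 I J u) (hv : Smooth2 I J v)
    {V : ℝ → ℝ → Mat m} (hV : Smooth2 I J V)
    (ht : ∀ t ∈ I, ∀ x ∈ J, HasDerivAt (fun s => (ψ s x : Mat m)) (ψ t x * V t x) t)
    {t x : ℝ} (htI : t ∈ I) (hxJ : x ∈ J) {a : ℍ} {b : Fin m → ℍ}
    (hab : deriv (V t) x + (frameMat (u t x) (v t x) * V t x -
      V t x * frameMat (u t x) (v t x)) = qh a b) :
    deriv (fun s => u s x) t = a ∧ ∀ j, deriv (fun s => v s x j) t = b j := by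
  have e := zero_curvature hI hJ h.1 (smooth2_frameMat hu hv) hV
    (fun t ht x hx => (h.2 t ht).hasDerivAt hJ hx) ht htI hxJ
  have d : deriv (fun s => frameMat (u s x) (v s x)) t = _ :=
    (hasDerivAt_frameMat (hu.hasDerivAt_fst hI hJ htI hxJ)
      fun j => (hv.component j).hasDerivAt_fst hI hJ htI hxJ).deriv
  rw [d, hab] at e
  obtain ⟨h1, h2⟩ := qh_inj e
  exact ⟨h1, fun j => congrFun h2 j⟩

set_option maxHeartbeats 2000000 in
/-- Existence of a non-stretching flow with given covariants. -/
theorem exists_flow_of_covariants (hI : IsOpenInterval I) (hJ : IsOpenInterval J)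
    {u : ℝ → ℝ → ℍ} {v : ℝ → ℝ → Fin m → ℍ} (hu : Smooth2 I J u) (hv : Smooth2 I J v)
    (hre : ∀ t ∈ I, ∀ x ∈ J, (u t x).re = 0) {V : ℝ → ℝ → Mat m} (hV : Smooth2 I J V)
    (hVs : ∀ t ∈ I, ∀ x ∈ J, star (V t x) = -V t x)
    (hz : ∀ t ∈ I, ∀ x ∈ J,
      (qh (deriv (fun s => u s x) t) fun j => deriv (fun s => v s x j) t) =
      deriv (V t) x + (frameMat (u t x) (v t x) * V t x - V t x * frameMat (u t x) (v t x))) :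
    ∃ γ ψ, IsNonStretching γ I J ∧ IsParallelFlowFrame γ I J ψ u v ∧
      ∀ t ∈ I, ∀ x ∈ J, velocity (fun s => γ s x) t = conj (ψ t x) (mPart (V t x)) := by
  obtain ⟨t₀, ht₀⟩ := hI.2.2
  obtain ⟨x₀, hx₀⟩ := hJ.2.2
  set M : ℝ → ℝ → Mat m := fun t x => frameMat (u t x) (v t x) with hMdef
  have hM : Smooth2 I J M := smooth2_frameMat hu hv
  have hMs : ∀ t ∈ I, ∀ x ∈ J, star (M t x) = -M t x := fun t ht x hx =>
    star_frameMat (star_eq_neg_of_re (hre t ht x hx)) _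
  -- The frame equations ψ_x = ψM and ψ_t = ψV multiply on the right, hence the flipped product.
  obtain ⟨φ, hφ₀, hφ, hφt, hφx⟩ := exists_compatible_bilinear (LinearMap.mul ℝ (Mat m)).flip
    hI hJ hM hV (fun t ht x hx X => by
      have d : deriv (fun s => M s x) t = _ :=
        (hasDerivAt_frameMat (hu.hasDerivAt_fst hI.1 hJ.1 ht hx)
          fun j => (hv.component j).hasDerivAt_fst hI.1 hJ.1 ht hx).deriv
      change X * deriv (fun s => M s x) t + X * V t x * M t x =
        X * deriv (V t) x + X * M t x * V t x
      rw [d, hz t ht x hx]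
      noncomm_ring)
    ht₀ hx₀ (1 : Mat m)
  simp only [LinearMap.flip_apply, LinearMap.mul_apply'] at hφt hφx
  have hφ1 : ∀ t ∈ I, ∀ x ∈ J, φ t x * star (φ t x) = 1 := fun t ht x hx => by
    -- The adjoint of φ solves the left-multiplied system with coefficients −M and −V, so φφ* is
    -- constant.
    have := conj_const hI hJ (M := fun t x => -M t x) (N := fun t x => -V t x)
      (φ := fun t x => star (φ t x)) (X := fun _ _ => 1)
      (fun t ht x hx => by rw [star_neg, hMs t ht x hx])
      (fun t ht x hx => by rw [star_neg, hVs t ht x hx])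
      (fun t ht x hx => by
        have := hasDerivAt_star (hφt t ht x hx)
        rwa [star_mul, hVs t ht x hx] at this)
      (fun t ht x hx => by
        have := hasDerivAt_star (hφx t ht x hx)
        rwa [star_mul, hMs t ht x hx] at this)
      (fun t _ x _ => by
        rw [mul_one, one_mul, sub_self]; exact hasDerivAt_const t (1 : Mat m))
      (fun t _ x _ => by
        rw [mul_one, one_mul, sub_self]; exact hasDerivAt_const x (1 : Mat m)) ht₀ hx₀ ht hx
    simpa [hφ₀] using this
  classical
  set ψ : ℝ → ℝ → UGroup m := fun t x => if h : φ t x ∈ unitary (Mat m) then ⟨φ t x, h⟩ else 1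
    with hψdef
  have hψ : ∀ t ∈ I, ∀ x ∈ J, (ψ t x : Mat m) = φ t x := fun t ht x hx => by
    simp only [hψdef, dif_pos (mem_unitary_of_mul_star (hφ1 t ht x hx))]
  clear_value ψ
  have hψt : ∀ t ∈ I, ∀ x ∈ J, HasDerivAt (fun s => (ψ s x : Mat m)) (ψ t x * V t x) t := by
    intro t ht x hx
    have h : (fun s : ℝ => (ψ s x : Mat m)) =ᶠ[𝓝 t] fun s => φ s x := by
      filter_upwards [hI.1.mem_nhds ht] with s hs using hψ s hs x hx
    rw [hψ t ht x hx]
    exact (hφt t ht x hx).congr_of_eventuallyEq h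
  have hψx : ∀ t ∈ I, ∀ x ∈ J, HasDerivAt (fun y => (ψ t y : Mat m)) (ψ t x * M t x) x := by
    intro t ht x hx
    have h : (fun y : ℝ => (ψ t y : Mat m)) =ᶠ[𝓝 x] fun y => φ t y := by
      filter_upwards [hJ.1.mem_nhds hx] with y hy using hψ t ht y hy
    rw [hψ t ht x hx]
    exact (hφx t ht x hx).congr_of_eventuallyEq h
  have hψs : Smooth2 I J fun t x => (ψ t x : Mat m) := hφ.congr hψ
  refine ⟨fun t x => (ψ t x : HP m), ψ, ⟨?_, fun t ht x hx => ?_⟩,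
    ⟨hψs, fun t ht => ⟨hψs.right ht, fun x hx => ?_⟩⟩, fun t ht x hx => ?_⟩
  · have hR : Smooth2 I J fun t x => (ψ t x : Mat m) * symmS m * star (ψ t x : Mat m) :=
      (hψs.mul (smooth2_const (symmS m))).mul hψs.star
    have hR' : Smooth2 I J fun t x => reflection (ψ t x : HP m) := hR.congr fun _ _ _ _ => rfl
    exact hR'
  · have h := velocity_of_lift (c := fun x => (ψ t x : HP m)) (hψx t ht x hx)
      (Eventually.of_forall fun _ => rfl)
    have h' : velocity (fun x => (ψ t x : HP m)) x =
        conj (ψ t x) ((1 / √(chi m)) • qm 1 0) := by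
      rw [h, (ψ t x).star_mul_cancel]
      simp only [hMdef, frameMat]
      rw [(mPart_qm_add_qh _ _ _ _ _).1, conj_apply]
    rw [h', metric_conj, qm_smul, metric_qm]
    have hs : √(chi m) * √(chi m) = chi m := Real.mul_self_sqrt chi_pos.le
    have hc := sqrt_chi_pos (m := m)
    simp [herm, Quaternion.star_smul]
    rw [← mul_inv, hs, mul_inv_cancel₀ chi_pos.ne']
  · have hmc : mcForm (ψ t) x = frameMat (u t x) (v t x) := by
      have d : deriv (fun r => (ψ t r : Mat m)) x = _ := (hψx t ht x hx).deriv
      rw [mcForm, d, (ψ t x).star_mul_cancel]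
    obtain ⟨r1, r2⟩ := mPart_qm_add_qh (1 / √(chi m)) 1 0 (u t x) (v t x)
    exact ⟨rfl, hre t ht x hx, by rw [hmc, frameMat, r1, mMat_eq], by
      rw [hmc, frameMat, r2, hMat_eq]⟩
  · have h := velocity_of_lift (c := fun s => (ψ s x : HP m)) (hψt t ht x hx)
      (Eventually.of_forall fun _ => rfl)
    rw [h, (ψ t x).star_mul_cancel, conj_apply]

end FlowFrames

/-! ### The curve flows of the hierarchy -/

section CurveFlows

open Set Filter Topology

variable {m : ℕ}

variable (m) in
/-- The operator `Y_(l)` of the `(+l)`-flow. -/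
def flowOperator (l : ℕ) : CurveOperator m :=
  jetOperator m (((-1 : ℝ) ^ l * (1 / √(chi m))) • jetLax m (2 * l))

variable {c : ℝ → HP m} {J : Set ℝ} {ψ : ℝ → UGroup m} {u : ℝ → ℍ} {v : ℝ → Fin m → ℍ}

theorem curveLax_parity (hJ : IsOpen J) (h : IsParallelFrame c J ψ u v) (l : ℕ) {x : ℝ}
    (hx : x ∈ J) : IsTangent (c x) (curveLax c (2 * l) x) ∧
      star (curveLax c (2 * l + 1) x) = -curveLax c (2 * l + 1) x ∧
      curveLax c (2 * l + 1) x * reflection (c x) = reflection (c x) * curveLax c (2 * l + 1) x := by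
  have hR : reflection (c x) = conj (ψ x) (symmS m) := by rw [(h.2 x hx).1, reflection_mk]
  have hp := parity_evalMat_laxQ (u := u) (v := v) x l
  refine ⟨⟨?_, ?_⟩, ?_, ?_⟩
  · rw [curveLax_frame hJ h _ hx, star_conj, star_evalMat_laxQ, map_neg]
  · rw [curveLax_frame hJ h _ hx, hR, ← map_mul, ← map_mul, hp.1, map_neg]
  · rw [curveLax_frame hJ h _ hx, star_conj, star_evalMat_laxQ, map_neg]
  · rw [curveLax_frame hJ h _ hx, hR, ← map_mul, ← map_mul]
    congr 1
    nth_rewrite 1 [← hp.2]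
    rw [mul_assoc, symmS_sq, mul_one]

theorem flowOperator_along (hJ : IsOpen J) (h : IsParallelFrame c J ψ u v) (l : ℕ) {x : ℝ}
    (hx : x ∈ J) : (flowOperator m l).along c x =
      ((-1 : ℝ) ^ l * (1 / √(chi m))) • curveLax c (2 * l) x := by
  have e : FreeAlgebra.lift ℝ (fun k => covJet c k x)
      (((-1 : ℝ) ^ l * (1 / √(chi m))) • jetLax m (2 * l)) =
      ((-1 : ℝ) ^ l * (1 / √(chi m))) • curveLax c (2 * l) x := map_smul _ _ _
  rw [flowOperator, jetOperator_along, jetVector_eq, e]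
  rw [e]
  exact (curveLax_parity hJ h l hx).1.smul _

theorem flowOperator_along_frame (hJ : IsOpen J) (h : IsParallelFrame c J ψ u v) (l : ℕ) {x : ℝ}
    (hx : x ∈ J) : (flowOperator m (l + 1)).along c x = conj (ψ x) ((1 / √(chi m)) •
      qm (evalJet u v x (hPar (hier m l)) + (1 / 2 : ℝ) • evalJet u v x (hier m l).1)
        fun j => -evalJet u v x ((hier m l).2 j)) := by
  have e1 : evalJet u v x (hPar (hier m l) + (1 / 2 : ℝ) • (hier m l).1) =
      evalJet u v x (hPar (hier m l)) + (1 / 2 : ℝ) • evalJet u v x (hier m l).1 := by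
    simp only [← evalHom_apply, map_add, map_smul]
  have e2 : ∀ j, evalJet u v x (-(hier m l).2 j) = -evalJet u v x ((hier m l).2 j) := fun j => by
    simp only [← evalHom_apply, map_neg]
  rw [flowOperator_along hJ h _ hx, curveLax_frame hJ h _ hx, show 2 * (l + 1) = 2 * l + 2 by ring,
    (evenForm l).2.2.2, map_smul (evalMat u v x), map_smul (conj (ψ x)), evalMat_qm, smul_smul,
    e1, funext e2, map_smul (conj (ψ x)), mul_right_comm, ← mul_pow]
  norm_num

theorem mul_sub_mul_smul {A : Type*} [Ring A] [Algebra ℝ A] (x y : A) (r : ℝ) :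
    x * (r • y) - (r • y) * x = r • (x * y - y * x) := by
  rw [mul_smul_comm, smul_mul_assoc, smul_sub]

/-- The term [γ_x, L] in the ambient derivative is exactly what the covariant derivative removes, so
only the bracket with the next Lax coefficient survives. -/
theorem covDeriv_flowOperator (hJ : IsOpen J) (hc : IsUnitSpeed c J)
    (h : IsParallelFrame c J ψ u v) (l : ℕ) {x : ℝ} (hx : x ∈ J) :
    covDeriv c ((flowOperator m l).along c) x = -((-1 : ℝ) ^ l) •
      (velocity c x * curveLax c (2 * l + 1) x - curveLax c (2 * l + 1) x * velocity c x) := by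
  have hd := (hasDerivAt_curveLax hJ h (2 * l) hx).const_smul ((-1 : ℝ) ^ l * (1 / √(chi m)))
  have he : (flowOperator m l).along c =ᶠ[𝓝 x]
      fun y => ((-1 : ℝ) ^ l * (1 / √(chi m))) • curveLax c (2 * l) y := by
    filter_upwards [hJ.mem_nhds hx] with y hy using flowOperator_along hJ h l hy
  rw [(covDeriv_eq (((hc.1.contDiffAt (hJ.mem_nhds hx)).differentiableAt (by simp)))
    (hd.congr_of_eventuallyEq he) (by
      filter_upwards [hJ.mem_nhds hx] with y hy
      rw [flowOperator_along hJ h l hy]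
      exact (curveLax_parity hJ h l hy).1.smul _)).2, flowOperator_along hJ h l hx,
    mul_sub_mul_smul, ← smul_sub, add_sub_cancel_right, smul_smul]
  congr 1
  field_simp [sqrt_chi_pos.ne']

/-- Cyclicity of the real trace, i.e. invariance of the Killing form. It accounts both for
non-stretching and for the conservation of |γ_t|. -/
theorem metric_comm_self (T W : Mat m) : metric (T * W - W * T) T = 0 := by
  have hre : ∀ X Y : Mat m, (X - Y).trace.re = X.trace.re - Y.trace.re := fun X Y => by
    rw [Matrix.trace_sub, Quaternion.re_sub]
  rw [metric, killing, sub_mul, hre, re_trace_mul_comm, ← mul_assoc, re_trace_mul_comm (T * T),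
    ← mul_assoc, sub_self, mul_zero, neg_zero]

theorem metric_smul_left (r : ℝ) (X Y : Mat m) : metric (r • X) Y = r * metric X Y := by
  rw [metric, metric, killing, killing, smul_mul_assoc, Matrix.trace_smul, Quaternion.re_smul,
    smul_eq_mul]
  ring

theorem flowOperator_nonstretching (hJ : IsOpenInterval J) (hc : IsUnitSpeed c J) (l : ℕ) {x : ℝ}
    (hx : x ∈ J) : metric (covDeriv c ((flowOperator m l).along c) x) (velocity c x) = 0 := by
  obtain ⟨ψ, u, v, h⟩ := hc.exists_parallelFrame hJ
  rw [covDeriv_flowOperator hJ.1 hc h l hx, metric_smul_left, metric_comm_self, mul_zero]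

/-- The generator of the frame evolution under the `(+l)`-flow. -/
def flowGenerator (l : ℕ) (c : ℝ → HP m) (x : ℝ) : Mat m :=
  (-1 : ℝ) ^ l • ((1 / √(chi m)) • curveLax c (2 * l) x + curveLax c (2 * l + 1) x)

/-- The generator of the frame evolution, in a parallel frame. -/
def flowMat (l : ℕ) (u : ℝ → ℍ) (v : ℝ → Fin m → ℍ) (x : ℝ) : Mat m :=
  (-1 : ℝ) ^ l • ((1 / √(chi m)) • evalMat u v x (laxQ m (2 * l)) +
    evalMat u v x (laxQ m (2 * l + 1)))

theorem flowGenerator_frame (hJ : IsOpen J) (h : IsParallelFrame c J ψ u v) (l : ℕ) {x : ℝ}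
    (hx : x ∈ J) : flowGenerator l c x = conj (ψ x) (flowMat l u v x) := by
  rw [flowGenerator, flowMat, curveLax_frame hJ h _ hx, curveLax_frame hJ h _ hx, map_smul, map_add,
    map_smul]

theorem mPart_flowMat (l : ℕ) (x : ℝ) : mPart (flowMat l u v x) =
    ((-1 : ℝ) ^ l * (1 / √(chi m))) • evalMat u v x (laxQ m (2 * l)) := by
  obtain ⟨h1, h2⟩ := parity_evalMat_laxQ (u := u) (v := v) x l
  rw [mPart, flowMat, mul_smul_comm, smul_mul_assoc, mul_add, add_mul, h2, mul_smul_comm,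
    smul_mul_assoc, h1, ← smul_sub, add_sub_add_right_eq_sub, smul_neg, sub_neg_eq_add, smul_comm,
    half_smul_add_self, smul_smul]

theorem star_flowMat (l : ℕ) (x : ℝ) : star (flowMat l u v x) = -flowMat l u v x := by
  rw [flowMat, star_smul_mat, star_add, star_smul_mat, star_evalMat_laxQ, star_evalMat_laxQ]
  simp only [smul_neg, ← neg_add]

theorem comm_of_commute {A : Type*} [Ring A] [Algebra ℝ A] {L Q R : A} (h : L * R = R * L)
    (r s : ℝ) : ((s * r) • Q) * R - R * ((s * r) • Q) =
      (s • (r • Q + L)) * R - R * (s • (r • Q + L)) := by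
  simp only [mul_smul_comm, smul_mul_assoc, mul_add, add_mul, h]
  module

theorem half_sub_half_neg {M : Type*} [AddCommGroup M] [Module ℝ M] (p h : M) :
    p + (1 / 2 : ℝ) • h - (p + (1 / 2 : ℝ) • -h) = h := by module

/-- V_x + [M, V] with the Lax equation inserted for consecutive coefficients Q, Q′, P. All brackets
with F = (u, v) cancel, and so do the two copies of r[E, Q′]. -/
theorem zeroCurvature_alg {A : Type*} [Ring A] [Algebra ℝ A] (E F Q Q' P : A) (r s : ℝ) :
    s • (r • (-(E * Q' - Q' * E) - (F * Q - Q * F)) + (-(E * P - P * E) - (F * Q' - Q' * F))) +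
      ((r • E + F) * (s • (r • Q + Q')) - (s • (r • Q + Q')) * (r • E + F)) =
    s • ((r * r) • (E * Q - Q * E) - (E * P - P * E)) := by
  simp only [mul_smul_comm, smul_mul_assoc, ← smul_sub, ← smul_add, mul_add, add_mul, smul_smul]
  module

/-- The two surviving brackets are with q_{2l+2} and q_{2l+4}. Since ad E annihilates h_∥, they are
multiples of h_(l) and h_(l+1); the factor χ⁻¹ is the square of the scale of e_x. -/
theorem hasDerivAt_flowMat (hJ : IsOpen J) (hu : ContDiffOn ℝ ∞ u J) (hv : ContDiffOn ℝ ∞ v J)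
    {x : ℝ} (hx : x ∈ J) (hre : (u x).re = 0) (l : ℕ) :
    ∃ V', HasDerivAt (flowMat (l + 1) u v) V' x ∧
      V' + (frameMat (u x) (v x) * flowMat (l + 1) u v x -
        flowMat (l + 1) u v x * frameMat (u x) (v x)) =
      qh (evalJet u v x (hier m (l + 1)).1 + (chi m)⁻¹ • evalJet u v x (hier m l).1)
        fun j => evalJet u v x ((hier m (l + 1)).2 j) +
          (chi m)⁻¹ • evalJet u v x ((hier m l).2 j) := by
  have hd := (((hasDerivAt_evalMat hJ hu hv hx (laxQ m (2 * (l + 1)))).const_smul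
    (1 / √(chi m))).add (hasDerivAt_evalMat hJ hu hv hx (laxQ m (2 * (l + 1) + 1)))).const_smul
      ((-1 : ℝ) ^ (l + 1))
  rw [evalMat_laxQ_map hre, evalMat_laxQ_map hre] at hd
  refine ⟨_, hd, ?_⟩
  have hE : ∀ k, qm 1 0 * evalMat u v x (laxQ m (2 * k + 2)) -
      evalMat u v x (laxQ m (2 * k + 2)) * qm 1 0 = (-1 : ℝ) ^ (k + 1) •
        qh (evalJet u v x (hier m k).1) fun j => evalJet u v x ((hier m k).2 j) := fun k => by
    obtain ⟨h1, h2, -, h3⟩ := evenForm (m := m) k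
    have e := congrArg (evalMat u v x) (E_qm (hPar (hier m k) + (1 / 2 : ℝ) • (hier m k).1)
      fun j => -(hier m k).2 j)
    rw [h3, map_smul, mul_sub_mul_smul]
    congr 1
    rw [map_sub, map_mul, map_mul, evalMat_qm_one, evalMat_qh, star_add, Quaternion.star_smul, h1,
      h2] at e
    rw [e]
    have e1 : hPar (hier m k) + (1 / 2 : ℝ) • (hier m k).1 -
        (hPar (hier m k) + (1 / 2 : ℝ) • -(hier m k).1) = (hier m k).1 :=
      half_sub_half_neg _ _
    rw [e1]
    simp only [neg_neg]
  have hs : (1 / √(chi m)) * (1 / √(chi m)) = (chi m)⁻¹ := by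
    rw [← mul_div_mul_comm, Real.mul_self_sqrt chi_pos.le, one_mul, one_div]
  have key := zeroCurvature_alg (qm 1 0) (qh (u x) (v x)) (evalMat u v x (laxQ m (2 * (l + 1))))
    (evalMat u v x (laxQ m (2 * (l + 1) + 1))) (evalMat u v x (laxQ m (2 * (l + 1) + 1 + 1)))
    (1 / √(chi m)) ((-1 : ℝ) ^ (l + 1))
  refine key.trans ?_
  have a1 := hE l
  have a2 := hE (l + 1)
  rw [show 2 * l + 2 = 2 * (l + 1) by ring] at a1
  rw [show 2 * (l + 1) + 2 = 2 * (l + 1) + 1 + 1 by ring] at a2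
  have s0 : (-1 : ℝ) ^ (l + 1) * (-1 : ℝ) ^ (l + 1) = 1 := by rw [← mul_pow]; norm_num
  have s1 : (-1 : ℝ) ^ (l + 1) * (chi m)⁻¹ * (-1 : ℝ) ^ (l + 1) = (chi m)⁻¹ := by
    rw [mul_right_comm, s0, one_mul]
  have s2 : (-1 : ℝ) ^ (l + 1) * (-1 : ℝ) ^ (l + 1 + 1) = -1 := by
    rw [pow_succ _ (l + 1), ← mul_assoc, s0, one_mul]
  rw [a1, a2, hs, smul_sub, smul_smul, smul_smul, smul_smul, s1, s2, neg_one_smul, sub_neg_eq_add,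
    qh_smul, qh_add]
  congr 1
  · exact add_comm _ _
  · exact funext fun j => add_comm _ _

variable {I : Set ℝ} {γ : ℝ → ℝ → HP m}

theorem smooth2_flowMat {l : ℕ} (hI : IsOpen I) (hJ : IsOpen J) {u : ℝ → ℝ → ℍ}
    {v : ℝ → ℝ → Fin m → ℍ} (hu : Smooth2 I J u) (hv : Smooth2 I J v) :
    Smooth2 I J fun t => flowMat l (u t) (v t) :=
  (((smooth2_evalMat hI hJ hu hv _).const_smul _).add (smooth2_evalMat hI hJ hu hv _)).const_smul _

theorem smooth2_flowGenerator (hI : IsOpen I) (hJ : IsOpen J)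
    (h : Smooth2 I J fun t x => reflection (γ t x)) (l : ℕ) :
    Smooth2 I J fun t => flowGenerator l (γ t) := by
  have hL : ∀ k, Smooth2 I J fun t => curveLax (γ t) k := fun k =>
    contDiffOn_lift (X := fun q : ℝ × ℝ => fun j => covJet (γ q.1) j q.2)
      (fun j => smooth2_covJet hI hJ h j) (jetLax m k)
  exact (((hL _).const_smul _).add (hL _)).const_smul _

theorem covDeriv_congr {V W : ℝ → Mat m} {x : ℝ} (h : V =ᶠ[𝓝 x] W) :
    covDeriv c V x = covDeriv c W x := by
  have e : deriv V x = deriv W x := h.deriv_eq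
  rw [covDeriv, covDeriv, e]

-- The generator is a polynomial in the jets of the curve, hence available before any time-dependent
-- frame is chosen. Once `exists_flow_frame` has produced the frame, its time evolution is ψV with V
-- = `flowMat`, and zero curvature reads off the (+l)-flow.
set_option maxHeartbeats 1000000 in
theorem IsCurveFlow.exists_frame (hI : IsOpenInterval I) (hJ : IsOpenInterval J) {l : ℕ}
    (h : IsCurveFlow (flowOperator m (l + 1)) γ I J) :
    ∃ ψ u v, IsParallelFlowFrame γ I J ψ u v ∧ IsHierarchyFlow (l + 1) I J u v := by
  have hR : Smooth2 I J fun t x => reflection (γ t x) := h.1.1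
  have hN := smooth2_flowGenerator hI.1 hJ.1 hR (l + 1)
  have hfr : ∀ t ∈ I, ∃ ψ u v, IsParallelFrame (γ t) J ψ u v := fun t ht =>
    (h.1.isUnitSpeed ht).exists_parallelFrame hJ
  have hY : ∀ t ∈ I, ∀ x ∈ J, velocity (fun s => γ s x) t =
      ((-1 : ℝ) ^ (l + 1) * (1 / √(chi m))) • curveLax (γ t) (2 * (l + 1)) x :=
    fun t ht x hx => by
      obtain ⟨ψ, u, v, hψ⟩ := hfr t ht
      rw [h.2 t ht x hx, flowOperator_along hJ.1 hψ _ hx]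
  obtain ⟨ψ, u, v, hψ, hu, hv, hψt⟩ := exists_flow_frame hI hJ h.1 hN
    (fun t ht x hx => by
      obtain ⟨ψ, u, v, hψ⟩ := hfr t ht
      rw [flowGenerator_frame hJ.1 hψ _ hx, star_conj, star_flowMat, map_neg])
    (fun t ht x hx => by
      obtain ⟨ψ, u, v, hψ⟩ := hfr t ht
      have h1 := (velocity_spec (c := fun s => γ s x) (s := t)
        (hR.hasDerivAt_fst hI.1 hJ.1 ht hx).differentiableAt).2
      refine h1.congr_deriv ?_
      have h2 := (curveLax_parity hJ.1 hψ (l + 1) hx).2.2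
      rw [hY t ht x hx, flowGenerator]
      exact comm_of_commute h2 _ _)
    -- Torsion-freeness gives T_t = ∇_xγ_t + [γ_t, T]; here ∇_xγ_t is the bracket of the 𝔥-part of
    -- the generator with T.
    (fun t ht x hx => by
      obtain ⟨ψ, u, v, hψ⟩ := hfr t ht
      refine (torsion_free hI.1 hJ.1 hR ht hx).congr_deriv ?_
      have h1 := covDeriv_flowOperator hJ.1 (h.1.isUnitSpeed ht) hψ (l + 1) hx
      have h2 : (fun y => velocity (fun s => γ s y) t) =ᶠ[𝓝 x]
          (flowOperator m (l + 1)).along (γ t) := by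
        filter_upwards [hJ.1.mem_nhds hx] with y hy using h.2 t ht y hy
      rw [covDeriv_congr h2, h1, hY t ht x hx, flowGenerator]
      simp only [smul_add, smul_smul, add_mul, mul_add, smul_mul_assoc, mul_smul_comm, smul_sub]
      module)
    -- By `hasDerivAt_curveLax` the derivative of every Lax coefficient is a bracket with T.
    (fun t ht x hx => by
      obtain ⟨ψ, u, v, hψ⟩ := hfr t ht
      have h1 := (((hasDerivAt_curveLax hJ.1 hψ (2 * (l + 1)) hx).const_smul (1 / √(chi m))).add
        (hasDerivAt_curveLax hJ.1 hψ (2 * (l + 1) + 1) hx)).const_smul ((-1 : ℝ) ^ (l + 1))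
      have h2 : deriv (flowGenerator (l + 1) (γ t)) x = _ := h1.deriv
      refine ⟨(-1 : ℝ) ^ (l + 1) • ((1 / √(chi m)) • curveLax (γ t) (2 * (l + 1)) x -
        √(chi m) • curveLax (γ t) (2 * (l + 1) + 1 + 1) x), ?_⟩
      have h3 : (1 / √(chi m)) * (-√(chi m)) = -1 := by
        rw [mul_neg, one_div_mul_cancel sqrt_chi_pos.ne']
      rw [h2, smul_add (1 / √(chi m)), smul_smul, h3]
      simp only [smul_add, smul_smul, mul_sub, sub_mul, smul_mul_assoc, mul_smul_comm, smul_sub]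
      module)
  refine ⟨ψ, u, v, hψ, hu, hv, fun t ht x hx => ?_⟩
  have hut := hu.right ht
  have hvt := hv.right ht
  obtain ⟨-, hre, -, -⟩ := (hψ.2 t ht).2 x hx
  obtain ⟨V', h1, h2⟩ := hasDerivAt_flowMat hJ.1 hut hvt hx hre l
  have hV : Smooth2 I J fun t => flowMat (l + 1) (u t) (v t) :=
    smooth2_flowMat hI.1 hJ.1 hu hv
  have h3 : deriv (flowMat (l + 1) (u t) (v t)) x = V' := h1.deriv
  rw [← h3] at h2
  exact ⟨hre, hψ.evolution hI.1 hJ.1 hu hv hV (fun t ht x hx => by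
    have h4 := hψt t ht x hx
    rwa [flowGenerator_frame hJ.1 (hψ.2 t ht) _ hx, conj_apply, mul_assoc _ (star _),
      (ψ t x).star_mul, mul_one] at h4) ht hx h2⟩

/-- The (+l)-flow is precisely the zero curvature condition, so the frame can be integrated; the
𝔪-part of the generator is Y in that frame. -/
theorem IsHierarchyFlow.exists_curveFlow (hI : IsOpenInterval I) (hJ : IsOpenInterval J) {l : ℕ}
    {u : ℝ → ℝ → ℍ} {v : ℝ → ℝ → Fin m → ℍ} (h : IsHierarchyFlow (l + 1) I J u v) :
    ∃ γ ψ, IsCurveFlow (flowOperator m (l + 1)) γ I J ∧ IsParallelFlowFrame γ I J ψ u v := by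
  have hu : Smooth2 I J u := h.1
  have hv : Smooth2 I J v := h.2.1
  obtain ⟨γ, ψ, h1, h2, h3⟩ := exists_flow_of_covariants hI hJ hu hv
    (fun t ht x hx => (h.2.2 t ht x hx).1) (smooth2_flowMat (l := l + 1) hI.1 hJ.1 hu hv)
    (fun t _ x _ => star_flowMat (l + 1) x)
    (fun t ht x hx => by
      obtain ⟨hre, e1, e2⟩ := h.2.2 t ht x hx
      obtain ⟨V', d1, d2⟩ := hasDerivAt_flowMat hJ.1 (hu.right ht) (hv.right ht) hx hre l
      have d3 : deriv (flowMat (l + 1) (u t) (v t)) x = V' := d1.deriv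
      rw [d3, d2, e1, funext e2]
      rfl)
  refine ⟨γ, ψ, ⟨h1, fun t ht x hx => ?_⟩, h2⟩
  rw [h3 t ht x hx, mPart_flowMat, map_smul, ← curveLax_frame hJ.1 (h2.2 t ht) _ hx,
    flowOperator_along hJ.1 (h2.2 t ht) _ hx]

end CurveFlows

/-! ### The wave map -/

section WaveMaps

open Set Filter Topology

variable {m : ℕ}

theorem symplectic_scalar_eq (u h h' : ℍ) (p p' : ℝ) (v k : Fin m → ℍ) :
    (p' : ℍ) + (1 / 2 : ℝ) • h' + (u * ((p : ℍ) + (1 / 2 : ℝ) • h) +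
      ((p : ℍ) + (1 / 2 : ℝ) • h) * u - herm k v) =
    ((p' : ℍ) - hParDeriv u v h k) + (2 : ℝ) • symplS u v k h' p := by
  have hc : u * (p : ℍ) = p * u := (Quaternion.coe_commutes p u).symm
  rw [hParDeriv, symplS, acomm, acommV, commV]
  simp only [mul_add, add_mul, hc, mul_smul_comm, smul_mul_assoc]
  generalize (p : ℍ) * u = a
  generalize u * h = b
  generalize h * u = c
  module

/-- The left side is y_x + [ω, y] for y = (p + ½h, −k). Its scalar entry splits into a self-adjoint
part, the equation for h_∥, and a skew part, twice the scalar part of 𝒥; these vanish separately. -/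
theorem symplectic_iff {u h h' : ℍ} (hu : star u = -u) (hh : star h = -h) (hh' : star h' = -h')
    (p p' : ℝ) (v k k' : Fin m → ℍ) :
    (qm ((p' : ℍ) + (1 / 2 : ℝ) • h') (fun j => -k' j) : Mat m) +
      (qh u v * qm ((p : ℍ) + (1 / 2 : ℝ) • h) (fun j => -k j) -
        qm ((p : ℍ) + (1 / 2 : ℝ) • h) (fun j => -k j) * qh u v) = 0 ↔
    (p' : ℍ) = hParDeriv u v h k ∧ symplS u v k h' p = 0 ∧ symplV u v h k k' p = 0 := by
  have hA : star ((p' : ℍ) - hParDeriv u v h k) = (p' : ℍ) - hParDeriv u v h k := by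
    rw [hParDeriv, acomm, acommV]
    simp only [star_sub, star_neg, Quaternion.star_smul, star_add, star_mul, hu, hh, star_herm,
      neg_mul_neg, Quaternion.star_coe]
    rw [add_comm (h * u), add_comm (herm k v)]
  have hB : star (symplS u v k h' p) = -symplS u v k h' p := by
    have hc : u * (p : ℍ) = p * u := (Quaternion.coe_commutes p u).symm
    rw [symplS, commV]
    simp only [star_sub, star_neg, Quaternion.star_smul, star_add, star_mul, hu, hh', star_herm,
      Quaternion.star_coe, neg_mul, hc]
    module
  have hV : (∀ j, -k' j + (u * -k j - ((p : ℍ) + (1 / 2 : ℝ) • h) * v j) = 0) ↔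
      symplV u v h k k' p = 0 := by
    rw [funext_iff]
    refine forall_congr' fun j => ?_
    rw [← neg_eq_zero, symplV, Pi.zero_apply]
    have : -(-k' j + (u * -k j - ((p : ℍ) + (1 / 2 : ℝ) • h) * v j)) =
        k' j + (1 / 2 : ℝ) • (h * v j) + u * k j + p * v j := by
      rw [add_mul, smul_mul_assoc, mul_neg]
      abel
    rw [this]
  have hz : (qm 0 (fun _ => 0) : Mat m) = 0 := by
    have := qm_smul (0 : ℝ) (0 : ℍ) (fun _ : Fin m => (0 : ℍ))
    simpa using this.symm
  rw [qh_qm hu, qm_add, herm_neg_left, ← sub_eq_add_neg, symplectic_scalar_eq]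
  constructor
  · intro e
    rw [← hz] at e
    obtain ⟨e1, e2⟩ := qm_inj e
    have e3 := congrArg star e1
    rw [star_add, Quaternion.star_smul, hA, hB, star_zero, smul_neg, ← sub_eq_add_neg] at e3
    have e4 : (p' : ℍ) - hParDeriv u v h k = 0 := by
      have e5 := half_smul_add_self ((p' : ℍ) - hParDeriv u v h k)
      rw [← e5, smul_eq_zero]
      right
      have := congrArg₂ (· + ·) e1 e3
      simp only [add_add_sub_cancel, add_zero] at this
      exact this
    rw [e4, zero_add] at e1
    exact ⟨sub_eq_zero.1 e4, (smul_eq_zero.1 e1).resolve_left two_ne_zero,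
      hV.1 fun j => congrFun e2 j⟩
  · rintro ⟨e1, e2, e3⟩
    rw [sub_eq_zero.2 e1, e2, funext (hV.2 e3), smul_zero, add_zero, hz]

/-- The frame matrix of the wave map equation. -/
def waveMat (h : ℍ) (k : Fin m → ℍ) (p : ℝ) : Mat m :=
  (1 / √(chi m)) • qm ((p : ℍ) + (1 / 2 : ℝ) • h) fun j => -k j

theorem one_div_sqrt_chi_sq : (1 / √(chi m)) * (1 / √(chi m)) = (chi m)⁻¹ := by
  rw [← mul_div_mul_comm, Real.mul_self_sqrt chi_pos.le, one_mul, one_div]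

theorem add_comm_smul {A : Type*} [Ring A] [Algebra ℝ A] (E F Q : A) (r : ℝ) :
    (r • E + F) * (r • Q) - (r • Q) * (r • E + F) =
      (r * r) • (E * Q - Q * E) + (F * (r • Q) - (r • Q) * F) := by
  simp only [add_mul, mul_add, smul_mul_assoc, mul_smul_comm, smul_sub, smul_smul]
  module

/-- The bracket with χ^{-1/2}E is χ⁻¹(h, k), the right side of the −1 flow; what remains is the
connection term of the covariant derivative. -/
theorem frameMat_comm_waveMat {u h : ℍ} (hh : star h = -h) (v k : Fin m → ℍ) (p : ℝ) :
    frameMat u v * waveMat h k p - waveMat h k p * frameMat u v =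
      (qh ((chi m)⁻¹ • h) fun j => (chi m)⁻¹ • k j) +
      (qh u v * waveMat h k p - waveMat h k p * qh u v) := by
  have hE := E_qm ((p : ℍ) + (1 / 2 : ℝ) • h) fun j => -k j
  rw [star_add, Quaternion.star_smul, Quaternion.star_coe, hh, half_sub_half_neg] at hE
  simp only [neg_neg] at hE
  rw [← qh_smul, ← hE, ← one_div_sqrt_chi_sq, frameMat, waveMat]
  exact add_comm_smul _ _ _ _

theorem hasDerivAt_waveMat {h : ℝ → ℍ} {k : ℝ → Fin m → ℍ} {p : ℝ → ℝ} {h' : ℍ} {k' : Fin m → ℍ}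
    {p' : ℝ} {s : ℝ} (hh : HasDerivAt h h' s) (hk : ∀ j, HasDerivAt (fun r => k r j) (k' j) s)
    (hp : HasDerivAt p p' s) :
    HasDerivAt (fun r => waveMat (h r) (k r) (p r)) (waveMat h' k' p') s := by
  have hp' : HasDerivAt (fun r => (p r : ℍ)) (p' : ℍ) s := by
    simp only [coe_smul_one]
    exact hp.smul_const (1 : ℍ)
  exact HasDerivAt.const_smul (1 / √(chi m))
    (hasDerivAt_qm (hp'.add (hh.const_smul (1 / 2 : ℝ))) fun j => (hk j).neg)

theorem qh_comm_waveMat_eq_zero {u h h' : ℍ} (hu : star u = -u) (hh : star h = -h)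
    (hh' : star h' = -h') (p p' : ℝ) (v k k' : Fin m → ℍ) :
    waveMat h' k' p' + (qh u v * waveMat h k p - waveMat h k p * qh u v) = 0 ↔
    (p' : ℍ) = hParDeriv u v h k ∧ symplS u v k h' p = 0 ∧ symplV u v h k k' p = 0 := by
  rw [← symplectic_iff hu hh hh', waveMat, waveMat, mul_sub_mul_smul, ← smul_add, smul_eq_zero]
  exact or_iff_right (one_div_ne_zero sqrt_chi_pos.ne')

variable {I J : Set ℝ} {γ : ℝ → ℝ → HP m}

theorem smooth2_waveMat {h : ℝ → ℝ → ℍ} {k : ℝ → ℝ → Fin m → ℍ} {p : ℝ → ℝ → ℝ}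
    (hh : Smooth2 I J h) (hk : Smooth2 I J k) (hp : Smooth2 I J p) :
    Smooth2 I J fun t x => waveMat (h t x) (k t x) (p t x) := by
  have hp' : Smooth2 I J fun t x => (p t x : ℍ) := by
    simp only [coe_smul_one]
    exact ContDiffOn.smul hp (contDiffOn_const (c := (1 : ℍ)))
  have hk' : Smooth2 I J fun t x j => -k t x j := ContDiffOn.neg hk
  have hh' : Smooth2 I J fun t x => (p t x : ℍ) + (1 / 2 : ℝ) • h t x :=
    ContDiffOn.add hp' (ContDiffOn.const_smul (1 / 2 : ℝ) hh)
  exact (smooth2_qm hh' hk').const_smul _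

theorem hasDerivAt_imaginary (hJ : IsOpen J) {f : ℝ → ℍ} {f' : ℍ} {x : ℝ}
    (hf : ∀ y ∈ J, (f y).re = 0) (hx : x ∈ J) (hd : HasDerivAt f f' x) : star f' = -f' := by
  have h1 := (coordL 0).hasFDerivAt.comp_hasDerivAt x hd
  have h2 : (fun y => (coordL 0) (f y)) =ᶠ[𝓝 x] fun _ => (0 : ℝ) := by
    filter_upwards [hJ.mem_nhds hx] with y hy using hf y hy
  exact star_eq_neg_of_re (h1.unique ((hasDerivAt_const x (0 : ℝ)).congr_of_eventuallyEq h2))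

/-- With a generator lying in 𝔪, the equation 𝒥(h, k) = 0 cancels V_x against the connection term,
and zero curvature reduces to (u, v)_t = χ⁻¹(h, k). -/
theorem exists_waveMap (hI : IsOpenInterval I) (hJ : IsOpenInterval J) {u : ℝ → ℝ → ℍ}
    {v : ℝ → ℝ → Fin m → ℍ} {h : ℝ → ℝ → ℍ} {k : ℝ → ℝ → Fin m → ℍ} {p : ℝ → ℝ → ℝ}
    (H : IsMinusOneFlow I J u v h k p) :
    ∃ γ ψ, IsWaveMap γ I J ∧ IsParallelFlowFrame γ I J ψ u v ∧
      ∀ t ∈ I, ∀ x ∈ J, coframe (ψ t x) (velocity (fun s => γ s x) t) =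
        (1 / √(chi m)) • mMat ((p t x : ℍ) + (1 / 2 : ℝ) • h t x) (fun j => -k t x j) := by
  obtain ⟨hu, hv, hh, hk, hp, H⟩ := H
  have hu : Smooth2 I J u := hu
  have hv : Smooth2 I J v := hv
  have hh : Smooth2 I J h := hh
  have hk : Smooth2 I J k := hk
  have hp : Smooth2 I J p := hp
  have hdV : ∀ t ∈ I, ∀ x ∈ J, HasDerivAt (fun y => waveMat (h t y) (k t y) (p t y))
      (waveMat (deriv (fun y => h t y) x) (fun j => deriv (fun y => k t y j) x)
        (deriv (fun y => p t y) x)) x := fun t ht x hx =>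
    hasDerivAt_waveMat (hh.hasDerivAt_snd hI.1 hJ.1 ht hx)
      (fun j => (hk.component j).hasDerivAt_snd hI.1 hJ.1 ht hx)
      (hp.hasDerivAt_snd hI.1 hJ.1 ht hx)
  have hwave : ∀ t ∈ I, ∀ x ∈ J, waveMat (deriv (fun y => h t y) x)
      (fun j => deriv (fun y => k t y j) x) (deriv (fun y => p t y) x) +
      (qh (u t x) (v t x) * waveMat (h t x) (k t x) (p t x) -
        waveMat (h t x) (k t x) (p t x) * qh (u t x) (v t x)) = 0 := fun t ht x hx => by
    obtain ⟨h1, h2, h3, h4, h5, -, -⟩ := H t ht x hx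
    refine (qh_comm_waveMat_eq_zero (star_eq_neg_of_re h1) (star_eq_neg_of_re h2) ?_ _ _ _ _ _).2
      ⟨h3, h4, h5⟩
    have e1 := hasDerivAt_imaginary hJ.1 (fun y hy => (H t ht y hy).2.1) hx
      (hh.hasDerivAt_snd hI.1 hJ.1 ht hx)
    exact e1
  obtain ⟨γ, ψ, h1, h2, h3⟩ := exists_flow_of_covariants hI hJ hu hv
    (fun t ht x hx => (H t ht x hx).1) (smooth2_waveMat hh hk hp)
    (fun t _ x _ => by rw [waveMat, star_smul_mat, star_qm, smul_neg])
    (fun t ht x hx => by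
      obtain ⟨-, g2, -, -, -, g6, g7⟩ := H t ht x hx
      have d : deriv (fun y => waveMat (h t y) (k t y) (p t y)) x = _ := (hdV t ht x hx).deriv
      rw [d, frameMat_comm_waveMat (star_eq_neg_of_re g2), add_left_comm, hwave t ht x hx, add_zero,
        g6, funext g7])
  have hpar : ∀ t x, symmS m * waveMat (h t x) (k t x) (p t x) * symmS m =
      -waveMat (h t x) (k t x) (p t x) := fun t x => by
    rw [waveMat, mul_smul_comm, smul_mul_assoc, symmS_eq, qS_qm, smul_neg]
  have hm : ∀ t x, mPart (waveMat (h t x) (k t x) (p t x)) = waveMat (h t x) (k t x) (p t x) :=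
    fun t x => by rw [mPart, hpar, sub_neg_eq_add, half_smul_add_self]
  refine ⟨γ, ψ, ⟨h1, fun t ht x hx => ?_⟩, h2, fun t ht x hx => ?_⟩
  · have hψ := (h2.2 t ht).hasDerivAt hJ.1 hx
    rw [covDeriv_of_lift hψ ((h2.2 t ht).2 x hx).1 (hdV t ht x hx) (hpar t) (by
      filter_upwards [hJ.1.mem_nhds hx] with y hy
      rw [h3 t ht y hy, hm, conj_apply]), (ψ t x).star_mul_cancel, frameMat,
      (mPart_qm_add_qh _ _ _ _ _).2, Ring.lie_def, hwave t ht x hx, mul_zero, zero_mul]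
  · rw [h3 t ht x hx, hm, coframe_conj, waveMat, mMat_eq]

theorem smul_components (a : ℍ) : (1 / √(chi m)) • (((√(chi m) * a.re : ℝ) : ℍ) +
    (1 / 2 : ℝ) • (√(chi m) • (a - star a))) = a := by
  have hc := (sqrt_chi_pos (m := m)).ne'
  apply Quaternion.ext <;> simp <;> field_simp <;> ring

theorem lax_of_frame {A : Type*} [Ring A] {P S : A} (h : S * P = 1) (Y e F : A) :
    (-(e + F) * S * Y + S * (P * e * S * Y - Y * (P * e * S))) * P + S * Y * (P * (e + F)) =
      -(F * (S * Y * P) - (S * Y * P) * F) := by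
  have h' : ∀ z, S * (P * z) = z := fun z => by rw [← mul_assoc, h, one_mul]
  simp only [mul_add, add_mul, mul_sub, sub_mul, neg_mul, mul_assoc, h, h', mul_one]
  abel

theorem hasDerivAt_metric {X Y : ℝ → Mat m} {X' Y' : Mat m} {s : ℝ} (hX : HasDerivAt X X' s)
    (hY : HasDerivAt Y Y' s) :
    HasDerivAt (fun r => metric (X r) (Y r)) (metric X' (Y s) + metric (X s) Y') s := by
  let L : Mat m →ₗ[ℝ] ℝ :=
    { toFun := fun Z => -(4 * ((m : ℝ) + 3) * Z.trace.re)
      map_add' := fun Z W => by rw [Matrix.trace_add, Quaternion.re_add]; ring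
      map_smul' := fun r Z => by
        rw [Matrix.trace_smul, Quaternion.re_smul, RingHom.id_apply, smul_eq_mul, smul_eq_mul]
        ring }
  have h := L.toContinuousLinearMap.hasFDerivAt.comp_hasDerivAt s (hasDerivAt_mul hX hY)
  exact h.congr_deriv (L.map_add (X' * Y s) (X s * Y'))

/-- In ambient terms the wave map equation leaves only the bracket [γ_x, γ_t] in the x-derivative of
γ_t. -/
theorem IsWaveMap.velocity_spec (hI : IsOpen I) (hJ : IsOpen J) (h : IsWaveMap γ I J) {t x : ℝ}
    (ht : t ∈ I) (hx : x ∈ J) : IsTangent (γ t x) (velocity (fun s => γ s x) t) ∧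
      HasDerivAt (fun y => velocity (fun s => γ s y) t)
        (velocity (γ t) x * velocity (fun s => γ s x) t -
          velocity (fun s => γ s x) t * velocity (γ t) x) x := by
  have hR : Smooth2 I J fun t x => reflection (γ t x) := h.1.1
  have hT : ∀ y ∈ J, IsTangent (γ t y) (velocity (fun s => γ s y) t) := fun y hy =>
    (QuatFlow.velocity_spec (c := fun s => γ s y)
      (hR.hasDerivAt_fst hI hJ ht hy).differentiableAt).1
  have hd := (smooth2_velocity_fst hI hJ hR).hasDerivAt_snd hI hJ ht hx
  have h1 := (covDeriv_eq (hR.hasDerivAt_snd hI hJ ht hx).differentiableAt hd (by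
    filter_upwards [hJ.mem_nhds hx] with y hy using hT y hy)).2
  rw [h.2 t ht x hx] at h1
  exact ⟨hT x hx, hd.congr_deriv (sub_eq_zero.1 h1.symm)⟩

-- Here γ_t itself is the generator: torsion-freeness and ∇_xγ_t = 0 give T_t = [γ_t, T], and its
-- x-derivative is a bracket with T. The functions h, k and p are read off from the first row of
-- ψ*γ_tψ.
set_option maxHeartbeats 1000000 in
theorem IsWaveMap.exists_frame (hI : IsOpenInterval I) (hJ : IsOpenInterval J)
    (H : IsWaveMap γ I J) :
    ∃ ψ u v h k p, IsParallelFlowFrame γ I J ψ u v ∧ IsMinusOneFlow I J u v h k p ∧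
      ∀ t ∈ I, ∀ x ∈ J, coframe (ψ t x) (velocity (fun s => γ s x) t) =
        (1 / √(chi m)) • mMat ((p t x : ℍ) + (1 / 2 : ℝ) • h t x) (fun j => -k t x j) := by
  have hR : Smooth2 I J fun t x => reflection (γ t x) := H.1.1
  set Y : ℝ → ℝ → Mat m := fun t x => velocity (fun s => γ s x) t with hYdef
  have hY : Smooth2 I J Y := smooth2_velocity_fst hI.1 hJ.1 hR
  have hYt : ∀ t ∈ I, ∀ x ∈ J, IsTangent (γ t x) (Y t x) := fun t ht x hx =>
    (H.velocity_spec hI.1 hJ.1 ht hx).1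
  have hYx : ∀ t ∈ I, ∀ x ∈ J, HasDerivAt (Y t)
      (velocity (γ t) x * Y t x - Y t x * velocity (γ t) x) x := fun t ht x hx =>
    (H.velocity_spec hI.1 hJ.1 ht hx).2
  obtain ⟨ψ, u, v, hψ, hu, hv, hψt⟩ := exists_flow_frame hI hJ H.1 hY
    (fun t ht x hx => (hYt t ht x hx).1)
    (fun t ht x hx => (QuatFlow.velocity_spec (c := fun s => γ s x)
      (hR.hasDerivAt_fst hI.1 hJ.1 ht hx).differentiableAt).2)
    (fun t ht x hx => by
      have h := torsion_free hI.1 hJ.1 hR ht hx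
      rw [H.2 t ht x hx, zero_add] at h
      exact h)
    (fun t ht x hx => ⟨Y t x, (hYx t ht x hx).deriv⟩)
  have hψs : Smooth2 I J fun t x => (ψ t x : Mat m) := hψ.1
  have hc := sqrt_chi_pos (m := m)
  set V : ℝ → ℝ → Mat m := fun t x => star (ψ t x : Mat m) * Y t x * ψ t x with hVdef
  have hV : Smooth2 I J V := (hψs.star.mul hY).mul hψs
  set h : ℝ → ℝ → ℍ := fun t x => √(chi m) • (V t x 0 1 - star (V t x 0 1)) with hh
  set k : ℝ → ℝ → Fin m → ℍ := fun t x j => -(√(chi m) • V t x 0 j.succ.succ) with hk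
  set p : ℝ → ℝ → ℝ := fun t x => √(chi m) * (V t x 0 1).re with hp
  have hVw : ∀ t ∈ I, ∀ x ∈ J, V t x = waveMat (h t x) (k t x) (p t x) := fun t ht x hx => by
    have h1 := hYt t ht x hx
    rw [((hψ.2 t ht).2 x hx).1] at h1
    obtain ⟨a, b, hab⟩ := isTangent_mk.1 h1
    have h2 : V t x = qm a b := by
      have := coframe_conj (ψ t x) (qm a b)
      rw [← hab] at this
      exact this
    have ha : V t x 0 1 = a := by rw [h2]; rfl
    simp only [hh, hk, hp]
    rw [ha, waveMat, qm_smul, smul_components, h2]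
    congr 1
    funext j
    change b j = (1 / √(chi m)) • -(-(√(chi m) • b j))
    rw [neg_neg, smul_smul, one_div_mul_cancel hc.ne', one_smul]
  have hhs : Smooth2 I J h := ContDiffOn.const_smul (√(chi m))
    (ContDiffOn.sub (hV.entry 0 1) (hV.star.entry 1 0))
  have hks : Smooth2 I J k := smooth2_pi fun j =>
    ContDiffOn.neg (ContDiffOn.const_smul (√(chi m)) (hV.entry 0 j.succ.succ))
  have hps : Smooth2 I J p := ContDiffOn.const_smul (√(chi m))
    ((coordL 0).contDiff.comp_contDiffOn (n := ∞) (hV.entry 0 1))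
  have hre : ∀ t x, (h t x).re = 0 := fun t x => by simp [hh]
  have hVx : ∀ t ∈ I, ∀ x ∈ J, HasDerivAt (V t)
      (-(qh (u t x) (v t x) * V t x - V t x * qh (u t x) (v t x))) x := fun t ht x hx => by
    have d1 := (hψ.2 t ht).hasDerivAt hJ.1 hx
    have d2 := hasDerivAt_mul (hasDerivAt_mul (hasDerivAt_star d1) (hYx t ht x hx)) d1
    refine d2.congr_deriv ?_
    rw [velocity_frame hJ.1 (hψ.2 t ht) hx, StarMul.star_mul,
      star_frameMat ((hψ.2 t ht).star_u hx), conj_apply]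
    exact lax_of_frame (ψ t x).star_mul _ _ _
  have hwx : ∀ t ∈ I, ∀ x ∈ J, HasDerivAt (V t) (waveMat (deriv (fun y => h t y) x)
      (fun j => deriv (fun y => k t y j) x) (deriv (fun y => p t y) x)) x := fun t ht x hx => by
    refine HasDerivAt.congr_of_eventuallyEq (hasDerivAt_waveMat
      (hhs.hasDerivAt_snd hI.1 hJ.1 ht hx)
      (fun j => (hks.component j).hasDerivAt_snd hI.1 hJ.1 ht hx)
      (hps.hasDerivAt_snd hI.1 hJ.1 ht hx)) ?_
    filter_upwards [hJ.1.mem_nhds hx] with y hy using hVw t ht y hy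
  refine ⟨ψ, u, v, h, k, p, hψ, ⟨hu, hv, hhs, hks, hps, fun t ht x hx => ?_⟩, fun t ht x hx => ?_⟩
  · have hus := (hψ.2 t ht).star_u hx
    have hhst := star_eq_neg_of_re (hre t x)
    have e := (hwx t ht x hx).unique (hVx t ht x hx)
    rw [hVw t ht x hx] at e
    obtain ⟨e1, e2, e3⟩ := (qh_comm_waveMat_eq_zero hus hhst
      (hasDerivAt_imaginary hJ.1 (fun y _ => hre t y) hx (hhs.hasDerivAt_snd hI.1 hJ.1 ht hx))
      _ _ _ _ _).1 (by rw [e, neg_add_cancel])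
    have hVd : deriv (V t) x = _ := (hVx t ht x hx).deriv
    obtain ⟨f1, f2⟩ := hψ.evolution hI.1 hJ.1 hu hv hV (fun t ht x hx => by
      have h4 := hψt t ht x hx
      simp only [hVdef]
      rwa [mul_assoc (star _), (ψ t x).mul_star_cancel]) ht hx
      (a := (chi m)⁻¹ • h t x) (b := fun j => (chi m)⁻¹ • k t x j) (by
        rw [hVd, hVw t ht x hx, frameMat_comm_waveMat hhst]
        abel)
    exact ⟨((hψ.2 t ht).2 x hx).2.1, hre t x, e1, e2, e3, f1, f2⟩
  · have := hVw t ht x hx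
    rw [waveMat, ← mMat_eq] at this
    exact this

/-- The wave map equation conserves `|γ_t|`. -/
theorem IsWaveMap.metric_eq (hI : IsOpen I) (hJ : IsOpenInterval J) (h : IsWaveMap γ I J)
    {t x y : ℝ} (ht : t ∈ I) (hx : x ∈ J) (hy : y ∈ J) :
    metric (velocity (fun s => γ s x) t) (velocity (fun s => γ s x) t) =
      metric (velocity (fun s => γ s y) t) (velocity (fun s => γ s y) t) := by
  refine hJ.eq_of_hasDerivAt_zero
    (f := fun y => metric (velocity (fun s => γ s y) t) (velocity (fun s => γ s y) t))
    (fun z hz => ?_) hx hy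
  have hd := (h.velocity_spec hI hJ.1 ht hz).2
  refine (hasDerivAt_metric hd hd).congr_deriv ?_
  -- Both terms equal g([γ_x, γ_t], γ_t), which vanishes by invariance of the Killing form.
  rw [metric_comm _ (_ - _), ← neg_sub, ← neg_one_smul ℝ, metric_smul_left, metric_comm_self]
  norm_num

theorem IsWaveMap.smul (h : IsWaveMap γ I J) (g : UGroup m) :
    IsWaveMap (fun t x => g • γ t x) I J := by
  refine ⟨h.1.smul g, fun t ht x hx => ?_⟩
  have e : (fun y => velocity (fun s => g • γ s y) t) =
      fun y => conj g (velocity (fun s => γ s y) t) :=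
    funext fun y => velocity_smul g (fun s => γ s y) t
  rw [e, covDeriv_smul g (γ t), h.2 t ht x hx, map_zero]

end WaveMaps

/-! ### The mKdV map -/

section MKdV

open Set Filter Topology

variable {m : ℕ}

theorem hPar_aux {M : Type*} [AddCommGroup M] [Module ℝ M] (a b c d : M) :
    (1 / 2 : ℝ) • (c + d - (b + a)) = -((1 / 2 : ℝ) • (a + b) - (1 / 2 : ℝ) • (d + c)) := by
  module

theorem smul_comm_smul {A : Type*} [Ring A] [Algebra ℝ A] (r : ℝ) (x z : A) :
    r • x * (r • x * z - z * r • x) - (r • x * z - z * r • x) * r • x =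
      (r * r) • (x * (x * z - z * x) - (x * z - z * x) * x) := by
  simp only [smul_mul_assoc, mul_smul_comm, mul_sub, sub_mul, smul_sub, smul_smul]

/-- The integrand −½A(u, u_x) + ½A(v, v_x) is half the derivative of ⟨v, v⟩ − u². -/
theorem hPar_jetVar_one : hPar (jetVar m 1) =
    (1 / 2 : ℝ) • (herm (jetVar m 0).2 (jetVar m 0).2 - (jetVar m 0).1 * (jetVar m 0).1) := by
  refine qDInv_eq ?_ ?_
  · simp [herm, (qcc_jetVar (m := m) 0).1, (qcc_jetVar (m := m) 0).2]
  · have h : ∀ a b : Fin m → ℍ[DPoly m], qD (herm a b) =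
        herm (fun j => qD (a j)) b + herm a fun j => qD (b j) := fun a b => by
      simp only [herm, ← qDHom_apply, map_sum, ← Finset.sum_add_distrib]
      refine Finset.sum_congr rfl fun j _ => ?_
      simp only [qDHom_apply, qD_mul, qD_star]
    rw [qD_smul, qD_sub, h, qD_mul, (qD_jetVar 0).1, funext (qD_jetVar (m := m) 0).2, hParDeriv,
      acomm, acommV, zero_add]
    generalize (jetVar m 0).1 * (jetVar m 1).1 = a
    generalize (jetVar m 1).1 * (jetVar m 0).1 = b
    exact hPar_aux _ _ _ _

/-- The operator has eigenvalue 4r² on imaginary a, r² on b, and kernel the real line. So 𝒳_γ is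
invertible on the normal space. -/
theorem adSq_qm (r : ℝ) (a : ℍ) (b : Fin m → ℍ) :
    -adSq (r • qm 1 0) (qm a b) = (r * r) • (qm ((2 : ℝ) • (a - star a)) b : Mat m) := by
  have h := E_qh (w := a - star a) (by simp) (fun j => -b j) 0 (0 : Matrix (Fin m) (Fin m) ℍ)
  rw [qd_zero, add_zero] at h
  have hneg : -(qm (-(2 : ℝ) • (a - star a)) (fun j => -b j) : Mat m) =
      qm ((2 : ℝ) • (a - star a)) b := by
    rw [← neg_one_smul ℝ, qm_smul, smul_smul]
    simp
  rw [adSq, Ring.lie_def, Ring.lie_def, smul_comm_smul, E_qm, h, ← smul_neg, hneg]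

theorem adSq_conj (g : UGroup m) (X Z : Mat m) :
    adSq (conj g X) (conj g Z) = conj g (adSq X Z) := by
  simp only [adSq, Ring.lie_def, map_sub, map_mul]

theorem metric_E (r s : ℝ) (a : ℍ) (b : Fin m → ℍ) :
    metric (r • qm a b) (s • qm 1 0) = r * s * chi m * a.re := by
  rw [metric_smul_left, metric_comm, metric_smul_left, metric_comm, metric_qm]
  simp [herm]
  ring

/-- Normality of B forces an imaginary first component, where 𝒳_γ acts by 4χ⁻¹; on the vector part
it acts by χ⁻¹. -/
theorem isXInv_iff {g : UGroup m} {a : ℍ} (ha : star a = -a) (b : Fin m → ℍ) (B : Mat m) :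
    IsXInv (g : HP m) (conj g ((1 / √(chi m)) • qm 1 0))
      (conj g ((chi m)⁻¹ • qm ((4 : ℝ) • a) b)) B ↔ B = conj g (qm a b) := by
  have hc := sqrt_chi_pos (m := m)
  have key : ∀ {a' : ℍ} (b' : Fin m → ℍ), star a' = -a' →
      -adSq (conj g ((1 / √(chi m)) • qm 1 0)) (conj g (qm a' b')) =
        conj g ((chi m)⁻¹ • qm ((4 : ℝ) • a') b') := fun {a'} b' h => by
    rw [adSq_conj, ← map_neg, adSq_qm, one_div_sqrt_chi_sq, h, sub_neg_eq_add, ← two_smul ℝ a',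
      smul_smul]
    norm_num
  constructor
  · rintro ⟨h1, h2, h3⟩
    obtain ⟨a', b', rfl⟩ := isTangent_mk.1 h1
    have h4 : a'.re = 0 := by
      have := metric_E (1 : ℝ) (1 / √(chi m)) a' b'
      rw [one_smul, ← metric_conj g, h2, one_mul] at this
      exact (mul_eq_zero.1 this.symm).resolve_left
        (mul_ne_zero (one_div_ne_zero hc.ne') chi_pos.ne')
    rw [key _ (star_eq_neg_of_re h4)] at h3
    have h5 := congrArg (coframe g) h3
    rw [coframe_conj, coframe_conj] at h5
    obtain ⟨h6, h7⟩ := qm_inj (smul_right_injective _ (inv_ne_zero chi_pos.ne') h5)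
    rw [smul_right_injective _ (four_ne_zero (α := ℝ)) h6, h7]
  · rintro rfl
    refine ⟨isTangent_mk.2 ⟨a, b, rfl⟩, ?_, key b ha⟩
    have := metric_E (1 : ℝ) (1 / √(chi m)) a b
    rw [one_smul, re_eq_zero_of_star ha, mul_zero] at this
    rw [metric_conj, this]

variable {c : ℝ → HP m} {J : Set ℝ} {ψ : ℝ → UGroup m} {u : ℝ → ℍ} {v : ℝ → Fin m → ℍ}

theorem covJet_aux {M : Type*} [AddCommGroup M] [Module ℝ M] (a b c : M) :
    c + c + (a + a + (a + a) + -b) = (2 : ℝ) • c + ((4 : ℝ) • a - b) := by module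

theorem covJet_aux' {M : Type*} [AddCommGroup M] [Module ℝ M] (b c : M) :
    -c + (-b - (b + b)) = -c - (3 : ℝ) • b := by module

theorem smul_comm_smul' {A : Type*} [Ring A] [Algebra ℝ A] (r : ℝ) (x z : A) :
    r • x * (r • x * r • z - r • z * r • x) - (r • x * r • z - r • z * r • x) * r • x =
      (r * r * r) • ((z * x - x * z) * x - x * (z * x - x * z)) := by
  simp only [smul_mul_assoc, mul_smul_comm, mul_sub, sub_mul, smul_sub, smul_smul]
  module

/-- Two applications of D_x + ad(u, v) to the constant χ^{-1/2}E. In ∇_x²γ_x the terms 4u² − ⟨v, v⟩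
are real, hence tangential, and −3uv is the nonlinear normal term. -/
theorem covJet_frame_low (hJ : IsOpen J) (h : IsParallelFrame c J ψ u v) {x : ℝ} (hx : x ∈ J) :
    covJet c 0 x = conj (ψ x) ((1 / √(chi m)) • qm 1 0) ∧
    covJet c 1 x = conj (ψ x) ((1 / √(chi m)) • qm (u x + u x) fun j => -v x j) ∧
    covJet c 2 x = conj (ψ x) ((1 / √(chi m)) •
      qm ((2 : ℝ) • evalJet u v x (jetVar m 1).1 +
          ((4 : ℝ) • (u x * u x) - herm (v x) (v x)))
        fun j => -evalJet u v x ((jetVar m 1).2 j) - (3 : ℝ) • (u x * v x j)) := by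
  obtain ⟨e1, e2⟩ := evalJet_jetVar_zero (v := v) (h.2 x hx).2.1
  have hu0 := star_jetVar (m := m) 0
  have q1 : covJetQ m 1 = (1 / √(chi m)) •
      qm ((jetVar m 0).1 + (jetVar m 0).1) fun j => -(jetVar m 0).2 j := by
    change covQ m ((1 / √(chi m)) • qm 1 0) = _
    rw [covD_smul isQDer_qD, covD_qm isQDer_qD hu0]
    simp [qDHom_apply, qD_one, qD_zero, herm]
  have q2 : covJetQ m 2 = (1 / √(chi m)) •
      qm ((2 : ℝ) • (jetVar m 1).1 + ((4 : ℝ) • ((jetVar m 0).1 * (jetVar m 0).1) -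
          herm (jetVar m 0).2 (jetVar m 0).2))
        fun j => -(jetVar m 1).2 j - (3 : ℝ) • ((jetVar m 0).1 * (jetVar m 0).2 j) := by
    have e : covJetQ m 2 = covQ m (covJetQ m 1) := Function.iterate_succ_apply' _ 1 _
    rw [e, q1, covD_smul isQDer_qD, covD_qm isQDer_qD hu0, herm_neg_left, map_add]
    simp only [qDHom_apply, qD_neg, (qD_jetVar 0).1, (qD_jetVar 0).2, mul_add, add_mul, mul_neg,
      zero_add]
    generalize (jetVar m 0).1 * (jetVar m 0).1 = a
    congr 2
    · exact covJet_aux _ _ _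
    · funext j
      generalize (jetVar m 0).1 * (jetVar m 0).2 j = b
      exact covJet_aux' _ _
  have e3 : evalJet u v x ((2 : ℝ) • (jetVar m 1).1 + ((4 : ℝ) • ((jetVar m 0).1 *
      (jetVar m 0).1) - herm (jetVar m 0).2 (jetVar m 0).2)) =
      (2 : ℝ) • evalJet u v x (jetVar m 1).1 + ((4 : ℝ) • (u x * u x) - herm (v x) (v x)) := by
    simp only [← evalHom_apply, map_add, map_sub, map_smul, map_mul, herm, map_sum, evalHom_star]
    simp only [evalHom_apply, e1, e2]
  have e4 : ∀ j, evalJet u v x (-(jetVar m 1).2 j - (3 : ℝ) • ((jetVar m 0).1 *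
      (jetVar m 0).2 j)) = -evalJet u v x ((jetVar m 1).2 j) - (3 : ℝ) • (u x * v x j) := fun j => by
    simp only [← evalHom_apply, map_sub, map_smul, map_mul, map_neg]
    simp only [evalHom_apply, e1, e2]
  have e5 : evalJet u v x ((jetVar m 0).1 + (jetVar m 0).1) = u x + u x := by
    simp only [← evalHom_apply, map_add]
    simp only [evalHom_apply, e1]
  have e6 : ∀ j, evalJet u v x (-(jetVar m 0).2 j) = -v x j := fun j => by
    simp only [← evalHom_apply, map_neg]
    simp only [evalHom_apply, e2]
  refine ⟨velocity_frame hJ h hx, ?_, ?_⟩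
  · rw [covJet_frame hJ h 1 x hx, q1, map_smul (evalMat u v x), evalMat_qm, e5, funext e6]
  · rw [covJet_frame hJ h 2 x hx, q2, map_smul (evalMat u v x), evalMat_qm, e3, funext e4]

theorem adSq_normal (r : ℝ) {a : ℍ} (ha : star a = -a) (b : Fin m → ℍ) :
    adSq (r • qm (a + a) fun j => -b j) (r • qm 1 0) =
      (r * r * r) • (qm ((16 : ℝ) • (a * a) - herm b b) fun j => (-6 : ℝ) • (a * b j) : Mat m) := by
  have h1 := E_qm (a + a) fun j => -b j
  have h2 := qh_qm (u := (4 : ℝ) • a) (by rw [Quaternion.star_smul, ha, smul_neg]) b (a + a)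
    fun j => -b j
  have e : a + a - star (a + a) = (4 : ℝ) • a := by
    rw [star_add, ha]
    module
  rw [e] at h1
  simp only [neg_neg] at h1
  rw [← h1, herm_neg_left] at h2
  rw [adSq, Ring.lie_def, Ring.lie_def, smul_comm_smul', h2]
  congr 2
  · simp only [smul_mul_assoc, mul_smul_comm, mul_add, add_mul]
    module
  · funext j
    simp only [smul_mul_assoc, mul_neg, add_mul]
    module

theorem normalPart_conj (g : UGroup m) (X Y : Mat m) :
    normalPart (conj g X) (conj g Y) = conj g (normalPart X Y) := by
  rw [normalPart, normalPart, metric_conj, map_sub, map_smul]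

theorem normalPart_qm (s : ℝ) {a q : ℍ} (ha : star a = -a) (hq : star q = q) (b : Fin m → ℍ) :
    normalPart ((1 / √(chi m)) • qm 1 0) (s • qm (a + q) b : Mat m) = s • qm a b := by
  have hq' : q = q.re • (1 : ℍ) := by
    rw [← coe_smul_one]
    exact Quaternion.star_eq_self.1 hq
  have e : s * (1 / √(chi m)) * chi m * (a + q).re * (1 / √(chi m)) = -s * -q.re := by
    rw [Quaternion.re_add, re_eq_zero_of_star ha, zero_add, mul_right_comm _ _ (1 / √(chi m)),
      mul_right_comm _ _ (1 / √(chi m)), mul_assoc s, one_div_sqrt_chi_sq,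
      mul_assoc s, inv_mul_cancel₀ chi_pos.ne']
    ring
  rw [normalPart, metric_E, smul_smul, e, mul_smul, neg_smul, sub_neg_eq_add, ← smul_add, qm_smul,
    qm_add]
  congr 2
  · rw [hq', Quaternion.re_smul]
    simp
  · funext j
    simp

/-- The weights χ⁻¹ and −½ are chosen so that the nonlinear normal terms cancel: −3 + ½·6 = 0 in the
vector part. The remaining −4u² − ½⟨v, v⟩ is real and is removed by the normal projection. -/
theorem mKdV_normal {U a : ℍ} (hU : star U = -U) (ha : star a = -a) (b W : Fin m → ℍ) :
    normalPart ((1 / √(chi m)) • qm 1 0) ((chi m)⁻¹ • ((1 / √(chi m)) •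
      qm ((2 : ℝ) • U + ((4 : ℝ) • (a * a) - herm b b)) fun j => -W j - (3 : ℝ) • (a * b j)) -
      (1 / 2 : ℝ) • ((1 / √(chi m) * (1 / √(chi m)) * (1 / √(chi m))) •
        qm ((16 : ℝ) • (a * a) - herm b b) fun j => (-6 : ℝ) • (a * b j))) =
      ((chi m)⁻¹ • qm ((4 : ℝ) • (1 / √(chi m) * (1 / 2)) • U)
        fun j => (1 / √(chi m)) • -W j : Mat m) := by
  have h1 : (chi m)⁻¹ • ((1 / √(chi m)) •
      qm ((2 : ℝ) • U + ((4 : ℝ) • (a * a) - herm b b)) fun j => -W j - (3 : ℝ) • (a * b j)) -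
      (1 / 2 : ℝ) • ((1 / √(chi m) * (1 / √(chi m)) * (1 / √(chi m))) •
        qm ((16 : ℝ) • (a * a) - herm b b) fun j => (-6 : ℝ) • (a * b j)) =
      ((chi m)⁻¹ * (1 / √(chi m))) • (qm ((2 : ℝ) • U + (-(4 : ℝ) • (a * a) -
        (1 / 2 : ℝ) • herm b b)) fun j => -W j : Mat m) := by
    rw [one_div_sqrt_chi_sq, ← mul_smul, smul_comm (1 / 2 : ℝ), ← smul_sub, sub_eq_add_neg,
      ← neg_smul, qm_smul, qm_add]
    congr 2
    · module
    · funext j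
      module
  have h2 : star (-(4 : ℝ) • (a * a) - (1 / 2 : ℝ) • herm b b) =
      -(4 : ℝ) • (a * a) - (1 / 2 : ℝ) • herm b b := by
    rw [star_sub, Quaternion.star_smul, Quaternion.star_smul, star_mul, ha, neg_mul_neg, star_herm]
  rw [h1, normalPart_qm _ (by rw [Quaternion.star_smul, hU, smul_neg]) h2, mul_smul, qm_smul]
  congr 2
  module

theorem mKdV_first (a : ℍ) (b : Fin m → ℍ) :
    (1 / √(chi m)) • qm (a + a) (fun j => -b j) =
      ((chi m)⁻¹ • qm ((4 : ℝ) • (chi m * (1 / √(chi m)) * (1 / 2)) • a)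
        fun j => (chi m * (1 / √(chi m))) • -b j : Mat m) := by
  have h := inv_mul_cancel₀ (chi_pos (m := m)).ne'
  rw [qm_smul, qm_smul]
  congr 1
  · rw [smul_smul, smul_smul, ← two_smul ℝ a, smul_smul]
    congr 1
    linear_combination (-2 * (1 / √(chi m))) * h
  · funext j
    rw [smul_smul, ← mul_assoc, h, one_mul]

/-- Multiplied by ½χ⁻¹ this is the value of h_∥ from `hPar_jetVar_one`, so the tangential term of
the mKdV map supplies h_∥. -/
theorem mKdV_metric {a : ℍ} (ha : star a = -a) (b : Fin m → ℍ) :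
    metric (qm ((chi m * (1 / √(chi m)) * (1 / 2)) • a) fun j => (chi m * (1 / √(chi m))) • -b j)
      ((1 / √(chi m)) • qm (a + a) fun j => -b j : Mat m) = chi m * (herm b b - a * a).re := by
  have h1 : (qm ((chi m * (1 / √(chi m)) * (1 / 2)) • a) fun j =>
      (chi m * (1 / √(chi m))) • -b j : Mat m) =
      (chi m * (1 / √(chi m))) • qm ((1 / 2 : ℝ) • a) fun j => -b j := by
    rw [qm_smul, mul_smul (chi m * _)]
  have h2 : (1 / 2 : ℝ) • a * star (a + a) + herm (fun j => -b j) (fun j => -b j) =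
      herm b b - a * a := by
    rw [star_add, ha, smul_mul_assoc, mul_add, half_smul_add_self]
    simp only [herm, star_neg, neg_mul, mul_neg, neg_neg]
    abel
  have h3 := chi_pos (m := m)
  rw [h1, metric_smul_left, metric_comm, metric_smul_left, metric_comm, metric_qm, h2, ← mul_assoc,
    mul_assoc (chi m), one_div_sqrt_chi_sq, mul_inv_cancel₀ h3.ne', one_mul]

theorem mKdV_sum {a : ℍ} (ha : star a = -a) (U : ℍ) (b W : Fin m → ℍ) :
    (1 / √(chi m)) • qm ((1 / 2 : ℝ) • (herm b b - a * a) + (1 / 2 : ℝ) • U) (fun j => -W j) =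
      qm ((1 / √(chi m) * (1 / 2)) • U) (fun j => (1 / √(chi m)) • -W j) +
      ((1 / 2 : ℝ) * (chi m)⁻¹ * (chi m * (herm b b - a * a).re)) •
        ((1 / √(chi m)) • qm 1 0 : Mat m) := by
  have h1 : star (herm b b - a * a) = herm b b - a * a := by
    rw [star_sub, star_mul, ha, neg_mul_neg, star_herm]
  have h2 : herm b b - a * a = (herm b b - a * a).re • (1 : ℍ) := by
    rw [← coe_smul_one]
    exact Quaternion.star_eq_self.1 h1
  generalize herm b b - a * a = q at *
  rw [mul_assoc, inv_mul_cancel_left₀ chi_pos.ne', qm_smul, qm_smul, qm_smul, qm_add]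
  congr 1
  · nth_rewrite 1 [h2]
    module
  · funext j
    simp

/-- In a parallel frame both sides become explicit: 𝒳_γ⁻¹ turns the linear normal terms 2u_x and
−v_x into ½u_x and −v_x, up to scale, and the tangential term adds h_∥. Existence of a parallel
frame suffices, as neither side depends on it. -/
theorem mKdV_iff (hJ : IsOpenInterval J) (hc : IsUnitSpeed c J) {x : ℝ} (hx : x ∈ J) (V : Mat m) :
    V = (flowOperator m 1).along c x ↔ IsMKdVVector c x V := by
  obtain ⟨ψ, u, v, h⟩ := hc.exists_parallelFrame hJ
  have hu := h.star_u hx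
  have hr := sqrt_chi_pos (m := m)
  obtain ⟨h0, h1, h2⟩ := covJet_frame_low hJ.1 h hx
  have h3 := flowOperator_along_frame hJ.1 h 0 hx
  obtain ⟨e1, e2⟩ := evalJet_jetVar_zero (v := v) (h.2 x hx).2.1
  have hU : star (evalJet u v x (jetVar m 1).1) = -evalJet u v x (jetVar m 1).1 := by
    rw [← evalHom_apply, ← evalHom_star, star_jetVar, map_neg]
  have hP : evalJet u v x (hPar (jetVar m 1)) =
      (1 / 2 : ℝ) • (herm (v x) (v x) - u x * u x) := by
    rw [hPar_jetVar_one]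
    simp only [← evalHom_apply, map_add, map_sub, map_smul, map_mul, herm, map_sum, evalHom_star]
    simp only [evalHom_apply, e1, e2]
  have hh : hier m 0 = jetVar m 1 := rfl
  rw [hh, hP, zero_add] at h3
  rw [h3]
  simp only [IsMKdVVector]
  rw [h0, h1, h2, (h.2 x hx).1]
  obtain ⟨W, hW⟩ : ∃ W : Fin m → ℍ, ∀ j, evalJet u v x ((jetVar m 1).2 j) = W j :=
    ⟨_, fun _ => rfl⟩
  simp only [hW]
  generalize evalJet u v x (jetVar m 1).1 = U at *
  rw [adSq_conj, ← map_smul, ← map_smul, ← map_sub, normalPart_conj, adSq_normal _ hu, mKdV_normal hU hu]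
  have hA := isXInv_iff (g := ψ x) (a := (1 / √(chi m) * (1 / 2)) • U)
    (by rw [Quaternion.star_smul, hU, smul_neg]) fun j => (1 / √(chi m)) • -W j
  have hB := isXInv_iff (g := ψ x) (a := (chi m * (1 / √(chi m)) * (1 / 2)) • u x)
    (by rw [Quaternion.star_smul, hu, smul_neg]) fun j => (chi m * (1 / √(chi m))) • -v x j
  rw [← mKdV_first] at hB
  simp only [hA, hB]
  have key : conj (ψ x) ((1 / √(chi m)) • qm ((1 / 2 : ℝ) • (herm (v x) (v x) - u x * u x) +
      (1 / 2 : ℝ) • U) fun j => -W j) =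
      conj (ψ x) (qm ((1 / √(chi m) * (1 / 2)) • U) fun j => (1 / √(chi m)) • -W j) +
      ((1 / 2 : ℝ) * (chi m)⁻¹ * metric (conj (ψ x)
        (qm ((chi m * (1 / √(chi m)) * (1 / 2)) • u x) fun j => (chi m * (1 / √(chi m))) • -v x j))
        (conj (ψ x) ((1 / √(chi m)) • qm (u x + u x) fun j => -v x j))) •
        conj (ψ x) ((1 / √(chi m)) • qm 1 0) := by
    rw [metric_conj, mKdV_metric hu, ← map_smul, ← map_add]
    congr 1
    exact mKdV_sum hu _ _ _
  rw [key]
  constructor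
  · rintro rfl
    exact ⟨_, _, rfl, rfl, rfl⟩
  · rintro ⟨A, B, rfl, rfl, rfl⟩
    rfl

end MKdV

end QuatFlow

end

/-! ### The main theorem -/

open QuatFlow in
theorem mainTheorem5 (m : ℕ) :
    -- the hierarchy consists of differential polynomials: `D_x⁻¹` only meets total derivatives
    (∀ l, IsLocalAt (hier m l)) ∧
    -- the flows `γ_t = Y_(l)(γ_x, ∇_xγ_x, …)`, `l ≥ 1`
    (∃ Y : ℕ → CurveOperator m,
      (∀ l, 1 ≤ l →
        -- invariance under the isometry group `U(n+1,ℍ)`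
        (Y l).IsInvariant ∧
        (∀ (g : UGroup m) (I J : Set ℝ) (γ : ℝ → ℝ → HP m), IsOpenInterval I → IsOpenInterval J →
          IsCurveFlow (Y l) γ I J → IsCurveFlow (Y l) (fun t x => g • γ t x) I J) ∧
        -- preservation of arclength: `g(∇_x Y_(l), γ_x) = 0` on every unit-speed curve
        (∀ (J : Set ℝ) (c : ℝ → HP m), IsOpenInterval J → IsUnitSpeed c J →
          ∀ x ∈ J, metric (covDeriv c ((Y l).along c) x) (velocity c x) = 0) ∧
        -- the frame components of `Y_(l)` in any parallel frame are given by `h_(l-1)`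
        (∀ (J : Set ℝ) (c : ℝ → HP m) (ψ : ℝ → UGroup m) (u : ℝ → ℍ) (v : ℝ → Fin m → ℍ),
          IsOpenInterval J → IsUnitSpeed c J → IsParallelFrame c J ψ u v →
          ∀ x ∈ J, coframe (ψ x) ((Y l).along c x) = (1 / √(chi m)) •
            mMat (evalJet u v x (hPar (hier m (l - 1))) +
                (1 / 2 : ℝ) • evalJet u v x (hier m (l - 1)).1)
              (fun j => -evalJet u v x ((hier m (l - 1)).2 j))) ∧
        -- every such curve flow induces the `(+l)`-flow on the covariants of a parallel frame
        (∀ (I J : Set ℝ) (γ : ℝ → ℝ → HP m), IsOpenInterval I → IsOpenInterval J →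
          IsCurveFlow (Y l) γ I J →
          ∃ ψ u v, IsParallelFlowFrame γ I J ψ u v ∧ IsHierarchyFlow l I J u v) ∧
        -- every solution of the `(+l)`-flow arises from such a curve flow
        (∀ (I J : Set ℝ) (u : ℝ → ℝ → ℍ) (v : ℝ → ℝ → Fin m → ℍ),
          IsOpenInterval I → IsOpenInterval J → IsHierarchyFlow l I J u v →
          ∃ γ ψ, IsCurveFlow (Y l) γ I J ∧ IsParallelFlowFrame γ I J ψ u v)) ∧
      -- for `l = 1` the curve flow is the non-stretching mKdV map
      (∀ (J : Set ℝ) (c : ℝ → HP m), IsOpenInterval J → IsUnitSpeed c J →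
        ∀ x ∈ J, ∀ V : Mat m, V = (Y 1).along c x ↔ IsMKdVVector c x V)) ∧
    -- every non-stretching wave map induces the `-1` flow
    (∀ (I J : Set ℝ) (γ : ℝ → ℝ → HP m), IsOpenInterval I → IsOpenInterval J →
      IsWaveMap γ I J →
      (∃ ψ u v h k p, IsParallelFlowFrame γ I J ψ u v ∧ IsMinusOneFlow I J u v h k p ∧
        ∀ t ∈ I, ∀ x ∈ J, coframe (ψ t x) (velocity (fun s => γ s x) t) =
          (1 / √(chi m)) • mMat ((p t x : ℍ) + (1 / 2 : ℝ) • h t x) (fun j => -k t x j)) ∧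
      -- conservation law `∇_x |γ_t| = 0`
      (∀ t ∈ I, ∀ x ∈ J, ∀ y ∈ J,
        metric (velocity (fun s => γ s x) t) (velocity (fun s => γ s x) t) =
          metric (velocity (fun s => γ s y) t) (velocity (fun s => γ s y) t)) ∧
      -- invariance under the isometry group
      (∀ g : UGroup m, IsWaveMap (fun t x => g • γ t x) I J)) ∧
    -- every solution of the `-1` flow arises from a non-stretching wave map
    (∀ (I J : Set ℝ) (u : ℝ → ℝ → ℍ) (v : ℝ → ℝ → Fin m → ℍ) (h : ℝ → ℝ → ℍ)
      (k : ℝ → ℝ → Fin m → ℍ) (p : ℝ → ℝ → ℝ),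
      IsOpenInterval I → IsOpenInterval J → IsMinusOneFlow I J u v h k p →
      ∃ γ ψ, IsWaveMap γ I J ∧ IsParallelFlowFrame γ I J ψ u v ∧
        ∀ t ∈ I, ∀ x ∈ J, coframe (ψ t x) (velocity (fun s => γ s x) t) =
          (1 / √(chi m)) • mMat ((p t x : ℍ) + (1 / 2 : ℝ) • h t x) (fun j => -k t x j)) := by
  refine ⟨isLocalAt_hier, ⟨flowOperator m, fun l hl => ?_, fun J c hJ hc x hx V =>
    mKdV_iff hJ hc hx V⟩, fun I J γ hI hJ h => ⟨h.exists_frame hI hJ,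
    fun t ht x hx y hy => h.metric_eq hI.1 hJ ht hx hy, h.smul⟩,
    fun I J u v h k p hI hJ H => exists_waveMap hI hJ H⟩
  -- Writing l + 1 for the index makes the shifted index l − 1 of the statement reduce to l.
  obtain ⟨l, rfl⟩ := Nat.exists_eq_add_of_le' hl
  refine ⟨jetOperator_isInvariant _, fun g I J γ _ _ h => jetOperator_flow_smul _ g h,
    fun J c hJ hc x hx => flowOperator_nonstretching hJ hc _ hx,
    fun J c ψ u v hJ _ h x hx => ?_, fun I J γ hI hJ h => h.exists_frame hI hJ,
    fun I J u v hI hJ h => h.exists_curveFlow hI hJ⟩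
  rw [flowOperator_along_frame hJ.1 h l hx, coframe_conj, mMat_eq]
  rfl
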